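/- Throughout, $\mathbb{R}$ is a regular category and a fibration $\mathcal{C}:|\mathcal{C}|\to\mathbb{R}$ is called a *finite-limit pre-stack* if its fibers have finite limits preserved by reindexing, and if for every regular epimorphism $e:J\to I$ of $\mathbb{R}$ the comparison functor from $\mathcal{C}_I$ to the category of descent data along $e$ is full and faithful. It is a *pre-stack of regular categories* if moreover the fibers are regular and the reindexing functors are regular. The *predicates* on $A\in|\mathcal{C}|$ are the vertical monomorphisms into $A$; ordered by inclusion and reindexed by pullback they form the fibered subobject fibration $\mathrm{sub}(\mathcal{C})$ on $|\mathcal{C}|$. A *geometric pre-stack* is a pre-stack of regular categories in which reindexing of predicates along cartesian arrows has left adjoints (internal unions), subject to the Beck–Chevalley condition for pullbacks along arbitrary arrows of $|\mathcal{C}|$. A *fibered pretopos* is a pre-stack of regular categories with exact fibers which is also an opfibration whose cocartesian arrows are stable under pullback along arbitrary arrows and disjoint (the diagonal $A\to A\times_BA$ of a cocartesian $A\to B$ is cocartesian). $\mathbf{Geo}(\mathbb{R})(\mathcal{S},\mathcal{X})$ denotes the category of functors over $\mathbb{R}$ that preserve cartesian arrows, are regular on the fibers and preserve internal unions; $\mathbf{Pretop}(\mathbb{R})(\mathcal{T},\mathcal{X})$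 that of functors over $\mathbb{R}$ that preserve cartesian arrows, are regular on the fibers and preserve cocartesian arrows; morphisms are the natural transformations with vertical components. For an existential fibration $\mathcal{D}$ on a finite-limit category, let $\mathrm{Eq}(\mathcal{D})$ be the category whose objects are pairs $(A,\rho)$ of an object and a (total) equivalence relation on it in the internal logic of $\mathcal{D}$, and whose morphisms are functional relations. For a geometric pre-stack $\mathcal{S}$ put $\mathbb{R}[\mathcal{S}]=\mathrm{Eq}(\mathrm{sub}(\mathcal{S}))$; for a finite-limit pre-stack $\mathcal{C}$ put $\mathbb{R}\{\mathcal{C}\}=\mathrm{Eq}(\mathrm{siev}(\mathcal{C}))$, where predicates of $\mathrm{siev}(\mathcal{C})$ on $X$ are arrows $f:Y\to X$ of $|\mathcal{C}|$, with $f\le g$ iff there are $k$ and a cartesian $c$ over a regular epimorphism with $f\circ c=g\circ k$. In both cases let $\Delta$ be the functor from $\mathbb{R}$ sending $I$ to $(1_I,=)$, where $1_I$ is terminal in the fiber over $I$, and define $\mathbf{Sh}(\mathcal{S})=\mathrm{gl}_\Delta(\mathbb{R}[\mathcal{S}])$ and $\widehat{\mathcal{C}}=\mathrm{gl}_\Delta(\mathbb{R}\{\mathcal{C}\})$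 as the pullbacks along $\Delta$ of the codomain fibrations. The embeddings $Z:\mathcal{S}\to\mathbf{Sh}(\mathcal{S})$ and $Y:\mathcal{C}\to\widehat{\mathcal{C}}$ send $A$ over $I$ to $(A,=)\to\Delta I$, and $D\mathcal{C}$ is the full subfibration of $\widehat{\mathcal{C}}$ on the vertical subobjects of objects $YA$. (i) Let $\mathcal{S}$ be a geometric pre-stack on $\mathbb{R}$. Then $\mathbf{Sh}(\mathcal{S})$ is the free fibered pretopos on $\mathcal{S}$: it is a fibered pretopos, $Z$ is geometric, and for every fibered pretopos $\mathcal{X}$ on $\mathbb{R}$ precomposition with $Z$ is a well-defined functor and an equivalence of categories $$\mathbf{Pretop}(\mathbb{R})(\mathbf{Sh}(\mathcal{S}),\mathcal{X})\simeq\mathbf{Geo}(\mathbb{R})(\mathcal{S},\mathcal{X}).$$ This characterizes $\mathbf{Sh}(\mathcal{S})$: if $W:\mathcal{S}\to\mathcal{T}$ has the same properties, there is an equivalence $K:\mathbf{Sh}(\mathcal{S})\to\mathcal{T}$ over $\mathbb{R}$ with $K\circ Z\cong W$. (ii) Let $\mathcal{C}$ be a finite-limit pre-stack on $\mathbb{R}$.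 Then $D\mathcal{C}$ is a geometric pre-stack, there is an equivalence $\widehat{\mathcal{C}}\simeq\mathbf{Sh}(D\mathcal{C})$ of fibrations over $\mathbb{R}$, and $\mathbb{R}\{\mathcal{C}\}\simeq\mathbb{R}[D\mathcal{C}]$. -/

import Mathlib

open CategoryTheory CategoryTheory.Limits CategoryTheory.Functor
open scoped CategoryTheory.BasedFunctor

universe v₁ u₁ v₂ u₂ v₃ u₃ v₄ u₄ w

set_option linter.style.haveILetI false
set_option linter.unusedSectionVars false

namespace FibSh

section Fib
variable {R : Type u₁} [Category.{v₁} R] {E : Type u₂} [Category.{v₂} E] (p : E ⥤ R)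

/-- `f` is a cartesian arrow of the total category. -/
abbrev IsCart {A B : E} (f : A ⟶ B) : Prop := p.IsStronglyCartesian (p.map f) f

/-- `f` is a cocartesian arrow of the total category. -/
abbrev IsCocart {A B : E} (f : A ⟶ B) : Prop := p.IsStronglyCocartesian (p.map f) f

/-- `f` lies over an identity arrow. -/
abbrev IsVertical {A B : E} (f : A ⟶ B) : Prop := p.IsHomLift (𝟙 (p.obj B)) f

variable {p} in
/-- The object of the total category underlying an object of a fiber. -/
abbrev fo {I : R} (A : p.Fiber I) : E := Functor.Fiber.fiberInclusion.obj A

variable {p} in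
/-- The vertical arrow underlying an arrow of a fiber. -/
def fm {I : R} {A B : p.Fiber I} (f : A ⟶ B) : fo A ⟶ fo B := Functor.Fiber.fiberInclusion.map f

instance {I : R} {A B : p.Fiber I} (f : A ⟶ B) : p.IsHomLift (𝟙 I) (fm f) := f.2

variable {p} in
@[simp] lemma fm_id {I : R} (A : p.Fiber I) : fm (𝟙 A) = 𝟙 (fo A) := rfl

variable {p} in
@[simp] lemma fm_comp {I : R} {A B C : p.Fiber I} (f : A ⟶ B) (g : B ⟶ C) :
    fm (f ≫ g) = fm f ≫ fm g := rfl

variable {p} in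
lemma fo_over {I : R} (A : p.Fiber I) : p.obj (fo A) = I := A.2

variable {p} in
/-- A vertical arrow as an arrow of a fiber. -/
def fhom {I : R} {A B : p.Fiber I} (x : fo A ⟶ fo B) (h : p.IsHomLift (𝟙 I) x) : A ⟶ B := ⟨x, h⟩

variable {p} in
@[simp] lemma fm_fhom {I : R} {A B : p.Fiber I} (x : fo A ⟶ fo B) (h : p.IsHomLift (𝟙 I) x) :
    fm (fhom x h) = x := rfl

/-- The reindexed object `u^* A`. -/
noncomputable def robj₀ [p.IsPreFibered] {J I : R} (u : J ⟶ I) (A : p.Fiber I) : p.Fiber J :=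
  Functor.Fiber.mk (IsPreFibered.pullbackObj_proj (fo_over A) u)

/-- The cartesian arrow `u^* A ⟶ A` over `u`. -/
noncomputable def rmap₀ [p.IsPreFibered] {J I : R} (u : J ⟶ I) (A : p.Fiber I) :
    fo (robj₀ p u A) ⟶ fo A :=
  IsPreFibered.pullbackMap (fo_over A) u

instance [p.IsPreFibered] {J I : R} (u : J ⟶ I) (A : p.Fiber I) : p.IsCartesian u (rmap₀ p u A) :=
  IsPreFibered.pullbackMap.IsCartesian (fo_over A) u

/-- The factorization of `x : X ⟶ A` over `u` through the cartesian arrow `u^* A ⟶ A`. -/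
noncomputable def flift₀ [p.IsPreFibered] {J I : R} (u : J ⟶ I) {X : p.Fiber J} {A : p.Fiber I}
    (x : fo X ⟶ fo A) (h : p.IsHomLift u x) : X ⟶ robj₀ p u A :=
  fhom (IsCartesian.map p u (rmap₀ p u A) x) inferInstance

@[simp]
lemma flift_fac₀ [p.IsPreFibered] {J I : R} (u : J ⟶ I) {X : p.Fiber J} {A : p.Fiber I}
    (x : fo X ⟶ fo A) (h : p.IsHomLift u x) : fm (flift₀ p u x h) ≫ rmap₀ p u A = x :=
  IsCartesian.fac p u (rmap₀ p u A) x

lemma rhom_ext₀ [p.IsPreFibered] {J I : R} (u : J ⟶ I) {X : p.Fiber J} {A : p.Fiber I}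
    {f g : X ⟶ robj₀ p u A} (h : fm f ≫ rmap₀ p u A = fm g ≫ rmap₀ p u A) : f = g :=
  Functor.Fiber.hom_ext (IsCartesian.ext p u (rmap₀ p u A) _ _ h)

/-- Reindexing `u^* : p_I ⥤ p_J` along `u : J ⟶ I`, by means of a choice of cartesian lifts. -/
noncomputable def reindex [p.IsPreFibered] {J I : R} (u : J ⟶ I) : p.Fiber I ⥤ p.Fiber J where
  obj A := robj₀ p u A
  map {A B} f := flift₀ p u (rmap₀ p u A ≫ fm f) inferInstance
  map_id A := rhom_ext₀ p u (by simp)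
  map_comp {A B C} f g := rhom_ext₀ p u (by
    rw [flift_fac₀, fm_comp, fm_comp, Category.assoc, flift_fac₀, ← Category.assoc,
      ← Category.assoc, flift_fac₀])

/-- The cartesian arrow `u^* A ⟶ A` over `u`. -/
noncomputable def rmap [p.IsPreFibered] {J I : R} (u : J ⟶ I) (A : p.Fiber I) :
    fo ((reindex p u).obj A) ⟶ fo A := rmap₀ p u A

instance rmap_isCartesian [p.IsPreFibered] {J I : R} (u : J ⟶ I) (A : p.Fiber I) :
    p.IsCartesian u (rmap p u A) :=
  IsPreFibered.pullbackMap.IsCartesian (fo_over A) u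

/-- The factorization of `x : X ⟶ A` over `u` through the cartesian arrow `u^* A ⟶ A`. -/
noncomputable def flift [p.IsPreFibered] {J I : R} (u : J ⟶ I) {X : p.Fiber J} {A : p.Fiber I}
    (x : fo X ⟶ fo A) (h : p.IsHomLift u x) : X ⟶ (reindex p u).obj A := flift₀ p u x h

lemma flift_fac [p.IsPreFibered] {J I : R} (u : J ⟶ I) {X : p.Fiber J} {A : p.Fiber I}
    (x : fo X ⟶ fo A) (h : p.IsHomLift u x) : fm (flift p u x h) ≫ rmap p u A = x :=
  flift_fac₀ p u x h

lemma rhom_ext [p.IsPreFibered] {J I : R} (u : J ⟶ I) {X : p.Fiber J} {A : p.Fiber I}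
    {f g : X ⟶ (reindex p u).obj A} (h : fm f ≫ rmap p u A = fm g ≫ rmap p u A) : f = g :=
  rhom_ext₀ p u h

lemma reindex_fac [p.IsPreFibered] {J I : R} (u : J ⟶ I) {A B : p.Fiber I} (f : A ⟶ B) :
    fm ((reindex p u).map f) ≫ rmap p u B = rmap p u A ≫ fm f :=
  flift_fac₀ p u _ _

/-- A finite limit fibration: the fibers have finite limits, preserved by reindexing. -/
class IsFiniteLimitFibration : Prop extends p.IsFibered where
  hasFiniteLimits (I : R) : HasFiniteLimits (p.Fiber I)
  preserves {J I : R} (u : J ⟶ I) : PreservesFiniteLimits (reindex p u)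

attribute [instance] IsFiniteLimitFibration.hasFiniteLimits IsFiniteLimitFibration.preserves

lemma isHomLift_of_comp_vertical {I J : R} {X B C : E} (t : J ⟶ I) (y : X ⟶ B) (g : B ⟶ C)
    [hg : p.IsHomLift (𝟙 I) g] [h : p.IsHomLift t (y ≫ g)] : p.IsHomLift t y := by
  have h1 := IsHomLift.fac' p (𝟙 I) g
  have h2 := IsHomLift.fac' p t (y ≫ g)
  apply IsHomLift.of_fac' p t y (IsHomLift.domain_eq p t (y ≫ g)) (IsHomLift.domain_eq p (𝟙 I) g)
  rw [p.map_comp, h1] at h2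
  simp only [Category.id_comp, eqToHom_trans] at h2
  rw [← cancel_mono (eqToHom ((IsHomLift.domain_eq p (𝟙 I) g).trans
    (IsHomLift.codomain_eq p (𝟙 I) g).symm)), h2]
  simp

lemma homLift_unique {p : E ⥤ R} {I J : R} {X Y : E} {f : X ⟶ Y} {u v : I ⟶ J}
    (hu : p.IsHomLift u f) (hv : p.IsHomLift v f) : u = v := by
  have h1 := IsHomLift.fac' p u f
  have h2 := IsHomLift.fac' p v f
  rw [h1, cancel_epi, cancel_mono] at h2
  exact h2

lemma isPullback_of_existsUnique {D : Type*} [Category D] {P A B C : D} {a : P ⟶ A} {b : P ⟶ B}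
    {f : A ⟶ C} {g : B ⟶ C} (w : a ≫ f = b ≫ g)
    (H : ∀ (X : D) (x : X ⟶ A) (y : X ⟶ B), x ≫ f = y ≫ g → ∃ l : X ⟶ P, l ≫ a = x ∧ l ≫ b = y)
    (U : ∀ (X : D) (l l' : X ⟶ P), l ≫ a = l' ≫ a → l ≫ b = l' ≫ b → l = l') :
    IsPullback a b f g := by
  choose l hl using H
  exact ⟨⟨w⟩, ⟨PullbackCone.IsLimit.mk w (fun s => l _ s.fst s.snd s.condition)
    (fun s => (hl _ s.fst s.snd s.condition).1) (fun s => (hl _ s.fst s.snd s.condition).2)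
    (fun s m h1 h2 => U _ _ _ (h1.trans (hl _ s.fst s.snd s.condition).1.symm)
      (h2.trans (hl _ s.fst s.snd s.condition).2.symm))⟩⟩

variable {p}

/-- The arrow of the base underlying `x : X ⟶ A`, where `A` is an object of the fiber over `I`. -/
def under {J I : R} {X : p.Fiber J} {A : p.Fiber I} (x : fo X ⟶ fo A) : J ⟶ I :=
  eqToHom (fo_over X).symm ≫ p.map x ≫ eqToHom (fo_over A)

lemma under_isHomLift {J I : R} {X : p.Fiber J} {A : p.Fiber I} (x : fo X ⟶ fo A) :
    p.IsHomLift (under x) x :=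
  IsHomLift.of_fac' p _ x (fo_over X) (fo_over A) (by simp [under])

/-- Pullbacks in a fiber are pullbacks in the total category. -/
theorem isPullback_of_fiber [IsFiniteLimitFibration p] {I : R} {W A B C : p.Fiber I}
    {a : W ⟶ A} {b : W ⟶ B} {f : A ⟶ C} {g : B ⟶ C} (h : IsPullback a b f g) :
    IsPullback (fm a) (fm b) (fm f) (fm g) := by
  have ex : ∀ {J : R} (X : p.Fiber J) (x : fo X ⟶ fo A) (y : fo X ⟶ fo B),
      x ≫ fm f = y ≫ fm g → ∃ l : fo X ⟶ fo W, l ≫ fm a = x ∧ l ≫ fm b = y := by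
    intro J X x y hxy
    let t := under x
    have hx : p.IsHomLift t x := under_isHomLift x
    have hy' : p.IsHomLift t (y ≫ fm g) := by rw [← hxy]; infer_instance
    have hy : p.IsHomLift t y := isHomLift_of_comp_vertical p t y (fm g)
    have hp := h.map (reindex p t)
    have hc : flift p t x hx ≫ (reindex p t).map f = flift p t y hy ≫ (reindex p t).map g := by
      apply rhom_ext p t
      rw [fm_comp, fm_comp, Category.assoc, Category.assoc, reindex_fac,
        reindex_fac, ← Category.assoc, ← Category.assoc, flift_fac, flift_fac, hxy]
    refine ⟨fm (hp.lift _ _ hc) ≫ rmap p t W, ?_, ?_⟩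
    · rw [Category.assoc, ← reindex_fac, ← Category.assoc, ← fm_comp, hp.lift_fst]
      exact flift_fac p t x hx
    · rw [Category.assoc, ← reindex_fac, ← Category.assoc, ← fm_comp, hp.lift_snd]
      exact flift_fac p t y hy
  have un : ∀ {J : R} (X : p.Fiber J) (l l' : fo X ⟶ fo W),
      l ≫ fm a = l' ≫ fm a → l ≫ fm b = l' ≫ fm b → l = l' := by
    intro J X l l' h1 h2
    let t := under l
    have hl : p.IsHomLift t l := under_isHomLift l
    have hl'' : p.IsHomLift t (l' ≫ fm a) := by rw [← h1]; infer_instance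
    have hl' : p.IsHomLift t l' := isHomLift_of_comp_vertical p t l' (fm a)
    have hp := h.map (reindex p t)
    have key : flift p t l hl = flift p t l' hl' := by
      apply hp.hom_ext
      · apply rhom_ext p t
        rw [fm_comp, fm_comp, Category.assoc, Category.assoc, reindex_fac,
          ← Category.assoc, ← Category.assoc, flift_fac, flift_fac, h1]
      · apply rhom_ext p t
        rw [fm_comp, fm_comp, Category.assoc, Category.assoc, reindex_fac,
          ← Category.assoc, ← Category.assoc, flift_fac, flift_fac, h2]
    rw [← flift_fac p t l hl, key, flift_fac p t l' hl']
  exact isPullback_of_existsUnique (by rw [← fm_comp, h.w, fm_comp])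
    (fun X x y hxy => ex (Functor.Fiber.mk (a := X) rfl) x y hxy)
    (fun X l l' h1 h2 => un (Functor.Fiber.mk (a := X) rfl) l l' h1 h2)

theorem exists_isPullback_aux [IsFiniteLimitFibration p] {P I J K : R} {q₁ : P ⟶ I} {q₂ : P ⟶ J}
    {u : I ⟶ K} {v : J ⟶ K} {A : p.Fiber I} {B : p.Fiber J} {C : p.Fiber K}
    (f : fo A ⟶ fo C) (g : fo B ⟶ fo C) (hf : p.IsHomLift u f) (hg : p.IsHomLift v g)
    (hq : IsPullback q₁ q₂ u v) :
    ∃ (W : p.Fiber P) (a : fo W ⟶ fo A) (b : fo W ⟶ fo B),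
      p.IsHomLift q₁ a ∧ p.IsHomLift q₂ b ∧ IsPullback a b f g := by
  have hf1 : p.IsHomLift (q₁ ≫ u) (rmap p q₁ A ≫ f) := inferInstance
  have hg1 : p.IsHomLift (q₁ ≫ u) (rmap p q₂ B ≫ g) := by rw [hq.w]; infer_instance
  let f' := flift p (q₁ ≫ u) _ hf1
  let g' := flift p (q₁ ≫ u) _ hg1
  have hf' : fm f' ≫ rmap p (q₁ ≫ u) C = rmap p q₁ A ≫ f := flift_fac p _ _ _
  have hg' : fm g' ≫ rmap p (q₁ ≫ u) C = rmap p q₂ B ≫ g := flift_fac p _ _ _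
  have hT := isPullback_of_fiber (IsPullback.of_hasPullback f' g')
  let w₁ := pullback.fst f' g'
  let w₂ := pullback.snd f' g'
  have ha : p.IsHomLift q₁ (fm w₁ ≫ rmap p q₁ A) := inferInstance
  have hb : p.IsHomLift q₂ (fm w₂ ≫ rmap p q₂ B) := inferInstance
  have ex : ∀ {L : R} (X : p.Fiber L) (x : fo X ⟶ fo A) (y : fo X ⟶ fo B), x ≫ f = y ≫ g →
      ∃ l : fo X ⟶ fo (pullback f' g'), l ≫ fm w₁ ≫ rmap p q₁ A = x ∧
        l ≫ fm w₂ ≫ rmap p q₂ B = y := by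
    intro L X x y hxy
    have hx := under_isHomLift x
    have hy := under_isHomLift y
    have e : under x ≫ u = under y ≫ v := by
      have i1 : p.IsHomLift (under x ≫ u) (x ≫ f) := inferInstance
      have i2 : p.IsHomLift (under y ≫ v) (x ≫ f) := by rw [hxy]; infer_instance
      exact homLift_unique i1 i2
    let t := hq.lift _ _ e
    have hx2 : p.IsHomLift (t ≫ q₁) x := by rw [hq.lift_fst]; exact hx
    have hy2 : p.IsHomLift (t ≫ q₂) y := by rw [hq.lift_snd]; exact hy
    let x' := IsStronglyCartesian.map p q₁ (rmap p q₁ A) (g := t) rfl x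
    let y' := IsStronglyCartesian.map p q₂ (rmap p q₂ B) (g := t) rfl y
    have hx' : x' ≫ rmap p q₁ A = x := IsStronglyCartesian.fac p q₁ (rmap p q₁ A) rfl x
    have hy' : y' ≫ rmap p q₂ B = y := IsStronglyCartesian.fac p q₂ (rmap p q₂ B) rfl y
    have hxl : p.IsHomLift t x' := IsStronglyCartesian.map_isHomLift p q₁ (rmap p q₁ A) rfl x
    have hyl : p.IsHomLift t y' := IsStronglyCartesian.map_isHomLift p q₂ (rmap p q₂ B) rfl y
    have hc : x' ≫ fm f' = y' ≫ fm g' := by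
      have i1 : p.IsHomLift t (x' ≫ fm f') := inferInstance
      have i2 : p.IsHomLift t (y' ≫ fm g') := inferInstance
      apply IsStronglyCartesian.ext p (q₁ ≫ u) (rmap p (q₁ ≫ u) C) t
      rw [Category.assoc, Category.assoc, hf', hg', ← Category.assoc, ← Category.assoc, hx', hy',
        hxy]
    refine ⟨hT.lift x' y' hc, ?_, ?_⟩
    · rw [← Category.assoc, hT.lift_fst, hx']
    · rw [← Category.assoc, hT.lift_snd, hy']
  have un : ∀ {L : R} (X : p.Fiber L) (l l' : fo X ⟶ fo (pullback f' g')),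
      l ≫ fm w₁ ≫ rmap p q₁ A = l' ≫ fm w₁ ≫ rmap p q₁ A →
      l ≫ fm w₂ ≫ rmap p q₂ B = l' ≫ fm w₂ ≫ rmap p q₂ B → l = l' := by
    intro L X l l' h1 h2
    have hl := under_isHomLift l
    have hl' := under_isHomLift l'
    have ht : under l = under l' := by
      apply hq.hom_ext
      · have i1 : p.IsHomLift (under l ≫ q₁) (l ≫ fm w₁ ≫ rmap p q₁ A) := inferInstance
        have i2 : p.IsHomLift (under l' ≫ q₁) (l ≫ fm w₁ ≫ rmap p q₁ A) := by
          rw [h1]; infer_instance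
        exact homLift_unique i1 i2
      · have i1 : p.IsHomLift (under l ≫ q₂) (l ≫ fm w₂ ≫ rmap p q₂ B) := inferInstance
        have i2 : p.IsHomLift (under l' ≫ q₂) (l ≫ fm w₂ ≫ rmap p q₂ B) := by
          rw [h2]; infer_instance
        exact homLift_unique i1 i2
    rw [← ht] at hl'
    apply hT.hom_ext
    · have i1 : p.IsHomLift (under l) (l ≫ fm w₁) := inferInstance
      have i2 : p.IsHomLift (under l) (l' ≫ fm w₁) := inferInstance
      exact IsStronglyCartesian.ext p q₁ (rmap p q₁ A) (under l)
        (by rw [Category.assoc, Category.assoc, h1])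
    · have i1 : p.IsHomLift (under l) (l ≫ fm w₂) := inferInstance
      have i2 : p.IsHomLift (under l) (l' ≫ fm w₂) := inferInstance
      exact IsStronglyCartesian.ext p q₂ (rmap p q₂ B) (under l)
        (by rw [Category.assoc, Category.assoc, h2])
  refine ⟨_, _, _, ha, hb, isPullback_of_existsUnique ?_
    (fun X x y hxy => ex (Functor.Fiber.mk (a := X) rfl) x y hxy)
    (fun X l l' h1 h2 => un (Functor.Fiber.mk (a := X) rfl) l l' h1 h2)⟩
  rw [Category.assoc, Category.assoc, ← hf', ← hg', ← Category.assoc, ← Category.assoc, hT.w]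

theorem exists_isPullback [HasFiniteLimits R] [IsFiniteLimitFibration p] {A B C : E}
    (f : A ⟶ C) (g : B ⟶ C) : ∃ (W : E) (a : W ⟶ A) (b : W ⟶ B), IsPullback a b f g ∧
      IsPullback (p.map a) (p.map b) (p.map f) (p.map g) := by
  obtain ⟨W, (a : fo W ⟶ A), (b : fo W ⟶ B), ha, hb, h⟩ := exists_isPullback_aux (A := Functor.Fiber.mk (a := A) rfl)
    (B := Functor.Fiber.mk (a := B) rfl) (C := Functor.Fiber.mk (a := C) rfl) f g
    (inferInstanceAs (p.IsHomLift (p.map f) f)) (inferInstanceAs (p.IsHomLift (p.map g) g))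
    (IsPullback.of_hasPullback (p.map f) (p.map g))
  refine ⟨fo W, a, b, h, ?_⟩
  refine IsPullback.of_iso (IsPullback.of_hasPullback (p.map f) (p.map g))
      (eqToIso (fo_over W).symm) (Iso.refl _) (Iso.refl _) (Iso.refl _) ?_ ?_ (by simp) (by simp)
  · have : p.IsHomLift (pullback.fst (p.map f) (p.map g)) a := ha
    rw [IsHomLift.fac' p (pullback.fst (p.map f) (p.map g)) a]; simp
  · have : p.IsHomLift (pullback.snd (p.map f) (p.map g)) b := hb
    rw [IsHomLift.fac' p (pullback.snd (p.map f) (p.map g)) b]; simp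

theorem map_isPullback [HasFiniteLimits R] [IsFiniteLimitFibration p] {W A B C : E}
    {a : W ⟶ A} {b : W ⟶ B} {f : A ⟶ C} {g : B ⟶ C} (h : IsPullback a b f g) :
    IsPullback (p.map a) (p.map b) (p.map f) (p.map g) := by
  obtain ⟨W', a', b', h1, h2⟩ := exists_isPullback (p := p) f g
  refine IsPullback.of_iso h2 (p.mapIso (h1.isoIsPullback _ _ h)) (Iso.refl _) (Iso.refl _)
    (Iso.refl _) ?_ ?_ (by simp) (by simp)
  · simp [← p.map_comp]
  · simp [← p.map_comp]

/-- Cartesian arrows are stable under pullback along arbitrary arrows. -/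
theorem isCart_of_isPullback [HasFiniteLimits R] [IsFiniteLimitFibration p] {W A B C : E}
    {a : W ⟶ A} {b : W ⟶ B} {f : A ⟶ C} {g : B ⟶ C} (h : IsPullback a b f g) (hf : IsCart p f) :
    IsCart p b := by
  have hp := map_isPullback (p := p) h
  refine { universal_property' := ?_ }
  intro X t x hx
  haveI : p.IsHomLift ((t ≫ p.map a) ≫ p.map f) (x ≫ g) := by
    rw [Category.assoc, hp.w, ← Category.assoc]; infer_instance
  let y := IsStronglyCartesian.map p (p.map f) f (g := t ≫ p.map a) rfl (x ≫ g)
  have hy : y ≫ f = x ≫ g := IsStronglyCartesian.fac p (p.map f) f rfl (x ≫ g)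
  have hyl : p.IsHomLift (t ≫ p.map a) y := inferInstance
  have hl : p.IsHomLift t (h.lift y x hy) := by
    have : t = p.map (h.lift y x hy) := by
      apply hp.hom_ext
      · rw [← p.map_comp, h.lift_fst]; exact IsHomLift.eq_of_isHomLift p _ _
      · rw [← p.map_comp, h.lift_snd]; exact IsHomLift.eq_of_isHomLift p _ _
    rw [this]; infer_instance
  refine ⟨h.lift y x hy, ⟨hl, h.lift_snd _ _ _⟩, ?_⟩
  rintro l ⟨hl', hl2⟩
  apply h.hom_ext
  · rw [h.lift_fst]
    exact IsStronglyCartesian.map_uniq p (p.map f) f rfl (x ≫ g) (l ≫ a)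
      (by rw [Category.assoc, h.w, reassoc_of% hl2])
  · rw [h.lift_snd, hl2]

section Terminal
variable (p) [IsFiniteLimitFibration p]

/-- The terminal object of the fiber over `I`. -/
noncomputable def one (I : R) : E := fo (⊤_ (p.Fiber I))

lemma one_over (I : R) : p.obj (one p I) = I := fo_over (⊤_ (p.Fiber I))

lemma existsUnique_toOne_aux {I J : R} (X : p.Fiber J) (t : J ⟶ I) :
    ∃! f : fo X ⟶ fo (⊤_ (p.Fiber I)), p.IsHomLift t f := by
  have hT : IsTerminal ((reindex p t).obj (⊤_ (p.Fiber I))) :=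
    IsTerminal.isTerminalObj (reindex p t) _ terminalIsTerminal
  refine ⟨fm (hT.from X) ≫ rmap p t _, inferInstance, ?_⟩
  intro g hg
  rw [← flift_fac p t g hg, hT.hom_ext (flift p t g hg) (hT.from X)]

lemma existsUnique_toOne {X : E} {I : R} (t : p.obj X ⟶ I) :
    ∃! f : X ⟶ one p I, p.IsHomLift t f :=
  existsUnique_toOne_aux p (Functor.Fiber.mk (a := X) rfl) t

/-- The unique arrow `X ⟶ 1_I` over `t`. -/
noncomputable def toOne {X : E} {I : R} (t : p.obj X ⟶ I) : X ⟶ one p I :=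
  (existsUnique_toOne p t).choose

instance toOne_isHomLift {X : E} {I : R} (t : p.obj X ⟶ I) : p.IsHomLift t (toOne p t) :=
  (existsUnique_toOne p t).choose_spec.1

lemma eq_toOne {X : E} {I : R} (t : p.obj X ⟶ I) (f : X ⟶ one p I) (hf : p.IsHomLift t f) :
    f = toOne p t :=
  (existsUnique_toOne p t).choose_spec.2 f hf

/-- The functor `I ↦ 1_I` sending `u` to the unique arrow `1_I ⟶ 1_J` over `u`. -/
noncomputable def oneFunctor : R ⥤ E where
  obj I := one p I
  map {I J} u := toOne p (eqToHom (one_over p I) ≫ u)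
  map_id I := (eq_toOne p _ _ (by
    simpa using IsHomLift.id_lift_eqToHom_domain (one_over p I) rfl)).symm
  map_comp {I J K} u v := (eq_toOne p _ _ (by
    have h1 : p.IsHomLift u (toOne p (eqToHom (one_over p I) ≫ u)) := by
      simpa using toOne_isHomLift p (eqToHom (one_over p I) ≫ u)
    have h2 : p.IsHomLift v (toOne p (eqToHom (one_over p J) ≫ v)) := by
      simpa using toOne_isHomLift p (eqToHom (one_over p J) ≫ v)
    have := IsHomLift.comp p u v (toOne p (eqToHom (one_over p I) ≫ u))
      (toOne p (eqToHom (one_over p J) ≫ v))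
    simpa using this)).symm

/-- The unique vertical arrow `A ⟶ 1_{p A}`. -/
noncomputable def bang (A : E) : A ⟶ one p (p.obj A) := toOne p (𝟙 _)

lemma oneFunctor_map_isHomLift {I J : R} (u : I ⟶ J) : p.IsHomLift u ((oneFunctor p).map u) := by
  have h : p.IsHomLift u (toOne p (eqToHom (one_over p I) ≫ u)) := by
    simpa using toOne_isHomLift p (eqToHom (one_over p I) ≫ u)
  exact h

lemma bang_natural {A B : E} (f : A ⟶ B) :
    f ≫ bang p B = bang p A ≫ (oneFunctor p).map (p.map f) := by
  have h1 : p.IsHomLift (p.map f) (f ≫ bang p B) := by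
    have : p.IsHomLift (p.map f ≫ 𝟙 _) (f ≫ bang p B) :=
      haveI : p.IsHomLift (𝟙 _) (bang p B) := toOne_isHomLift p _
      inferInstance
    simpa using this
  have h2 : p.IsHomLift (p.map f) (bang p A ≫ (oneFunctor p).map (p.map f)) := by
    have i1 := oneFunctor_map_isHomLift p (p.map f)
    have i2 : p.IsHomLift (𝟙 _) (bang p A) := toOne_isHomLift p _
    have := @IsHomLift.comp _ _ _ _ p _ _ _ _ _ _ (𝟙 _) (p.map f) (bang p A)
      ((oneFunctor p).map (p.map f)) i2 i1
    simpa using this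
  rw [eq_toOne p (p.map f) _ h1, eq_toOne p (p.map f) _ h2]

theorem hasFiniteLimits_total (p : E ⥤ R) [IsFiniteLimitFibration p] [HasFiniteLimits R] :
    HasFiniteLimits E := by
  haveI : ∀ {X Y Z : E} {f : X ⟶ Z} {g : Y ⟶ Z}, HasLimit (cospan f g) := by
    intro X Y Z f g
    obtain ⟨W, a, b, h, -⟩ := exists_isPullback (p := p) f g
    exact h.hasPullback
  haveI : HasPullbacks E := hasPullbacks_of_hasLimit_cospan _
  haveI : HasTerminal E := by
    haveI : ∀ X : E, Subsingleton (X ⟶ one p (⊤_ R)) := fun X => ⟨fun f g => by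
      have hf : ∀ f : X ⟶ one p (⊤_ R), p.IsHomLift (terminal.from (p.obj X)) f := fun f => by
        refine IsHomLift.of_fac' p _ f rfl (one_over p _) ?_
        rw [← cancel_mono (eqToHom (one_over p (⊤_ R)))]
        exact Subsingleton.elim _ _
      rw [eq_toOne p _ f (hf f), eq_toOne p _ g (hf g)]⟩
    haveI : ∀ X : E, Unique (X ⟶ one p (⊤_ R)) := fun X =>
      ⟨⟨toOne p (terminal.from _)⟩, fun _ => Subsingleton.elim _ _⟩
    exact hasTerminal_of_unique (one p (⊤_ R))
  exact hasFiniteLimits_of_hasTerminal_and_pullbacks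

end Terminal
end Fib

/-- A regular functor preserves finite limits and regular epimorphisms. -/
structure IsRegularFunctor {C : Type u₁} [Category.{v₁} C] {D : Type u₂} [Category.{v₂} D]
    (F : C ⥤ D) : Prop where
  preservesFiniteLimits : PreservesFiniteLimits F
  map_regularEpi {X Y : C} (f : X ⟶ Y) : IsRegularEpi f → IsRegularEpi (F.map f)

/-- An exact category: a regular category in which every equivalence relation is a kernel pair. -/
class IsExact (C : Type u₁) [Category.{v₁} C] : Prop extends Regular C where
  effective {X Q : C} (p₁ p₂ : Q ⟶ X) : IsEquivalenceRelation p₁ p₂ →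
    ∃ (Y : C) (π : X ⟶ Y), IsKernelPair π p₁ p₂

section
variable {R : Type u₁} [Category.{v₁} R] {E : Type u₂} [Category.{v₂} E] (p : E ⥤ R)

/-- The pre-stack condition for the regular topology: for a regular epimorphism `e : J ⟶ I`, the
functor from the fiber over `I` to descent data along `e` is full and faithful. Here `A₁, B₁` are
reindexings of `A, B` along `e`, with their canonical descent data given by the reindexings
`A₂, B₂` to the kernel pair of `e`, and `f₁ : A₁ ⟶ B₁` is a morphism of descent data. -/
def IsPreStack : Prop :=
  ∀ ⦃I J K : R⦄ (e : J ⟶ I) (d₀ d₁ : K ⟶ J), IsRegularEpi e → IsKernelPair e d₀ d₁ →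
    ∀ ⦃A A₁ A₂ B B₁ B₂ : E⦄ (a : A₁ ⟶ A) (a₀ a₁ : A₂ ⟶ A₁) (b : B₁ ⟶ B) (b₀ b₁ : B₂ ⟶ B₁),
      p.IsStronglyCartesian e a → p.IsStronglyCartesian d₀ a₀ → p.IsStronglyCartesian d₁ a₁ →
      a₀ ≫ a = a₁ ≫ a →
      p.IsStronglyCartesian e b → p.IsStronglyCartesian d₀ b₀ → p.IsStronglyCartesian d₁ b₁ →
      b₀ ≫ b = b₁ ≫ b →
      ∀ (f₁ : A₁ ⟶ B₁) (f₂ : A₂ ⟶ B₂), p.IsHomLift (𝟙 J) f₁ → p.IsHomLift (𝟙 K) f₂ →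
        f₂ ≫ b₀ = a₀ ≫ f₁ → f₂ ≫ b₁ = a₁ ≫ f₁ →
        ∃! h : A ⟶ B, p.IsHomLift (𝟙 I) h ∧ a ≫ h = f₁ ≫ b

/-- `c` is cartesian over a regular epimorphism. -/
def IsCoverCart {A B : E} (c : A ⟶ B) : Prop := IsCart p c ∧ IsRegularEpi (p.map c)

/-- `m` is a vertical monomorphism, i.e. a predicate on its codomain. -/
def IsVMono {U A : E} (m : U ⟶ A) : Prop := IsVertical p m ∧ Mono m

/-- `n` is the image of the vertical monomorphism `m` under the left adjoint of reindexing along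
`c`: for every vertical monomorphism `k`, `n ≤ k` if and only if `m ≤ c^* k`. -/
def IsUnion {A B U V : E} (c : A ⟶ B) (m : U ⟶ A) (n : V ⟶ B) : Prop :=
  ∀ ⦃W : E⦄ (k : W ⟶ B), IsVMono p k →
    ((∃ t : V ⟶ W, t ≫ k = n) ↔ ∃ t : U ⟶ W, t ≫ k = m ≫ c)

/-- Stable internal unions: left adjoints to reindexing of vertical monomorphisms along cartesian
arrows, with the Beck–Chevalley condition for pullbacks along arbitrary arrows. -/
structure HasStableUnions : Prop where
  exists_union {A B U : E} (c : A ⟶ B) (m : U ⟶ A) : IsCart p c → IsVMono p m →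
    ∃ (V : E) (n : V ⟶ B), IsVMono p n ∧ IsUnion p c m n
  stable {A B A' B' U V U' V' : E} {c : A ⟶ B} {c' : A' ⟶ B'} {g : B' ⟶ B} {g' : A' ⟶ A}
    {m : U ⟶ A} {n : V ⟶ B} {m' : U' ⟶ A'} {n' : V' ⟶ B'} {x : U' ⟶ U} {y : V' ⟶ V} :
    IsCart p c → IsPullback g' c' c g → IsVMono p m → IsVMono p n → IsVMono p m' → IsVMono p n' →
    IsPullback x m' m g' → IsPullback y n' n g → IsUnion p c m n → IsUnion p c' m' n'

/-- Extensive internal sums: cocartesian lifts exist, are stable under pullback along arbitrary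
arrows, and are disjoint, i.e. the diagonal of a cocartesian arrow is cocartesian. -/
structure HasExtensiveSums : Prop where
  exists_sum (A : E) {I : R} (u : p.obj A ⟶ I) :
    ∃ (B : E) (s : A ⟶ B), p.IsStronglyCocartesian u s
  stable {W A B C : E} {a : W ⟶ A} {b : W ⟶ B} {f : A ⟶ C} {g : B ⟶ C} :
    IsPullback a b f g → IsCocart p f → IsCocart p b
  disjoint {A B K : E} {s : A ⟶ B} {k₀ k₁ : K ⟶ A} {d : A ⟶ K} :
    IsCocart p s → IsKernelPair s k₀ k₁ → d ≫ k₀ = 𝟙 A → d ≫ k₁ = 𝟙 A → IsCocart p d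

/-- A finite-limit pre-stack. -/
class IsFiniteLimitPreStack : Prop extends IsFiniteLimitFibration p where
  preStack : IsPreStack p

/-- A pre-stack of regular categories. -/
class IsRegularPreStack : Prop extends IsFiniteLimitPreStack p where
  regular (I : R) : Regular (p.Fiber I)
  reindex_regular {J I : R} (u : J ⟶ I) : IsRegularFunctor (reindex p u)

/-- A geometric pre-stack: a pre-stack of regular categories with stable internal unions. -/
class IsGeometricPreStack : Prop extends IsRegularPreStack p where
  unions : HasStableUnions p

/-- A fibered pretopos: a pre-stack with exact fibers, regular reindexing functors and extensive
internal sums. -/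
class IsFiberedPretopos : Prop extends IsRegularPreStack p where
  exact (I : R) : IsExact (p.Fiber I)
  sums : HasExtensiveSums p

end

section
variable {R : Type u₁} [Category.{v₁} R] {S : BasedCategory.{v₂, u₂} R}
  {T : BasedCategory.{v₃, u₃} R}

/-- The functor between fibers induced by a functor over the base. -/
def fiberMap (F : S ⥤ᵇ T) (I : R) : S.p.Fiber I ⥤ T.p.Fiber I where
  obj A := Functor.Fiber.mk (a := F.obj (fo A)) ((F.w_obj _).trans (fo_over A))
  map f := ⟨F.map (fm f), BasedFunctor.preserves_isHomLift F (𝟙 I) (fm f)⟩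
  map_id A := Functor.Fiber.hom_ext (F.map_id (fo A))
  map_comp f g := Functor.Fiber.hom_ext (F.map_comp (fm f) (fm g))

/-- A fibered functor: a functor over the base preserving cartesian arrows. -/
def IsFiberedFunctor (F : S ⥤ᵇ T) : Prop :=
  ∀ ⦃A B : S.obj⦄ (f : A ⟶ B), IsCart S.p f → IsCart T.p (F.map f)

/-- A geometric functor: fibered, regular on the fibers, and preserving internal unions. -/
structure IsGeometricFunctor (F : S ⥤ᵇ T) : Prop where
  fibered : IsFiberedFunctor F
  regular (I : R) : IsRegularFunctor (fiberMap F I)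
  map_union {A B U V : S.obj} (c : A ⟶ B) (m : U ⟶ A) (n : V ⟶ B) :
    IsCart S.p c → IsVMono S.p m → IsVMono S.p n → IsUnion S.p c m n →
    IsUnion T.p (F.map c) (F.map m) (F.map n)

/-- A functor of fibered pretoposes: fibered, regular on the fibers, and preserving internal
sums. -/
structure IsPretoposFunctor (F : S ⥤ᵇ T) : Prop where
  fibered : IsFiberedFunctor F
  regular (I : R) : IsRegularFunctor (fiberMap F I)
  map_sum {A B : S.obj} (s : A ⟶ B) : IsCocart S.p s → IsCocart T.p (F.map s)

end

/-- An existential fibration on a category with finite limits, given by its posets of predicates: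
fiberwise finite meets, stable under reindexing, and left adjoints to all reindexing maps subject
to the Beck–Chevalley and Frobenius conditions. -/
structure ExDoctrine (E : Type u₂) [Category.{v₂} E] [HasFiniteLimits E] where
  Pred : E → Type w
  semilatticeInf (A : E) : SemilatticeInf (Pred A)
  orderTop (A : E) : OrderTop (Pred A)
  pull {A B : E} (f : A ⟶ B) : Pred B → Pred A
  pull_id {A : E} (φ : Pred A) : pull (𝟙 A) φ = φ
  pull_comp {A B C : E} (f : A ⟶ B) (g : B ⟶ C) (φ : Pred C) :
    pull (f ≫ g) φ = pull f (pull g φ)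
  pull_inf {A B : E} (f : A ⟶ B) (φ ψ : Pred B) : pull f (φ ⊓ ψ) = pull f φ ⊓ pull f ψ
  pull_top {A B : E} (f : A ⟶ B) : pull f ⊤ = ⊤
  ex {A B : E} (f : A ⟶ B) : Pred A → Pred B
  ex_le_iff {A B : E} (f : A ⟶ B) (φ : Pred A) (ψ : Pred B) : ex f φ ≤ ψ ↔ φ ≤ pull f ψ
  beckChevalley {W A B C : E} {a : W ⟶ A} {b : W ⟶ B} {f : A ⟶ C} {g : B ⟶ C} :
    IsPullback a b f g → ∀ φ : Pred A, pull g (ex f φ) = ex b (pull a φ)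
  frobenius {A B : E} (f : A ⟶ B) (φ : Pred A) (ψ : Pred B) :
    ex f φ ⊓ ψ = ex f (φ ⊓ pull f ψ)

attribute [instance] ExDoctrine.semilatticeInf ExDoctrine.orderTop

namespace ExDoctrine
variable {E : Type u₂} [Category.{v₂} E] [HasFiniteLimits E] (D : ExDoctrine.{v₂, u₂, w} E)

lemma pull_mono {A B : E} (f : A ⟶ B) {φ ψ : D.Pred B} (h : φ ≤ ψ) : D.pull f φ ≤ D.pull f ψ := by
  rw [← inf_eq_left] at h ⊢
  rw [← D.pull_inf, h]

lemma le_pull_ex {A B X : E} (f : A ⟶ B) (φ : D.Pred A) (a : X ⟶ A) :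
    D.pull a φ ≤ D.pull (a ≫ f) (D.ex f φ) := by
  rw [D.pull_comp]
  exact D.pull_mono a ((D.ex_le_iff f φ _).1 le_rfl)

lemma ex_elim {A B X : E} (f : A ⟶ B) (φ : D.Pred A) (y : X ⟶ B) (ψ χ : D.Pred X)
    (H : ∀ (Y : E) (k : Y ⟶ X) (a : Y ⟶ A), k ≫ y = a ≫ f →
      D.pull a φ ⊓ D.pull k ψ ≤ D.pull k χ) : D.pull y (D.ex f φ) ⊓ ψ ≤ χ := by
  rw [D.beckChevalley (IsPullback.of_hasPullback f y), D.frobenius, D.ex_le_iff]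
  exact H _ _ _ pullback.condition.symm

/-- The predicate `ρ(x, y)`. -/
noncomputable def sub₂ {A B X : E} (ρ : D.Pred (A ⨯ B)) (x : X ⟶ A) (y : X ⟶ B) : D.Pred X :=
  D.pull (prod.lift x y) ρ

lemma pull_sub₂ {A B X Y : E} (ρ : D.Pred (A ⨯ B)) (x : X ⟶ A) (y : X ⟶ B) (k : Y ⟶ X) :
    D.pull k (D.sub₂ ρ x y) = D.sub₂ ρ (k ≫ x) (k ≫ y) := by
  rw [sub₂, sub₂, ← D.pull_comp, prod.comp_lift]

lemma sub₂_fst_snd {A B : E} (ρ : D.Pred (A ⨯ B)) : D.sub₂ ρ prod.fst prod.snd = ρ := by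
  rw [sub₂, prod.lift_fst_snd, D.pull_id]

lemma sub₂_le {A B : E} {ρ σ : D.Pred (A ⨯ B)}
    (h : ∀ (X : E) (x : X ⟶ A) (y : X ⟶ B), D.sub₂ ρ x y ≤ D.sub₂ σ x y) : ρ ≤ σ := by
  have := h _ prod.fst prod.snd
  rwa [sub₂_fst_snd, sub₂_fst_snd] at this

/-- The equality predicate `∃_δ ⊤`, where `δ` is the diagonal. -/
noncomputable def eq (A : E) : D.Pred (A ⨯ A) := D.ex (diag A) ⊤

lemma eq_refl {A X : E} (x : X ⟶ A) : ⊤ ≤ D.sub₂ (D.eq A) x x := by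
  have := D.le_pull_ex (diag A) ⊤ x
  rwa [D.pull_top, prod.comp_diag] at this

lemma eq_elim {A X : E} (x y : X ⟶ A) (ψ χ : D.Pred X)
    (H : ∀ (Y : E) (k : Y ⟶ X), k ≫ x = k ≫ y → D.pull k ψ ≤ D.pull k χ) :
    D.sub₂ (D.eq A) x y ⊓ ψ ≤ χ := by
  refine D.ex_elim _ _ _ _ _ (fun Y k a h => inf_le_right.trans (H Y k ?_))
  have h1 := congrArg (· ≫ prod.fst) h
  have h2 := congrArg (· ≫ prod.snd) h
  simp only [Category.assoc, prod.lift_fst, prod.lift_snd] at h1 h2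
  rw [h1, h2]

lemma eq_le {A X : E} (x y : X ⟶ A) (χ : D.Pred X)
    (H : ∀ (Y : E) (k : Y ⟶ X), k ≫ x = k ≫ y → ⊤ ≤ D.pull k χ) :
    D.sub₂ (D.eq A) x y ≤ χ := by
  have := D.eq_elim x y ⊤ χ (fun Y k h => le_top.trans (H Y k h))
  rwa [inf_top_eq] at this

/-- An object equipped with an equivalence relation in the internal logic of `D`. -/
structure EqObj where
  obj : E
  rel : D.Pred (obj ⨯ obj)
  refl {X : E} (x : X ⟶ obj) : ⊤ ≤ D.sub₂ rel x x
  symm {X : E} (x y : X ⟶ obj) : D.sub₂ rel x y ≤ D.sub₂ rel y x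
  trans {X : E} (x y z : X ⟶ obj) : D.sub₂ rel x y ⊓ D.sub₂ rel y z ≤ D.sub₂ rel x z

variable {D}

/-- A functional relation: compatible with the equivalence relations, single-valued and total. -/
@[ext]
structure EqHom (A B : D.EqObj) where
  rel : D.Pred (A.obj ⨯ B.obj)
  cong {X : E} (x x' : X ⟶ A.obj) (y y' : X ⟶ B.obj) :
    D.sub₂ A.rel x x' ⊓ D.sub₂ rel x y ⊓ D.sub₂ B.rel y y' ≤ D.sub₂ rel x' y'
  singval {X : E} (x : X ⟶ A.obj) (y y' : X ⟶ B.obj) :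
    D.sub₂ rel x y ⊓ D.sub₂ rel x y' ≤ D.sub₂ B.rel y y'
  tot : ⊤ ≤ D.ex prod.fst rel

/-- The relation `∃ y, φ(x, y) ∧ γ(y, z)`. -/
noncomputable def relComp {A B C : E} (φ : D.Pred (A ⨯ B)) (γ : D.Pred (B ⨯ C)) : D.Pred (A ⨯ C) :=
  D.ex (prod.fst : (A ⨯ C) ⨯ B ⟶ A ⨯ C)
    (D.sub₂ φ (prod.fst ≫ prod.fst) prod.snd ⊓ D.sub₂ γ prod.snd (prod.fst ≫ prod.snd))

lemma le_relComp {A B C X : E} (φ : D.Pred (A ⨯ B)) (γ : D.Pred (B ⨯ C)) (x : X ⟶ A) (y : X ⟶ B)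
    (z : X ⟶ C) : D.sub₂ φ x y ⊓ D.sub₂ γ y z ≤ D.sub₂ (relComp φ γ) x z := by
  have := D.le_pull_ex (prod.fst : (A ⨯ C) ⨯ B ⟶ A ⨯ C)
    (D.sub₂ φ (prod.fst ≫ prod.fst) prod.snd ⊓ D.sub₂ γ prod.snd (prod.fst ≫ prod.snd))
    (prod.lift (prod.lift x z) y)
  rw [D.pull_inf, pull_sub₂, pull_sub₂] at this
  simpa only [sub₂, relComp, prod.lift_fst, prod.lift_snd, prod.lift_fst_assoc,
    prod.lift_snd_assoc] using this

lemma relComp_elim {A B C X : E} (φ : D.Pred (A ⨯ B)) (γ : D.Pred (B ⨯ C)) (x : X ⟶ A) (z : X ⟶ C)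
    (ψ χ : D.Pred X) (H : ∀ (Y : E) (k : Y ⟶ X) (y : Y ⟶ B),
      (D.sub₂ φ (k ≫ x) y ⊓ D.sub₂ γ y (k ≫ z)) ⊓ D.pull k ψ ≤ D.pull k χ) :
    D.sub₂ (relComp φ γ) x z ⊓ ψ ≤ χ := by
  refine D.ex_elim _ _ _ _ _ (fun Y k a h => ?_)
  rw [D.pull_inf, pull_sub₂, pull_sub₂, ← Category.assoc, ← Category.assoc, ← h, Category.assoc,
    Category.assoc, prod.lift_fst, prod.lift_snd]
  exact H Y k _

lemma relComp_le {A B C X : E} (φ : D.Pred (A ⨯ B)) (γ : D.Pred (B ⨯ C)) (x : X ⟶ A) (z : X ⟶ C)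
    (χ : D.Pred X) (H : ∀ (Y : E) (k : Y ⟶ X) (y : Y ⟶ B),
      D.sub₂ φ (k ≫ x) y ⊓ D.sub₂ γ y (k ≫ z) ≤ D.pull k χ) :
    D.sub₂ (relComp φ γ) x z ≤ χ := by
  have := relComp_elim φ γ x z ⊤ χ (fun Y k y => inf_le_left.trans (H Y k y))
  rwa [inf_top_eq] at this

lemma EqHom.tot_elim {A B : D.EqObj} (φ : EqHom A B) {X : E} (x : X ⟶ A.obj) (ψ χ : D.Pred X)
    (H : ∀ (Y : E) (k : Y ⟶ X) (y : Y ⟶ B.obj),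
      D.sub₂ φ.rel (k ≫ x) y ⊓ D.pull k ψ ≤ D.pull k χ) : ψ ≤ χ := by
  have h1 : ⊤ ≤ D.pull x (D.ex prod.fst φ.rel) := by
    rw [← D.pull_top x]; exact D.pull_mono x φ.tot
  have h2 : D.pull x (D.ex prod.fst φ.rel) ⊓ ψ ≤ χ := by
    refine D.ex_elim _ _ _ _ _ (fun Y k a h => ?_)
    refine le_trans (le_of_eq ?_) (H Y k (a ≫ prod.snd))
    rw [h, sub₂]
    congr 2
    apply prod.hom_ext <;> simp only [prod.lift_fst, prod.lift_snd]
  exact (le_inf (le_top.trans h1) le_rfl).trans h2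

lemma EqHom.tot_intro {A B : E} (φ : D.Pred (A ⨯ B)) {X : E} (x : X ⟶ A) (y : X ⟶ B) :
    D.sub₂ φ x y ≤ D.pull x (D.ex prod.fst φ) := by
  have := D.le_pull_ex (prod.fst : A ⨯ B ⟶ A) φ (prod.lift x y)
  rwa [prod.lift_fst] at this

/-- The identity functional relation. -/
def EqHom.id (A : D.EqObj) : EqHom A A where
  rel := A.rel
  cong x x' y y' :=
    (inf_le_inf_right _ (inf_le_inf_right _ (A.symm x x'))).trans
      ((inf_le_inf_right _ (A.trans x' x y)).trans (A.trans x' y y'))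
  singval x y y' := (inf_le_inf_right _ (A.symm x y)).trans (A.trans y x y')
  tot := by
    have h1 := A.refl (𝟙 A.obj)
    have h2 := EqHom.tot_intro A.rel (𝟙 A.obj) (𝟙 A.obj)
    rw [D.pull_id] at h2
    exact h1.trans h2

/-- Composition of functional relations. -/
noncomputable def EqHom.comp {A B C : D.EqObj} (φ : EqHom A B) (γ : EqHom B C) : EqHom A C where
  rel := relComp φ.rel γ.rel
  cong x x' z z' := by
    rw [inf_comm (D.sub₂ A.rel x x'), inf_assoc]
    refine relComp_elim _ _ _ _ _ _ (fun Y k y => ?_)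
    rw [D.pull_inf, pull_sub₂, pull_sub₂, pull_sub₂]
    refine le_trans (le_inf ?_ ?_) (le_relComp φ.rel γ.rel _ y _)
    · refine le_trans (le_inf (le_inf (inf_le_right.trans inf_le_left)
        (inf_le_left.trans inf_le_left)) (le_top.trans (B.refl y))) (φ.cong (k ≫ x) _ y y)
    · refine le_trans (le_inf (le_inf (le_top.trans (B.refl y))
        (inf_le_left.trans inf_le_right)) (inf_le_right.trans inf_le_right))
        (γ.cong y y (k ≫ z) _)
  singval x z z' := by
    refine relComp_elim _ _ _ _ _ _ (fun Y k y => ?_)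
    rw [pull_sub₂, pull_sub₂, inf_comm]
    refine relComp_elim _ _ _ _ _ _ (fun Y' k' y' => ?_)
    rw [D.pull_inf, pull_sub₂, pull_sub₂, pull_sub₂]
    have h1 : (D.sub₂ φ.rel (k' ≫ k ≫ x) y' ⊓ D.sub₂ γ.rel y' (k' ≫ k ≫ z')) ⊓
        (D.sub₂ φ.rel (k' ≫ k ≫ x) (k' ≫ y) ⊓ D.sub₂ γ.rel (k' ≫ y) (k' ≫ k ≫ z)) ≤
        D.sub₂ B.rel y' (k' ≫ y) :=
      (le_inf (inf_le_left.trans inf_le_left) (inf_le_right.trans inf_le_left)).trans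
        (φ.singval _ _ _)
    have h2 := (le_inf (le_inf h1 (inf_le_left.trans inf_le_right))
      (le_top.trans (C.refl (k' ≫ k ≫ z')))).trans (γ.cong y' (k' ≫ y) _ _)
    exact (le_inf (inf_le_right.trans inf_le_right) h2).trans (γ.singval _ _ _)
  tot := by
    refine φ.tot_elim (𝟙 _) _ _ (fun Y k y => ?_)
    refine γ.tot_elim y _ _ (fun Y' k' z => ?_)
    rw [D.pull_inf, pull_sub₂, ← D.pull_comp, ← D.pull_comp]
    refine le_trans ?_ (EqHom.tot_intro (relComp φ.rel γ.rel) (k' ≫ k) z)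
    refine le_trans (le_inf ?_ inf_le_left) (le_relComp φ.rel γ.rel (k' ≫ k) (k' ≫ y) z)
    exact inf_le_right.trans (inf_le_left.trans (by rw [Category.comp_id]))

/-- The category of equivalence relations and functional relations of an existential fibration. -/
noncomputable instance : Category D.EqObj where
  Hom A B := EqHom A B
  id A := EqHom.id A
  comp φ γ := EqHom.comp φ γ
  id_comp {A B} φ := by
    refine EqHom.ext (le_antisymm (D.sub₂_le fun X x z => ?_) (D.sub₂_le fun X x z => ?_))
    · refine relComp_le _ _ _ _ _ (fun Y k y => ?_)
      rw [pull_sub₂]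
      exact (le_inf (le_inf (inf_le_left.trans (A.symm _ _)) inf_le_right)
        (le_top.trans (B.refl _))).trans (φ.cong _ _ _ _)
    · exact (le_inf (le_top.trans (A.refl x)) le_rfl).trans (le_relComp A.rel φ.rel x x z)
  comp_id {A B} φ := by
    refine EqHom.ext (le_antisymm (D.sub₂_le fun X x z => ?_) (D.sub₂_le fun X x z => ?_))
    · refine relComp_le _ _ _ _ _ (fun Y k y => ?_)
      rw [pull_sub₂]
      exact (le_inf (le_inf (le_top.trans (A.refl _)) inf_le_left) inf_le_right).trans
        (φ.cong _ _ _ _)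
    · exact (le_inf le_rfl (le_top.trans (B.refl z))).trans (le_relComp φ.rel B.rel x z z)
  assoc {A B C G} φ γ δ := by
    refine EqHom.ext (le_antisymm (D.sub₂_le fun X x w => ?_) (D.sub₂_le fun X x w => ?_))
    · refine relComp_le _ _ _ _ _ (fun Y k z => ?_)
      refine relComp_elim _ _ _ _ _ _ (fun Y' k' y => ?_)
      rw [pull_sub₂, pull_sub₂, pull_sub₂]
      refine le_trans (le_inf (inf_le_left.trans inf_le_left)
        ((le_inf (inf_le_left.trans inf_le_right) inf_le_right).trans
          (le_relComp γ.rel δ.rel y (k' ≫ z) _))) (le_relComp φ.rel _ _ y _)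
    · refine relComp_le _ _ _ _ _ (fun Y k y => ?_)
      rw [inf_comm]
      refine relComp_elim _ _ _ _ _ _ (fun Y' k' z => ?_)
      rw [pull_sub₂, pull_sub₂, pull_sub₂]
      refine le_trans (le_inf ((le_inf inf_le_right (inf_le_left.trans inf_le_left)).trans
        (le_relComp φ.rel γ.rel _ (k' ≫ y) z)) (inf_le_left.trans inf_le_right))
        (le_relComp _ δ.rel _ z _)

variable (D)

/-- The object `A` with its equality predicate. -/
noncomputable def eqObj (A : E) : D.EqObj where
  obj := A
  rel := D.eq A
  refl x := D.eq_refl x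
  symm x y := D.eq_le x y _ (fun Y k h => by
    rw [pull_sub₂, h]; exact D.eq_refl _)
  trans x y z := D.eq_elim x y _ _ (fun Y k h => by
    rw [pull_sub₂, pull_sub₂, h])

/-- The graph of an arrow, as a predicate. -/
noncomputable def graphRel {A B : E} (f : A ⟶ B) : D.Pred (A ⨯ B) :=
  D.sub₂ (D.eq B) (prod.fst ≫ f) prod.snd

lemma sub₂_graphRel {A B X : E} (f : A ⟶ B) (x : X ⟶ A) (y : X ⟶ B) :
    D.sub₂ (D.graphRel f) x y = D.sub₂ (D.eq B) (x ≫ f) y := by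
  rw [graphRel, sub₂, pull_sub₂, ← Category.assoc, prod.lift_fst, prod.lift_snd]

lemma graphRel_cong {A B X : E} (f : A ⟶ B) (x x' : X ⟶ A) (y y' : X ⟶ B) :
    D.sub₂ (D.eq A) x x' ⊓ D.sub₂ (D.graphRel f) x y ⊓ D.sub₂ (D.eq B) y y' ≤
      D.sub₂ (D.graphRel f) x' y' := by
  rw [sub₂_graphRel, sub₂_graphRel, inf_assoc]
  refine D.eq_elim x x' _ _ (fun Y k h => ?_)
  rw [D.pull_inf, pull_sub₂, pull_sub₂, pull_sub₂, ← Category.assoc, ← Category.assoc, h]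
  exact (D.eqObj B).trans _ _ _

lemma graphRel_singval {A B X : E} (f : A ⟶ B) (x : X ⟶ A) (y y' : X ⟶ B) :
    D.sub₂ (D.graphRel f) x y ⊓ D.sub₂ (D.graphRel f) x y' ≤ D.sub₂ (D.eq B) y y' := by
  rw [sub₂_graphRel, sub₂_graphRel]
  exact (inf_le_inf_right _ ((D.eqObj B).symm _ _)).trans ((D.eqObj B).trans _ _ _)

lemma graphRel_tot {A B : E} (f : A ⟶ B) : ⊤ ≤ D.ex prod.fst (D.graphRel f) := by
  have h := EqHom.tot_intro (D.graphRel f) (𝟙 A) f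
  rw [sub₂_graphRel, Category.id_comp, D.pull_id] at h
  exact (D.eq_refl f).trans h

lemma graphRel_id (A : E) : D.graphRel (𝟙 A) = D.eq A := by
  rw [graphRel, Category.comp_id, sub₂_fst_snd]

lemma graphRel_comp {A B C : E} (f : A ⟶ B) (g : B ⟶ C) :
    D.graphRel (f ≫ g) = relComp (D.graphRel f) (D.graphRel g) := by
  refine le_antisymm (D.sub₂_le fun X x z => ?_) (D.sub₂_le fun X x z => ?_)
  · refine le_trans (le_inf (le_top.trans ?_) (le_of_eq ?_)) (le_relComp _ _ x (x ≫ f) z)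
    · rw [sub₂_graphRel]
      exact D.eq_refl _
    · rw [sub₂_graphRel, sub₂_graphRel, Category.assoc]
  · refine relComp_le _ _ _ _ _ (fun Y k y => ?_)
    rw [sub₂_graphRel, sub₂_graphRel, sub₂_graphRel, pull_sub₂]
    refine D.eq_elim _ _ _ _ (fun Y' k' h => ?_)
    rw [pull_sub₂, pull_sub₂, ← Category.assoc k' y g, ← h]
    simp only [Category.assoc, le_refl]

/-- The graph of an arrow, as a functional relation. -/
noncomputable def graph {A B : E} (f : A ⟶ B) : EqHom (D.eqObj A) (D.eqObj B) where
  rel := D.graphRel f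
  cong := D.graphRel_cong f
  singval := D.graphRel_singval f
  tot := D.graphRel_tot f

/-- The functor sending an object to itself with its equality predicate, and an arrow to its
graph. -/
noncomputable def graphFunctor : E ⥤ D.EqObj where
  obj A := D.eqObj A
  map f := D.graph f
  map_id A := EqHom.ext (D.graphRel_id A)
  map_comp f g := EqHom.ext (D.graphRel_comp f g)

end ExDoctrine

instance hasFiniteLimits_obj {R : Type u₁} [Category.{v₁} R] [HasFiniteLimits R]
    (S : BasedCategory.{v₂, u₂} R) [IsFiniteLimitFibration S.p] : HasFiniteLimits S.obj :=
  hasFiniteLimits_total S.p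

section
variable {R : Type u₁} [Category.{v₁} R] {E : Type u₂} [Category.{v₂} E] {p : E ⥤ R}

lemma isCart_of_isStronglyCartesian {I J : R} {u : I ⟶ J} {A B : E} {c : A ⟶ B}
    (h : p.IsStronglyCartesian u c) : IsCart p c := by
  subst_hom_lift p u c
  exact h

lemma isVertical_of_isHomLift {I : R} {A B : E} {f : A ⟶ B} (h : p.IsHomLift (𝟙 I) f) :
    IsVertical p f := by
  have := IsHomLift.codomain_eq p (𝟙 I) f
  subst this
  exact h

lemma isHomLift_of_isVertical {I : R} {A B : E} {f : A ⟶ B} (h : IsVertical p f)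
    (hB : p.obj B = I) : p.IsHomLift (𝟙 I) f := by
  subst hB
  exact h

lemma isIso_map_of_isVertical {A B : E} {f : A ⟶ B} (h : IsVertical p f) : IsIso (p.map f) := by
  have := IsHomLift.fac' p (𝟙 (p.obj B)) f
  rw [this]
  infer_instance

lemma isVertical_of_comp {A B C : E} {f : A ⟶ B} {g : B ⟶ C} (hg : IsVertical p g)
    (h : IsVertical p (f ≫ g)) : IsVertical p f :=
  isVertical_of_isHomLift (isHomLift_of_comp_vertical p (𝟙 (p.obj C)) f g)

lemma isVMono_id (A : E) : IsVMono p (𝟙 A) := ⟨IsHomLift.id rfl, inferInstance⟩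

lemma mono_fm [IsFiniteLimitFibration p] {I : R} {A B : p.Fiber I} (m : A ⟶ B) [Mono m] :
    Mono (fm m) := by
  have h := isPullback_of_fiber (IsKernelPair.id_of_mono m)
  rw [fm_id] at h
  exact IsKernelPair.mono_of_isIso_fst h

/-- An arrow that is invertible in the base becomes vertical after precomposition with an
isomorphism. -/
lemma exists_verticalization [p.IsFibered] {A B : E} (f : A ⟶ B) [IsIso (p.map f)] :
    ∃ (A' : E) (i : A' ⟶ A), IsIso i ∧ IsVertical p (i ≫ f) := by
  let c := IsPreFibered.pullbackMap (p := p) (a := A) rfl (inv (p.map f))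
  haveI : IsIso c := IsStronglyCartesian.isIso_of_base_isIso p (inv (p.map f)) c
  have h : p.IsHomLift (inv (p.map f) ≫ p.map f) (c ≫ f) := inferInstance
  rw [IsIso.inv_hom_id] at h
  exact ⟨_, c, inferInstance, h⟩

lemma exists_vPullback [HasFiniteLimits R] [IsFiniteLimitFibration p] {U A B : E} {m : U ⟶ A}
    (hm : IsVMono p m) (g : B ⟶ A) :
    ∃ (U' : E) (m' : U' ⟶ B) (x : U' ⟶ U), IsVMono p m' ∧ IsPullback x m' m g := by
  obtain ⟨W, a, b, h, h'⟩ := exists_isPullback (p := p) m g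
  haveI := hm.2
  haveI := isIso_map_of_isVertical hm.1
  haveI : IsIso (p.map b) := MorphismProperty.of_isPullback (P := .isomorphisms R) h' ‹_›
  obtain ⟨W', i, hi, hv⟩ := exists_verticalization (p := p) b
  haveI : Mono b := MorphismProperty.of_isPullback (P := .monomorphisms E) h ‹_›
  refine ⟨W', i ≫ b, i ≫ a, ⟨hv, inferInstance⟩, ?_⟩
  exact IsPullback.of_iso h (asIso i).symm (Iso.refl _) (Iso.refl _) (Iso.refl _) (by simp)
    (by simp) (by simp) (by simp)

variable (p) in
/-- `e` is a stable collective cover. -/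
def SColl {U V : E} (e : U ⟶ V) : Prop :=
  ∀ ⦃X : E⦄ (t : X ⟶ V) ⦃W : E⦄ (k : W ⟶ X), IsVMono p k →
    (∀ ⦃Y : E⦄ (y : Y ⟶ U) (r : Y ⟶ X), y ≫ e = r ≫ t → ∃ s : Y ⟶ W, s ≫ k = r) →
    ∃ s : X ⟶ W, s ≫ k = 𝟙 X

lemma sColl_of_regularEpi_aux [IsRegularPreStack p] {I J : R} {Q M : p.Fiber I} (q : Q ⟶ M)
    (hq : IsRegularEpi q) {X W : p.Fiber J} (t : fo X ⟶ fo M) (k : W ⟶ X) (hk : Mono k)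
    (H : ∀ ⦃Y : E⦄ (y : Y ⟶ fo Q) (r : Y ⟶ fo X), y ≫ fm q = r ≫ t →
      ∃ s : Y ⟶ fo W, s ≫ fm k = r) :
    ∃ s : fo X ⟶ fo W, s ≫ fm k = 𝟙 _ := by
  haveI := IsRegularPreStack.regular (p := p) J
  let u := under t
  have hq' : IsRegularEpi ((reindex p u).map q) :=
    (IsRegularPreStack.reindex_regular u).map_regularEpi q hq
  let t' := flift p u t (under_isHomLift t)
  let r := pullback.snd ((reindex p u).map q) t'
  have hr : IsRegularEpi r := inferInstance
  obtain ⟨s, hs⟩ := H (fm (pullback.fst ((reindex p u).map q) t') ≫ rmap p u Q) (fm r) (by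
    rw [Category.assoc, ← reindex_fac, ← Category.assoc, ← fm_comp, pullback.condition, fm_comp,
      Category.assoc, flift_fac])
  have hsl : p.IsHomLift (𝟙 J) (s ≫ fm k) := by rw [hs]; infer_instance
  have hsv : p.IsHomLift (𝟙 J) s := isHomLift_of_comp_vertical p (𝟙 J) s (fm k)
  have e : fhom s hsv ≫ k = r := Functor.Fiber.hom_ext hs
  haveI : IsIso k := ExtremalEpi.isIso r (fhom s hsv) k e
  exact ⟨fm (inv k), by rw [← fm_comp, IsIso.inv_hom_id, fm_id]⟩

lemma sColl_of_regularEpi [IsRegularPreStack p] {I : R} {Q M : p.Fiber I} (q : Q ⟶ M)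
    (hq : IsRegularEpi q) : SColl p (fm q) := by
  intro X t W k hk H
  have hk1 := hk.1
  haveI := hk.2
  let X₀ : p.Fiber (p.obj X) := Functor.Fiber.mk (a := X) rfl
  let W₀ : p.Fiber (p.obj X) := Functor.Fiber.mk (a := W) (IsHomLift.domain_eq p (𝟙 (p.obj X)) k)
  let k₀ : W₀ ⟶ X₀ := ⟨k, hk1⟩
  have hk₀ : Mono k₀ := by
    haveI : Mono (Functor.Fiber.fiberInclusion.map k₀) := hk.2
    exact Functor.mono_of_mono_map Functor.Fiber.fiberInclusion this
  exact sColl_of_regularEpi_aux q hq (X := X₀) (W := W₀) t k₀ hk₀ H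

lemma exists_vImage_aux [IsRegularPreStack p] {I : R} {U W : p.Fiber I} (v : U ⟶ W) :
    ∃ (M : E) (q : fo U ⟶ M) (m : M ⟶ fo W), IsVMono p m ∧ SColl p q ∧ q ≫ m = fm v := by
  haveI := IsRegularPreStack.regular (p := p) I
  let F := Regular.strongEpiMonoFactorisation v
  have hF : F.e ≫ F.m = v := F.fac
  have hm : p.IsHomLift (𝟙 I) (fm F.m) := inferInstance
  exact ⟨fo F.I, fm F.e, fm F.m, ⟨isVertical_of_isHomLift hm, mono_fm F.m⟩,
    sColl_of_regularEpi F.e (inferInstanceAs (IsRegularEpi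
      (Regular.strongEpiMonoFactorisation v).e)), by rw [← fm_comp, hF]⟩

lemma exists_vImage [IsRegularPreStack p] {U W : E} (v : U ⟶ W) (hv : IsVertical p v) :
    ∃ (M : E) (q : U ⟶ M) (m : M ⟶ W), IsVMono p m ∧ SColl p q ∧ q ≫ m = v :=
  exists_vImage_aux (I := p.obj W)
    (U := Functor.Fiber.mk (a := U) (IsHomLift.domain_eq p (𝟙 (p.obj W)) v))
    (W := Functor.Fiber.mk (a := W) rfl) ⟨v, hv⟩

lemma exists_vertical_cartesian_aux [p.IsFibered] {I J : R} {U : p.Fiber I} {V : p.Fiber J}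
    (e : fo U ⟶ fo V) :
    ∃ (W : E) (v : fo U ⟶ W) (c : W ⟶ fo V), IsVertical p v ∧ IsCart p c ∧ v ≫ c = e := by
  let v := flift p (under e) e (under_isHomLift e)
  have hv : p.IsHomLift (𝟙 I) (fm v) := inferInstance
  have hc : p.IsStronglyCartesian (under e) (rmap p (under e) V) := inferInstance
  exact ⟨_, fm v, rmap p (under e) V, isVertical_of_isHomLift hv,
    isCart_of_isStronglyCartesian hc, flift_fac p _ _ _⟩

lemma exists_vertical_cartesian [p.IsFibered] {U V : E} (e : U ⟶ V) :
    ∃ (W : E) (v : U ⟶ W) (c : W ⟶ V), IsVertical p v ∧ IsCart p c ∧ v ≫ c = e :=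
  exists_vertical_cartesian_aux (U := Functor.Fiber.mk (a := U) rfl)
    (V := Functor.Fiber.mk (a := V) rfl) e

lemma sColl_comp_union [HasFiniteLimits R] [IsGeometricPreStack p] {U M W V : E} {q : U ⟶ M}
    {m : M ⟶ W} {c : W ⟶ V} (hq : SColl p q) (hm : IsVMono p m) (hc : IsCart p c)
    (hu : IsUnion p c m (𝟙 V)) : SColl p (q ≫ m ≫ c) := by
  intro X t K k hk H
  obtain ⟨W', t', c', hW, -⟩ := exists_isPullback (p := p) c t
  obtain ⟨M', m', x, hm', hM⟩ := exists_vPullback hm t'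
  have hu' : IsUnion p c' m' (𝟙 X) :=
    (IsGeometricPreStack.unions (p := p)).stable hc hW hm (isVMono_id V) hm' (isVMono_id X) hM
      (IsPullback.of_vert_isIso ⟨by simp⟩ : IsPullback t (𝟙 X) (𝟙 V) t) hu
  obtain ⟨L, k₂, z, hk₂, hL⟩ := exists_vPullback hk (m' ≫ c')
  refine (hu' k hk).2 ?_
  obtain ⟨s, hs⟩ := hq x k₂ hk₂ (fun Y y r h => by
    obtain ⟨s, hs⟩ := H y (r ≫ m' ≫ c') (by
      rw [Category.assoc, Category.assoc, ← hW.w, ← reassoc_of% hM.w, reassoc_of% h])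
    exact ⟨hL.lift s r hs, hL.lift_snd _ _ _⟩)
  exact ⟨s ≫ z, by rw [Category.assoc, hL.w, reassoc_of% hs]⟩

lemma exists_image [HasFiniteLimits R] [IsGeometricPreStack p] {U B : E} (e : U ⟶ B) :
    ∃ (V : E) (e' : U ⟶ V) (n : V ⟶ B), IsVMono p n ∧ SColl p e' ∧ e' ≫ n = e := by
  obtain ⟨W, v, c, hv, hc, rfl⟩ := exists_vertical_cartesian (p := p) e
  obtain ⟨M, q, m, hm, hq, rfl⟩ := exists_vImage v hv
  obtain ⟨V, n, hn, hu⟩ := (IsGeometricPreStack.unions (p := p)).exists_union c m hc hm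
  obtain ⟨w, hw⟩ := (hu n hn).1 ⟨𝟙 _, Category.id_comp _⟩
  obtain ⟨W₂, a, c₂, ha, hW⟩ := exists_vPullback hn c
  haveI := ha.2
  haveI := hn.2
  haveI := hm.2
  let m₂ : M ⟶ W₂ := hW.lift w m hw
  have h1 : m₂ ≫ c₂ = w := hW.lift_fst _ _ _
  have h2 : m₂ ≫ a = m := hW.lift_snd _ _ _
  have hm₂ : IsVMono p m₂ := ⟨isVertical_of_comp ha.1 (by rw [h2]; exact hm.1), by
    haveI : Mono (m₂ ≫ a) := by rw [h2]; infer_instance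
    exact mono_of_mono m₂ a⟩
  have hc₂ : IsCart p c₂ := isCart_of_isPullback hW.flip hc
  have hM : IsPullback (𝟙 M) m₂ m a := by
    refine isPullback_of_existsUnique (by rw [Category.id_comp, h2]) (fun X x y h => ⟨x, ?_, ?_⟩)
      (fun X l l' h _ => by simpa using h)
    · simp
    · rw [← cancel_mono a, Category.assoc, h2, h]
  have hu₂ : IsUnion p c₂ m₂ (𝟙 V) :=
    (IsGeometricPreStack.unions (p := p)).stable hc hW.flip hm hn hm₂ (isVMono_id V) hM
      (IsKernelPair.id_of_mono n) hu
  refine ⟨V, q ≫ m₂ ≫ c₂, n, hn, sColl_comp_union hq hm₂ hc₂ hu₂, ?_⟩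
  rw [h1, Category.assoc, Category.assoc, hw]

end

section
variable {R : Type u₁} [Category.{v₁} R] [HasFiniteLimits R] (S : BasedCategory.{v₂, u₂} R)

/-- The predicates on `A`: subobjects represented by vertical monomorphisms. -/
def VSub (A : S.obj) : Type (max u₂ v₂) :=
  { P : Subobject A // ∃ (U : S.obj) (m : U ⟶ A) (_ : Mono m),
    IsVertical S.p m ∧ P = Subobject.mk m }

variable {S} [IsFiniteLimitFibration S.p]

lemma isIso_map_arrow {A : S.obj} (P : VSub S A) : IsIso (S.p.map P.1.arrow) := by
  obtain ⟨P, U, m, hm, hv, rfl⟩ := P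
  have h := isIso_map_of_isVertical hv
  have e : (Subobject.underlyingIso m).hom ≫ m = (Subobject.mk m).arrow := by simp
  change IsIso (S.p.map (Subobject.mk m).arrow)
  rw [← e, S.p.map_comp]
  infer_instance

lemma exists_rep_of_isIso {A : S.obj} (P : Subobject A) (h : IsIso (S.p.map P.arrow)) :
    ∃ (U : S.obj) (m : U ⟶ A) (_ : Mono m), IsVertical S.p m ∧ P = Subobject.mk m := by
  obtain ⟨U, i, hi, hv⟩ := exists_verticalization (p := S.p) P.arrow
  refine ⟨U, i ≫ P.arrow, inferInstance, hv, ?_⟩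
  conv_lhs => rw [← Subobject.mk_arrow P]
  exact Subobject.mk_eq_mk_of_comm _ _ (asIso i).symm (by simp)

lemma factors_mk {A U X : S.obj} (m : U ⟶ A) [Mono m] (x : X ⟶ A) :
    (Subobject.mk m).Factors x ↔ ∃ t : X ⟶ U, t ≫ m = x := by
  rw [Subobject.mk_factors_iff]
  rfl

lemma le_of_factors_imp {A : S.obj} {P Q : Subobject A}
    (h : ∀ (X : S.obj) (x : X ⟶ A), P.Factors x → Q.Factors x) : P ≤ Q :=
  Subobject.le_of_factors (h _ _ P.factors_self)

namespace VSub

instance (A : S.obj) : PartialOrder (VSub S A) := Subtype.partialOrder _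

/-- Reindexing of predicates by pullback. -/
noncomputable def pull {A B : S.obj} (f : A ⟶ B) (P : VSub S B) : VSub S A :=
  ⟨(Subobject.pullback f).obj P.1, exists_rep_of_isIso _ (by
    have h := map_isPullback (p := S.p) (Subobject.isPullback f P.1)
    exact MorphismProperty.of_isPullback (P := .isomorphisms R) h (isIso_map_arrow P))⟩

lemma factors_pull {A B X : S.obj} (f : A ⟶ B) (P : VSub S B) (x : X ⟶ A) :
    (pull f P).1.Factors x ↔ P.1.Factors (x ≫ f) := pullback_factors_iff f P.1 x

lemma ext' {A : S.obj} {P Q : VSub S A}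
    (h : ∀ (X : S.obj) (x : X ⟶ A), P.1.Factors x ↔ Q.1.Factors x) : P = Q :=
  Subtype.ext (le_antisymm (le_of_factors_imp fun X x => (h X x).1)
    (le_of_factors_imp fun X x => (h X x).2))

/-- Intersection of predicates. -/
noncomputable def inf {A : S.obj} (P Q : VSub S A) : VSub S A :=
  ⟨P.1 ⊓ Q.1, exists_rep_of_isIso _ (by
    have h := map_isPullback (p := S.p) (Subobject.inf_isPullback P.1 Q.1)
    haveI := isIso_map_arrow P
    haveI := isIso_map_arrow Q
    haveI : IsIso (S.p.map ((P.1 ⊓ Q.1).ofLE Q.1 inf_le_right)) :=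
      MorphismProperty.of_isPullback (P := .isomorphisms R) h (isIso_map_arrow P)
    rw [← Subobject.ofLE_arrow (inf_le_right : P.1 ⊓ Q.1 ≤ Q.1), S.p.map_comp]
    infer_instance)⟩

/-- The true predicate. -/
noncomputable def top (A : S.obj) : VSub S A := ⟨⊤, A, 𝟙 A, inferInstance, IsHomLift.id rfl, rfl⟩

noncomputable instance (A : S.obj) : SemilatticeInf (VSub S A) where
  inf := inf
  inf_le_left P Q := (inf_le_left : P.1 ⊓ Q.1 ≤ P.1)
  inf_le_right P Q := (inf_le_right : P.1 ⊓ Q.1 ≤ Q.1)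
  le_inf P Q T h h' := (le_inf h h' : P.1 ≤ Q.1 ⊓ T.1)

noncomputable instance (A : S.obj) : OrderTop (VSub S A) where
  top := top A
  le_top P := (le_top : P.1 ≤ ⊤)

lemma factors_inf {A X : S.obj} (P Q : VSub S A) (x : X ⟶ A) :
    (P ⊓ Q).1.Factors x ↔ P.1.Factors x ∧ Q.1.Factors x := Subobject.inf_factors x

lemma le_iff {A : S.obj} {P Q : VSub S A} :
    P ≤ Q ↔ ∀ (X : S.obj) (x : X ⟶ A), P.1.Factors x → Q.1.Factors x :=
  ⟨fun h _ x hx => Subobject.factors_of_le x h hx, fun h => le_of_factors_imp h⟩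

end VSub
end

section
variable {R : Type u₁} [Category.{v₁} R] [HasFiniteLimits R] {S : BasedCategory.{v₂, u₂} R}
  [IsGeometricPreStack S.p]

namespace VSub

lemma exists_imageOf {U B : S.obj} (e : U ⟶ B) : ∃ Q : VSub S B, Q.1.Factors e ∧
    ∀ ⦃X Z : S.obj⦄ (t : X ⟶ B) (s : X ⟶ Z) (K : VSub S Z), Q.1.Factors t →
      (∀ (Y : S.obj) (y : Y ⟶ U) (r : Y ⟶ X), y ≫ e = r ≫ t → K.1.Factors (r ≫ s)) →
      K.1.Factors s := by
  obtain ⟨V, e', n, hn, he, rfl⟩ := exists_image (p := S.p) e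
  haveI := hn.2
  refine ⟨⟨Subobject.mk n, V, n, hn.2, hn.1, rfl⟩, (factors_mk n _).2 ⟨e', rfl⟩, ?_⟩
  intro X Z t s K ht H
  obtain ⟨t', rfl⟩ := (factors_mk n t).1 ht
  have hK := (pull s K).2
  obtain ⟨W, k, hk, hkv, hkK⟩ := hK
  have hf : ∀ (Y : S.obj) (r : Y ⟶ X), K.1.Factors (r ≫ s) ↔ ∃ j : Y ⟶ W, j ≫ k = r := by
    intro Y r
    rw [← factors_pull, hkK, factors_mk]
  obtain ⟨j, hj⟩ := he t' k ⟨hkv, hk⟩ (fun Y y r h => (hf Y r).1 (H Y y r (by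
    rw [reassoc_of% h])))
  have := (hf X (𝟙 X)).2 ⟨j, hj⟩
  rwa [Category.id_comp] at this

/-- Existential quantification: the least predicate on `B` through which `P ⟶ A ⟶ B` factors. -/
noncomputable def ex {A B : S.obj} (f : A ⟶ B) (P : VSub S A) : VSub S B :=
  (exists_imageOf (P.1.arrow ≫ f)).choose

lemma factors_ex {A B X : S.obj} (f : A ⟶ B) (P : VSub S A) (x : X ⟶ A) (hx : P.1.Factors x) :
    (ex f P).1.Factors (x ≫ f) := by
  have h := (exists_imageOf (P.1.arrow ≫ f)).choose_spec.1
  rw [← P.1.factorThru_arrow x hx, Category.assoc]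
  exact Subobject.factors_of_factors_right _ h

lemma ex_elim {A B X Z : S.obj} (f : A ⟶ B) (P : VSub S A) (t : X ⟶ B) (s : X ⟶ Z) (K : VSub S Z)
    (ht : (ex f P).1.Factors t) (H : ∀ (Y : S.obj) (y : Y ⟶ A) (r : Y ⟶ X), P.1.Factors y →
      y ≫ f = r ≫ t → K.1.Factors (r ≫ s)) : K.1.Factors s :=
  (exists_imageOf (P.1.arrow ≫ f)).choose_spec.2 t s K ht (fun Y y r h =>
    H Y (y ≫ P.1.arrow) r (Subobject.factors_comp_arrow y) (by rw [Category.assoc, h]))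

lemma ex_le_iff {A B : S.obj} (f : A ⟶ B) (P : VSub S A) (Q : VSub S B) :
    ex f P ≤ Q ↔ P ≤ pull f Q := by
  rw [le_iff, le_iff]
  constructor
  · intro h X x hx
    exact (factors_pull f Q x).2 (h _ _ (factors_ex f P x hx))
  · intro h X x hx
    exact ex_elim f P x x Q hx (fun Y y r hy e => e ▸ (factors_pull f Q y).1 (h _ _ hy))

end VSub

variable (S) in
/-- The fibered subobject fibration of a geometric pre-stack, as an existential fibration. -/
noncomputable def subDoctrine : ExDoctrine S.obj where
  Pred A := VSub S A
  semilatticeInf A := inferInstance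
  orderTop A := inferInstance
  pull f P := VSub.pull f P
  pull_id P := Subtype.ext (Subobject.pullback_id P.1)
  pull_comp f g P := Subtype.ext (Subobject.pullback_comp f g P.1)
  pull_inf f P Q := Subtype.ext (Subobject.inf_pullback f P.1 Q.1)
  pull_top f := Subtype.ext (Subobject.pullback_top f)
  ex f P := VSub.ex f P
  ex_le_iff f P Q := VSub.ex_le_iff f P Q
  beckChevalley {W A B C a b f g} h P := by
    apply le_antisymm
    · rw [VSub.le_iff]
      intro X x hx
      refine VSub.ex_elim f P (x ≫ g) x _ ((VSub.factors_pull _ _ _).1 hx) (fun Y y r hy e => ?_)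
      have e' : y ≫ f = (r ≫ x) ≫ g := by rw [e, Category.assoc]
      rw [← h.lift_snd y (r ≫ x) e']
      exact VSub.factors_ex _ _ _ ((VSub.factors_pull _ _ _).2 (by rwa [h.lift_fst]))
    · rw [VSub.ex_le_iff, VSub.le_iff]
      intro X x hx
      rw [VSub.factors_pull, VSub.factors_pull, Category.assoc, ← h.w, ← Category.assoc]
      exact VSub.factors_ex _ _ _ ((VSub.factors_pull _ _ _).1 hx)
  frobenius {A B} f P Q := by
    apply le_antisymm
    · rw [VSub.le_iff]
      intro X x hx
      rw [VSub.factors_inf] at hx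
      refine VSub.ex_elim f P x x _ hx.1 (fun Y y r hy e => ?_)
      rw [← e]
      refine VSub.factors_ex _ _ _ ((VSub.factors_inf _ _ _).2 ⟨hy, ?_⟩)
      rw [VSub.factors_pull, e]
      exact Subobject.factors_of_factors_right _ hx.2
    · refine le_inf ((VSub.ex_le_iff _ _ _).2 (inf_le_left.trans ((VSub.ex_le_iff _ _ _).1 le_rfl)))
        ((VSub.ex_le_iff _ _ _).2 inf_le_right)

end

section
variable {R : Type u₁} [Category.{v₁} R] [Regular R] {E : Type u₂} [Category.{v₂} E] {p : E ⥤ R}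

lemma isCoverCart_id (A : E) : IsCoverCart p (𝟙 A) := by
  refine ⟨?_, by rw [p.map_id]; infer_instance⟩
  haveI : p.IsHomLift (p.map (𝟙 A)) (𝟙 A) := inferInstance
  exact IsStronglyCartesian.of_isIso p (p.map (𝟙 A)) (𝟙 A)

lemma isCoverCart_comp {A B C : E} {f : A ⟶ B} {g : B ⟶ C} (hf : IsCoverCart p f)
    (hg : IsCoverCart p g) : IsCoverCart p (f ≫ g) := by
  haveI := hf.1
  haveI := hg.1
  haveI := hf.2
  haveI := hg.2
  refine ⟨isCart_of_isStronglyCartesian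
    (inferInstance : p.IsStronglyCartesian (p.map f ≫ p.map g) (f ≫ g)), ?_⟩
  rw [p.map_comp]
  haveI : StrongEpi (p.map f ≫ p.map g) := strongEpi_comp _ _
  infer_instance

lemma isCoverCart_of_isPullback [IsFiniteLimitFibration p] {W A B C : E} {a : W ⟶ A} {b : W ⟶ B}
    {f : A ⟶ C} {g : B ⟶ C} (h : IsPullback a b f g) (hf : IsCoverCart p f) :
    IsCoverCart p b :=
  ⟨isCart_of_isPullback h hf.1,
    Regular.regularEpiIsStableUnderBaseChange.of_isPullback (map_isPullback (p := p) h) hf.2⟩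

end

section
variable {R : Type u₁} [Category.{v₁} R] [Regular R] {C : BasedCategory.{v₂, u₂} R}
  [IsFiniteLimitFibration C.p]

/-- All arrows `x` with `e ≫ x = k ≫ f` for some `k` and some cover-cartesian `e`. -/
def gen {X Y : C.obj} (f : Y ⟶ X) : Sieve X where
  arrows W x := ∃ (Z : C.obj) (e : Z ⟶ W) (k : Z ⟶ Y), IsCoverCart C.p e ∧ e ≫ x = k ≫ f
  downward_closed := by
    rintro W W' x ⟨Z, e, k, he, h⟩ w
    refine ⟨pullback e w, pullback.snd e w, pullback.fst e w ≫ k,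
      isCoverCart_of_isPullback (IsPullback.of_hasPullback e w) he, ?_⟩
    rw [← reassoc_of% (pullback.condition : pullback.fst e w ≫ e = _), h, Category.assoc]

variable (C) in
/-- The predicates on `X`: arrows `f : Y ⟶ X`, where `f ≤ g` means that `e ≫ f = k ≫ g` for some
`k` and some cover-cartesian `e`, and predicates entailing each other are identified. -/
def SievPred (X : C.obj) : Type (max u₂ v₂) :=
  { S : Sieve X // ∃ (Y : C.obj) (f : Y ⟶ X), S = gen f }

namespace SievPred

/-- The predicate given by an arrow. -/
def mk {X Y : C.obj} (f : Y ⟶ X) : SievPred C X := ⟨gen f, Y, f, rfl⟩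

instance (X : C.obj) : PartialOrder (SievPred C X) := Subtype.partialOrder _

lemma self_mem {X Y : C.obj} (f : Y ⟶ X) : gen f f :=
  ⟨Y, 𝟙 Y, 𝟙 Y, isCoverCart_id Y, rfl⟩

lemma mem_of_cover {X W Z : C.obj} (P : SievPred C X) (x : W ⟶ X) (e : Z ⟶ W)
    (he : IsCoverCart C.p e) (h : P.1 (e ≫ x)) : P.1 x := by
  obtain ⟨P, Y, f, rfl⟩ := P
  obtain ⟨Z', e', k, he', h'⟩ := h
  exact ⟨Z', e' ≫ e, k, isCoverCart_comp he' he, by rw [Category.assoc, h']⟩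

lemma gen_le_iff {X Y : C.obj} (f : Y ⟶ X) (P : SievPred C X) : gen f ≤ P.1 ↔ P.1 f := by
  constructor
  · exact fun h => h f (self_mem f)
  · rintro h W x ⟨Z, e, k, he, hx⟩
    exact mem_of_cover P x e he (hx ▸ P.1.downward_closed h k)

lemma mk_le_mk_iff {X Y Y' : C.obj} (f : Y ⟶ X) (g : Y' ⟶ X) : mk f ≤ mk g ↔
    ∃ (Z : C.obj) (e : Z ⟶ Y) (k : Z ⟶ Y'), IsCoverCart C.p e ∧ e ≫ f = k ≫ g :=
  gen_le_iff f (mk g)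

lemma pullback_gen {X X' Y : C.obj} (f : Y ⟶ X) (g : X' ⟶ X) :
    (gen f).pullback g = gen (pullback.snd f g) := by
  ext W x
  constructor
  · rintro ⟨Z, e, k, he, h⟩
    exact ⟨Z, e, pullback.lift k (e ≫ x) (by rw [← h, Category.assoc]), he,
      (pullback.lift_snd _ _ _).symm⟩
  · rintro ⟨Z, e, k, he, h⟩
    exact ⟨Z, e, k ≫ pullback.fst f g, he, by
      rw [← Category.assoc, h, Category.assoc, Category.assoc, pullback.condition]⟩

/-- Reindexing of predicates by pullback. -/
noncomputable def pull {X X' : C.obj} (g : X' ⟶ X) (P : SievPred C X) : SievPred C X' :=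
  ⟨P.1.pullback g, by
    obtain ⟨P, Y, f, rfl⟩ := P
    exact ⟨_, _, pullback_gen f g⟩⟩

lemma inf_gen {X Y Y' : C.obj} (f : Y ⟶ X) (g : Y' ⟶ X) :
    gen f ⊓ gen g = gen (pullback.fst f g ≫ f) := by
  ext W x
  constructor
  · rintro ⟨⟨Z, e, k, he, h⟩, ⟨Z', e', k', he', h'⟩⟩
    refine ⟨pullback e e', pullback.fst e e' ≫ e, pullback.lift (pullback.fst e e' ≫ k)
      (pullback.snd e e' ≫ k') ?_, ?_, ?_⟩
    · rw [Category.assoc, Category.assoc, ← h, ← h', reassoc_of% (pullback.condition :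
        pullback.fst e e' ≫ e = _)]
    · exact isCoverCart_comp
        (isCoverCart_of_isPullback (IsPullback.of_hasPullback e e').flip he') he
    · rw [← Category.assoc, pullback.lift_fst, Category.assoc, Category.assoc, h]
  · rintro ⟨Z, e, k, he, h⟩
    refine ⟨⟨Z, e, k ≫ pullback.fst f g, he, by rw [h, Category.assoc]⟩,
      ⟨Z, e, k ≫ pullback.snd f g, he, by rw [h, Category.assoc, pullback.condition]⟩⟩

/-- Conjunction of predicates. -/
noncomputable def inf {X : C.obj} (P Q : SievPred C X) : SievPred C X :=
  ⟨P.1 ⊓ Q.1, by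
    obtain ⟨P, Y, f, rfl⟩ := P
    obtain ⟨Q, Y', g, rfl⟩ := Q
    exact ⟨_, _, inf_gen f g⟩⟩

noncomputable instance (X : C.obj) : SemilatticeInf (SievPred C X) where
  inf := inf
  inf_le_left P Q := (inf_le_left : P.1 ⊓ Q.1 ≤ P.1)
  inf_le_right P Q := (inf_le_right : P.1 ⊓ Q.1 ≤ Q.1)
  le_inf P Q T h h' := (le_inf h h' : P.1 ≤ Q.1 ⊓ T.1)

lemma top_eq_gen (X : C.obj) : (⊤ : Sieve X) = gen (𝟙 X) := by
  ext W x
  exact ⟨fun _ => ⟨W, 𝟙 W, x, isCoverCart_id W, by simp⟩, fun _ => trivial⟩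

instance (X : C.obj) : OrderTop (SievPred C X) where
  top := ⟨⊤, X, 𝟙 X, top_eq_gen X⟩
  le_top P := (le_top : P.1 ≤ ⊤)

/-- The domain of a chosen arrow representing `P`. -/
noncomputable def dom {X : C.obj} (P : SievPred C X) : C.obj := P.2.choose

/-- A chosen arrow representing `P`. -/
noncomputable def arrow {X : C.obj} (P : SievPred C X) : P.dom ⟶ X := P.2.choose_spec.choose

lemma gen_arrow {X : C.obj} (P : SievPred C X) : P.1 = gen P.arrow :=
  P.2.choose_spec.choose_spec

/-- Existential quantification along `f`, given by composition with `f`. -/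
noncomputable def ex {X X' : C.obj} (f : X ⟶ X') (P : SievPred C X) : SievPred C X' :=
  mk (P.arrow ≫ f)

lemma ex_le_iff {X X' : C.obj} (f : X ⟶ X') (P : SievPred C X) (Q : SievPred C X') :
    ex f P ≤ Q ↔ P ≤ pull f Q := by
  have h1 : P ≤ pull f Q ↔ gen P.arrow ≤ (pull f Q).1 := by
    rw [← gen_arrow]; rfl
  rw [h1, gen_le_iff]
  exact gen_le_iff (P.arrow ≫ f) Q

lemma mem_ex {X X' W : C.obj} (f : X ⟶ X') (P : SievPred C X) (x : W ⟶ X) (hx : P.1 x) :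
    (ex f P).1 (x ≫ f) :=
  ((ex_le_iff f P _).1 le_rfl) x hx

lemma exists_of_mem_ex {X X' W : C.obj} (f : X ⟶ X') (P : SievPred C X) (x : W ⟶ X')
    (hx : (ex f P).1 x) : ∃ (Z : C.obj) (e : Z ⟶ W) (k : Z ⟶ X), IsCoverCart C.p e ∧ P.1 k ∧
      e ≫ x = k ≫ f := by
  obtain ⟨Z, e, k, he, hk⟩ := hx
  refine ⟨Z, e, k ≫ P.arrow, he, ?_, by rw [hk, Category.assoc]⟩
  rw [gen_arrow]
  exact (gen P.arrow).downward_closed (self_mem P.arrow) k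

end SievPred

variable (C) in
/-- The existential fibration of predicates generated by arrows of the total category. -/
noncomputable def sievDoctrine : ExDoctrine C.obj where
  Pred X := SievPred C X
  semilatticeInf X := inferInstance
  orderTop X := inferInstance
  pull f P := SievPred.pull f P
  pull_id P := Subtype.ext Sieve.pullback_id
  pull_comp f g P := Subtype.ext (Sieve.pullback_comp P.1)
  pull_inf f P Q := Subtype.ext (Sieve.pullback_inter P.1 Q.1)
  pull_top f := Subtype.ext Sieve.pullback_top
  ex f P := SievPred.ex f P
  ex_le_iff f P Q := SievPred.ex_le_iff f P Q
  beckChevalley {W A B C a b f g} h P := by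
    apply le_antisymm
    · intro X x hx
      obtain ⟨Z, e, k, he, hk, hx'⟩ := SievPred.exists_of_mem_ex f P _ hx
      rw [← Category.assoc] at hx'
      refine SievPred.mem_of_cover _ x e he ?_
      rw [← h.lift_snd k (e ≫ x) hx'.symm]
      refine SievPred.mem_ex _ _ _ ?_
      change P.1 (h.lift k (e ≫ x) hx'.symm ≫ a)
      rwa [h.lift_fst]
    · rw [SievPred.ex_le_iff]
      intro X x hx
      change (SievPred.ex f P).1 ((x ≫ b) ≫ g)
      rw [Category.assoc, ← h.w, ← Category.assoc]
      exact SievPred.mem_ex _ _ _ hx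
  frobenius {A B} f P Q := by
    apply le_antisymm
    · rintro X x ⟨hx, hx'⟩
      obtain ⟨Z, e, k, he, hk, h⟩ := SievPred.exists_of_mem_ex f P _ hx
      refine SievPred.mem_of_cover _ x e he ?_
      rw [h]
      refine SievPred.mem_ex _ _ _ ⟨hk, ?_⟩
      change Q.1 (k ≫ f)
      rw [← h]
      exact Q.1.downward_closed hx' e
    · refine le_inf ((SievPred.ex_le_iff _ _ _).2
        (inf_le_left.trans ((SievPred.ex_le_iff _ _ _).1 le_rfl)))
        ((SievPred.ex_le_iff _ _ _).2 inf_le_right)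

end

section
variable {R : Type u₁} [Category.{v₁} R] [HasFiniteLimits R] (S : BasedCategory.{v₂, u₂} R)
  [IsFiniteLimitFibration S.p] (D : ExDoctrine.{v₂, u₂, w} S.obj)

/-- The constant object functor `Δ`, sending `I` to the terminal object of the fiber over `I` with
its equality predicate. -/
noncomputable def constFunctor : R ⥤ D.EqObj := Functor.comp (oneFunctor S.p) D.graphFunctor

/-- The gluing fibration of `Δ`: an object over `I` is an object `X` of the category of equivalence
relations with an arrow `X ⟶ Δ I`. -/
noncomputable def glue : BasedCategory R :=
  BasedCategory.ofFunctor (Comma.snd (Functor.id D.EqObj) (constFunctor S D))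

/-- The functor sending `A` over `I` to `A` with its equality predicate, over `Δ I` by way of the
graph of the unique vertical arrow `A ⟶ 1_I`. -/
noncomputable def discreteFunctor : S.obj ⥤ Comma (Functor.id D.EqObj) (constFunctor S D) where
  obj A := ⟨D.graphFunctor.obj A, S.p.obj A, D.graphFunctor.map (bang S.p A)⟩
  map {A B} f :=
    { left := D.graphFunctor.map f
      right := S.p.map f
      w := by
        change D.graphFunctor.map f ≫ D.graphFunctor.map (bang S.p B) =
          D.graphFunctor.map (bang S.p A) ≫ D.graphFunctor.map ((oneFunctor S.p).map (S.p.map f))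
        exact (D.graphFunctor.map_comp _ _).symm.trans
          ((congrArg D.graphFunctor.map (bang_natural S.p f)).trans
            (D.graphFunctor.map_comp (bang S.p A) ((oneFunctor S.p).map (S.p.map f)))) }
  map_id A := by
    apply CommaMorphism.ext
    · exact D.graphFunctor.map_id A
    · exact S.p.map_id A
  map_comp f g := by
    apply CommaMorphism.ext
    · exact D.graphFunctor.map_comp f g
    · exact S.p.map_comp f g

/-- The embedding of `S` into the gluing fibration. -/
noncomputable def discrete : S ⥤ᵇ glue S D where
  toFunctor := discreteFunctor S D
  w := rfl

end

section
variable {R : Type u₁} [Category.{v₁} R]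

/-- The category `R[S]` of equivalence relations and functional relations in the fibered subobject
fibration of a geometric pre-stack. -/
abbrev EqRelSub [HasFiniteLimits R] (S : BasedCategory.{v₂, u₂} R) [IsGeometricPreStack S.p] :=
  (subDoctrine S).EqObj

/-- The fibration of sheaves on a geometric pre-stack. -/
noncomputable def Sheaves [HasFiniteLimits R] (S : BasedCategory.{v₂, u₂} R)
    [IsGeometricPreStack S.p] : BasedCategory.{max v₁ u₂ v₂, max u₁ u₂ v₂} R :=
  glue S (subDoctrine S)

/-- The embedding of a geometric pre-stack into its fibration of sheaves. -/
noncomputable def zeta [HasFiniteLimits R] (S : BasedCategory.{v₂, u₂} R)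
    [IsGeometricPreStack S.p] : S ⥤ᵇ Sheaves S :=
  discrete S (subDoctrine S)

/-- The category `R{C}` of equivalence relations and functional relations in the fibration of
sieves of a finite-limit pre-stack. -/
abbrev EqRelSiev [Regular R] (C : BasedCategory.{v₂, u₂} R) [IsFiniteLimitPreStack C.p] :=
  (sievDoctrine C).EqObj

/-- The fibration of presheaves on a finite-limit pre-stack. -/
noncomputable def Presheaves [Regular R] (C : BasedCategory.{v₂, u₂} R)
    [IsFiniteLimitPreStack C.p] : BasedCategory.{max v₁ u₂ v₂, max u₁ u₂ v₂} R :=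
  glue C (sievDoctrine C)

/-- The fibered Yoneda embedding. -/
noncomputable def fiberedYoneda [Regular R] (C : BasedCategory.{v₂, u₂} R)
    [IsFiniteLimitPreStack C.p] : C ⥤ᵇ Presheaves C :=
  discrete C (sievDoctrine C)

/-- The vertical subobjects of representables in the fibration of presheaves. -/
def isSubrepresentable [Regular R] (C : BasedCategory.{v₂, u₂} R) [IsFiniteLimitPreStack C.p] :
    ObjectProperty (Presheaves C).obj := fun X =>
  ∃ (A : C.obj) (m : X ⟶ (fiberedYoneda C).obj A), IsVMono (Presheaves C).p m

/-- The full subfibration of the fibration of presheaves on the vertical subobjects of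
representables. -/
noncomputable def Subrepresentables [Regular R] (C : BasedCategory.{v₂, u₂} R)
    [IsFiniteLimitPreStack C.p] : BasedCategory.{max v₁ u₂ v₂, max u₁ u₂ v₂} R :=
  BasedCategory.ofFunctor (Functor.comp (isSubrepresentable C).ι (Presheaves C).p)

/-- An equivalence of fibrations over `R`. -/
structure BasedEquiv (S : BasedCategory.{v₂, u₂} R) (T : BasedCategory.{v₃, u₃} R) where
  functor : S ⥤ᵇ T
  inverse : T ⥤ᵇ S
  unitIso : BasedFunctor.id S ≅ functor ⋙ inverse
  counitIso : inverse ⋙ functor ≅ BasedFunctor.id T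

/-- Geometric functors and vertical natural transformations. -/
abbrev Geo (S : BasedCategory.{v₂, u₂} R) (X : BasedCategory.{v₃, u₃} R) :=
  ObjectProperty.FullSubcategory (fun F : S ⥤ᵇ X => IsGeometricFunctor F)

/-- Functors of fibered pretoposes and vertical natural transformations. -/
abbrev Pretop (T : BasedCategory.{v₂, u₂} R) (X : BasedCategory.{v₃, u₃} R) :=
  ObjectProperty.FullSubcategory (fun F : T ⥤ᵇ X => IsPretoposFunctor F)

/-- Precomposition with `W`. -/
def precomp {S : BasedCategory.{v₂, u₂} R} {T : BasedCategory.{v₃, u₃} R} (W : S ⥤ᵇ T)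
    (X : BasedCategory.{v₄, u₄} R) : (T ⥤ᵇ X) ⥤ (S ⥤ᵇ X) where
  obj F := W ⋙ F
  map α := BasedCategory.whiskerLeft W α

/-- Precomposition with `W`, from functors of fibered pretoposes to geometric functors. -/
def precompGeo {S : BasedCategory.{v₂, u₂} R} {T : BasedCategory.{v₃, u₃} R} (W : S ⥤ᵇ T)
    (X : BasedCategory.{v₄, u₄} R)
    (h : ∀ F : T ⥤ᵇ X, IsPretoposFunctor F → IsGeometricFunctor (W ⋙ F)) :
    Pretop T X ⥤ Geo S X :=
  ObjectProperty.lift _ (Functor.comp (ObjectProperty.ι _) (precomp W X)) (fun F => h F.1 F.2)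

/-- `W` exhibits `T` as the free fibered pretopos on `S`, with respect to fibered pretoposes in the
universes `v₄, u₄`: `T` is a fibered pretopos, `W` is geometric, and for every fibered pretopos `X`
precomposition with `W` is an equivalence from `Pretop T X` to `Geo S X`. -/
structure IsFreePretopos {S : BasedCategory.{v₂, u₂} R} {T : BasedCategory.{v₃, u₃} R}
    (W : S ⥤ᵇ T) : Prop where
  pretopos : IsFiberedPretopos T.p
  geometric : IsGeometricFunctor W
  comp_geometric (X : BasedCategory.{v₄, u₄} R) : IsFiberedPretopos X.p →
    ∀ F : T ⥤ᵇ X, IsPretoposFunctor F → IsGeometricFunctor (W ⋙ F)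
  isEquivalence (X : BasedCategory.{v₄, u₄} R) (hX : IsFiberedPretopos X.p) :
    (precompGeo W X (comp_geometric X hX)).IsEquivalence

end

end FibSh

open FibSh

/-! Everything is carried by one notion, the cover `SColl`: an arrow none of whose pullbacks factors
through a proper vertical subobject. In a pre-stack of regular categories the vertical covers are
the regular epimorphisms of the fibers (`sColl_fm_iff`). In a geometric pre-stack every arrow is a
cover followed by a vertical monomorphism, and unions are exactly such factorizations. Hence
geometric functors between geometric pre-stacks are those that preserve pullbacks of the total
categories, fiberwise terminal objects and covers (`IsCoherentFunctor`). A fibered pretopos is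
itself geometric, its cocartesian arrows being the covers that are locally injective, so the
functors of fibered pretoposes are again the coherent ones. Both sides of the universal property
thus consist of coherent functors.

Freeness then follows from density (`IsDense.isFreePretopos`). Let `i` be a full and faithful
coherent embedding into a fibered pretopos whose image is closed under predicates and covers every
object. The kernel pair of a cover `i U ⟶ Y` comes from the domain of `i`, and a coherent functor
`F` turns it into an equivalence relation on `F U` that lies over the kernel pair of a base arrow.
Such relations have effective quotients (`exists_quotient`): push forward along the base arrow, then
use exactness of the fiber. The quotients are the values of an extension of `F`, and descent along
covers makes the extension functorial, coherent and unique. Uniqueness of free fibered pretoposes is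
formal.

For (i) it remains to see that sheaves form a fibered pretopos and that `Z` is dense. In a doctrine
where every predicate is the image of an arrow, the internal logic can be read on generalized
elements, existence meaning existence after a cover. In this language equivalence relations and
functional relations form an exact category (`ExDoctrine.isExact`), and gluing along a functor `Δ`
that preserves pullbacks and regular epimorphisms yields a fibered pretopos
(`Gluing.isFiberedPretopos`). For subobjects, the pre-stack condition is what makes `Δ` preserve
regular epimorphisms. The embedding `Z` is full because a functional relation between discrete
objects is a predicate whose projection to the source is a monic cover, hence invertible.

For (ii), `DC` is closed under finite limits and subobjects in the fibered pretopos of presheaves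
and covers it, so it is geometric and its inclusion is dense. Presheaves on `C` and sheaves on `DC`
are then both free on `DC`, hence equivalent. The objects over terminal objects of the base recover
the two categories of equivalence relations. -/

namespace FibSh

/-! ### Calculus of covers and vertical monomorphisms -/

section
variable {R : Type u₁} [Category.{v₁} R] [HasFiniteLimits R] {E : Type u₂} [Category.{v₂} E]
  {p : E ⥤ R}

variable (p) in
/-- A monomorphism that is invertible in the base; up to isomorphism, a vertical monomorphism. -/
structure IsPred {U A : E} (m : U ⟶ A) : Prop where
  mono : Mono m
  isIso_map : IsIso (p.map m)

lemma IsVMono.isPred {U A : E} {m : U ⟶ A} (h : IsVMono p m) : IsPred p m :=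
  ⟨h.2, isIso_map_of_isVertical h.1⟩

lemma IsPred.exists_vMono [p.IsFibered] {U A : E} {m : U ⟶ A} (h : IsPred p m) :
    ∃ (U' : E) (i : U' ⟶ U), IsIso i ∧ IsVMono p (i ≫ m) := by
  haveI := h.1
  haveI := h.2
  obtain ⟨U', i, hi, hv⟩ := exists_verticalization (p := p) m
  exact ⟨U', i, hi, hv, inferInstance⟩

variable [IsFiniteLimitFibration p]

lemma totalHasFiniteLimits (p : E ⥤ R) [IsFiniteLimitFibration p] : HasFiniteLimits E :=
  hasFiniteLimits_total p

lemma IsPred.of_isPullback {W A B C : E} {a : W ⟶ A} {b : W ⟶ B} {f : A ⟶ C} {g : B ⟶ C}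
    (h : IsPullback a b f g) (hf : IsPred p f) : IsPred p b := by
  haveI := hf.1
  haveI := hf.2
  exact ⟨MorphismProperty.of_isPullback (P := .monomorphisms E) h ‹_›,
    MorphismProperty.of_isPullback (P := .isomorphisms R) (map_isPullback (p := p) h) ‹_›⟩

/-- The defining property of `SColl`, for monomorphisms that are invertible in the base. -/
lemma SColl.exists_section {U V : E} {e : U ⟶ V} (he : SColl p e) {X W : E} (t : X ⟶ V)
    (k : W ⟶ X) (hk : IsPred p k)
    (H : ∀ ⦃Y : E⦄ (y : Y ⟶ U) (r : Y ⟶ X), y ≫ e = r ≫ t → ∃ s : Y ⟶ W, s ≫ k = r) :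
    ∃ s : X ⟶ W, s ≫ k = 𝟙 X := by
  obtain ⟨W', i, hi, hv⟩ := hk.exists_vMono
  obtain ⟨s, hs⟩ := he t (i ≫ k) hv (fun Y y r h => by
    obtain ⟨s, hs⟩ := H y r h
    exact ⟨s ≫ inv i, by simp [hs]⟩)
  exact ⟨s ≫ i, by rw [Category.assoc, hs]⟩

omit [HasFiniteLimits R] [IsFiniteLimitFibration p] in
lemma SColl.of_comp {U V W : E} {e : U ⟶ V} {f : V ⟶ W} (h : SColl p (e ≫ f)) : SColl p f := by
  intro X t K k hk H
  exact h t k hk (fun Y y r hy => H (y ≫ e) r (by rw [Category.assoc, hy]))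

omit [HasFiniteLimits R] [IsFiniteLimitFibration p] in
lemma SColl.of_isPullback {W A B C : E} {a : W ⟶ A} {b : W ⟶ B} {f : A ⟶ C} {g : B ⟶ C}
    (h : IsPullback a b f g) (hf : SColl p f) : SColl p b := by
  intro X t K k hk H
  exact hf (t ≫ g) k hk (fun Y y r hy =>
    H (h.lift y (r ≫ t) (by rw [hy, Category.assoc])) r (h.lift_snd _ _ _))

omit [HasFiniteLimits R] [IsFiniteLimitFibration p] in
lemma SColl.of_isSplitEpi {U V : E} (e : U ⟶ V) (s : V ⟶ U) (hs : s ≫ e = 𝟙 V) : SColl p e := by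
  intro X t K k hk H
  exact H (t ≫ s) (𝟙 X) (by rw [Category.assoc, hs, Category.comp_id, Category.id_comp])

omit [HasFiniteLimits R] [IsFiniteLimitFibration p] in
lemma SColl.of_isIso {U V : E} (e : U ⟶ V) [IsIso e] : SColl p e :=
  SColl.of_isSplitEpi e (inv e) (by simp)

/-- Covers are left orthogonal to predicates: a lift of `e ≫ x` through `n` makes `e` factor through
the pullback of `n` along `x`, which therefore has a section. -/
lemma SColl.exists_lift {X Z A V : E} {e : Z ⟶ X} (he : SColl p e) {n : V ⟶ A} (hn : IsPred p n)
    (x : X ⟶ A) (k : Z ⟶ V) (h : e ≫ x = k ≫ n) : ∃ l : X ⟶ V, l ≫ n = x := by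
  haveI := totalHasFiniteLimits p
  have hp := IsPullback.of_hasPullback n x
  obtain ⟨s, hs⟩ := he.exists_section (𝟙 X) (pullback.snd n x) (hn.of_isPullback hp)
    (fun Y y r hy => ⟨hp.lift (y ≫ k) r (by rw [Category.assoc, ← h, reassoc_of% hy]),
      hp.lift_snd _ _ _⟩)
  exact ⟨s ≫ pullback.fst n x, by rw [Category.assoc, hp.w, reassoc_of% hs]⟩

lemma SColl.isIso_of_isPred {U V : E} {e : U ⟶ V} (he : SColl p e) (h : IsPred p e) : IsIso e := by
  haveI := h.1
  obtain ⟨l, hl⟩ := he.exists_lift h (𝟙 V) (𝟙 U) (by simp)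
  exact ⟨l, by rw [← cancel_mono e, Category.assoc, hl]; simp, hl⟩

lemma SColl.comp {U V W : E} {e : U ⟶ V} {f : V ⟶ W} (he : SColl p e) (hf : SColl p f) :
    SColl p (e ≫ f) := by
  haveI := totalHasFiniteLimits p
  intro X t K k hk H
  refine hf t k hk (fun Y y r hy => ?_)
  -- The lift exists over the pullback of `e` along `y`, and it descends to `Y` because covers lift
  -- against predicates.
  refine SColl.exists_lift (SColl.of_isPullback (IsPullback.of_hasPullback e y) he) hk.isPred r ?_ ?_
  · exact (H (pullback.fst e y) (pullback.snd e y ≫ r) (by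
      rw [reassoc_of% (pullback.condition : pullback.fst e y ≫ e = _), hy, Category.assoc])).choose
  · exact (H (pullback.fst e y) (pullback.snd e y ≫ r) (by
      rw [reassoc_of% (pullback.condition : pullback.fst e y ≫ e = _), hy,
        Category.assoc])).choose_spec.symm

/-- `E ⟶ R` preserves binary products. -/
lemma map_prod_hom_ext [HasFiniteLimits E] {A B : E} {X : R} {f g : X ⟶ p.obj (A ⨯ B)}
    (h₁ : f ≫ p.map prod.fst = g ≫ p.map prod.fst)
    (h₂ : f ≫ p.map prod.snd = g ≫ p.map prod.snd) : f = g :=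
  (map_isPullback (p := p) (IsPullback.of_hasBinaryProduct' A B)).hom_ext h₁ h₂

/-- Arrows that agree in the base and after a cover agree. -/
lemma SColl.hom_ext {Z X T : E} {e : Z ⟶ X} (he : SColl p e) {f g : X ⟶ T}
    (hp : p.map f = p.map g) (h : e ≫ f = e ≫ g) : f = g := by
  haveI := totalHasFiniteLimits p
  -- The pullback of the two graphs is the equalizer of `f` and `g`. As they agree in the base it is
  -- a predicate, and the cover `e` factors through it.
  have hP := IsPullback.of_hasPullback (prod.lift (𝟙 X) f) (prod.lift (𝟙 X) g)
  have h1 : pullback.fst (prod.lift (𝟙 X) f) (prod.lift (𝟙 X) g) =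
      pullback.snd (prod.lift (𝟙 X) f) (prod.lift (𝟙 X) g) := by
    simpa only [Category.assoc, prod.lift_fst, Category.comp_id] using
      congrArg (· ≫ prod.fst) hP.w
  have h2 := congrArg (· ≫ prod.snd) hP.w
  simp only [Category.assoc, prod.lift_snd] at h2
  have hm : p.map (prod.lift (𝟙 X) f) = p.map (prod.lift (𝟙 X) g) := by
    apply map_prod_hom_ext <;> simp only [← p.map_comp, prod.lift_fst, prod.lift_snd, hp]
  have hP' := map_isPullback (p := p) hP
  rw [← hm] at hP'
  haveI : Mono (p.map (prod.lift (𝟙 X) f)) := by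
    haveI : Mono (p.map (prod.lift (𝟙 X) f) ≫ p.map prod.fst) := by
      rw [← p.map_comp, prod.lift_fst, p.map_id]; infer_instance
    exact mono_of_mono _ (p.map prod.fst)
  haveI : IsIso (p.map (pullback.fst (prod.lift (𝟙 X) f) (prod.lift (𝟙 X) g))) :=
    IsKernelPair.isIso_of_mono hP'
  haveI : Mono (prod.lift (𝟙 X) g) := by
    haveI : Mono (prod.lift (𝟙 X) g ≫ prod.fst) := by rw [prod.lift_fst]; infer_instance
    exact mono_of_mono _ prod.fst
  haveI : Mono (pullback.fst (prod.lift (𝟙 X) f) (prod.lift (𝟙 X) g)) := inferInstance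
  obtain ⟨l, hl⟩ := he.exists_lift (n := pullback.fst (prod.lift (𝟙 X) f) (prod.lift (𝟙 X) g))
    ⟨inferInstance, inferInstance⟩ (𝟙 X) (hP.lift e e (by
      apply Limits.prod.hom_ext <;> simp [h])) (by rw [hP.lift_fst, Category.comp_id])
  rw [← Category.id_comp f, ← Category.id_comp g, ← hl, Category.assoc, h2, ← h1, Category.assoc]

/-! ### Fiberwise terminal objects and cartesian arrows -/

section One

variable (p) in
/-- `T` is terminal in its fiber, stably under reindexing. -/
def IsOne (T : E) : Prop :=
  ∀ ⦃X : E⦄ (t : p.obj X ⟶ p.obj T), ∃! f : X ⟶ T, p.IsHomLift t f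

omit [HasFiniteLimits R] [IsFiniteLimitFibration p] in
lemma IsOne.existsUnique {T X : E} (h : IsOne p T) {I J : R} (hT : p.obj T = I) (hX : p.obj X = J)
    (t : J ⟶ I) : ∃! f : X ⟶ T, p.IsHomLift t f := by
  subst hT
  subst hX
  exact h t

omit [HasFiniteLimits R] [IsFiniteLimitFibration p] in
lemma IsOne.hom_ext {T X : E} (h : IsOne p T) {f g : X ⟶ T} (hp : p.map f = p.map g) : f = g :=
  (h (p.map f)).unique inferInstance (by rw [hp]; infer_instance)

omit [HasFiniteLimits R] in
lemma isOne_one (I : R) : IsOne p (one p I) := by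
  intro X t
  refine ⟨toOne p (t ≫ eqToHom (one_over p I)), ?_, ?_⟩
  · have := toOne_isHomLift p (t ≫ eqToHom (one_over p I))
    rwa [IsHomLift.lift_comp_eqToHom_iff] at this
  · intro f hf
    apply eq_toOne
    rwa [IsHomLift.lift_comp_eqToHom_iff]

omit [HasFiniteLimits R] [IsFiniteLimitFibration p] in
lemma IsOne.isCart {T T' : E} (h : IsOne p T) (h' : IsOne p T') (f : T ⟶ T') : IsCart p f := by
  refine { universal_property' := ?_ }
  intro X t x hx
  obtain ⟨l, hl, hu⟩ := h t
  refine ⟨l, ⟨hl, h'.hom_ext ?_⟩, fun y hy => hu y hy.1⟩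
  have h1 := IsHomLift.eq_of_isHomLift p t l
  have h2 := IsHomLift.eq_of_isHomLift p (t ≫ p.map f) x
  rw [p.map_comp, ← h1, ← h2]

/-- Cartesian arrows are exactly the pullbacks of arrows between fiberwise terminal objects. -/
lemma isCart_iff_isPullback {A B T T' : E} (hT : IsOne p T) (hT' : IsOne p T') (f : A ⟶ B)
    (a : A ⟶ T) (ha : IsIso (p.map a)) (b : B ⟶ T') (hb : IsIso (p.map b)) (g : T ⟶ T')
    (w : f ≫ b = a ≫ g) : IsCart p f ↔ IsPullback f a b g := by
  constructor
  · intro hf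
    refine isPullback_of_existsUnique w (fun X x y h => ?_) (fun X l l' h1 h2 => ?_)
    · have e : p.map x = (p.map y ≫ inv (p.map a)) ≫ p.map f := by
        have h' := congrArg p.map h
        have w' := congrArg p.map w
        simp only [p.map_comp] at h' w'
        rw [← cancel_mono (p.map b), h', Category.assoc, Category.assoc, w']
        simp
      let l := IsStronglyCartesian.map p (p.map f) f e x
      have hl : l ≫ f = x := IsStronglyCartesian.fac p (p.map f) f e x
      have hl' : p.IsHomLift (p.map y ≫ inv (p.map a)) l :=
        IsStronglyCartesian.map_isHomLift p (p.map f) f e x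
      refine ⟨l, hl, hT.hom_ext ?_⟩
      rw [p.map_comp, ← IsHomLift.eq_of_isHomLift p (p.map y ≫ inv (p.map a)) l]
      simp
    · have e : p.map l = p.map l' := by
        have := congrArg p.map h2
        rwa [p.map_comp, p.map_comp, cancel_mono] at this
      haveI : p.IsHomLift (p.map l) l' := by rw [e]; infer_instance
      exact IsStronglyCartesian.ext p (p.map f) f (p.map l) h1
  · intro h
    exact isCart_of_isPullback h.flip (hT.isCart hT' g)

lemma exists_toOne (A : E) : ∃ (T : E) (a : A ⟶ T), IsOne p T ∧ IsIso (p.map a) := by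
  have : p.IsHomLift (𝟙 (p.obj A)) (bang p A) := toOne_isHomLift p _
  refine ⟨_, bang p A, isOne_one _, ?_⟩
  rw [IsHomLift.fac' p (𝟙 (p.obj A)) (bang p A)]
  infer_instance

end One

end

/-! ### Finite limits in the fibers and in the total category -/

section
variable {R : Type u₁} [Category.{v₁} R] [HasFiniteLimits R] {E : Type u₂} [Category.{v₂} E]
  {p : E ⥤ R}

lemma preservesFiniteLimits_of_isPullback {C : Type u₁} [Category.{v₁} C] {D : Type u₂}
    [Category.{v₂} D] [HasFiniteLimits C] (G : C ⥤ D) (hT : Nonempty (IsTerminal (G.obj (⊤_ C))))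
    (hP : ∀ ⦃W X Y Z : C⦄ ⦃a : W ⟶ X⦄ ⦃b : W ⟶ Y⦄ ⦃f : X ⟶ Z⦄ ⦃g : Y ⟶ Z⦄, IsPullback a b f g →
      IsPullback (G.map a) (G.map b) (G.map f) (G.map g)) : PreservesFiniteLimits G := by
  haveI : ∀ {X Y Z : C} (f : X ⟶ Z) (g : Y ⟶ Z), PreservesLimit (cospan f g) G := fun f g =>
    preservesLimit_of_preserves_limit_cone (IsPullback.of_hasPullback f g).isLimit
      ((isLimitMapConePullbackConeEquiv G (IsPullback.of_hasPullback f g).w).symm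
        (hP (IsPullback.of_hasPullback f g)).isLimit)
  haveI : PreservesLimitsOfShape WalkingCospan G :=
    ⟨fun {K} => preservesLimit_of_iso_diagram G (diagramIsoCospan K).symm⟩
  haveI : PreservesLimit (Functor.empty.{0} C) G :=
    preservesLimit_of_preserves_limit_cone (terminalIsTerminal (C := C))
      ((isLimitMapConeEmptyConeEquiv G (⊤_ C)).symm hT.some)
  haveI : PreservesLimitsOfShape (Discrete PEmpty) G :=
    preservesLimitsOfShape_pempty_of_preservesTerminal G
  exact preservesFiniteLimits_of_preservesTerminal_and_pullbacks G

variable [IsFiniteLimitFibration p]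

omit [HasFiniteLimits R] in
lemma isPullback_fm_iff {I : R} {W A B C : p.Fiber I} {a : W ⟶ A} {b : W ⟶ B} {f : A ⟶ C}
    {g : B ⟶ C} : IsPullback (fm a) (fm b) (fm f) (fm g) ↔ IsPullback a b f g := by
  refine ⟨fun h => isPullback_of_existsUnique (Functor.Fiber.hom_ext h.w) ?_ ?_,
    isPullback_of_fiber⟩
  · intro X x y hxy
    have e : fm x ≫ fm f = fm y ≫ fm g := congrArg fm hxy
    have h1 := h.lift_fst (fm x) (fm y) e
    have : p.IsHomLift (𝟙 I) (h.lift (fm x) (fm y) e ≫ fm a) := by rw [h1]; infer_instance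
    have := isHomLift_of_comp_vertical p (𝟙 I) (h.lift (fm x) (fm y) e) (fm a)
    exact ⟨fhom (h.lift (fm x) (fm y) e) this, Functor.Fiber.hom_ext h1,
      Functor.Fiber.hom_ext (h.lift_snd (fm x) (fm y) e)⟩
  · intro X l l' h1 h2
    exact Functor.Fiber.hom_ext (h.hom_ext (congrArg fm h1) (congrArg fm h2))

omit [HasFiniteLimits R] in
lemma IsOne.of_iso {A B : E} (e : A ≅ B) (he : p.IsHomLift (𝟙 (p.obj B)) e.hom)
    (h : IsOne p A) : IsOne p B := by
  intro X t
  obtain ⟨f, hf, hu⟩ := h.existsUnique (IsHomLift.domain_eq p (𝟙 (p.obj B)) e.hom) rfl t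
  refine ⟨f ≫ e.hom, inferInstance, fun g hg => ?_⟩
  rw [← hu (g ≫ e.inv) inferInstance]
  simp

-- Reindexing preserves terminal objects, so terminality within one fiber already controls the
-- arrows over every base arrow.
omit [HasFiniteLimits R] in
lemma isOne_iff_isTerminal {I : R} (A : p.Fiber I) :
    IsOne p (fo A) ↔ Nonempty (IsTerminal A) := by
  constructor
  · intro h
    have H : ∀ X : p.Fiber I, ∃! f : fo X ⟶ fo A, p.IsHomLift (𝟙 I) f := fun X =>
      h.existsUnique (fo_over A) (fo_over X) (𝟙 I)
    exact ⟨IsTerminal.ofUniqueHom (fun X => fhom _ (H X).choose_spec.1)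
      (fun X m => Functor.Fiber.hom_ext ((H X).choose_spec.2 (fm m) inferInstance))⟩
  · rintro ⟨h⟩
    let e : ⊤_ (p.Fiber I) ≅ A := terminalIsTerminal.uniqueUpToIso h
    have he : p.IsHomLift (𝟙 I) (fm e.hom) := inferInstance
    exact (isOne_one I).of_iso (Functor.Fiber.fiberInclusion.mapIso e)
      (isHomLift_of_isVertical (isVertical_of_isHomLift he) rfl)

/-- Pullbacks in the total category are computed from pullbacks in the base and pullbacks in a
fiber. -/
lemma isPullback_of_isCart_of_fiber {P I J K : R} {q₁ : P ⟶ I} {q₂ : P ⟶ J}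
    {u : I ⟶ K} {v : J ⟶ K} (hq : IsPullback q₁ q₂ u v) {A : p.Fiber I} {B : p.Fiber J}
    {C : p.Fiber K} {A' B' C' W : p.Fiber P} {f : fo A ⟶ fo C} {g : fo B ⟶ fo C}
    (hf : p.IsHomLift u f) (hg : p.IsHomLift v g) (α : fo A' ⟶ fo A) (β : fo B' ⟶ fo B)
    (γ : fo C' ⟶ fo C) (hα : p.IsStronglyCartesian q₁ α) (hβ : p.IsStronglyCartesian q₂ β)
    (hγ : p.IsStronglyCartesian (q₁ ≫ u) γ) {f' : A' ⟶ C'} {g' : B' ⟶ C'} {w₁ : W ⟶ A'}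
    {w₂ : W ⟶ B'} (hf' : fm f' ≫ γ = α ≫ f) (hg' : fm g' ≫ γ = β ≫ g)
    (hW : IsPullback w₁ w₂ f' g') : IsPullback (fm w₁ ≫ α) (fm w₂ ≫ β) f g := by
  have hT := isPullback_of_fiber hW
  have ha : p.IsHomLift q₁ (fm w₁ ≫ α) := inferInstance
  have hb : p.IsHomLift q₂ (fm w₂ ≫ β) := inferInstance
  have ex : ∀ {L : R} (X : p.Fiber L) (x : fo X ⟶ fo A) (y : fo X ⟶ fo B), x ≫ f = y ≫ g →
      ∃ l : fo X ⟶ fo W, l ≫ fm w₁ ≫ α = x ∧ l ≫ fm w₂ ≫ β = y := by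
    intro L X x y hxy
    have hx := under_isHomLift x
    have hy := under_isHomLift y
    have e : under x ≫ u = under y ≫ v := by
      have i1 : p.IsHomLift (under x ≫ u) (x ≫ f) := inferInstance
      have i2 : p.IsHomLift (under y ≫ v) (x ≫ f) := by rw [hxy]; infer_instance
      exact homLift_unique i1 i2
    let t := hq.lift _ _ e
    have hx2 : p.IsHomLift (t ≫ q₁) x := by rw [hq.lift_fst]; exact hx
    have hy2 : p.IsHomLift (t ≫ q₂) y := by rw [hq.lift_snd]; exact hy
    let x' := IsStronglyCartesian.map p q₁ α (g := t) rfl x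
    let y' := IsStronglyCartesian.map p q₂ β (g := t) rfl y
    have hx' : x' ≫ α = x := IsStronglyCartesian.fac p q₁ α rfl x
    have hy' : y' ≫ β = y := IsStronglyCartesian.fac p q₂ β rfl y
    have hxl : p.IsHomLift t x' := IsStronglyCartesian.map_isHomLift p q₁ α rfl x
    have hyl : p.IsHomLift t y' := IsStronglyCartesian.map_isHomLift p q₂ β rfl y
    have hc : x' ≫ fm f' = y' ≫ fm g' := by
      have i1 : p.IsHomLift t (x' ≫ fm f') := inferInstance
      have i2 : p.IsHomLift t (y' ≫ fm g') := inferInstance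
      apply IsStronglyCartesian.ext p (q₁ ≫ u) γ t
      rw [Category.assoc, Category.assoc, hf', hg', ← Category.assoc, ← Category.assoc, hx', hy',
        hxy]
    refine ⟨hT.lift x' y' hc, ?_, ?_⟩
    · rw [← Category.assoc, hT.lift_fst, hx']
    · rw [← Category.assoc, hT.lift_snd, hy']
  have un : ∀ {L : R} (X : p.Fiber L) (l l' : fo X ⟶ fo W),
      l ≫ fm w₁ ≫ α = l' ≫ fm w₁ ≫ α → l ≫ fm w₂ ≫ β = l' ≫ fm w₂ ≫ β → l = l' := by
    intro L X l l' h1 h2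
    have hl := under_isHomLift l
    have hl' := under_isHomLift l'
    have ht : under l = under l' := by
      apply hq.hom_ext
      · have i1 : p.IsHomLift (under l ≫ q₁) (l ≫ fm w₁ ≫ α) := inferInstance
        have i2 : p.IsHomLift (under l' ≫ q₁) (l ≫ fm w₁ ≫ α) := by
          rw [h1]; infer_instance
        exact homLift_unique i1 i2
      · have i1 : p.IsHomLift (under l ≫ q₂) (l ≫ fm w₂ ≫ β) := inferInstance
        have i2 : p.IsHomLift (under l' ≫ q₂) (l ≫ fm w₂ ≫ β) := by
          rw [h2]; infer_instance
        exact homLift_unique i1 i2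
    rw [← ht] at hl'
    apply hT.hom_ext
    · have i1 : p.IsHomLift (under l) (l ≫ fm w₁) := inferInstance
      have i2 : p.IsHomLift (under l) (l' ≫ fm w₁) := inferInstance
      exact IsStronglyCartesian.ext p q₁ α (under l)
        (by rw [Category.assoc, Category.assoc, h1])
    · have i1 : p.IsHomLift (under l) (l ≫ fm w₂) := inferInstance
      have i2 : p.IsHomLift (under l) (l' ≫ fm w₂) := inferInstance
      exact IsStronglyCartesian.ext p q₂ β (under l)
        (by rw [Category.assoc, Category.assoc, h2])
  refine isPullback_of_existsUnique ?_
    (fun X x y hxy => ex (Functor.Fiber.mk (a := X) rfl) x y hxy)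
    (fun X l l' h1 h2 => un (Functor.Fiber.mk (a := X) rfl) l l' h1 h2)
  rw [Category.assoc, Category.assoc, ← hf', ← hg', ← Category.assoc, ← Category.assoc, hT.w]

omit [HasFiniteLimits R] [IsFiniteLimitFibration p] in
lemma IsCart.isStronglyCartesian {I J : R} {u : I ⟶ J} {A B : E} {c : A ⟶ B} (h : IsCart p c)
    (hu : p.IsHomLift u c) : p.IsStronglyCartesian u c := by
  subst_hom_lift p u c
  exact h

end

/-! ### Lex and coherent functors over the base -/

section
variable {R : Type u₁} [Category.{v₁} R] [HasFiniteLimits R] {S : BasedCategory.{v₂, u₂} R}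
  {T : BasedCategory.{v₃, u₃} R}

/-- Preservation of the finite limits of the total categories, and of the fiberwise terminal
objects. -/
structure IsLexFunctor (F : S ⥤ᵇ T) : Prop where
  map_isPullback {W A B C : S.obj} {a : W ⟶ A} {b : W ⟶ B} {f : A ⟶ C} {g : B ⟶ C} :
    IsPullback a b f g → IsPullback (F.map a) (F.map b) (F.map f) (F.map g)
  map_isOne {A : S.obj} : IsOne S.p A → IsOne T.p (F.obj A)

/-- A lex functor preserving stable collective covers. -/
structure IsCoherentFunctor (F : S ⥤ᵇ T) : Prop extends IsLexFunctor F where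
  map_sColl {A B : S.obj} {e : A ⟶ B} : SColl S.p e → SColl T.p (F.map e)

lemma IsLexFunctor.comp {U : BasedCategory.{v₄, u₄} R} {F : S ⥤ᵇ T} {G : T ⥤ᵇ U}
    (hF : IsLexFunctor F) (hG : IsLexFunctor G) : IsLexFunctor (F ⋙ G) where
  map_isPullback h := hG.map_isPullback (hF.map_isPullback h)
  map_isOne h := hG.map_isOne (hF.map_isOne h)

lemma IsCoherentFunctor.comp {U : BasedCategory.{v₄, u₄} R} {F : S ⥤ᵇ T} {G : T ⥤ᵇ U}
    (hF : IsCoherentFunctor F) (hG : IsCoherentFunctor G) : IsCoherentFunctor (F ⋙ G) where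
  toIsLexFunctor := hF.toIsLexFunctor.comp hG.toIsLexFunctor
  map_sColl h := hG.map_sColl (hF.map_sColl h)

lemma isIso_map_map_iff (F : S ⥤ᵇ T) {A B : S.obj} (f : A ⟶ B) :
    IsIso (T.p.map (F.map f)) ↔ IsIso (S.p.map f) :=
  NatIso.isIso_map_iff (eqToIso F.w) f

lemma IsLexFunctor.map_mono {F : S ⥤ᵇ T} (hF : IsLexFunctor F) {A B : S.obj} {m : A ⟶ B}
    (hm : Mono m) : Mono (F.map m) := by
  have h := hF.map_isPullback (IsKernelPair.id_of_mono m)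
  rw [F.map_id] at h
  exact IsKernelPair.mono_of_isIso_fst h

lemma IsLexFunctor.map_isPred {F : S ⥤ᵇ T} (hF : IsLexFunctor F) {A B : S.obj} {m : A ⟶ B}
    (hm : IsPred S.p m) : IsPred T.p (F.map m) :=
  ⟨hF.map_mono hm.1, (isIso_map_map_iff F m).2 hm.2⟩

lemma map_isVMono {F : S ⥤ᵇ T} (hF : IsLexFunctor F) {A B : S.obj} {m : A ⟶ B}
    (hm : IsVMono S.p m) : IsVMono T.p (F.map m) := by
  have := hm.1
  exact ⟨isVertical_of_isHomLift (BasedFunctor.preserves_isHomLift F (𝟙 (S.p.obj B)) m),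
    hF.map_mono hm.2⟩

variable [IsFiniteLimitFibration S.p] [IsFiniteLimitFibration T.p]

/-- Cartesian arrows are the pullbacks of arrows between fiberwise terminal objects
(`isCart_iff_isPullback`), and a lex functor preserves both ingredients. -/
lemma IsLexFunctor.isFiberedFunctor {F : S ⥤ᵇ T} (hF : IsLexFunctor F) : IsFiberedFunctor F := by
  intro A B f hf
  obtain ⟨T₁, a, hT₁, ha⟩ := exists_toOne (p := S.p) A
  obtain ⟨T₂, b, hT₂, hb⟩ := exists_toOne (p := S.p) B
  obtain ⟨g, hg, -⟩ := hT₂ (inv (S.p.map a) ≫ S.p.map f ≫ S.p.map b)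
  have w : f ≫ b = a ≫ g := hT₂.hom_ext (by
    have := IsHomLift.eq_of_isHomLift S.p (inv (S.p.map a) ≫ S.p.map f ≫ S.p.map b) g
    rw [S.p.map_comp, S.p.map_comp, ← this]; simp)
  refine (isCart_iff_isPullback (hF.map_isOne hT₁) (hF.map_isOne hT₂) (F.map f) (F.map a)
    ((isIso_map_map_iff F a).2 ha) (F.map b) ((isIso_map_map_iff F b).2 hb) (F.map g) ?_).2
    (hF.map_isPullback ((isCart_iff_isPullback hT₁ hT₂ f a ha b hb g w).1 hf))
  rw [← F.map_comp, w, F.map_comp]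

lemma IsLexFunctor.preservesFiniteLimits_fiberMap {F : S ⥤ᵇ T} (hF : IsLexFunctor F) (I : R) :
    PreservesFiniteLimits (fiberMap F I) := by
  refine preservesFiniteLimits_of_isPullback _ ?_ ?_
  · exact (isOne_iff_isTerminal _).1 (hF.map_isOne ((isOne_iff_isTerminal _).2
      ⟨terminalIsTerminal⟩))
  · intro W X Y Z a b f g h
    exact isPullback_fm_iff.1 (hF.map_isPullback (isPullback_of_fiber h))

/-- A pullback of the total category is assembled from its base square, three cartesian lifts and a
pullback in the fiber over the vertex (`isPullback_of_isCart_of_fiber`). Each of these is preserved,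
hence so is the square. -/
lemma isLexFunctor_of_fiberMap {F : S ⥤ᵇ T} (hF : IsFiberedFunctor F)
    (h : ∀ I, PreservesFiniteLimits (fiberMap F I)) : IsLexFunctor F where
  map_isOne {A} hA := by
    obtain ⟨hA⟩ := (isOne_iff_isTerminal (Functor.Fiber.mk (p := S.p) (a := A) rfl)).1 hA
    exact (isOne_iff_isTerminal _).2 ⟨IsTerminal.isTerminalObj (fiberMap F (S.p.obj A)) _ hA⟩
  map_isPullback {W A B C a b f g} hW := by
    have hq := map_isPullback (p := S.p) hW
    let A₀ : S.p.Fiber (S.p.obj A) := Functor.Fiber.mk (a := A) rfl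
    let B₀ : S.p.Fiber (S.p.obj B) := Functor.Fiber.mk (a := B) rfl
    let C₀ : S.p.Fiber (S.p.obj C) := Functor.Fiber.mk (a := C) rfl
    have hf : S.p.IsHomLift (S.p.map f) (show fo A₀ ⟶ fo C₀ from f) :=
      inferInstanceAs (S.p.IsHomLift (S.p.map f) f)
    have hg : S.p.IsHomLift (S.p.map g) (show fo B₀ ⟶ fo C₀ from g) :=
      inferInstanceAs (S.p.IsHomLift (S.p.map g) g)
    have hf1 : S.p.IsHomLift (S.p.map a ≫ S.p.map f)
      (rmap S.p (S.p.map a) A₀ ≫ (show fo A₀ ⟶ fo C₀ from f)) := inferInstance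
    have hg1 : S.p.IsHomLift (S.p.map a ≫ S.p.map f)
      (rmap S.p (S.p.map b) B₀ ≫ (show fo B₀ ⟶ fo C₀ from g)) := by rw [hq.w]; infer_instance
    let f' := flift S.p _ _ hf1
    let g' := flift S.p _ _ hg1
    have hf' := flift_fac S.p _ _ hf1
    have hg' := flift_fac S.p _ _ hg1
    have hV := IsPullback.of_hasPullback f' g'
    have sc : ∀ {I J : R} (u : I ⟶ J) (X : S.p.Fiber J),
        S.p.IsStronglyCartesian u (rmap S.p u X) := fun u X => inferInstance
    have key := isPullback_of_isCart_of_fiber hq hf hg _ _ _ (sc _ _) (sc _ _) (sc _ _) hf' hg' hV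
    have sc' : ∀ {I J : R} (u : I ⟶ J) (X : S.p.Fiber J),
        T.p.IsStronglyCartesian u (F.map (rmap S.p u X)) := fun u X =>
      (hF _ (isCart_of_isStronglyCartesian (sc u X))).isStronglyCartesian inferInstance
    have h' := h (S.p.obj W)
    have key' := isPullback_of_isCart_of_fiber (p := T.p) hq
      (A := (fiberMap F _).obj A₀) (B := (fiberMap F _).obj B₀) (C := (fiberMap F _).obj C₀)
      (f := F.map f) (g := F.map g) (BasedFunctor.preserves_isHomLift F _ f)
      (BasedFunctor.preserves_isHomLift F _ g)
      (A' := (fiberMap F _).obj ((reindex S.p (S.p.map a)).obj A₀))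
      (B' := (fiberMap F _).obj ((reindex S.p (S.p.map b)).obj B₀))
      (C' := (fiberMap F _).obj ((reindex S.p (S.p.map a ≫ S.p.map f)).obj C₀))
      (F.map (rmap S.p _ A₀)) (F.map (rmap S.p _ B₀)) (F.map (rmap S.p _ C₀))
      (sc' _ _) (sc' _ _) (sc' _ _)
      (by exact (F.map_comp _ _).symm.trans ((congrArg F.map hf').trans (F.map_comp _ _)))
      (by exact (F.map_comp _ _).symm.trans ((congrArg F.map hg').trans (F.map_comp _ _)))
      (hV.map (fiberMap F (S.p.obj W)))
    refine IsPullback.of_iso key' (F.mapIso (key.isoIsPullback _ _ hW)) (Iso.refl _)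
      (Iso.refl _) (Iso.refl _) ?_ ?_ ((Category.comp_id _).trans (Category.id_comp _).symm)
      ((Category.comp_id _).trans (Category.id_comp _).symm)
    · refine (Category.comp_id _).trans ?_
      refine Eq.trans (F.map_comp _ _).symm (Eq.trans ?_ (F.map_comp _ _))
      exact congrArg F.map (key.isoIsPullback_hom_fst _ _ hW).symm
    · refine (Category.comp_id _).trans ?_
      refine Eq.trans (F.map_comp _ _).symm (Eq.trans ?_ (F.map_comp _ _))
      exact congrArg F.map (key.isoIsPullback_hom_snd _ _ hW).symm

end

/-! ### Covers, regular epimorphisms and unions -/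

section
variable {R : Type u₁} [Category.{v₁} R] [HasFiniteLimits R] {E : Type u₂} [Category.{v₂} E]
  {p : E ⥤ R}

/-- In a regular category, an arrow is a regular epimorphism as soon as it does not factor through
proper subobjects. -/
lemma isRegularEpi_of_forall_mono {C : Type u₁} [Category.{v₁} C] [Regular C] {X Y : C}
    (f : X ⟶ Y) (h : ∀ ⦃M : C⦄ (q : X ⟶ M) (m : M ⟶ Y), Mono m → q ≫ m = f → IsIso m) :
    IsRegularEpi f := by
  let F := Regular.strongEpiMonoFactorisation f
  have hF : F.e ≫ F.m = f := F.fac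
  haveI := h F.e F.m inferInstance hF
  haveI : IsRegularEpi F.e := inferInstanceAs
    (IsRegularEpi (Regular.strongEpiMonoFactorisation f).e)
  rw [← hF]
  have : MorphismProperty.regularEpi C (F.e ≫ F.m) :=
    (MorphismProperty.cancel_right_of_respectsIso (P := .regularEpi C) _ _).2 ‹_›
  exact this

/-- If a cover factors through a subobject, the subobject is both a cover and a predicate, hence
everything; in a regular fiber this forces a regular epimorphism. The converse rests on stability of
regular epimorphisms under reindexing and pullback. -/
lemma sColl_fm_iff [IsRegularPreStack p] {I : R} {Q M : p.Fiber I} (q : Q ⟶ M) :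
    SColl p (fm q) ↔ IsRegularEpi q := by
  refine ⟨fun h => ?_, sColl_of_regularEpi q⟩
  haveI := IsRegularPreStack.regular (p := p) I
  refine isRegularEpi_of_forall_mono q (fun N e m hm he => ?_)
  have hv : p.IsHomLift (𝟙 I) (fm m) := inferInstance
  have hm' : IsPred p (fm m) :=
    IsVMono.isPred (p := p) ⟨isVertical_of_isHomLift hv, mono_fm m⟩
  have : SColl p (fm m) := by
    rw [← he, fm_comp] at h
    exact h.of_comp
  haveI := this.isIso_of_isPred hm'
  have hi : p.IsHomLift (𝟙 I) (inv (fm m)) := inferInstance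
  exact ⟨fhom (inv (fm m)) hi, Functor.Fiber.hom_ext (IsIso.hom_inv_id (fm m)),
    Functor.Fiber.hom_ext (IsIso.inv_hom_id (fm m))⟩

lemma isUnion_of_sColl [IsFiniteLimitFibration p] {A B U V : E} {c : A ⟶ B} {m : U ⟶ A}
    {n : V ⟶ B} (e : U ⟶ V) (he : SColl p e) (h : e ≫ n = m ≫ c) : IsUnion p c m n := by
  intro W k hk
  constructor
  · rintro ⟨t, ht⟩
    exact ⟨e ≫ t, by rw [Category.assoc, ht, h]⟩
  · rintro ⟨t, ht⟩
    exact he.exists_lift hk.isPred n t (by rw [h, ht])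

/-- The universal property determines a union up to isomorphism, so any factorization of `m ≫ c`
into a cover and a predicate identifies that predicate with `n`. -/
lemma IsUnion.exists_sColl_of_fac [IsFiniteLimitFibration p] {A B U V V' : E} {c : A ⟶ B}
    {m : U ⟶ A} {n : V ⟶ B} (hu : IsUnion p c m n) (hn : IsVMono p n) (e' : U ⟶ V')
    (he : SColl p e') (n' : V' ⟶ B) (hn' : IsVMono p n') (h : e' ≫ n' = m ≫ c) :
    ∃ e : U ⟶ V, SColl p e ∧ e ≫ n = m ≫ c := by
  obtain ⟨t, ht⟩ := (hu n' hn').2 ⟨e', h⟩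
  obtain ⟨t₀, ht₀⟩ := (hu n hn).1 ⟨𝟙 _, Category.id_comp _⟩
  obtain ⟨t', ht'⟩ := he.exists_lift hn.isPred n' t₀ (by rw [h, ht₀])
  haveI := hn.2
  haveI := hn'.2
  haveI : IsIso t' := ⟨t, by rw [← cancel_mono n', Category.assoc, ht, ht', Category.id_comp],
    by rw [← cancel_mono n, Category.assoc, ht', ht, Category.id_comp]⟩
  exact ⟨e' ≫ t', he.comp (.of_isIso t'), by rw [Category.assoc, ht', h]⟩

lemma IsUnion.exists_sColl [IsGeometricPreStack p] {A B U V : E} {c : A ⟶ B} {m : U ⟶ A}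
    {n : V ⟶ B} (hu : IsUnion p c m n) (hn : IsVMono p n) :
    ∃ e : U ⟶ V, SColl p e ∧ e ≫ n = m ≫ c := by
  obtain ⟨V', e', n', hn', he, h⟩ := exists_image (p := p) (m ≫ c)
  exact hu.exists_sColl_of_fac hn e' he n' hn' h

/-- Stable factorizations into covers and vertical monomorphisms yield stable unions. -/
lemma hasStableUnions_of_factorization [IsFiniteLimitFibration p]
    (H : ∀ ⦃U B : E⦄ (f : U ⟶ B), ∃ (V : E) (e : U ⟶ V) (n : V ⟶ B),
      IsVMono p n ∧ SColl p e ∧ e ≫ n = f) : HasStableUnions p where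
  exists_union c m _ _ := by
    obtain ⟨V, e, n, hn, he, h⟩ := H (m ≫ c)
    exact ⟨V, n, hn, isUnion_of_sColl e he h⟩
  stable {A B A' B' U V U' V' c c' g g' m n m' n' x y} _ hW hm hn hm' hn' hM hN hu := by
    obtain ⟨V₁, e₁, n₁, hn₁, he₁, h₁⟩ := H (m ≫ c)
    obtain ⟨e, he, h⟩ := hu.exists_sColl_of_fac hn e₁ he₁ n₁ hn₁ h₁
    have hB := hM.paste_vert hW
    have w : (x ≫ e) ≫ n = (m' ≫ c') ≫ g := by
      rw [Category.assoc, h, ← hB.w]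
    -- The comparison `U' ⟶ V'` is a pullback of the cover `e`, hence again a cover.
    refine isUnion_of_sColl (hN.lift _ _ w) (SColl.of_isPullback (a := x) (g := y) ?_ he)
      (hN.lift_snd _ _ w)
    have hB' : IsPullback x (hN.lift _ _ w ≫ n') (e ≫ n) g := by
      rw [hN.lift_snd, h]
      exact hB
    exact IsPullback.of_bot hB' (hN.lift_fst _ _ w).symm hN

end

/-! ### Geometric functors are the coherent functors -/

section
variable {R : Type u₁} [Category.{v₁} R] [HasFiniteLimits R] {S : BasedCategory.{v₂, u₂} R}
  {T : BasedCategory.{v₃, u₃} R}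

lemma IsCoherentFunctor.map_regularEpi [IsRegularPreStack S.p] [IsRegularPreStack T.p]
    {F : S ⥤ᵇ T} (hF : IsCoherentFunctor F) {I : R} {A B : S.p.Fiber I} (q : A ⟶ B)
    (hq : IsRegularEpi q) : IsRegularEpi ((fiberMap F I).map q) :=
  (sColl_fm_iff _).1 (hF.map_sColl ((sColl_fm_iff q).2 hq))

lemma IsCoherentFunctor.isRegularFunctor [IsRegularPreStack S.p] [IsRegularPreStack T.p]
    {F : S ⥤ᵇ T} (hF : IsCoherentFunctor F) (I : R) : IsRegularFunctor (fiberMap F I) where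
  preservesFiniteLimits := hF.preservesFiniteLimits_fiberMap I
  map_regularEpi q hq := hF.map_regularEpi q hq

/-- A union is witnessed by a cover `e` with `e ≫ n = m ≫ c`, and such a witness is preserved. -/
lemma IsCoherentFunctor.isGeometricFunctor [IsGeometricPreStack S.p] [IsRegularPreStack T.p]
    {F : S ⥤ᵇ T} (hF : IsCoherentFunctor F) : IsGeometricFunctor F where
  fibered := hF.isFiberedFunctor
  regular := hF.isRegularFunctor
  map_union c m n _ _ hn hu := by
    obtain ⟨e, he, h⟩ := hu.exists_sColl hn
    exact isUnion_of_sColl (F.map e) (hF.map_sColl he) (by rw [← F.map_comp, h, F.map_comp])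

lemma IsGeometricFunctor.isLexFunctor [IsFiniteLimitFibration S.p] [IsFiniteLimitFibration T.p]
    {F : S ⥤ᵇ T} (hF : IsGeometricFunctor F) : IsLexFunctor F :=
  isLexFunctor_of_fiberMap hF.fibered (fun I => (hF.regular I).preservesFiniteLimits)

/-- Write `v` as a regular epimorphism followed by a monomorphism. That the composite with `c` is a
cover says that the union of this monomorphism along `c` is everything. Regularity on the fibers and
preservation of unions transport the two halves, and `sColl_comp_union` puts them together again. -/
lemma IsGeometricFunctor.map_sColl_aux [IsGeometricPreStack S.p] [IsGeometricPreStack T.p]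
    {F : S ⥤ᵇ T} (hF : IsGeometricFunctor F) {I : R} {U W : S.p.Fiber I} (v : U ⟶ W) {V : S.obj}
    (c : fo W ⟶ V) (hc : IsCart S.p c) (h : SColl S.p (fm v ≫ c)) :
    SColl T.p (F.map (fm v ≫ c)) := by
  haveI := IsRegularPreStack.regular (p := S.p) I
  let G := Regular.strongEpiMonoFactorisation v
  have hG : G.e ≫ G.m = v := G.fac
  have hm : IsVMono S.p (fm G.m) := by
    have : S.p.IsHomLift (𝟙 I) (fm G.m) := inferInstance
    exact ⟨isVertical_of_isHomLift this, mono_fm G.m⟩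
  have hq : SColl T.p (F.map (fm G.e)) :=
    sColl_of_regularEpi ((fiberMap F I).map G.e) ((hF.regular I).map_regularEpi G.e
      (inferInstanceAs (IsRegularEpi (Regular.strongEpiMonoFactorisation v).e)))
  rw [← hG, fm_comp, Category.assoc] at h ⊢
  have hu : IsUnion S.p c (fm G.m) (𝟙 V) := by
    intro K k hk
    constructor
    · rintro ⟨t, ht⟩
      exact ⟨fm G.m ≫ c ≫ t, by rw [Category.assoc, Category.assoc, ht, Category.comp_id]⟩
    · rintro ⟨t, ht⟩
      refine h.exists_lift hk.isPred (𝟙 V) (fm G.e ≫ t) ?_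
      rw [Category.comp_id]
      exact (congrArg (fm G.e ≫ ·) ht.symm).trans (Category.assoc _ _ _).symm
  have hu' := hF.map_union c (fm G.m) (𝟙 V) hc hm (isVMono_id V) hu
  rw [F.map_id] at hu'
  rw [F.map_comp, F.map_comp]
  exact sColl_comp_union hq (map_isVMono hF.isLexFunctor hm) (hF.fibered c hc) hu'

lemma IsGeometricFunctor.isCoherentFunctor [IsGeometricPreStack S.p] [IsGeometricPreStack T.p]
    {F : S ⥤ᵇ T} (hF : IsGeometricFunctor F) : IsCoherentFunctor F where
  toIsLexFunctor := hF.isLexFunctor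
  map_sColl {A B e} he := by
    let A₀ : S.p.Fiber (S.p.obj A) := Functor.Fiber.mk (a := A) rfl
    let B₀ : S.p.Fiber (S.p.obj B) := Functor.Fiber.mk (a := B) rfl
    have hl : S.p.IsHomLift (S.p.map e) (show fo A₀ ⟶ fo B₀ from e) :=
      inferInstanceAs (S.p.IsHomLift (S.p.map e) e)
    have h := flift_fac S.p (S.p.map e) (X := A₀) (A := B₀) e hl
    have hc : S.p.IsStronglyCartesian (S.p.map e) (rmap S.p (S.p.map e) B₀) := inferInstance
    have := hF.map_sColl_aux (flift S.p (S.p.map e) (X := A₀) (A := B₀) e hl) _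
      (isCart_of_isStronglyCartesian hc) (by rw [h]; exact he)
    rwa [h] at this

end

/-! ### Covers in a fibered pretopos: descent and quotients -/

section
variable {R : Type u₁} [Category.{v₁} R] [HasFiniteLimits R] {E : Type u₂} [Category.{v₂} E]
  {p : E ⥤ R}

lemma exists_fo_eq {I : R} {A : E} (h : p.obj A = I) : ∃ A₀ : p.Fiber I, fo A₀ = A :=
  ⟨Functor.Fiber.mk h, rfl⟩

lemma exists_fm_eq {I : R} {A B : p.Fiber I} (f : fo A ⟶ fo B) (h : p.IsHomLift (𝟙 I) f) :
    ∃ f₀ : A ⟶ B, fm f₀ = f :=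
  ⟨fhom f h, rfl⟩

/-- Two generalized elements become equal after a cover. -/
def LocallyEq (p : E ⥤ R) {X A : E} (x y : X ⟶ A) : Prop :=
  ∃ (X' : E) (c : X' ⟶ X), SColl p c ∧ c ≫ x = c ≫ y

lemma SColl.exists_cover [IsFiniteLimitFibration p] {A B X : E} {e : A ⟶ B} (he : SColl p e)
    (x : X ⟶ B) : ∃ (X' : E) (c : X' ⟶ X) (x' : X' ⟶ A), SColl p c ∧ c ≫ x = x' ≫ e := by
  haveI := totalHasFiniteLimits p
  have h := IsPullback.of_hasPullback e x
  exact ⟨_, _, _, SColl.of_isPullback h he, h.w.symm⟩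

lemma isCocart_of_isStronglyCocartesian {I J : R} {u : I ⟶ J} {A B : E} {c : A ⟶ B}
    (h : p.IsStronglyCocartesian u c) : IsCocart p c := by
  subst_hom_lift p u c
  exact h

section
variable [IsFiberedPretopos p]

/-- Cocartesian arrows are stable under pullback, and the universal property of the pulled back
arrow turns a factorization through `k` into a vertical section of `k`. -/
lemma sColl_of_isCocart {A B : E} {s : A ⟶ B} (hs : IsCocart p s) : SColl p s := by
  haveI := totalHasFiniteLimits p
  intro X t K k hk H
  have h := IsPullback.of_hasPullback s t
  have hb : IsCocart p (pullback.snd s t) := (IsFiberedPretopos.sums (p := p)).stable h hs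
  obtain ⟨y, hy⟩ := H (pullback.fst s t) (pullback.snd s t) h.w
  have hk1 := hk.1
  have h1 : p.IsHomLift (p.map (pullback.snd s t)) (y ≫ k) := by rw [hy]; infer_instance
  have hyl : p.IsHomLift (p.map (pullback.snd s t)) y := isHomLift_of_comp_vertical p _ y k
  let l := IsStronglyCocartesian.map p (p.map (pullback.snd s t)) (pullback.snd s t)
    (g := 𝟙 _) (Category.comp_id _).symm y
  have hl : pullback.snd s t ≫ l = y := IsStronglyCocartesian.fac p
    (p.map (pullback.snd s t)) (pullback.snd s t) (Category.comp_id _).symm y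
  have hll : p.IsHomLift (𝟙 (p.obj X)) l := IsStronglyCocartesian.map_isHomLift p
    (p.map (pullback.snd s t)) (pullback.snd s t) (Category.comp_id _).symm y
  refine ⟨l, ?_⟩
  apply IsStronglyCocartesian.ext p (p.map (pullback.snd s t)) (pullback.snd s t) (𝟙 (p.obj X))
  rw [reassoc_of% hl, hy, Category.comp_id]

lemma exists_cocart_vertical {A B : E} (f : A ⟶ B) :
    ∃ (C : E) (s : A ⟶ C) (v : C ⟶ B), p.IsStronglyCocartesian (p.map f) s ∧ IsCocart p s ∧
      IsVertical p v ∧ s ≫ v = f := by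
  obtain ⟨C, s, hs⟩ := (IsFiberedPretopos.sums (p := p)).exists_sum A (p.map f)
  refine ⟨C, s, IsStronglyCocartesian.map p (p.map f) s (g := 𝟙 _) (Category.comp_id _).symm f, hs,
    isCocart_of_isStronglyCocartesian hs, ?_, IsStronglyCocartesian.fac p _ _ _ _⟩
  exact IsStronglyCocartesian.map_isHomLift p _ _ _ _

/-- An arrow is a cocartesian arrow followed by a vertical one; the former is a cover, and the
latter has an image in its fiber. -/
instance isGeometricPreStack_of_isFiberedPretopos : IsGeometricPreStack p where
  unions := hasStableUnions_of_factorization (fun U B f => by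
    obtain ⟨C, s, v, -, hs, hv, h⟩ := exists_cocart_vertical (p := p) f
    obtain ⟨M, q, m, hm, hq, hqm⟩ := exists_vImage v hv
    exact ⟨M, s ≫ q, m, hm, (sColl_of_isCocart hs).comp hq, by rw [Category.assoc, hqm, h]⟩)

/-- By disjointness the diagonal into the kernel pair of `s` is cocartesian, hence a cover, so every
element of the kernel pair lies on the diagonal after a cover. -/
lemma IsCocart.locallyEq {A B X : E} {s : A ⟶ B} (hs : IsCocart p s) {x y : X ⟶ A}
    (h : x ≫ s = y ≫ s) : LocallyEq p x y := by
  haveI := totalHasFiniteLimits p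
  have hk : IsKernelPair s (pullback.fst s s) (pullback.snd s s) := IsKernelPair.of_hasPullback s
  have hd : IsCocart p (pullback.lift (𝟙 A) (𝟙 A) rfl : A ⟶ pullback s s) :=
    (IsFiberedPretopos.sums (p := p)).disjoint hs hk (pullback.lift_fst _ _ _)
      (pullback.lift_snd _ _ _)
  obtain ⟨X', c, z, hc, hz⟩ := (sColl_of_isCocart hd).exists_cover (pullback.lift x y h)
  have h1 := congrArg (· ≫ pullback.fst s s) hz
  have h2 := congrArg (· ≫ pullback.snd s s) hz
  simp only [Category.assoc, pullback.lift_fst, pullback.lift_snd] at h1 h2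
  exact ⟨X', c, hc, h1.trans h2.symm⟩

/-- Factor `e` as a cocartesian arrow followed by a vertical `v`. Local injectivity makes `v` monic;
as `v` is also a cover, it is invertible. With `sColl_of_isCocart` and `IsCocart.locallyEq` this
characterizes cocartesian arrows as the locally injective covers. -/
lemma isCocart_of_locallyEq {A B : E} {e : A ⟶ B} (he : SColl p e)
    (H : ∀ ⦃X : E⦄ (x y : X ⟶ A), x ≫ e = y ≫ e → LocallyEq p x y) : IsCocart p e := by
  obtain ⟨C, s, v, hs', hs, hv, rfl⟩ := exists_cocart_vertical (p := p) e
  have hsc := sColl_of_isCocart hs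
  haveI := isIso_map_of_isVertical hv
  have hmono : Mono v := ⟨fun {X} x y hxy => by
    obtain ⟨X₁, c₁, x', hc₁, hx⟩ := hsc.exists_cover x
    obtain ⟨X₂, c₂, y', hc₂, hy⟩ := hsc.exists_cover (c₁ ≫ y)
    obtain ⟨X₃, c₃, hc₃, h⟩ := H (c₂ ≫ x') y' (by
      rw [Category.assoc, ← reassoc_of% hx, ← reassoc_of% hy, hxy])
    refine (hc₃.comp (hc₂.comp hc₁)).hom_ext ?_ ?_
    · have := congrArg p.map hxy
      rwa [p.map_comp, p.map_comp, cancel_mono] at this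
    · simp only [Category.assoc] at h ⊢
      rw [hx, reassoc_of% h, hy]⟩
  haveI := he.of_comp.isIso_of_isPred ⟨hmono, inferInstance⟩
  have h2 : p.IsStronglyCocartesian (p.map v) v := inferInstance
  exact isCocart_of_isStronglyCocartesian
    (inferInstance : p.IsStronglyCocartesian (p.map s ≫ p.map v) (s ≫ v))

/-- A regular epimorphism of the fiber is the coequalizer of its kernel pair. Whether the
factorization of `g` through the reindexing of `T` coequalizes the pair can be tested after pulling
back the cover `s`, where the hypothesis applies. -/
lemma exists_desc_fiber {I K : R} {A : E} {B C : p.Fiber I} {T : p.Fiber K} {s : A ⟶ fo C}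
    (hs : SColl p s) (v : C ⟶ B) (hv : IsRegularEpi v) (t : I ⟶ K) (g : fo C ⟶ fo T)
    (hg : p.IsHomLift t g)
    (H : ∀ ⦃X : E⦄ (x y : X ⟶ A), x ≫ s ≫ fm v = y ≫ s ≫ fm v → x ≫ s ≫ g = y ≫ s ≫ g) :
    ∃ h : fo B ⟶ fo T, p.IsHomLift t h ∧ fm v ≫ h = g := by
  have hk : IsKernelPair v (pullback.fst v v) (pullback.snd v v) := IsKernelPair.of_hasPullback v
  have key : pullback.fst v v ≫ flift p t g hg = pullback.snd v v ≫ flift p t g hg := by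
    apply rhom_ext
    rw [fm_comp, fm_comp, Category.assoc, Category.assoc, flift_fac]
    have hw : fm (pullback.fst v v) ≫ fm v = fm (pullback.snd v v) ≫ fm v := congrArg fm hk.w
    obtain ⟨X₁, c₁, x, hc₁, hx⟩ := hs.exists_cover (fm (pullback.fst v v))
    obtain ⟨X₂, c₂, y, hc₂, hy⟩ := hs.exists_cover (c₁ ≫ fm (pullback.snd v v))
    have i1 : p.IsHomLift (𝟙 I ≫ t) (fm (pullback.fst v v) ≫ g) := inferInstance
    have i2 : p.IsHomLift (𝟙 I ≫ t) (fm (pullback.snd v v) ≫ g) := inferInstance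
    have := H (c₂ ≫ x) y (by
      simp only [Category.assoc]
      rw [← reassoc_of% hx, ← reassoc_of% hy, hw])
    refine (hc₂.comp hc₁).hom_ext ?_ ?_
    · rw [IsHomLift.fac' p (𝟙 I ≫ t) (fm (pullback.fst v v) ≫ g),
        IsHomLift.fac' p (𝟙 I ≫ t) (fm (pullback.snd v v) ≫ g)]
    · simp only [Category.assoc] at this ⊢
      rw [reassoc_of% hx, reassoc_of% hy, this]
  obtain ⟨h, hh⟩ := IsRegularEpi.exists_of_isKernelPair v hk _ key
  refine ⟨fm h ≫ rmap p t T, inferInstance, ?_⟩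
  rw [← Category.assoc, ← fm_comp, hh, flift_fac]

/-- Descent along covers. -/
lemma SColl.exists_desc_aux {A B T : E} {e : A ⟶ B} (he : SColl p e) (t : p.obj B ⟶ p.obj T)
    (g : A ⟶ T) (hg : p.IsHomLift (p.map e ≫ t) g)
    (H : ∀ ⦃X : E⦄ (x y : X ⟶ A), x ≫ e = y ≫ e → x ≫ g = y ≫ g) :
    ∃ h : B ⟶ T, p.IsHomLift t h ∧ e ≫ h = g := by
  -- The arrow `g` descends along the cocartesian part by its universal property, and then along the
  -- vertical part, which is a regular epimorphism of a fiber.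
  obtain ⟨C, s, v, hs', hs, hv, hsv⟩ := exists_cocart_vertical (p := p) e
  have hg' : s ≫ IsStronglyCocartesian.map p (p.map e) s (g := t) rfl g = g :=
    IsStronglyCocartesian.fac p (p.map e) s rfl g
  have hgl : p.IsHomLift t (IsStronglyCocartesian.map p (p.map e) s (g := t) rfl g) :=
    IsStronglyCocartesian.map_isHomLift p (p.map e) s rfl g
  generalize IsStronglyCocartesian.map p (p.map e) s (g := t) rfl g = g' at hg' hgl
  obtain ⟨I, hI⟩ : ∃ I, I = p.obj B := ⟨_, rfl⟩
  obtain ⟨K, hK⟩ : ∃ K, K = p.obj T := ⟨_, rfl⟩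
  have hv' : p.IsHomLift (𝟙 I) v := isHomLift_of_isVertical hv hI.symm
  obtain ⟨B₀, rfl⟩ := exists_fo_eq hI.symm
  obtain ⟨T₀, rfl⟩ := exists_fo_eq hK.symm
  obtain ⟨C₀, rfl⟩ := exists_fo_eq (IsHomLift.domain_eq p (𝟙 I) v)
  obtain ⟨v₀, rfl⟩ := exists_fm_eq v hv'
  rw [← hsv] at he H
  have hv₀ : IsRegularEpi v₀ := (sColl_fm_iff v₀).1 he.of_comp
  have ht : p.IsHomLift (eqToHom hI ≫ t ≫ eqToHom hK.symm) g' := inferInstance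
  obtain ⟨h, hh, hvh⟩ := exists_desc_fiber (sColl_of_isCocart hs) v₀ hv₀ _ g' ht
    (fun X x y h => by
      have h1 := H x y h
      rwa [← hg'] at h1)
  refine ⟨h, ?_, ?_⟩
  · rwa [IsHomLift.lift_eqToHom_comp_iff, IsHomLift.lift_comp_eqToHom_iff] at hh
  · rw [← hsv, ← hg', Category.assoc, hvh]

lemma SColl.exists_desc {A B T : E} {e : A ⟶ B} (he : SColl p e) {I J K : R} (u : I ⟶ J)
    (t : J ⟶ K) (hu : p.IsHomLift u e) (g : A ⟶ T) (hg : p.IsHomLift (u ≫ t) g)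
    (H : ∀ ⦃X : E⦄ (x y : X ⟶ A), x ≫ e = y ≫ e → x ≫ g = y ≫ g) :
    ∃ h : B ⟶ T, p.IsHomLift t h ∧ e ≫ h = g := by
  have h1 := IsHomLift.codomain_eq p u e
  have h2 := IsHomLift.domain_eq p u e
  have h3 := IsHomLift.codomain_eq p (u ≫ t) g
  subst h1 h2 h3
  have := IsHomLift.eq_of_isHomLift p u e
  subst this
  exact he.exists_desc_aux t g hg H

/-- Quotients of equivalence relations in the total category that are local and lie over the kernel
pair of an arrow of the base. -/
theorem exists_quotient {U V : E} {I K : R} (u : I ⟶ K) (hU : p.obj U = I) (r₀ r₁ : V ⟶ U)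
    (hr : p.map r₀ ≫ eqToHom hU ≫ u = p.map r₁ ≫ eqToHom hU ≫ u)
    (refl : ∃ l : U ⟶ V, l ≫ r₀ = 𝟙 U ∧ l ≫ r₁ = 𝟙 U)
    (symm : ∃ l : V ⟶ V, l ≫ r₀ = r₁ ∧ l ≫ r₁ = r₀)
    (trans : ∀ ⦃X : E⦄ (x y : X ⟶ V), x ≫ r₁ = y ≫ r₀ →
      ∃ z : X ⟶ V, z ≫ r₀ = x ≫ r₀ ∧ z ≫ r₁ = y ≫ r₁)
    (loc : ∀ ⦃X X' : E⦄ (c : X' ⟶ X) (x y : X ⟶ U) (z : X' ⟶ V), SColl p c →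
      p.map x ≫ eqToHom hU ≫ u = p.map y ≫ eqToHom hU ≫ u → c ≫ x = z ≫ r₀ → c ≫ y = z ≫ r₁ →
      ∃ z' : X ⟶ V, z' ≫ r₀ = x ∧ z' ≫ r₁ = y) :
    ∃ (Q : E) (q : U ⟶ Q), SColl p q ∧ p.IsHomLift u q ∧
      ∀ ⦃X : E⦄ (x y : X ⟶ U), x ≫ q = y ≫ q ↔ ∃ z : X ⟶ V, z ≫ r₀ = x ∧ z ≫ r₁ = y := by
  subst hU
  simp only [eqToHom_refl, Category.id_comp] at hr loc
  -- Pushing `U` forward along `u` makes the relation vertical: the image of `V` in `C₀ ⨯ C₀` will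
  -- be an equivalence relation in the fiber over `K`, to which exactness applies.
  obtain ⟨C, s, hs⟩ := (IsFiberedPretopos.sums (p := p)).exists_sum U u
  have hs' : IsCocart p s := isCocart_of_isStronglyCocartesian hs
  have hsc := sColl_of_isCocart hs'
  obtain ⟨C₀, rfl⟩ := exists_fo_eq (IsHomLift.codomain_eq p u s)
  haveI := IsFiberedPretopos.exact (p := p) K
  have hD := isPullback_of_fiber (IsPullback.of_hasBinaryProduct' C₀ C₀)
  have h1 : IsOne p (fo (⊤_ (p.Fiber K))) := (isOne_iff_isTerminal _).2 ⟨terminalIsTerminal⟩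
  have hto : p.IsHomLift (𝟙 K) (fm (terminal.from C₀)) := inferInstance
  have pair : ∀ {X : E} (x y : X ⟶ U), p.map x ≫ u = p.map y ≫ u →
      ∃ z : X ⟶ fo (C₀ ⨯ C₀), z ≫ fm prod.fst = x ≫ s ∧ z ≫ fm prod.snd = y ≫ s := by
    intro X x y h
    have e : (x ≫ s) ≫ fm (terminal.from C₀) = (y ≫ s) ≫ fm (terminal.from C₀) := by
      have i1 : p.IsHomLift (p.map x ≫ u) ((x ≫ s) ≫ fm (terminal.from C₀)) := inferInstance
      have i2 : p.IsHomLift (p.map x ≫ u) ((y ≫ s) ≫ fm (terminal.from C₀)) := by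
        rw [h]; infer_instance
      exact (h1.existsUnique (fo_over _) rfl (p.map x ≫ u)).unique i1 i2
    exact ⟨hD.lift _ _ e, hD.lift_fst _ _ e, hD.lift_snd _ _ e⟩
  obtain ⟨w, hw₀, hw₁⟩ := pair r₀ r₁ hr
  obtain ⟨M, e, n, hn, he, hen⟩ := exists_image (p := p) w
  have hn1 : p.IsHomLift (𝟙 K) n := isHomLift_of_isVertical hn.1 (fo_over _)
  obtain ⟨M₀, rfl⟩ := exists_fo_eq (IsHomLift.domain_eq p (𝟙 K) n)
  obtain ⟨n₀, rfl⟩ := exists_fm_eq n hn1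
  haveI hmn := hn.2
  let ρ₀ := n₀ ≫ prod.fst
  let ρ₁ := n₀ ≫ prod.snd
  have eρ₀ : e ≫ fm ρ₀ = r₀ ≫ s := by rw [fm_comp, reassoc_of% hen, hw₀]
  have eρ₁ : e ≫ fm ρ₁ = r₁ ≫ s := by rw [fm_comp, reassoc_of% hen, hw₁]
  have jm : ∀ {X : E} (x y : X ⟶ fo M₀), x ≫ fm ρ₀ = y ≫ fm ρ₀ → x ≫ fm ρ₁ = y ≫ fm ρ₁ → x = y := by
    intro X x y h0 h1
    rw [← cancel_mono (fm n₀)]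
    rw [fm_comp, ← Category.assoc, ← Category.assoc] at h0 h1
    exact hD.hom_ext h0 h1
  -- A pair of arrows into `C₀` belongs to the image relation as soon as it does so after a cover,
  -- because `n₀` is a predicate.
  have lft : ∀ {X : p.Fiber K} {Z : E} (c : Z ⟶ fo X) (hc : SColl p c) (x y : X ⟶ C₀) (z : Z ⟶ fo M₀),
      c ≫ fm x = z ≫ fm ρ₀ → c ≫ fm y = z ≫ fm ρ₁ →
      ∃ l : X ⟶ M₀, l ≫ ρ₀ = x ∧ l ≫ ρ₁ = y := by
    intro X Z c hc x y z hx hy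
    obtain ⟨l, hl⟩ := hc.exists_lift hn.isPred (fm (prod.lift x y)) z (by
      rw [fm_comp, ← Category.assoc] at hx hy
      apply hD.hom_ext
      · rw [Category.assoc, ← fm_comp, prod.lift_fst, hx]
      · rw [Category.assoc, ← fm_comp, prod.lift_snd, hy])
    have hll : p.IsHomLift (𝟙 K) (l ≫ fm n₀) := by rw [hl]; infer_instance
    have hl1 := isHomLift_of_comp_vertical p (𝟙 K) l (fm n₀)
    have hl2 : fhom l hl1 ≫ n₀ = prod.lift x y := Functor.Fiber.hom_ext hl
    exact ⟨fhom l hl1, by rw [reassoc_of% hl2, prod.lift_fst],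
      by rw [reassoc_of% hl2, prod.lift_snd]⟩
  have hER : IsEquivalenceRelation ρ₀ ρ₁ := by
    obtain ⟨lr, hlr₀, hlr₁⟩ := refl
    obtain ⟨ls, hls₀, hls₁⟩ := symm
    obtain ⟨r, hr₀, hr₁⟩ := lft (X := C₀) s hsc (𝟙 _) (𝟙 _) (lr ≫ e)
      (by rw [Category.assoc, eρ₀, reassoc_of% hlr₀, fm_id, Category.comp_id])
      (by rw [Category.assoc, eρ₁, reassoc_of% hlr₁, fm_id, Category.comp_id])
    obtain ⟨σ, hσ₀, hσ₁⟩ := lft (X := M₀) e he ρ₁ ρ₀ (ls ≫ e)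
      (by rw [Category.assoc, eρ₀, reassoc_of% hls₀, eρ₁])
      (by rw [Category.assoc, eρ₁, reassoc_of% hls₁, eρ₀])
    obtain ⟨X₁, c₁, x, hc₁, hx⟩ := he.exists_cover (fm (pullback.fst ρ₁ ρ₀))
    obtain ⟨X₂, c₂, y, hc₂, hy⟩ := he.exists_cover (c₁ ≫ fm (pullback.snd ρ₁ ρ₀))
    -- A composable pair of the image relation lifts to elements of `V` whose middle terms agree
    -- only in `C₀`. Disjointness makes them equal in `U` after a further cover, and there `trans`
    -- applies.
    have hxy : (c₂ ≫ x ≫ r₁) ≫ s = (y ≫ r₀) ≫ s := by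
      have hp : fm (pullback.fst ρ₁ ρ₀) ≫ fm ρ₁ = fm (pullback.snd ρ₁ ρ₀) ≫ fm ρ₀ :=
        congrArg fm (pullback.condition (f := ρ₁) (g := ρ₀))
      rw [Category.assoc, Category.assoc, Category.assoc, ← eρ₀, ← eρ₁, ← reassoc_of% hx, hp,
        reassoc_of% hy]
    obtain ⟨X₃, c₃, hc₃, h3⟩ := hs'.locallyEq hxy
    obtain ⟨z, hz₀, hz₁⟩ := trans (c₃ ≫ c₂ ≫ x) (c₃ ≫ y) (by simpa only [Category.assoc] using h3)
    obtain ⟨τ, hτ₀, hτ₁⟩ := lft (X := pullback ρ₁ ρ₀) (c₃ ≫ c₂ ≫ c₁) (hc₃.comp (hc₂.comp hc₁))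
      (pullback.fst ρ₁ ρ₀ ≫ ρ₀) (pullback.snd ρ₁ ρ₀ ≫ ρ₁) (z ≫ e)
      (by rw [Category.assoc z, eρ₀, reassoc_of% hz₀, fm_comp]
          simp only [Category.assoc]
          rw [reassoc_of% hx, eρ₀])
      (by rw [Category.assoc z, eρ₁, reassoc_of% hz₁, fm_comp]
          simp only [Category.assoc]
          rw [reassoc_of% hy, eρ₁])
    exact ⟨⟨{
      right_cancellation := fun Y f g h0 h1 =>
        Functor.Fiber.hom_ext (jm (fm f) (fm g) (congrArg fm h0) (congrArg fm h1))
      r := r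
      reflexivity₁ := hr₀
      reflexivity₂ := hr₁
      s := σ
      symmetry₁ := hσ₀
      symmetry₂ := hσ₁
      c := _
      isLimit := (IsPullback.of_hasPullback ρ₁ ρ₀).isLimit
      t := τ
      transitivity₁ := hτ₀
      transitivity₂ := hτ₁ }⟩⟩
  obtain ⟨Y, π, hπ⟩ := IsExact.effective ρ₀ ρ₁ hER
  -- Exactness only provides some `π` with the right kernel pair; its regular image has the same
  -- kernel pair and is a cover.
  let F := Regular.strongEpiMonoFactorisation π
  have hF : F.e ≫ F.m = π := F.fac
  have hFe : IsRegularEpi F.e := inferInstanceAs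
    (IsRegularEpi (Regular.strongEpiMonoFactorisation π).e)
  rw [← hF] at hπ
  have hk := isPullback_of_fiber (IsKernelPair.cancel_right_of_mono hπ)
  refine ⟨fo F.I, s ≫ fm F.e, hsc.comp (sColl_of_regularEpi F.e hFe), inferInstance,
    fun X x y => ⟨fun h => ?_, ?_⟩⟩
  · rw [← Category.assoc, ← Category.assoc] at h
    obtain ⟨X₁, c₁, v, hc₁, hv⟩ := he.exists_cover (hk.lift (x ≫ s) (y ≫ s) h)
    have hv₀ : (c₁ ≫ x) ≫ s = (v ≫ r₀) ≫ s := by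
      rw [Category.assoc v, ← eρ₀, ← reassoc_of% hv, hk.lift_fst, Category.assoc]
    have hv₁ : (c₁ ≫ y) ≫ s = (v ≫ r₁) ≫ s := by
      rw [Category.assoc v, ← eρ₁, ← reassoc_of% hv, hk.lift_snd, Category.assoc]
    obtain ⟨X₂, c₂, hc₂, h2⟩ := hs'.locallyEq hv₀
    obtain ⟨X₃, c₃, hc₃, h3⟩ := hs'.locallyEq (x := c₂ ≫ c₁ ≫ y) (y := c₂ ≫ v ≫ r₁)
      (by simp only [Category.assoc] at hv₁ ⊢; rw [hv₁])
    -- Equality in the quotient yields an element of `V` only after a cover, which locality of the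
    -- relation removes.
    refine loc (c₃ ≫ c₂ ≫ c₁) x y (c₃ ≫ c₂ ≫ v) (hc₃.comp (hc₂.comp hc₁)) ?_ ?_ ?_
    · have i1 : p.IsHomLift (p.map x ≫ u) ((x ≫ s) ≫ fm F.e) := by
        rw [Category.assoc]; infer_instance
      have i2 : p.IsHomLift (p.map y ≫ u) ((x ≫ s) ≫ fm F.e) := by
        rw [h, Category.assoc]; infer_instance
      exact homLift_unique i1 i2
    · simp only [Category.assoc] at h2 ⊢
      rw [h2]
    · simpa only [Category.assoc] using h3
  · rintro ⟨z, rfl, rfl⟩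
    have hw := hk.w
    simp only [Category.assoc]
    rw [← reassoc_of% eρ₀, ← reassoc_of% eρ₁, hw]

end
end

/-! ### Functors of fibered pretoposes are the coherent functors -/

section
variable {R : Type u₁} [Category.{v₁} R] [HasFiniteLimits R] {S : BasedCategory.{v₂, u₂} R}
  {T : BasedCategory.{v₃, u₃} R}

variable [IsFiberedPretopos S.p] [IsFiberedPretopos T.p]

lemma IsPretoposFunctor.map_sColl_fiber {F : S ⥤ᵇ T} (hF : IsPretoposFunctor F) {I : R}
    {A B : S.p.Fiber I} (v : A ⟶ B) (hv : SColl S.p (fm v)) : SColl T.p (F.map (fm v)) :=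
  sColl_of_regularEpi ((fiberMap F I).map v)
    ((hF.regular I).map_regularEpi v ((sColl_fm_iff v).1 hv))

/-- A cover is a cocartesian arrow followed by a vertical cover, and the latter is a regular
epimorphism of a fiber. -/
lemma IsPretoposFunctor.isCoherentFunctor {F : S ⥤ᵇ T} (hF : IsPretoposFunctor F) :
    IsCoherentFunctor F where
  toIsLexFunctor := isLexFunctor_of_fiberMap hF.fibered
    (fun I => (hF.regular I).preservesFiniteLimits)
  map_sColl {A B e} he := by
    obtain ⟨C, s, v, -, hs, hv, rfl⟩ := exists_cocart_vertical (p := S.p) e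
    rw [F.map_comp]
    refine (sColl_of_isCocart (hF.map_sum s hs)).comp ?_
    have hv' := he.of_comp
    obtain ⟨I, hI⟩ : ∃ I, I = S.p.obj B := ⟨_, rfl⟩
    have hvl : S.p.IsHomLift (𝟙 I) v := isHomLift_of_isVertical hv hI.symm
    obtain ⟨B₀, rfl⟩ := exists_fo_eq hI.symm
    obtain ⟨C₀, rfl⟩ := exists_fo_eq (IsHomLift.domain_eq S.p (𝟙 I) v)
    obtain ⟨v₀, rfl⟩ := exists_fm_eq v hvl
    exact hF.map_sColl_fiber v₀ hv'

/-- Cocartesian arrows are the locally injective covers. Local injectivity follows once the diagonal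
into the kernel pair is a cover, and a coherent functor preserves kernel pairs and covers. -/
lemma IsCoherentFunctor.isPretoposFunctor {F : S ⥤ᵇ T} (hF : IsCoherentFunctor F) :
    IsPretoposFunctor F where
  fibered := hF.isFiberedFunctor
  regular := hF.isRegularFunctor
  map_sum {A B} s hs := by
    haveI := totalHasFiniteLimits S.p
    refine isCocart_of_locallyEq (hF.map_sColl (sColl_of_isCocart hs)) (fun X x y h => ?_)
    have hk : IsKernelPair s (pullback.fst s s) (pullback.snd s s) := IsKernelPair.of_hasPullback s
    have h0 : pullback.lift (𝟙 A) (𝟙 A) rfl ≫ pullback.fst s s = 𝟙 A := pullback.lift_fst _ _ _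
    have h1 : pullback.lift (𝟙 A) (𝟙 A) rfl ≫ pullback.snd s s = 𝟙 A := pullback.lift_snd _ _ _
    have hd := sColl_of_isCocart ((IsFiberedPretopos.sums (p := S.p)).disjoint hs hk h0 h1)
    have hk' := hF.map_isPullback hk
    obtain ⟨X', c, z, hc, hz⟩ := (hF.map_sColl hd).exists_cover (hk'.lift x y h)
    have e0 : F.map (pullback.lift (𝟙 A) (𝟙 A) rfl) ≫ F.map (pullback.fst s s) = 𝟙 _ := by
      rw [← F.map_comp, h0, F.map_id]
    have e1 : F.map (pullback.lift (𝟙 A) (𝟙 A) rfl) ≫ F.map (pullback.snd s s) = 𝟙 _ := by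
      rw [← F.map_comp, h1, F.map_id]
    have g0 := congrArg (· ≫ F.map (pullback.fst s s)) hz
    have g1 := congrArg (· ≫ F.map (pullback.snd s s)) hz
    simp only [Category.assoc, hk'.lift_fst, hk'.lift_snd, e0, e1] at g0 g1
    exact ⟨X', c, hc, g0.trans g1.symm⟩

end

/-! ### Testing pullbacks after a cover -/

section
variable {R : Type u₁} [Category.{v₁} R] [HasFiniteLimits R] {E : Type u₂} [Category.{v₂} E]
  {p : E ⥤ R}

lemma isPullback_map_of_isHomLift {I J K L : R} {u₀ : I ⟶ J} {u₁ : I ⟶ K} {v₀ : J ⟶ L}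
    {v₁ : K ⟶ L} (h : IsPullback u₀ u₁ v₀ v₁) {P A B C : E} {a : P ⟶ A} {b : P ⟶ B} {f : A ⟶ C}
    {g : B ⟶ C} (ha : p.IsHomLift u₀ a) (hb : p.IsHomLift u₁ b) (hf : p.IsHomLift v₀ f)
    (hg : p.IsHomLift v₁ g) : IsPullback (p.map a) (p.map b) (p.map f) (p.map g) := by
  refine IsPullback.of_iso h (eqToIso (IsHomLift.domain_eq p u₀ a).symm)
    (eqToIso (IsHomLift.codomain_eq p u₀ a).symm) (eqToIso (IsHomLift.codomain_eq p u₁ b).symm)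
    (eqToIso (IsHomLift.codomain_eq p v₀ f).symm) ?_ ?_ ?_ ?_
  · rw [IsHomLift.fac' p u₀ a]; simp
  · rw [IsHomLift.fac' p u₁ b]; simp
  · rw [IsHomLift.fac' p v₀ f]; simp
  · rw [IsHomLift.fac' p v₁ g]; simp

lemma map_eq_map_of_isHomLift {I J : R} {u : I ⟶ J} {A B : E} {f g : A ⟶ B}
    (hf : p.IsHomLift u f) (hg : p.IsHomLift u g) : p.map f = p.map g := by
  rw [IsHomLift.fac' p u f, IsHomLift.fac' p u g]

lemma IsOne.of_isIso {A B : E} (f : A ⟶ B) [IsIso f] (h : IsOne p A) : IsOne p B := by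
  intro X t
  obtain ⟨x, hx, hu⟩ := h (t ≫ inv (p.map f))
  have hx' := IsHomLift.eq_of_isHomLift p (t ≫ inv (p.map f)) x
  have ht : t = p.map (x ≫ f) := by rw [p.map_comp, ← hx']; simp
  refine ⟨x ≫ f, by rw [ht]; infer_instance, fun y hy => ?_⟩
  have hy' := IsHomLift.eq_of_isHomLift p t y
  rw [← hu (y ≫ inv f) ?_]
  · simp
  · have : t ≫ inv (p.map f) = p.map (y ≫ inv f) := by rw [p.map_comp, ← hy', p.map_inv]
    rw [this]
    infer_instance

/-- Generalized elements lift locally through a jointly monic pair; the lifts descend. -/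
lemma SColl.exists_lift_of_jointly_mono [IsFiberedPretopos p] {Z' Z P A B : E} {c : Z' ⟶ Z}
    (hc : SColl p c) {a : P ⟶ A} {b : P ⟶ B}
    (inj : ∀ ⦃X : E⦄ (l l' : X ⟶ P), l ≫ a = l' ≫ a → l ≫ b = l' ≫ b → l = l')
    (x : Z ⟶ A) (y : Z ⟶ B) (z : Z' ⟶ P) (hx : z ≫ a = c ≫ x) (hy : z ≫ b = c ≫ y)
    (t : p.obj Z ⟶ p.obj P) (htx : t ≫ p.map a = p.map x) (hty : t ≫ p.map b = p.map y)
    (hz : p.map z = p.map c ≫ t) : ∃ l : Z ⟶ P, l ≫ a = x ∧ l ≫ b = y := by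
  obtain ⟨l, hl, hcl⟩ := hc.exists_desc (p.map c) t inferInstance z
    (by rw [← hz]; infer_instance) (fun X f g h => inj _ _
      (by rw [Category.assoc, Category.assoc, hx, reassoc_of% h])
      (by rw [Category.assoc, Category.assoc, hy, reassoc_of% h]))
  have hl' := IsHomLift.eq_of_isHomLift p t l
  exact ⟨l, hc.hom_ext (by rw [p.map_comp, ← hl', htx]) (by rw [reassoc_of% hcl, hx]),
    hc.hom_ext (by rw [p.map_comp, ← hl', hty]) (by rw [reassoc_of% hcl, hy])⟩

/-- Local lifts through a jointly monic pair satisfy the descent condition automatically. The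
pullback in the base supplies the base arrow over which they descend. -/
lemma isPullback_of_locally [IsFiberedPretopos p] {P A B C : E} {a : P ⟶ A} {b : P ⟶ B} {f : A ⟶ C}
    {g : B ⟶ C} (w : a ≫ f = b ≫ g) (h : IsPullback (p.map a) (p.map b) (p.map f) (p.map g))
    (inj : ∀ ⦃X : E⦄ (l l' : X ⟶ P), l ≫ a = l' ≫ a → l ≫ b = l' ≫ b → l = l')
    (H : ∀ ⦃X : E⦄ (x : X ⟶ A) (y : X ⟶ B), x ≫ f = y ≫ g → ∃ (X' : E) (c : X' ⟶ X) (z : X' ⟶ P),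
      SColl p c ∧ z ≫ a = c ≫ x ∧ z ≫ b = c ≫ y) : IsPullback a b f g := by
  refine isPullback_of_existsUnique w (fun X x y hxy => ?_) (fun X l l' => inj l l')
  obtain ⟨X', c, z, hc, hx, hy⟩ := H x y hxy
  have e : p.map x ≫ p.map f = p.map y ≫ p.map g := by rw [← p.map_comp, hxy, p.map_comp]
  refine hc.exists_lift_of_jointly_mono inj x y z hx hy (h.lift _ _ e) (h.lift_fst _ _ e)
    (h.lift_snd _ _ e) (h.hom_ext ?_ ?_)
  · rw [Category.assoc, h.lift_fst, ← p.map_comp, hx, p.map_comp]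
  · rw [Category.assoc, h.lift_snd, ← p.map_comp, hy, p.map_comp]

end

/-! ### Dense embeddings -/

section
variable {R : Type u₁} [Category.{v₁} R] [HasFiniteLimits R] {S : BasedCategory.{v₂, u₂} R}
  {T : BasedCategory.{v₃, u₃} R} {X : BasedCategory.{v₄, u₄} R}

lemma isHomLift_map_map (i : S ⥤ᵇ T) (F : S ⥤ᵇ X) {A B : S.obj} (w : A ⟶ B) :
    X.p.IsHomLift (T.p.map (i.map w)) (F.map w) := by
  have h : T.p.IsHomLift (S.p.map w) (i.map w) := inferInstance
  rw [IsHomLift.fac' T.p (S.p.map w) (i.map w), IsHomLift.lift_eqToHom_comp_iff,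
    IsHomLift.lift_comp_eqToHom_iff]
  infer_instance

variable [IsFiniteLimitFibration S.p]

lemma IsLexFunctor.map_jointly_mono {F : S ⥤ᵇ X} (hF : IsLexFunctor F) {M A B : S.obj} {a : M ⟶ A}
    {b : M ⟶ B} (inj : ∀ ⦃Z : S.obj⦄ (l l' : Z ⟶ M), l ≫ a = l' ≫ a → l ≫ b = l' ≫ b → l = l')
    ⦃Z : X.obj⦄ (l l' : Z ⟶ F.obj M) (ha : l ≫ F.map a = l' ≫ F.map a)
    (hb : l ≫ F.map b = l' ≫ F.map b) : l = l' := by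
  haveI := totalHasFiniteLimits S.p
  have hm : Mono (prod.lift a b) := ⟨fun l l' h => inj l l'
    (by simpa only [Category.assoc, prod.lift_fst] using congrArg (· ≫ prod.fst) h)
    (by simpa only [Category.assoc, prod.lift_snd] using congrArg (· ≫ prod.snd) h)⟩
  haveI := hF.map_mono hm
  rw [← cancel_mono (F.map (prod.lift a b))]
  apply (hF.map_isPullback (IsPullback.of_hasBinaryProduct' A B)).hom_ext
  · rw [Category.assoc, Category.assoc, ← F.map_comp, prod.lift_fst, ha]
  · rw [Category.assoc, Category.assoc, ← F.map_comp, prod.lift_snd, hb]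

/-- The equalizer is the pullback of the two graphs, so `F` preserves it. -/
lemma IsLexFunctor.exists_equalizer {F : S ⥤ᵇ X} (hF : IsLexFunctor F) {A B : S.obj}
    (a b : A ⟶ B) : ∃ (K : S.obj) (k : K ⟶ A), k ≫ a = k ≫ b ∧ ∀ ⦃Z : X.obj⦄ (x : Z ⟶ F.obj A),
      x ≫ F.map a = x ≫ F.map b → ∃ l, l ≫ F.map k = x := by
  haveI := totalHasFiniteLimits S.p
  have h := IsPullback.of_hasPullback (prod.lift (𝟙 A) a) (prod.lift (𝟙 A) b)
  have h1 := congrArg (· ≫ prod.fst) h.w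
  have h2 := congrArg (· ≫ prod.snd) h.w
  simp only [Category.assoc, prod.lift_fst, prod.lift_snd, Category.comp_id] at h1 h2
  refine ⟨_, pullback.fst _ _, by rw [h2, h1], fun Z x hx => ?_⟩
  have h' := hF.map_isPullback h
  have e : x ≫ F.map (prod.lift (𝟙 A) a) = x ≫ F.map (prod.lift (𝟙 A) b) := by
    apply (hF.map_isPullback (IsPullback.of_hasBinaryProduct' A B)).hom_ext
    · rw [Category.assoc, Category.assoc, ← F.map_comp, ← F.map_comp, prod.lift_fst, prod.lift_fst]
    · rw [Category.assoc, Category.assoc, ← F.map_comp, ← F.map_comp, prod.lift_snd, prod.lift_snd,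
        hx]
  exact ⟨h'.lift x x e, h'.lift_fst _ _ _⟩

/-- A full and faithful coherent functor whose image is closed under predicates and covers the
codomain. -/
structure IsDense (i : S ⥤ᵇ T) : Prop where
  coherent : IsCoherentFunctor i
  full : i.toFunctor.Full
  faithful : i.toFunctor.Faithful
  exists_pred {A : S.obj} {U : T.obj} (m : U ⟶ i.obj A) : IsPred T.p m →
    ∃ (V : S.obj) (n : V ⟶ A) (e : U ≅ i.obj V), e.hom ≫ i.map n = m
  exists_cover (Y : T.obj) : ∃ (U : S.obj) (s : i.obj U ⟶ Y), SColl T.p s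

namespace IsDense
variable {i : S ⥤ᵇ T} (hi : IsDense i)
include hi

lemma exists_map {A B : S.obj} (f : i.obj A ⟶ i.obj B) : ∃ g : A ⟶ B, i.map g = f := by
  haveI := hi.full
  exact i.toFunctor.map_surjective f

lemma map_inj {A B : S.obj} {f g : A ⟶ B} (h : i.map f = i.map g) : f = g := by
  haveI := hi.faithful
  exact i.toFunctor.map_injective h

variable [IsFiniteLimitFibration T.p]

/-- The pullback over `Y` is contained, as a predicate, in the pullback over the terminal object of
the fiber of `Y`. The latter comes from `S`, and the image of `i` is closed under predicates. -/
lemma exists_isPullback {Y : T.obj} {A B : S.obj} (a : i.obj A ⟶ Y) (b : i.obj B ⟶ Y) :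
    ∃ (M : S.obj) (m₀ : M ⟶ A) (m₁ : M ⟶ B), IsPullback (i.map m₀) (i.map m₁) a b := by
  haveI := totalHasFiniteLimits T.p
  haveI := totalHasFiniteLimits S.p
  have hK : S.p.obj (one S.p (T.p.obj Y)) = T.p.obj Y := one_over S.p _
  have hO : IsOne T.p (i.obj (one S.p (T.p.obj Y))) := hi.coherent.map_isOne (isOne_one _)
  obtain ⟨y, hy, -⟩ := hO.existsUnique ((i.w_obj _).trans hK) rfl (𝟙 (T.p.obj Y))
  obtain ⟨α, hα⟩ := hi.exists_map (a ≫ y)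
  obtain ⟨β, hβ⟩ := hi.exists_map (b ≫ y)
  have hP := hi.coherent.map_isPullback (IsPullback.of_hasPullback α β)
  rw [hα, hβ] at hP
  have hQ := IsPullback.of_hasPullback a b
  have hw : pullback.fst a b ≫ a ≫ y = pullback.snd a b ≫ b ≫ y := by
    rw [← Category.assoc, hQ.w, Category.assoc]
  have hyi : IsIso (T.p.map y) := by
    rw [IsHomLift.fac' T.p (𝟙 (T.p.obj Y)) y]
    infer_instance
  have hpred : IsPred T.p (hP.lift _ _ hw) := by
    refine ⟨⟨fun l l' h => hQ.hom_ext ?_ ?_⟩, ?_⟩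
    · rw [← hP.lift_fst _ _ hw, reassoc_of% h]
    · rw [← hP.lift_snd _ _ hw, reassoc_of% h]
    · have h1 := map_isPullback (p := T.p) hP
      rw [T.p.map_comp, T.p.map_comp] at h1
      have h2 := map_isPullback (p := T.p) hQ
      have h3 : IsPullback (T.p.map (i.map (pullback.fst α β)))
          (T.p.map (i.map (pullback.snd α β))) (T.p.map a) (T.p.map b) := by
        refine isPullback_of_existsUnique ?_ (fun Z x z h => ?_) (fun Z l l' => h1.hom_ext)
        · have := h1.w
          rwa [← Category.assoc, ← Category.assoc, cancel_mono] at this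
        · have e : x ≫ T.p.map a ≫ T.p.map y = z ≫ T.p.map b ≫ T.p.map y := by
            rw [reassoc_of% h]
          exact ⟨h1.lift x z e, h1.lift_fst _ _ _, h1.lift_snd _ _ _⟩
      have : T.p.map (hP.lift _ _ hw) = (h2.isoIsPullback _ _ h3).hom := by
        apply h3.hom_ext
        · rw [← T.p.map_comp, hP.lift_fst, IsPullback.isoIsPullback_hom_fst]
        · rw [← T.p.map_comp, hP.lift_snd, IsPullback.isoIsPullback_hom_snd]
      rw [this]
      infer_instance
  obtain ⟨V, n, e, he⟩ := hi.exists_pred _ hpred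
  refine ⟨V, n ≫ pullback.fst α β, n ≫ pullback.snd α β, ?_⟩
  refine IsPullback.of_iso hQ e (Iso.refl _) (Iso.refl _) (Iso.refl _) ?_ ?_ (by simp) (by simp)
  · rw [i.map_comp, reassoc_of% he, hP.lift_fst]
    simp
  · rw [i.map_comp, reassoc_of% he, hP.lift_snd]
    simp

lemma jointly_mono {Y : T.obj} {M A B : S.obj} {a : i.obj A ⟶ Y} {b : i.obj B ⟶ Y} {m₀ : M ⟶ A}
    {m₁ : M ⟶ B} (h : IsPullback (i.map m₀) (i.map m₁) a b) ⦃Z : S.obj⦄ (l l' : Z ⟶ M)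
    (h₀ : l ≫ m₀ = l' ≫ m₀) (h₁ : l ≫ m₁ = l' ≫ m₁) : l = l' :=
  hi.map_inj (h.hom_ext (by rw [← i.map_comp, h₀, i.map_comp])
    (by rw [← i.map_comp, h₁, i.map_comp]))

lemma exists_lift {Y : T.obj} {M A B Z : S.obj} {a : i.obj A ⟶ Y} {b : i.obj B ⟶ Y} {m₀ : M ⟶ A}
    {m₁ : M ⟶ B} (h : IsPullback (i.map m₀) (i.map m₁) a b) (x : Z ⟶ A) (y : Z ⟶ B)
    (hxy : i.map x ≫ a = i.map y ≫ b) : ∃ l : Z ⟶ M, l ≫ m₀ = x ∧ l ≫ m₁ = y := by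
  obtain ⟨l, hl⟩ := hi.exists_map (h.lift _ _ hxy)
  exact ⟨l, hi.map_inj (by rw [i.map_comp, hl, h.lift_fst]),
    hi.map_inj (by rw [i.map_comp, hl, h.lift_snd])⟩

end IsDense
end

/-! ### Pointwise extension along a dense embedding -/

section
variable {R : Type u₁} [Category.{v₁} R] [HasFiniteLimits R] {S : BasedCategory.{v₂, u₂} R}
  {T : BasedCategory.{v₃, u₃} R} {X : BasedCategory.{v₄, u₄} R} [IsGeometricPreStack S.p]
  [IsFiberedPretopos T.p] [IsFiberedPretopos X.p]

namespace IsDense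
variable {i : S ⥤ᵇ T} (hi : IsDense i)
include hi

/-- The predicate part of `w` is sent to a predicate that is also a cover, hence to an isomorphism,
and a full and faithful functor reflects isomorphisms. -/
lemma sColl_of_map {A B : S.obj} {w : A ⟶ B} (h : SColl T.p (i.map w)) : SColl S.p w := by
  obtain ⟨V, e, n, hn, he, rfl⟩ := exists_image (p := S.p) w
  rw [i.map_comp] at h
  haveI := hi.full
  haveI := hi.faithful
  haveI : IsIso (i.map n) := h.of_comp.isIso_of_isPred (hi.coherent.map_isPred hn.isPred)
  haveI : IsIso n := isIso_of_reflects_iso n i.toFunctor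
  exact he.comp (.of_isIso n)

/-- Pull the cover `s` back along `a` and cover the result by an object of `S`. Fullness of `i`
provides the two legs, and `i` reflects covers. -/
lemma exists_local_lift {Y : T.obj} {A U : S.obj} {s : i.obj U ⟶ Y} (hs : SColl T.p s)
    (a : i.obj A ⟶ Y) : ∃ (W : S.obj) (w : W ⟶ A) (w' : W ⟶ U), SColl S.p w ∧
      i.map w ≫ a = i.map w' ≫ s := by
  obtain ⟨Z, c, x, hc, h⟩ := hs.exists_cover a
  obtain ⟨W, e, he⟩ := hi.exists_cover Z
  obtain ⟨w, hw⟩ := hi.exists_map (e ≫ c)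
  obtain ⟨w', hw'⟩ := hi.exists_map (e ≫ x)
  exact ⟨W, w, w', hi.sColl_of_map (by rw [hw]; exact he.comp hc), by
    rw [hw, hw', Category.assoc, Category.assoc, h]⟩

end IsDense

/-- The value at `Y` of the extension of `F` along `i`, as a cocone on the arrows `i A ⟶ Y`. -/
structure Realization (i : S ⥤ᵇ T) (F : S ⥤ᵇ X) (Y : T.obj) where
  pt : X.obj
  ι {A : S.obj} (a : i.obj A ⟶ Y) : F.obj A ⟶ pt
  isHomLift {A : S.obj} (a : i.obj A ⟶ Y) : X.p.IsHomLift (T.p.map a) (ι a)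
  nat {A B : S.obj} (w : A ⟶ B) (a : i.obj B ⟶ Y) : F.map w ≫ ι a = ι (i.map w ≫ a)
  sColl {U : S.obj} (s : i.obj U ⟶ Y) : SColl T.p s → SColl X.p (ι s)
  isPullback {M A B : S.obj} {m₀ : M ⟶ A} {m₁ : M ⟶ B} {a : i.obj A ⟶ Y} {b : i.obj B ⟶ Y} :
    IsPullback (i.map m₀) (i.map m₁) a b → IsPullback (F.map m₀) (F.map m₁) (ι a) (ι b)

/-- The realization given by a functor on the codomain. -/
def Realization.ofFunctor (i : S ⥤ᵇ T) {G : T ⥤ᵇ X} (hG : IsCoherentFunctor G) (Y : T.obj) :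
    Realization i (i ⋙ G) Y where
  pt := G.obj Y
  ι a := G.map a
  isHomLift a := BasedFunctor.preserves_isHomLift G (T.p.map a) a
  nat _ _ := (G.map_comp _ _).symm
  sColl _ hs := hG.map_sColl hs
  isPullback h := hG.map_isPullback h

namespace IsDense
variable {i : S ⥤ᵇ T} (hi : IsDense i)
include hi

/-- An arrow out of the realization is determined on one covering leg `ι s`, whose kernel pair is
the image under `F` of a kernel pair from `S`; naturality of `g` is the descent condition.
Compatibility with another `a` is tested on a local lift of `a` through `s`. -/
lemma existsUnique_desc {F : S ⥤ᵇ X} (hF : IsCoherentFunctor F) {Y : T.obj} (P : Realization i F Y)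
    {Z : X.obj} {L : R} (t : T.p.obj Y ⟶ L) (g : ∀ {A : S.obj}, (i.obj A ⟶ Y) → (F.obj A ⟶ Z))
    (hg : ∀ {A : S.obj} (a : i.obj A ⟶ Y), X.p.IsHomLift (T.p.map a ≫ t) (g a))
    (nat : ∀ {A B : S.obj} (w : A ⟶ B) (a : i.obj B ⟶ Y), F.map w ≫ g a = g (i.map w ≫ a)) :
    ∃! h : P.pt ⟶ Z, X.p.IsHomLift t h ∧ ∀ {A : S.obj} (a : i.obj A ⟶ Y), P.ι a ≫ h = g a := by
  obtain ⟨U, s, hs⟩ := hi.exists_cover Y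
  obtain ⟨M, m₀, m₁, hM⟩ := hi.exists_isPullback s s
  obtain ⟨h, hh, hsh⟩ := (P.sColl s hs).exists_desc (T.p.map s) t (P.isHomLift s) (g s) (hg s)
    (fun W x y hxy => by
      rw [← (P.isPullback hM).lift_fst x y hxy, Category.assoc, nat, hM.w, ← nat, ← Category.assoc,
        (P.isPullback hM).lift_snd x y hxy])
  refine ⟨h, ⟨hh, fun {A} a => ?_⟩, ?_⟩
  · obtain ⟨W, w, w', hw, hww⟩ := hi.exists_local_lift hs a
    have := P.isHomLift a
    refine (hF.map_sColl hw).hom_ext (map_eq_map_of_isHomLift (u := T.p.map a ≫ t)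
      inferInstance (hg a)) ?_
    rw [← Category.assoc, P.nat, hww, ← P.nat, Category.assoc, hsh, nat, nat, hww]
  · rintro h' ⟨hh', hsh'⟩
    exact (P.sColl s hs).hom_ext (map_eq_map_of_isHomLift hh' hh) (by rw [hsh, hsh'])

/-- For a cover `s : i U ⟶ Y` with kernel pair `N`, the value is the quotient of `F U` by the
equivalence relation `F N`. The leg at `a` descends along a local lift of `a` through `s`. -/
theorem exists_realization {F : S ⥤ᵇ X} (hF : IsCoherentFunctor F) (Y : T.obj) :
    Nonempty (Realization i F Y) := by
  haveI := totalHasFiniteLimits S.p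
  obtain ⟨U, s, hs⟩ := hi.exists_cover Y
  obtain ⟨N, n₀, n₁, hN⟩ := hi.exists_isPullback s s
  have lft : ∀ {A B : S.obj} (w : A ⟶ B), X.p.IsHomLift (T.p.map (i.map w)) (F.map w) :=
    fun w => isHomLift_map_map i F w
  have hU : X.p.obj (F.obj U) = T.p.obj (i.obj U) := (F.w_obj U).trans (i.w_obj U).symm
  have hNb := map_isPullback (p := T.p) hN
  have hr : X.p.map (F.map n₀) ≫ eqToHom hU ≫ T.p.map s =
      X.p.map (F.map n₁) ≫ eqToHom hU ≫ T.p.map s := by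
    have l₀ := lft n₀
    have l₁ := lft n₁
    rw [IsHomLift.fac' X.p (T.p.map (i.map n₀)) (F.map n₀),
      IsHomLift.fac' X.p (T.p.map (i.map n₁)) (F.map n₁)]
    simp [hNb.w]
  have hNX : IsPullback (X.p.map (F.map n₀)) (X.p.map (F.map n₁)) (eqToHom hU ≫ T.p.map s)
      (eqToHom hU ≫ T.p.map s) := by
    have l₀ := lft n₀
    have l₁ := lft n₁
    refine IsPullback.of_iso hNb (eqToIso ((F.w_obj N).trans (i.w_obj N).symm).symm)
      (eqToIso hU.symm) (eqToIso hU.symm) (Iso.refl _) ?_ ?_ (by simp) (by simp)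
    · rw [IsHomLift.fac' X.p (T.p.map (i.map n₀)) (F.map n₀)]; simp
    · rw [IsHomLift.fac' X.p (T.p.map (i.map n₁)) (F.map n₁)]; simp
  have jm := hF.map_jointly_mono (hi.jointly_mono hN)
  obtain ⟨Q, q, hq, hql, hqk⟩ := exists_quotient (p := X.p) (T.p.map s) hU (F.map n₀) (F.map n₁) hr
    (by
      obtain ⟨l, h₀, h₁⟩ := hi.exists_lift hN (𝟙 U) (𝟙 U) rfl
      exact ⟨F.map l, by rw [← F.map_comp, h₀, F.map_id], by rw [← F.map_comp, h₁, F.map_id]⟩)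
    (by
      obtain ⟨l, h₀, h₁⟩ := hi.exists_lift hN n₁ n₀ hN.w.symm
      exact ⟨F.map l, by rw [← F.map_comp, h₀], by rw [← F.map_comp, h₁]⟩)
    (fun Z x y hxy => by
      have hp := IsPullback.of_hasPullback n₁ n₀
      obtain ⟨l, h₀, h₁⟩ := hi.exists_lift hN (pullback.fst n₁ n₀ ≫ n₀) (pullback.snd n₁ n₀ ≫ n₁)
        (by
          have h := congrArg i.map hp.w
          simp only [i.map_comp, Category.assoc] at h ⊢
          rw [hN.w, reassoc_of% h, hN.w])
      refine ⟨(hF.map_isPullback hp).lift x y hxy ≫ F.map l, ?_, ?_⟩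
      · rw [Category.assoc, ← F.map_comp, h₀, F.map_comp, ← Category.assoc, IsPullback.lift_fst]
      · rw [Category.assoc, ← F.map_comp, h₁, F.map_comp, ← Category.assoc, IsPullback.lift_snd])
    -- Locality of the relation: `F N` is jointly monic over `F U`, so a local element descends,
    -- over the base arrow supplied by the base kernel pair `hNX`.
    (fun Z Z' c x y z hc hxy hx hy => by
      refine hc.exists_lift_of_jointly_mono jm x y z hx.symm hy.symm (hNX.lift _ _ hxy)
        (hNX.lift_fst _ _ _) (hNX.lift_snd _ _ _) (hNX.hom_ext ?_ ?_)
      · rw [Category.assoc, hNX.lift_fst, ← X.p.map_comp, ← hx, X.p.map_comp]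
      · rw [Category.assoc, hNX.lift_snd, ← X.p.map_comp, ← hy, X.p.map_comp])
  -- Elements of `U` identified by `s` factor through `N`, and are therefore identified in the
  -- quotient.
  have glue : ∀ {V : S.obj} (v v' : V ⟶ U), i.map v ≫ s = i.map v' ≫ s →
      F.map v ≫ q = F.map v' ≫ q := by
    intro V v v' h
    obtain ⟨l, rfl, rfl⟩ := hi.exists_lift hN v v' h
    exact (hqk _ _).2 ⟨F.map l, by rw [F.map_comp], by rw [F.map_comp]⟩
  have key : ∀ {A : S.obj} (a : i.obj A ⟶ Y), ∃ h : F.obj A ⟶ Q, X.p.IsHomLift (T.p.map a) h ∧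
      ∀ {V : S.obj} (v : V ⟶ A) (v' : V ⟶ U), i.map v ≫ a = i.map v' ≫ s →
        F.map v ≫ h = F.map v' ≫ q := by
    intro A a
    obtain ⟨W, w, w', hw, hww⟩ := hi.exists_local_lift hs a
    have l' := lft w'
    have hg : X.p.IsHomLift (T.p.map (i.map w) ≫ T.p.map a) (F.map w' ≫ q) := by
      rw [← T.p.map_comp, hww, T.p.map_comp]
      infer_instance
    obtain ⟨h, hh, hwh⟩ := (hF.map_sColl hw).exists_desc (T.p.map (i.map w)) (T.p.map a) (lft w)
      (F.map w' ≫ q) hg (fun Z x y hxy => by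
        have hk := IsKernelPair.of_hasPullback w
        have hk' := hF.map_isPullback hk
        have := glue (pullback.fst w w ≫ w') (pullback.snd w w ≫ w') (by
          rw [i.map_comp, i.map_comp, Category.assoc, Category.assoc, ← hww, ← Category.assoc,
            ← Category.assoc, ← i.map_comp, ← i.map_comp, hk.w])
        rw [F.map_comp, F.map_comp, Category.assoc, Category.assoc] at this
        rw [← hk'.lift_fst x y hxy, Category.assoc, this, ← Category.assoc, hk'.lift_snd])
    refine ⟨h, hh, fun {V} v v' hv => ?_⟩
    have hp := IsPullback.of_hasPullback w v
    refine (hF.map_sColl (SColl.of_isPullback hp hw)).hom_ext ?_ ?_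
    · have l₁ := lft v
      have l₂ := lft v'
      refine map_eq_map_of_isHomLift (u := T.p.map (i.map v) ≫ T.p.map a) inferInstance ?_
      rw [← T.p.map_comp, hv, T.p.map_comp]
      infer_instance
    · rw [← Category.assoc, ← F.map_comp, ← hp.w, F.map_comp, Category.assoc, hwh, ← Category.assoc,
        ← Category.assoc, ← F.map_comp, ← F.map_comp]
      apply glue
      rw [i.map_comp, Category.assoc, ← hww, ← Category.assoc, ← i.map_comp, hp.w, i.map_comp,
        Category.assoc, hv, i.map_comp, Category.assoc]
  choose ι hι hιs using @key
  have uniq : ∀ {A : S.obj} (a : i.obj A ⟶ Y) (h : F.obj A ⟶ Q), X.p.IsHomLift (T.p.map a) h →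
      (∀ {V : S.obj} (v : V ⟶ A) (v' : V ⟶ U), i.map v ≫ a = i.map v' ≫ s →
        F.map v ≫ h = F.map v' ≫ q) → h = ι a := by
    intro A a h hh hv
    obtain ⟨W, w, w', hw, hww⟩ := hi.exists_local_lift hs a
    exact (hF.map_sColl hw).hom_ext (map_eq_map_of_isHomLift hh (hι a))
      (by rw [hv w w' hww, hιs a w w' hww])
  refine ⟨⟨Q, ι, hι, ?_, ?_, ?_⟩⟩
  · intro A B w a
    have l₁ := lft w
    have l₂ := hι a
    refine uniq _ _ (by rw [T.p.map_comp]; infer_instance) (fun {V} v v' hv => ?_)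
    rw [← Category.assoc, ← F.map_comp]
    exact hιs a _ _ (by rw [i.map_comp, Category.assoc, hv])
  -- Lifting `s` locally through the cover `e` exhibits the cover `F w ≫ q` as factoring through `ι
  -- e`.
  · intro B e he
    obtain ⟨W, w, w', hw, hww⟩ := hi.exists_local_lift he s
    have h1 := hιs e w' w hww.symm
    have h2 : SColl X.p (F.map w' ≫ ι e) := by
      rw [h1]
      exact (hF.map_sColl hw).comp hq
    exact h2.of_comp
  · intro M A B m₀ m₁ a b hM
    have nat : ∀ {A B : S.obj} (w : A ⟶ B) (a : i.obj B ⟶ Y),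
        F.map w ≫ ι a = ι (i.map w ≫ a) := by
      intro A B w a
      have l₁ := lft w
      have l₂ := hι a
      refine uniq _ _ (by rw [T.p.map_comp]; infer_instance) (fun {V} v v' hv => ?_)
      rw [← Category.assoc, ← F.map_comp]
      exact hιs a _ _ (by rw [i.map_comp, Category.assoc, hv])
    refine isPullback_of_locally (by rw [nat, nat, hM.w]) (isPullback_map_of_isHomLift
      (map_isPullback (p := T.p) hM) (lft m₀) (lft m₁) (hι a) (hι b))
      (hF.map_jointly_mono (hi.jointly_mono hM)) (fun Z x y hxy => ?_)
    obtain ⟨W, w, w', hw, hww⟩ := hi.exists_local_lift hs a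
    obtain ⟨V, v, v', hv, hvv⟩ := hi.exists_local_lift hs b
    obtain ⟨Z₁, c₁, x', hc₁, hx⟩ := (hF.map_sColl hw).exists_cover x
    obtain ⟨Z₂, c₂, y', hc₂, hy⟩ := (hF.map_sColl hv).exists_cover (c₁ ≫ y)
    obtain ⟨z, hz₀, hz₁⟩ := (hqk (c₂ ≫ x' ≫ F.map w') (y' ≫ F.map v')).1 (by
      simp only [Category.assoc]
      rw [← hιs a w w' hww, ← hιs b v v' hvv, ← reassoc_of% hx, ← reassoc_of% hy, hxy])
    -- The local representatives of `x` and `y`, together with the relation between them, form an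
    -- element of `F` of the limit of `W`, `N` and `V` over `U`. The required arrow to `M` already
    -- exists on this limit in `S`.
    have hp₁ := IsPullback.of_hasPullback w' n₀
    have hp₂ := IsPullback.of_hasPullback (pullback.snd w' n₀ ≫ n₁) v'
    have e₁ : (c₂ ≫ x') ≫ F.map w' = z ≫ F.map n₀ := by rw [hz₀, Category.assoc]
    obtain ⟨g, hg₀, hg₁⟩ : ∃ g, g ≫ F.map (pullback.fst w' n₀) = c₂ ≫ x' ∧
        g ≫ F.map (pullback.snd w' n₀) = z :=
      ⟨(hF.map_isPullback hp₁).lift _ _ e₁, IsPullback.lift_fst _ _ _ _, IsPullback.lift_snd _ _ _ _⟩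
    have e₂ : g ≫ F.map (pullback.snd w' n₀ ≫ n₁) = y' ≫ F.map v' := by
      rw [F.map_comp, ← Category.assoc, hg₁, hz₁]
    obtain ⟨k, hk₀, hk₁⟩ : ∃ k, k ≫ F.map (pullback.fst (pullback.snd w' n₀ ≫ n₁) v') = g ∧
        k ≫ F.map (pullback.snd (pullback.snd w' n₀ ≫ n₁) v') = y' :=
      ⟨(hF.map_isPullback hp₂).lift _ _ e₂, IsPullback.lift_fst _ _ _ _, IsPullback.lift_snd _ _ _ _⟩
    obtain ⟨l, hl₀, hl₁⟩ := hi.exists_lift hM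
      (pullback.fst (pullback.snd w' n₀ ≫ n₁) v' ≫ pullback.fst w' n₀ ≫ w)
      (pullback.snd (pullback.snd w' n₀ ≫ n₁) v' ≫ v) (by
        simp only [i.map_comp, Category.assoc]
        rw [hww, hvv]
        have h1 := congrArg i.map hp₁.w
        have h2 := congrArg i.map hp₂.w
        simp only [i.map_comp] at h1 h2
        rw [← reassoc_of% h2, ← hN.w, reassoc_of% h1])
    refine ⟨Z₂, c₂ ≫ c₁, k ≫ F.map l, hc₂.comp hc₁, ?_, ?_⟩
    · rw [Category.assoc, ← F.map_comp, hl₀, F.map_comp, F.map_comp, reassoc_of% hk₀,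
        reassoc_of% hg₀, Category.assoc, hx]
    · rw [Category.assoc, ← F.map_comp, hl₁, F.map_comp, reassoc_of% hk₁, Category.assoc, hy]

end IsDense
end

/-! ### The extension as a coherent functor -/

section
variable {R : Type u₁} [Category.{v₁} R] [HasFiniteLimits R] {S : BasedCategory.{v₂, u₂} R}
  {T : BasedCategory.{v₃, u₃} R} {X : BasedCategory.{v₄, u₄} R} [IsGeometricPreStack S.p]
  [IsFiberedPretopos T.p] [IsFiberedPretopos X.p]

namespace IsDense
variable {i : S ⥤ᵇ T} (hi : IsDense i) {F : S ⥤ᵇ X} (hF : IsCoherentFunctor F)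
include hi

/-- A chosen realization. -/
noncomputable def real (Y : T.obj) : Realization i F Y := (hi.exists_realization hF Y).some

lemma p_obj_real (Y : T.obj) : X.p.obj (hi.real hF Y).pt = T.p.obj Y := by
  obtain ⟨U, s, -⟩ := hi.exists_cover Y
  have := (hi.real hF Y).isHomLift s
  exact IsHomLift.codomain_eq X.p (T.p.map s) ((hi.real hF Y).ι s)

lemma existsUnique_map {Y Y' : T.obj} (f : Y ⟶ Y') :
    ∃! h : (hi.real hF Y).pt ⟶ (hi.real hF Y').pt, X.p.IsHomLift (T.p.map f) h ∧
      ∀ {A : S.obj} (a : i.obj A ⟶ Y), (hi.real hF Y).ι a ≫ h = (hi.real hF Y').ι (a ≫ f) :=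
  hi.existsUnique_desc hF _ (T.p.map f) (fun a => (hi.real hF Y').ι (a ≫ f))
    (fun a => by rw [← T.p.map_comp]; exact (hi.real hF Y').isHomLift _)
    (fun w a => by rw [(hi.real hF Y').nat, Category.assoc])

/-- The extension of `F` along `i`, on arrows. -/
noncomputable def realMap {Y Y' : T.obj} (f : Y ⟶ Y') :
    (hi.real hF Y).pt ⟶ (hi.real hF Y').pt := (hi.existsUnique_map hF f).choose

lemma realMap_isHomLift {Y Y' : T.obj} (f : Y ⟶ Y') :
    X.p.IsHomLift (T.p.map f) (hi.realMap hF f) := (hi.existsUnique_map hF f).choose_spec.1.1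

lemma ι_realMap {Y Y' : T.obj} (f : Y ⟶ Y') {A : S.obj} (a : i.obj A ⟶ Y) :
    (hi.real hF Y).ι a ≫ hi.realMap hF f = (hi.real hF Y').ι (a ≫ f) :=
  (hi.existsUnique_map hF f).choose_spec.1.2 a

/-- The extension of `F` along `i`. -/
noncomputable def extend : T ⥤ᵇ X where
  obj Y := (hi.real hF Y).pt
  map f := hi.realMap hF f
  map_id Y := ((hi.existsUnique_map hF (𝟙 Y)).choose_spec.2 (𝟙 _)
    ⟨by rw [T.p.map_id]; exact IsHomLift.id (hi.p_obj_real hF Y), fun a => by simp⟩).symm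
  map_comp {Y Y' Y''} f g := ((hi.existsUnique_map hF (f ≫ g)).choose_spec.2
    (hi.realMap hF f ≫ hi.realMap hF g)
    ⟨by
      have h1 := hi.realMap_isHomLift hF f
      have h2 := hi.realMap_isHomLift hF g
      rw [T.p.map_comp]; infer_instance,
    fun a => by rw [← Category.assoc, ι_realMap, ι_realMap, Category.assoc]⟩).symm
  w := CategoryTheory.Functor.ext (fun Y => hi.p_obj_real hF Y) (fun Y Y' f => by
    have h1 := hi.realMap_isHomLift hF f
    exact IsHomLift.fac' X.p (T.p.map f) (hi.realMap hF f))

/-- The universal cocone of the extension. -/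
noncomputable def cocone {Y : T.obj} {A : S.obj} (a : i.obj A ⟶ Y) :
    F.obj A ⟶ (hi.extend hF).obj Y := (hi.real hF Y).ι a

lemma cocone_extend {Y Y' : T.obj} (f : Y ⟶ Y') {A : S.obj} (a : i.obj A ⟶ Y) :
    hi.cocone hF a ≫ (hi.extend hF).map f = hi.cocone hF (a ≫ f) := hi.ι_realMap hF f a

lemma cocone_nat {Y : T.obj} {A B : S.obj} (w : A ⟶ B) (a : i.obj B ⟶ Y) :
    F.map w ≫ hi.cocone hF a = hi.cocone hF (i.map w ≫ a) := (hi.real hF Y).nat w a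

lemma cocone_isHomLift {Y : T.obj} {A : S.obj} (a : i.obj A ⟶ Y) :
    X.p.IsHomLift (T.p.map a) (hi.cocone hF a) := (hi.real hF Y).isHomLift a

lemma cocone_sColl {Y : T.obj} {U : S.obj} {s : i.obj U ⟶ Y} (hs : SColl T.p s) :
    SColl X.p (hi.cocone hF s) := (hi.real hF Y).sColl s hs

lemma cocone_isPullback {Y : T.obj} {M A B : S.obj} {m₀ : M ⟶ A} {m₁ : M ⟶ B} {a : i.obj A ⟶ Y}
    {b : i.obj B ⟶ Y} (h : IsPullback (i.map m₀) (i.map m₁) a b) :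
    IsPullback (F.map m₀) (F.map m₁) (hi.cocone hF a) (hi.cocone hF b) :=
  (hi.real hF Y).isPullback h

/-- The leg at an isomorphism is a cover; it is also a predicate, since the trivial kernel pair of
`a` is carried to the kernel pair of the leg. -/
lemma isIso_cocone {Y : T.obj} {A : S.obj} (a : i.obj A ⟶ Y) [IsIso a] :
    IsIso (hi.cocone hF a) := by
  have h1 : IsPullback (i.map (𝟙 A)) (i.map (𝟙 A)) a a := by
    rw [i.map_id]
    exact IsKernelPair.id_of_mono a
  have h2 := hi.cocone_isPullback hF h1
  rw [F.map_id] at h2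
  have := hi.cocone_isHomLift hF a
  refine (hi.cocone_sColl hF (.of_isIso a)).isIso_of_isPred ⟨IsKernelPair.mono_of_isIso_fst h2, ?_⟩
  rw [IsHomLift.fac' X.p (T.p.map a) (hi.cocone hF a)]
  infer_instance

/-- After a cover the two elements are represented in `F U`. Their agreement in `A` and in `B` makes
them factor through the kernel pairs of `s ≫ a` and of `s ≫ b`. The common part of these is a finite
limit `K` in `S`; over it the assumption on `a` and `b` identifies the two elements in `T`, and the
cocone transports this identity. -/
lemma extend_jointly_mono {Y A B : T.obj} {a : Y ⟶ A} {b : Y ⟶ B}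
    (inj : ∀ ⦃Z : T.obj⦄ (l l' : Z ⟶ Y), l ≫ a = l' ≫ a → l ≫ b = l' ≫ b → l = l')
    (base : ∀ ⦃Z : R⦄ (t t' : Z ⟶ X.p.obj ((hi.extend hF).obj Y)),
      t ≫ X.p.map ((hi.extend hF).map a) = t' ≫ X.p.map ((hi.extend hF).map a) →
      t ≫ X.p.map ((hi.extend hF).map b) = t' ≫ X.p.map ((hi.extend hF).map b) → t = t')
    ⦃Z : X.obj⦄ (x y : Z ⟶ (hi.extend hF).obj Y)
    (ha : x ≫ (hi.extend hF).map a = y ≫ (hi.extend hF).map a)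
    (hb : x ≫ (hi.extend hF).map b = y ≫ (hi.extend hF).map b) : x = y := by
  obtain ⟨U, s, hs⟩ := hi.exists_cover Y
  have hs' := hi.cocone_sColl hF hs
  obtain ⟨Z₁, c₁, x', hc₁, hx⟩ := hs'.exists_cover x
  obtain ⟨Z₂, c₂, y', hc₂, hy⟩ := hs'.exists_cover (c₁ ≫ y)
  obtain ⟨M, m₀, m₁, hM⟩ := hi.exists_isPullback (s ≫ a) (s ≫ a)
  obtain ⟨N, n₀, n₁, hN⟩ := hi.exists_isPullback (s ≫ b) (s ≫ b)
  have eq : ∀ {C : T.obj} (f : Y ⟶ C),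
      x ≫ (hi.extend hF).map f = y ≫ (hi.extend hF).map f →
      (c₂ ≫ x') ≫ hi.cocone hF (s ≫ f) = y' ≫ hi.cocone hF (s ≫ f) := by
    intro C f hf
    rw [← cocone_extend, Category.assoc, ← reassoc_of% hx, ← reassoc_of% hy, hf]
  have hM' := hi.cocone_isPullback hF hM
  have hN' := hi.cocone_isPullback hF hN
  haveI := totalHasFiniteLimits S.p
  have hp := IsPullback.of_hasPullback m₀ n₀
  obtain ⟨g, hg₀, hg₁⟩ : ∃ g, g ≫ F.map m₀ = c₂ ≫ x' ∧ g ≫ F.map m₁ = y' :=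
    ⟨hM'.lift _ _ (eq a ha), IsPullback.lift_fst _ _ _ _, IsPullback.lift_snd _ _ _ _⟩
  obtain ⟨h, hh₀, hh₁⟩ : ∃ g, g ≫ F.map n₀ = c₂ ≫ x' ∧ g ≫ F.map n₁ = y' :=
    ⟨hN'.lift _ _ (eq b hb), IsPullback.lift_fst _ _ _ _, IsPullback.lift_snd _ _ _ _⟩
  obtain ⟨k, hk₀, hk₁⟩ : ∃ k, k ≫ F.map (pullback.fst m₀ n₀) = g ∧
      k ≫ F.map (pullback.snd m₀ n₀) = h :=
    ⟨(hF.map_isPullback hp).lift g h (by rw [hg₀, hh₀]), IsPullback.lift_fst _ _ _ _,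
      IsPullback.lift_snd _ _ _ _⟩
  obtain ⟨K, e, he, hK⟩ := hF.exists_equalizer (pullback.fst m₀ n₀ ≫ m₁) (pullback.snd m₀ n₀ ≫ n₁)
  obtain ⟨l, hl⟩ := hK k (by
    rw [F.map_comp, F.map_comp, reassoc_of% hk₀, reassoc_of% hk₁, hg₁, hh₁])
  have e₂ : i.map (e ≫ pullback.fst m₀ n₀ ≫ m₀) ≫ s =
      i.map (e ≫ pullback.fst m₀ n₀ ≫ m₁) ≫ s := by
    apply inj
    · simp only [i.map_comp, Category.assoc, hM.w]
    · conv_rhs => rw [he]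
      rw [hp.w]
      simp only [i.map_comp, Category.assoc, hN.w]
  refine (hc₂.comp hc₁).hom_ext (base _ _ ?_ ?_) ?_
  · rw [← X.p.map_comp, ha, X.p.map_comp]
  · rw [← X.p.map_comp, hb, X.p.map_comp]
  · have e₃ : F.map (e ≫ pullback.fst m₀ n₀ ≫ m₀) ≫ hi.cocone hF s =
        F.map (e ≫ pullback.fst m₀ n₀ ≫ m₁) ≫ hi.cocone hF s := by
      rw [cocone_nat, e₂, cocone_nat]
    simp only [F.map_comp, Category.assoc] at e₃
    rw [Category.assoc, Category.assoc, hx, hy, ← reassoc_of% hg₀, ← hg₁, ← hk₀, ← hl]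
    simp only [Category.assoc]
    rw [e₃]

/-- Each clause is reduced to the cocone: legs at covers are covers, a fiberwise terminal object is
isomorphic to one in the image of `i`, and elements of a pullback lift locally through a pullback of
covers coming from `S`. -/
theorem isCoherentFunctor_extend : IsCoherentFunctor (hi.extend hF) where
  map_sColl {Y Y' e} he := by
    obtain ⟨U, s, hs⟩ := hi.exists_cover Y
    have := hi.cocone_sColl hF (hs.comp he)
    rw [← cocone_extend] at this
    exact this.of_comp
  map_isOne {Y} hY := by
    have hO : IsOne T.p (i.obj (one S.p (T.p.obj Y))) := hi.coherent.map_isOne (isOne_one _)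
    obtain ⟨y, hy, -⟩ := hY.existsUnique rfl ((i.w_obj _).trans (one_over S.p _)) (𝟙 (T.p.obj Y))
    have hc := (hO.isCart hY y).isStronglyCartesian hy
    haveI : IsIso y := IsStronglyCartesian.isIso_of_base_isIso T.p (𝟙 (T.p.obj Y)) y
    haveI := hi.isIso_cocone hF y
    exact (hF.map_isOne (isOne_one _)).of_isIso (hi.cocone hF y)
  map_isPullback {W A B C a b f g} h := by
    have hb : IsPullback (X.p.map ((hi.extend hF).map a)) (X.p.map ((hi.extend hF).map b))
        (X.p.map ((hi.extend hF).map f)) (X.p.map ((hi.extend hF).map g)) :=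
      isPullback_map_of_isHomLift (map_isPullback (p := T.p) h) (hi.realMap_isHomLift hF a)
        (hi.realMap_isHomLift hF b) (hi.realMap_isHomLift hF f) (hi.realMap_isHomLift hF g)
    refine isPullback_of_locally (by rw [← Functor.map_comp, h.w, Functor.map_comp]) hb
      (hi.extend_jointly_mono hF (fun Z l l' => h.hom_ext) (fun Z t t' => hb.hom_ext))
      (fun Z x y hxy => ?_)
    obtain ⟨U, s, hs⟩ := hi.exists_cover A
    obtain ⟨V, r, hr⟩ := hi.exists_cover B
    obtain ⟨Z₁, c₁, x', hc₁, hx⟩ := (hi.cocone_sColl hF hs).exists_cover x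
    obtain ⟨Z₂, c₂, y', hc₂, hy⟩ := (hi.cocone_sColl hF hr).exists_cover (c₁ ≫ y)
    obtain ⟨M, m₀, m₁, hM⟩ := hi.exists_isPullback (s ≫ f) (r ≫ g)
    have e : (c₂ ≫ x') ≫ hi.cocone hF (s ≫ f) = y' ≫ hi.cocone hF (r ≫ g) := by
      rw [← cocone_extend, ← cocone_extend, Category.assoc, ← reassoc_of% hx, ← reassoc_of% hy, hxy]
    obtain ⟨k, hk₀, hk₁⟩ : ∃ k, k ≫ F.map m₀ = c₂ ≫ x' ∧ k ≫ F.map m₁ = y' :=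
      ⟨(hi.cocone_isPullback hF hM).lift _ _ e, IsPullback.lift_fst _ _ _ _,
        IsPullback.lift_snd _ _ _ _⟩
    have hM' : (i.map m₀ ≫ s) ≫ f = (i.map m₁ ≫ r) ≫ g := by
      rw [Category.assoc, Category.assoc, hM.w]
    refine ⟨Z₂, c₂ ≫ c₁, k ≫ hi.cocone hF (h.lift _ _ hM'), hc₂.comp hc₁, ?_, ?_⟩
    · rw [Category.assoc, cocone_extend, h.lift_fst, ← cocone_nat, reassoc_of% hk₀,
        Category.assoc, hx]
    · rw [Category.assoc, cocone_extend, h.lift_snd, ← cocone_nat, reassoc_of% hk₁,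
        Category.assoc, hy]

/-- The extension of `F` restricts to `F`. -/
noncomputable def extendIso : i ⋙ hi.extend hF ≅ F := by
  refine (BasedNatIso.mkNatIso (𝒳 := S) (𝒴 := X) (F := F) (G := i ⋙ hi.extend hF)
    (NatIso.ofComponents (fun A => @asIso _ _ _ _ (hi.cocone hF (𝟙 (i.obj A)))
      (hi.isIso_cocone hF (𝟙 (i.obj A)))) ?_) ?_).symm
  · intro A B f
    change F.map f ≫ hi.cocone hF (𝟙 (i.obj B)) =
      hi.cocone hF (𝟙 (i.obj A)) ≫ (hi.extend hF).map (i.map f)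
    rw [cocone_extend, cocone_nat, Category.comp_id, Category.id_comp]
  · intro A
    have := hi.cocone_isHomLift hF (𝟙 (i.obj A))
    rw [T.p.map_id] at this
    change X.p.IsHomLift (𝟙 (S.p.obj A)) (hi.cocone hF (𝟙 (i.obj A)))
    rwa [show S.p.obj A = T.p.obj (i.obj A) from (i.w_obj A).symm]

end IsDense

omit [IsFiberedPretopos T.p] [IsFiberedPretopos X.p] [HasFiniteLimits R]
  [IsGeometricPreStack S.p] in
lemma isHomLift_app {F G : S ⥤ᵇ X} (α : F ⟶ G) (A : S.obj) :
    X.p.IsHomLift (𝟙 (S.p.obj A)) (α.toNatTrans.app A) := α.isHomLift' A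

namespace IsDense
variable {i : S ⥤ᵇ T} (hi : IsDense i)
include hi

lemma precomp_injective {F G : T ⥤ᵇ X} (hF : IsCoherentFunctor F) {α β : F ⟶ G}
    (h : ∀ A, α.toNatTrans.app (i.obj A) = β.toNatTrans.app (i.obj A)) : α = β := by
  ext Y
  obtain ⟨U, s, hs⟩ := hi.exists_cover Y
  refine (hF.map_sColl hs).hom_ext (map_eq_map_of_isHomLift (isHomLift_app α Y)
    (isHomLift_app β Y)) ?_
  rw [α.toNatTrans.naturality, β.toNatTrans.naturality, h]

/-- A coherent functor on `T` is a realization of its own restriction (`Realization.ofFunctor`), so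
the components at a general object are obtained by `existsUnique_desc`. -/
lemma precomp_surjective {F G : T ⥤ᵇ X} (hF : IsCoherentFunctor F)
    (α : ∀ A : S.obj, F.obj (i.obj A) ⟶ G.obj (i.obj A))
    (lift : ∀ A, X.p.IsHomLift (𝟙 (T.p.obj (i.obj A))) (α A))
    (nat : ∀ {A B : S.obj} (w : A ⟶ B), F.map (i.map w) ≫ α B = α A ≫ G.map (i.map w)) :
    ∃ β : F ⟶ G, ∀ A, β.toNatTrans.app (i.obj A) = α A := by
  have key : ∀ Y : T.obj, ∃! h : F.obj Y ⟶ G.obj Y, X.p.IsHomLift (𝟙 (T.p.obj Y)) h ∧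
      ∀ {A : S.obj} (a : i.obj A ⟶ Y), F.map a ≫ h = α A ≫ G.map a := by
    intro Y
    refine hi.existsUnique_desc (hi.coherent.comp hF) (Realization.ofFunctor i hF Y)
      (𝟙 (T.p.obj Y)) (fun {A} a => α A ≫ G.map a) (fun {A} a => ?_) (fun {A B} w a => ?_)
    · have h2 : X.p.IsHomLift (T.p.map a) (G.map a) :=
        BasedFunctor.preserves_isHomLift G (T.p.map a) a
      have h1 := lift A
      have h3 : X.p.IsHomLift (𝟙 _ ≫ T.p.map a) (α A ≫ G.map a) := inferInstance
      rw [Category.id_comp] at h3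
      rwa [Category.comp_id]
    · change F.map (i.map w) ≫ α B ≫ G.map a = α A ≫ G.map (i.map w ≫ a)
      rw [← Category.assoc, nat, G.map_comp, Category.assoc]
  choose β hβ hu using key
  refine ⟨{ app := β, naturality := fun Y Y' f => ?_, isHomLift' := fun Y => (hβ Y).1 }, fun A => ?_⟩
  · obtain ⟨U, s, hs⟩ := hi.exists_cover Y
    have i1 := (hβ Y).1
    have i2 := (hβ Y').1
    refine (hF.map_sColl hs).hom_ext ?_ ?_
    · have h1 : X.p.IsHomLift (T.p.map f) (F.map f) := inferInstance
      have h2 : X.p.IsHomLift (T.p.map f) (G.map f) := inferInstance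
      have h3 : X.p.IsHomLift (T.p.map f ≫ 𝟙 _) (F.map f ≫ β Y') := IsHomLift.comp X.p _ _ _ _
      have h4 : X.p.IsHomLift (𝟙 _ ≫ T.p.map f) (β Y ≫ G.map f) := IsHomLift.comp X.p _ _ _ _
      rw [Category.comp_id] at h3
      rw [Category.id_comp] at h4
      exact map_eq_map_of_isHomLift h3 h4
    · rw [← Category.assoc, ← F.map_comp, (hβ Y').2, ← Category.assoc, (hβ Y).2, G.map_comp,
        Category.assoc]
  · have := (hβ (i.obj A)).2 (𝟙 _)
    rw [F.map_id, G.map_id, Category.id_comp, Category.comp_id] at this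
    exact this

end IsDense

lemma IsDense.comp_geometric {i : S ⥤ᵇ T} (hi : IsDense i) (F : T ⥤ᵇ X)
    (hF : IsPretoposFunctor F) : IsGeometricFunctor (i ⋙ F) :=
  (hi.coherent.comp hF.isCoherentFunctor).isGeometricFunctor

end

/-! ### Freeness of dense embeddings -/

section
variable {R : Type u₁} [Category.{v₁} R] [HasFiniteLimits R] {S : BasedCategory.{v₂, u₂} R}
  {T : BasedCategory.{v₃, u₃} R}  [IsGeometricPreStack S.p] [IsFiberedPretopos T.p]

/-- A dense embedding into a fibered pretopos is free. -/
theorem IsDense.isFreePretopos {i : S ⥤ᵇ T} (hi : IsDense i) :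
    IsFreePretopos.{v₁, u₁, v₂, u₂, v₃, u₃, v₄, u₄} i where
  pretopos := inferInstance
  geometric := hi.coherent.isGeometricFunctor
  comp_geometric X hX F hF := hi.comp_geometric F hF
  isEquivalence X hX := {
    faithful := ⟨fun {F G α β} h => ObjectProperty.hom_ext _
      (hi.precomp_injective F.2.isCoherentFunctor (fun A => by
        have := congrArg (fun γ => γ.hom.toNatTrans.app A) h
        exact this))⟩
    full := ⟨fun {F G} α => by
      obtain ⟨β, hβ⟩ := hi.precomp_surjective F.2.isCoherentFunctor (G := G.1)
        (fun A => α.hom.toNatTrans.app A) (fun A => α.hom.isHomLift (i.w_obj A).symm)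
        (fun w => α.hom.toNatTrans.naturality w)
      refine ⟨⟨β⟩, ObjectProperty.hom_ext _ ?_⟩
      apply BasedNatTrans.homCategory.ext
      ext A
      exact hβ A⟩
    essSurj := ⟨fun F => by
      have hF := F.2.isCoherentFunctor
      exact ⟨⟨hi.extend hF, (hi.isCoherentFunctor_extend hF).isPretoposFunctor⟩,
        ⟨(ObjectProperty.isoMk _ (hi.extendIso hF))⟩⟩⟩ }

end

/-! ### Uniqueness of free fibered pretoposes -/

section
variable {R : Type u₁} [Category.{v₁} R] [HasFiniteLimits R] {S : BasedCategory.{v₂, u₂} R}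
  {T₁ : BasedCategory.{v₃, u₃} R} {T₂ : BasedCategory.{v₄, u₄} R}

lemma IsFreePretopos.exists_lift {W₁ : S ⥤ᵇ T₁} {W₂ : S ⥤ᵇ T₂}
    (h₁ : IsFreePretopos.{v₁, u₁, v₂, u₂, v₃, u₃, v₄, u₄} W₁) [IsFiberedPretopos T₂.p]
    (h₂ : IsGeometricFunctor W₂) :
    ∃ K : T₁ ⥤ᵇ T₂, IsPretoposFunctor K ∧ Nonempty (W₁ ⋙ K ≅ W₂) := by
  haveI := h₁.isEquivalence T₂ inferInstance
  let P := precompGeo W₁ T₂ (h₁.comp_geometric T₂ inferInstance)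
  let W : Geo S T₂ := ⟨W₂, h₂⟩
  exact ⟨(P.objPreimage W).1, (P.objPreimage W).2,
    ⟨(ObjectProperty.ι _).mapIso (P.objObjPreimageIso W)⟩⟩

lemma IsFreePretopos.exists_iso {W₁ : S ⥤ᵇ T₁}
    (h₁ : IsFreePretopos.{v₁, u₁, v₂, u₂, v₃, u₃, v₄, u₄} W₁) [IsFiberedPretopos T₂.p]
    {F G : T₁ ⥤ᵇ T₂} (hF : IsPretoposFunctor F) (hG : IsPretoposFunctor G) (e : W₁ ⋙ F ≅ W₁ ⋙ G) :
    Nonempty (F ≅ G) := by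
  haveI := h₁.isEquivalence T₂ inferInstance
  let P := precompGeo W₁ T₂ (h₁.comp_geometric T₂ inferInstance)
  let F' : Pretop T₁ T₂ := ⟨F, hF⟩
  let G' : Pretop T₁ T₂ := ⟨G, hG⟩
  have e' : P.obj F' ≅ P.obj G' := ObjectProperty.isoMk _ e
  exact ⟨(ObjectProperty.ι _).mapIso (P.preimageIso e')⟩

lemma isCoherentFunctor_id (T : BasedCategory.{v₃, u₃} R) : IsCoherentFunctor (BasedFunctor.id T) :=
  ⟨⟨fun h => h, fun h => h⟩, fun h => h⟩

/-- Right whiskering of isomorphisms of functors over `R`. -/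
def whiskerRightIso {F G : S ⥤ᵇ T₁} (e : F ≅ G) (H : T₁ ⥤ᵇ T₂) : F ⋙ H ≅ G ⋙ H where
  hom := BasedCategory.whiskerRight e.hom H
  inv := BasedCategory.whiskerRight e.inv H
  hom_inv_id := by
    apply BasedNatTrans.homCategory.ext
    ext A
    have h : e.hom.toNatTrans.app A ≫ e.inv.toNatTrans.app A = 𝟙 (F.obj A) :=
      congrArg (fun γ : F ⟶ F => γ.toNatTrans.app A) e.hom_inv_id
    exact (H.map_comp _ _).symm.trans ((congrArg H.map h).trans (H.map_id _))
  inv_hom_id := by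
    apply BasedNatTrans.homCategory.ext
    ext A
    have h : e.inv.toNatTrans.app A ≫ e.hom.toNatTrans.app A = 𝟙 (G.obj A) :=
      congrArg (fun γ : G ⟶ G => γ.toNatTrans.app A) e.inv_hom_id
    exact (H.map_comp _ _).symm.trans ((congrArg H.map h).trans (H.map_id _))

/-- Free fibered pretoposes are unique up to equivalence. -/
theorem IsFreePretopos.exists_basedEquiv {W₁ : S ⥤ᵇ T₁} {W₂ : S ⥤ᵇ T₂}
    (h₁ : IsFreePretopos.{v₁, u₁, v₂, u₂, v₃, u₃, v₄, u₄} W₁)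
    (h₁' : IsFreePretopos.{v₁, u₁, v₂, u₂, v₃, u₃, v₃, u₃} W₁)
    (h₂ : IsFreePretopos.{v₁, u₁, v₂, u₂, v₄, u₄, v₃, u₃} W₂)
    (h₂' : IsFreePretopos.{v₁, u₁, v₂, u₂, v₄, u₄, v₄, u₄} W₂) :
    ∃ K : BasedEquiv T₁ T₂, Nonempty (W₁ ⋙ K.functor ≅ W₂) := by
  haveI := h₁.pretopos
  haveI := h₂.pretopos
  obtain ⟨K, hK, ⟨k⟩⟩ := h₁.exists_lift h₂.geometric
  obtain ⟨L, hL, ⟨l⟩⟩ := h₂.exists_lift h₁.geometric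
  have hKL := (hK.isCoherentFunctor.comp hL.isCoherentFunctor).isPretoposFunctor
  have hLK := (hL.isCoherentFunctor.comp hK.isCoherentFunctor).isPretoposFunctor
  -- The identity and `K ⋙ L` restrict to isomorphic functors on `S`. Here the target is `T₁`
  -- itself, whence the second universe instance of freeness.
  obtain ⟨u⟩ := h₁'.exists_iso (isCoherentFunctor_id T₁).isPretoposFunctor hKL
    ((whiskerRightIso k L ≪≫ l).symm : W₁ ≅ (W₁ ⋙ K) ⋙ L)
  obtain ⟨c⟩ := h₂'.exists_iso hLK (isCoherentFunctor_id T₂).isPretoposFunctor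
    (whiskerRightIso l K ≪≫ k : (W₂ ⋙ L) ⋙ K ≅ W₂)
  exact ⟨⟨K, L, u, c⟩, ⟨k⟩⟩

end

/-! ### Recognizing regular categories -/

section
variable {C : Type u₁} [Category.{v₁} C] [HasFiniteLimits C]

/-- A category is regular as soon as it has a class of regular epimorphisms that is stable under
base change and together with the monomorphisms factorizes all arrows; the class then contains all
regular epimorphisms. -/
theorem regular_of_factorization (W : MorphismProperty C) [W.IsStableUnderBaseChange]
    (fac : ∀ ⦃X Y : C⦄ (f : X ⟶ Y), ∃ (M : C) (e : X ⟶ M) (m : M ⟶ Y), W e ∧ Mono m ∧ e ≫ m = f)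
    (hW : ∀ ⦃X Y : C⦄ (e : X ⟶ Y), W e → IsRegularEpi e) :
    Regular C ∧ ∀ ⦃X Y : C⦄ (e : X ⟶ Y), IsRegularEpi e ↔ W e := by
  have h : ∀ ⦃X Y : C⦄ (e : X ⟶ Y), IsRegularEpi e ↔ W e := by
    refine fun X Y e => ⟨fun he => ?_, fun he => hW e he⟩
    obtain ⟨M, q, m, hq, hm, rfl⟩ := fac e
    -- A regular epimorphism is extremal, so the monic part of its factorization is invertible.
    haveI : IsIso m := ExtremalEpi.isIso (q ≫ m) q m rfl
    exact (MorphismProperty.cancel_right_of_respectsIso (P := W) _ _).2 hq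
  have hW' : MorphismProperty.regularEpi C = W := by
    ext X Y e
    exact h e
  refine ⟨⟨fun {X Y Z f g₁ g₂} hk => ?_, by rw [hW']; infer_instance⟩, h⟩
  obtain ⟨M, q, m, hq, hm, rfl⟩ := fac f
  haveI := hW q hq
  -- `q ≫ m` and `q` have the same kernel pair, whose coequalizer is the regular epimorphism `q`.
  have hk' := IsKernelPair.cancel_right_of_mono hk
  exact ⟨⟨_, hk'.toCoequalizer (hW q hq).regularEpi.some⟩⟩

end

/-! ### Internal logic by generalized elements -/

namespace ExDoctrine
variable {E : Type u₂} [Category.{v₂} E] [HasFiniteLimits E] {D : ExDoctrine.{v₂, u₂, w} E}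

/-- Every predicate is the image of an arrow. -/
def Comprehension (D : ExDoctrine.{v₂, u₂, w} E) : Prop :=
  ∀ ⦃A : E⦄ (P : D.Pred A), ∃ (U : E) (f : U ⟶ A), P = D.ex f ⊤

variable (D) in
/-- The generalized element `x` satisfies `P`. -/
def Mem {X A : E} (P : D.Pred A) (x : X ⟶ A) : Prop := ⊤ ≤ D.pull x P

variable (D) in
/-- `e` is surjective in the internal logic. -/
def Cov {X Y : E} (e : Y ⟶ X) : Prop := ⊤ ≤ D.ex e ⊤

variable (D) in
/-- The generalized elements `x` and `y` are related by `ρ`. -/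
def Rel {X A B : E} (ρ : D.Pred (A ⨯ B)) (x : X ⟶ A) (y : X ⟶ B) : Prop := ⊤ ≤ D.sub₂ ρ x y

lemma Mem.comp {X Y A : E} {P : D.Pred A} {x : X ⟶ A} (h : D.Mem P x) (k : Y ⟶ X) :
    D.Mem P (k ≫ x) := by
  rw [Mem, D.pull_comp, ← D.pull_top k]
  exact D.pull_mono k h

lemma mem_inf {X A : E} {P Q : D.Pred A} {x : X ⟶ A} : D.Mem (P ⊓ Q) x ↔ D.Mem P x ∧ D.Mem Q x := by
  rw [Mem, D.pull_inf, le_inf_iff]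
  rfl

lemma mem_sub₂ {X Y A B : E} {ρ : D.Pred (A ⨯ B)} {x : X ⟶ A} {y : X ⟶ B} {k : Y ⟶ X} :
    D.Mem (D.sub₂ ρ x y) k ↔ D.Rel ρ (k ≫ x) (k ≫ y) := by
  rw [Mem, pull_sub₂]
  rfl

lemma mem_top {X A : E} (x : X ⟶ A) : D.Mem ⊤ x := by rw [Mem, D.pull_top]

lemma Mem.of_cov {X Y A : E} {P : D.Pred A} {e : Y ⟶ X} (he : D.Cov e) {x : X ⟶ A}
    (h : D.Mem P (e ≫ x)) : D.Mem P x := by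
  refine le_trans he ?_
  rw [D.ex_le_iff, ← D.pull_comp]
  exact h

lemma Rel.comp {X Y A B : E} {ρ : D.Pred (A ⨯ B)} {x : X ⟶ A} {y : X ⟶ B} (h : D.Rel ρ x y)
    (k : Y ⟶ X) : D.Rel ρ (k ≫ x) (k ≫ y) := by
  rw [Rel, sub₂, ← prod.comp_lift]
  exact Mem.comp h k

lemma Rel.of_cov {X Y A B : E} {ρ : D.Pred (A ⨯ B)} {e : Y ⟶ X} (he : D.Cov e) {x : X ⟶ A}
    {y : X ⟶ B} (h : D.Rel ρ (e ≫ x) (e ≫ y)) : D.Rel ρ x y := by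
  rw [Rel, sub₂, ← prod.comp_lift] at h
  exact Mem.of_cov he h

lemma mem_ex_of_mem {X A B : E} {f : A ⟶ B} {P : D.Pred A} {x : X ⟶ A} (h : D.Mem P x) :
    D.Mem (D.ex f P) (x ≫ f) :=
  le_trans h (D.le_pull_ex f P x)

lemma Cov.of_isSplitEpi {X Y : E} (e : Y ⟶ X) (s : X ⟶ Y) (h : s ≫ e = 𝟙 X) : D.Cov e := by
  have := mem_ex_of_mem (f := e) (mem_top (D := D) s)
  rw [h, Mem, D.pull_id] at this
  exact this

lemma cov_id (X : E) : D.Cov (𝟙 X) := .of_isSplitEpi _ (𝟙 X) (Category.comp_id _)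

lemma Cov.comp {X Y Z : E} {f : X ⟶ Y} {g : Y ⟶ Z} (hf : D.Cov f) (hg : D.Cov g) :
    D.Cov (f ≫ g) := by
  refine le_trans hg ((D.ex_le_iff _ _ _).2 (le_trans hf ((D.ex_le_iff _ _ _).2 ?_)))
  rw [← D.pull_comp]
  exact (D.ex_le_iff _ _ _).1 le_rfl

lemma Cov.of_comp {X Y Z : E} {f : X ⟶ Y} {g : Y ⟶ Z} (h : D.Cov (f ≫ g)) : D.Cov g := by
  refine le_trans h ((D.ex_le_iff _ _ _).2 ?_)
  exact mem_ex_of_mem (mem_top f)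

lemma Cov.of_isPullback {W A B C : E} {a : W ⟶ A} {b : W ⟶ B} {f : A ⟶ C} {g : B ⟶ C}
    (h : IsPullback a b f g) (hf : D.Cov f) : D.Cov b := by
  have := D.beckChevalley h ⊤
  rw [D.pull_top] at this
  rw [Cov, ← this, ← D.pull_top g]
  exact D.pull_mono g hf

lemma Cov.exists_cover {X Y Z : E} {e : Y ⟶ X} (he : D.Cov e) (x : Z ⟶ X) :
    ∃ (Z' : E) (c : Z' ⟶ Z) (y : Z' ⟶ Y), D.Cov c ∧ c ≫ x = y ≫ e :=
  ⟨_, _, _, he.of_isPullback (IsPullback.of_hasPullback e x), pullback.condition.symm⟩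

/-- The Kripke–Joyal reading of the existential quantifier: represent `P` as the image of an arrow
`g` and pull `g ≫ f` back along `y`, using Beck–Chevalley. -/
lemma Comprehension.mem_ex (hD : D.Comprehension) {X A B : E} {f : A ⟶ B} {P : D.Pred A}
    {y : X ⟶ B} : D.Mem (D.ex f P) y ↔
      ∃ (Z : E) (e : Z ⟶ X) (k : Z ⟶ A), D.Cov e ∧ D.Mem P k ∧ e ≫ y = k ≫ f := by
  constructor
  · intro h
    obtain ⟨U, g, rfl⟩ := hD P
    have h1 : D.ex f (D.ex g ⊤) ≤ D.ex (g ≫ f) ⊤ := by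
      rw [D.ex_le_iff, D.ex_le_iff, ← D.pull_comp]
      exact (D.ex_le_iff _ _ _).1 le_rfl
    have h2 : D.Mem (D.ex (g ≫ f) ⊤) y := le_trans h (D.pull_mono y h1)
    rw [Mem, D.beckChevalley (IsPullback.of_hasPullback (g ≫ f) y), D.pull_top] at h2
    refine ⟨_, pullback.snd (g ≫ f) y, pullback.fst (g ≫ f) y ≫ g, h2, ?_, ?_⟩
    · exact mem_ex_of_mem (mem_top _)
    · rw [← pullback.condition, Category.assoc]
  · rintro ⟨Z, e, k, he, hk, h⟩
    refine Mem.of_cov he ?_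
    rw [h]
    exact mem_ex_of_mem hk

/-- A predicate is the image of some arrow `f`, so an inequality holds as soon as it holds at the
generic element `f`. This licenses arguing with elements from here on. -/
lemma Comprehension.le_iff (hD : D.Comprehension) {A : E} {P Q : D.Pred A} :
    P ≤ Q ↔ ∀ ⦃X : E⦄ (x : X ⟶ A), D.Mem P x → D.Mem Q x := by
  constructor
  · exact fun h X x hx => le_trans hx (D.pull_mono x h)
  · intro h
    obtain ⟨U, f, rfl⟩ := hD P
    rw [D.ex_le_iff]
    have := mem_ex_of_mem (f := f) (mem_top (D := D) (𝟙 U))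
    rw [Category.id_comp] at this
    exact h f this

/-- Equality is the image of the diagonal, so in the logic elements are equal when they are so after
a cover. -/
lemma Comprehension.rel_eq (hD : D.Comprehension) {A X : E} {x y : X ⟶ A} :
    D.Rel (D.eq A) x y ↔ ∃ (Z : E) (e : Z ⟶ X), D.Cov e ∧ e ≫ x = e ≫ y := by
  rw [Rel, sub₂]
  refine (hD.mem_ex (f := diag A)).trans ⟨?_, ?_⟩
  · rintro ⟨Z, e, k, he, -, h⟩
    have h1 := congrArg (· ≫ prod.fst) h
    have h2 := congrArg (· ≫ prod.snd) h
    simp only [Category.assoc, prod.lift_fst, prod.lift_snd] at h1 h2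
    exact ⟨Z, e, he, h1.trans h2.symm⟩
  · rintro ⟨Z, e, he, h⟩
    exact ⟨Z, e, e ≫ x, he, mem_top _, by rw [prod.comp_lift, h, prod.comp_diag]⟩

namespace EqObj

/-- Equality of generalized elements of an object with an equivalence relation. -/
def Eqv (A : D.EqObj) {X : E} (x y : X ⟶ A.obj) : Prop := D.Rel A.rel x y

variable {A : D.EqObj} {X : E}

lemma Eqv.refl (x : X ⟶ A.obj) : A.Eqv x x := A.refl x

lemma Eqv.of_eq {x y : X ⟶ A.obj} (h : x = y) : A.Eqv x y := h ▸ Eqv.refl x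

lemma Eqv.symm {x y : X ⟶ A.obj} (h : A.Eqv x y) : A.Eqv y x := le_trans h (A.symm x y)

lemma Eqv.trans {x y z : X ⟶ A.obj} (h : A.Eqv x y) (h' : A.Eqv y z) : A.Eqv x z :=
  le_trans (le_inf h h') (A.trans x y z)

lemma Eqv.comp {Y : E} {x y : X ⟶ A.obj} (h : A.Eqv x y) (k : Y ⟶ X) : A.Eqv (k ≫ x) (k ≫ y) :=
  Rel.comp h k

lemma Eqv.of_cov {Y : E} {e : Y ⟶ X} (he : D.Cov e) {x y : X ⟶ A.obj}
    (h : A.Eqv (e ≫ x) (e ≫ y)) : A.Eqv x y := Rel.of_cov he h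

/-- Equivalence relations, elementwise. -/
def ofRel (hD : D.Comprehension) (A : E) (ρ : D.Pred (A ⨯ A))
    (refl : ∀ ⦃X : E⦄ (x : X ⟶ A), D.Rel ρ x x)
    (symm : ∀ ⦃X : E⦄ (x y : X ⟶ A), D.Rel ρ x y → D.Rel ρ y x)
    (trans : ∀ ⦃X : E⦄ (x y z : X ⟶ A), D.Rel ρ x y → D.Rel ρ y z → D.Rel ρ x z) : D.EqObj where
  obj := A
  rel := ρ
  refl x := refl x
  symm _ _ := hD.le_iff.2 fun _ _ h => mem_sub₂.2 (symm _ _ (mem_sub₂.1 h))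
  trans _ _ _ := hD.le_iff.2 fun _ _ h =>
    mem_sub₂.2 (trans _ _ _ (mem_sub₂.1 (mem_inf.1 h).1) (mem_sub₂.1 (mem_inf.1 h).2))

end EqObj

/-- `φ` takes the generalized element `x` to `y`. -/
def App {A B : D.EqObj} (φ : A ⟶ B) {X : E} (x : X ⟶ A.obj) (y : X ⟶ B.obj) : Prop :=
  D.Rel (EqHom.rel φ) x y

section
variable {A B C : D.EqObj} {X : E}

lemma App.comp {φ : A ⟶ B} {x : X ⟶ A.obj} {y : X ⟶ B.obj} (h : App φ x y) {Y : E} (k : Y ⟶ X) :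
    App φ (k ≫ x) (k ≫ y) := Rel.comp h k

lemma App.of_cov {φ : A ⟶ B} {Y : E} {e : Y ⟶ X} (he : D.Cov e) {x : X ⟶ A.obj} {y : X ⟶ B.obj}
    (h : App φ (e ≫ x) (e ≫ y)) : App φ x y := Rel.of_cov he h

lemma App.cong {φ : A ⟶ B} {x x' : X ⟶ A.obj} {y y' : X ⟶ B.obj} (h : App φ x y)
    (hx : A.Eqv x x') (hy : B.Eqv y y') : App φ x' y' :=
  le_trans (le_inf (le_inf hx h) hy) (EqHom.cong φ x x' y y')

lemma App.eqv {φ : A ⟶ B} {x : X ⟶ A.obj} {y y' : X ⟶ B.obj} (h : App φ x y) (h' : App φ x y') :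
    B.Eqv y y' :=
  le_trans (le_inf h h') (EqHom.singval φ x y y')

lemma Comprehension.exists_app (hD : D.Comprehension) (φ : A ⟶ B) (x : X ⟶ A.obj) :
    ∃ (Z : E) (e : Z ⟶ X) (y : Z ⟶ B.obj), D.Cov e ∧ App φ (e ≫ x) y := by
  have h : D.Mem (D.ex prod.fst (EqHom.rel φ)) x := by
    rw [Mem, ← D.pull_top x]
    exact D.pull_mono x (EqHom.tot φ)
  obtain ⟨Z, e, k, he, hk, h'⟩ := hD.mem_ex.1 h
  refine ⟨Z, e, k ≫ prod.snd, he, ?_⟩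
  rw [App, Rel, sub₂, h', ← prod.comp_lift, prod.lift_fst_snd, Category.comp_id]
  exact hk

lemma app_id {x y : X ⟶ A.obj} : App (𝟙 A) x y ↔ A.Eqv x y := Iff.rfl

lemma App.trans {φ : A ⟶ B} {γ : B ⟶ C} {x : X ⟶ A.obj} {y : X ⟶ B.obj} {z : X ⟶ C.obj}
    (h : App φ x y) (h' : App γ y z) : App (φ ≫ γ) x z :=
  le_trans (le_inf h h') (le_relComp (EqHom.rel φ) (EqHom.rel γ) x y z)

/-- Totality of both relations gives an intermediate value and a final value after a cover;
single-valuedness of the composite identifies the final value with `z`. -/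
lemma Comprehension.app_comp (hD : D.Comprehension) {φ : A ⟶ B} {γ : B ⟶ C} {x : X ⟶ A.obj}
    {z : X ⟶ C.obj} (h : App (φ ≫ γ) x z) :
    ∃ (Z : E) (e : Z ⟶ X) (y : Z ⟶ B.obj), D.Cov e ∧ App φ (e ≫ x) y ∧ App γ y (e ≫ z) := by
  obtain ⟨Z, e, y, he, hy⟩ := hD.exists_app φ x
  obtain ⟨Z', e', z', he', hz⟩ := hD.exists_app γ y
  have h1 : App (φ ≫ γ) ((e' ≫ e) ≫ x) z' := by
    rw [Category.assoc]
    exact (hy.comp e').trans hz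
  refine ⟨Z', e' ≫ e, e' ≫ y, he'.comp he, ?_, hz.cong (.refl _) (h1.eqv (h.comp _))⟩
  rw [Category.assoc]
  exact hy.comp e'

/-- Given the image of an element under `φ`, its images under `φ ≫ γ` are the images of its image
under `γ`. -/
lemma App.of_comp (hD : D.Comprehension) {φ : A ⟶ B} {γ : B ⟶ C} {x : X ⟶ A.obj} {y : X ⟶ B.obj}
    {z : X ⟶ C.obj} (h : App φ x y) (h' : App (φ ≫ γ) x z) : App γ y z := by
  obtain ⟨Z, e, y', he, h1, h2⟩ := hD.app_comp h'
  exact App.of_cov he (h2.cong (h1.eqv (h.comp e)) (.refl _))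

/-- One inclusion suffices: a total relation contained in a single-valued one is equal to it. -/
lemma Comprehension.hom_ext (hD : D.Comprehension) {φ ψ : A ⟶ B}
    (h : ∀ ⦃X : E⦄ (x : X ⟶ A.obj) (y : X ⟶ B.obj), App φ x y → App ψ x y) : φ = ψ := by
  have key : ∀ {φ ψ : A ⟶ B}, (∀ ⦃X : E⦄ (x : X ⟶ A.obj) (y : X ⟶ B.obj), App φ x y → App ψ x y) →
      EqHom.rel φ ≤ EqHom.rel ψ := by
    intro φ ψ h
    refine D.sub₂_le fun X x y => hD.le_iff.2 fun Y k hk => mem_sub₂.2 (h _ _ (mem_sub₂.1 hk))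
  refine EqHom.ext (le_antisymm (key h) (key fun X x y hxy => ?_))
  obtain ⟨Z, e, y', he, hy⟩ := hD.exists_app φ x
  exact App.of_cov he (hy.cong (.refl _) ((h _ _ hy).eqv (hxy.comp e)))

/-- Functional relations, elementwise. -/
def homOfRel (hD : D.Comprehension) (ρ : D.Pred (A.obj ⨯ B.obj))
    (cong : ∀ ⦃X : E⦄ (x x' : X ⟶ A.obj) (y y' : X ⟶ B.obj), A.Eqv x x' → D.Rel ρ x y →
      B.Eqv y y' → D.Rel ρ x' y')
    (singval : ∀ ⦃X : E⦄ (x : X ⟶ A.obj) (y y' : X ⟶ B.obj), D.Rel ρ x y → D.Rel ρ x y' →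
      B.Eqv y y')
    (tot : ∀ ⦃X : E⦄ (x : X ⟶ A.obj), ∃ (Z : E) (e : Z ⟶ X) (y : Z ⟶ B.obj), D.Cov e ∧
      D.Rel ρ (e ≫ x) y) : A ⟶ B where
  rel := ρ
  cong _ _ _ _ := hD.le_iff.2 fun _ _ h => mem_sub₂.2
    (cong _ _ _ _ (mem_sub₂.1 (mem_inf.1 (mem_inf.1 h).1).1)
      (mem_sub₂.1 (mem_inf.1 (mem_inf.1 h).1).2) (mem_sub₂.1 (mem_inf.1 h).2))
  singval _ _ _ := hD.le_iff.2 fun _ _ h => mem_sub₂.2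
    (singval _ _ _ (mem_sub₂.1 (mem_inf.1 h).1) (mem_sub₂.1 (mem_inf.1 h).2))
  tot := by
    obtain ⟨Z, e, y, he, h⟩ := tot (𝟙 A.obj)
    refine le_trans he ((D.ex_le_iff _ _ _).2 ?_)
    have := mem_ex_of_mem (D := D) (f := (prod.fst : A.obj ⨯ B.obj ⟶ A.obj)) h
    rwa [prod.lift_fst, Category.comp_id] at this

/-- A predicate on `A ⨯ B` described elementwise by an arrow; used to define functional relations
by formulas. -/
lemma rel_ofArrow (hD : D.Comprehension) {A B U : E} (f : U ⟶ A) (g : U ⟶ B) {x : X ⟶ A}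
    {y : X ⟶ B} : D.Rel (D.ex (prod.lift f g) ⊤) x y ↔
      ∃ (Z : E) (e : Z ⟶ X) (u : Z ⟶ U), D.Cov e ∧ e ≫ x = u ≫ f ∧ e ≫ y = u ≫ g := by
  rw [Rel, sub₂]
  refine (hD.mem_ex (f := prod.lift f g)).trans ⟨?_, ?_⟩
  · rintro ⟨Z, e, k, he, -, h⟩
    have h1 := congrArg (· ≫ prod.fst) h
    have h2 := congrArg (· ≫ prod.snd) h
    simp only [Category.assoc, prod.lift_fst, prod.lift_snd] at h1 h2
    exact ⟨Z, e, k, he, h1, h2⟩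
  · rintro ⟨Z, e, k, he, h1, h2⟩
    exact ⟨Z, e, k, he, mem_top _, by rw [prod.comp_lift, prod.comp_lift, h1, h2]⟩

end

end ExDoctrine

/-! ### Exactness of the category of equivalence relations -/

namespace ExDoctrine
variable {E : Type u₂} [Category.{v₂} E] [HasFiniteLimits E] {D : ExDoctrine.{v₂, u₂, w} E}

/-- The opposite relation. -/
noncomputable def relSwap {A B : E} (ρ : D.Pred (A ⨯ B)) : D.Pred (B ⨯ A) :=
  D.sub₂ ρ prod.snd prod.fst

lemma rel_relSwap {X A B : E} {ρ : D.Pred (A ⨯ B)} {x : X ⟶ A} {y : X ⟶ B} :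
    D.Rel (relSwap ρ) y x ↔ D.Rel ρ x y := by
  rw [Rel, sub₂, relSwap]
  refine mem_sub₂.trans ?_
  rw [prod.lift_fst, prod.lift_snd]

lemma rel_relComp (hD : D.Comprehension) {X A B C : E} {φ : D.Pred (A ⨯ B)} {γ : D.Pred (B ⨯ C)}
    {x : X ⟶ A} {z : X ⟶ C} : D.Rel (relComp φ γ) x z ↔
      ∃ (Z : E) (e : Z ⟶ X) (y : Z ⟶ B), D.Cov e ∧ D.Rel φ (e ≫ x) y ∧ D.Rel γ y (e ≫ z) := by
  constructor
  · intro h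
    rw [Rel, sub₂] at h
    obtain ⟨Z, e, k, he, hk, h'⟩ := (hD.mem_ex (f := (prod.fst : (A ⨯ C) ⨯ B ⟶ A ⨯ C))).1 h
    have h1 := congrArg (· ≫ prod.fst) h'
    have h2 := congrArg (· ≫ prod.snd) h'
    simp only [Category.assoc, prod.lift_fst, prod.lift_snd] at h1 h2
    obtain ⟨hk₁, hk₂⟩ := mem_inf.1 hk
    rw [mem_sub₂, ← h1] at hk₁
    rw [mem_sub₂, ← h2] at hk₂
    exact ⟨Z, e, k ≫ prod.snd, he, hk₁, hk₂⟩
  · rintro ⟨Z, e, y, he, h1, h2⟩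
    exact Rel.of_cov he (le_trans (le_inf h1 h2) (le_relComp φ γ _ y _))

lemma rel_inf {X A B : E} {ρ σ : D.Pred (A ⨯ B)} {x : X ⟶ A} {y : X ⟶ B} :
    D.Rel (ρ ⊓ σ) x y ↔ D.Rel ρ x y ∧ D.Rel σ x y := mem_inf

variable {A B C : D.EqObj}

/-- The functional relation given by an arrow respecting the equivalence relations. -/
noncomputable def ofArrow (hD : D.Comprehension) (f : A.obj ⟶ B.obj)
    (hf : ∀ ⦃X : E⦄ (x x' : X ⟶ A.obj), A.Eqv x x' → B.Eqv (x ≫ f) (x' ≫ f)) : A ⟶ B :=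
  homOfRel hD (D.sub₂ B.rel (prod.fst ≫ f) prod.snd)
    (fun X x x' y y' hx h hy => by
      have h' := mem_sub₂.1 h
      rw [← Category.assoc, prod.lift_fst, prod.lift_snd] at h'
      refine mem_sub₂.2 ?_
      rw [← Category.assoc, prod.lift_fst, prod.lift_snd]
      exact ((hf _ _ hx).symm.trans h').trans hy)
    (fun X x y y' h h' => by
      have h := mem_sub₂.1 h
      have h' := mem_sub₂.1 h'
      rw [← Category.assoc, prod.lift_fst, prod.lift_snd] at h h'
      exact EqObj.Eqv.trans (EqObj.Eqv.symm h) h')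
    (fun X x => ⟨X, 𝟙 X, x ≫ f, cov_id X, mem_sub₂.2 (by
      rw [← Category.assoc, prod.lift_fst, prod.lift_snd, Category.id_comp]
      exact EqObj.Eqv.refl _)⟩)

lemma app_ofArrow (hD : D.Comprehension) {f : A.obj ⟶ B.obj}
    {hf : ∀ ⦃X : E⦄ (x x' : X ⟶ A.obj), A.Eqv x x' → B.Eqv (x ≫ f) (x' ≫ f)} {X : E}
    {x : X ⟶ A.obj} {y : X ⟶ B.obj} : App (ofArrow hD f hf) x y ↔ B.Eqv (x ≫ f) y := by
  refine mem_sub₂.trans ?_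
  rw [← Category.assoc, prod.lift_fst, prod.lift_snd]
  rfl

lemma eqv_eqObj (hD : D.Comprehension) {A X : E} {x y : X ⟶ A} :
    (D.eqObj A).Eqv x y ↔ ∃ (Z : E) (e : Z ⟶ X), D.Cov e ∧ e ≫ x = e ≫ y := hD.rel_eq

lemma app_graph {A B X : E} {f : A ⟶ B} {x : X ⟶ A} {y : X ⟶ B} :
    App (D.graphFunctor.map f) x y ↔ (D.eqObj B).Eqv (x ≫ f) y := by
  change ⊤ ≤ D.sub₂ (D.graphRel f) x y ↔ _
  rw [sub₂_graphRel]
  rfl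

/-- A generalized element as an arrow. -/
noncomputable def elt (hD : D.Comprehension) {X : E} (x : X ⟶ A.obj) : D.eqObj X ⟶ A :=
  ofArrow (A := D.eqObj X) hD x (fun Y k l h => by
    obtain ⟨Z, e, he, h'⟩ := (eqv_eqObj hD).1 h
    refine EqObj.Eqv.of_cov he (.of_eq ?_)
    have h' : e ≫ k = e ≫ l := h'
    exact (Category.assoc _ _ _).symm.trans ((congrArg (· ≫ x) h').trans (Category.assoc _ _ _)))

lemma app_elt (hD : D.Comprehension) {X Y : E} {x : X ⟶ A.obj} {k : Y ⟶ X} {y : Y ⟶ A.obj} :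
    App (elt hD x) k y ↔ A.Eqv (k ≫ x) y := app_ofArrow (A := D.eqObj X) hD

/-- Applying `φ` to elements is composition with arrows out of discrete objects. This translates
between universal properties in the category and statements about elements. -/
lemma elt_comp_eq_elt_iff (hD : D.Comprehension) {X : E} {φ : A ⟶ B} {x : X ⟶ A.obj}
    {y : X ⟶ B.obj} : elt hD x ≫ φ = elt hD y ↔ App φ x y := by
  constructor
  · intro h
    have h1 : App (elt hD x) (𝟙 X) x := (app_elt hD).2 (.of_eq (Category.id_comp x))
    have h2 : App (elt hD x ≫ φ) (𝟙 X) y := by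
      rw [h]
      exact (app_elt hD).2 (.of_eq (Category.id_comp y))
    exact h1.of_comp hD h2
  · intro h
    refine hD.hom_ext fun Y k z hz => ?_
    have h1 : App (elt hD x) k (k ≫ x) := (app_elt hD).2 (.refl _)
    have h2 : App φ (k ≫ x) (k ≫ y) := h.comp k
    exact (app_elt hD).2 (h2.eqv (h1.of_comp hD hz))

lemma elt_eq_elt_iff (hD : D.Comprehension) {X : E} {x y : X ⟶ A.obj} :
    elt hD x = elt hD y ↔ A.Eqv x y := by
  rw [← app_id, ← elt_comp_eq_elt_iff hD, Category.comp_id]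

/-- An arrow out of a discrete object is total only in the logic, so it becomes an element after a
cover on which a value exists. -/
lemma exists_eq_elt (hD : D.Comprehension) {X : E} (φ : D.eqObj X ⟶ A) :
    ∃ (Z : E) (e : Z ⟶ X) (y : Z ⟶ A.obj), D.Cov e ∧ D.graphFunctor.map e ≫ φ = elt hD y := by
  obtain ⟨Z, e, y, he, h⟩ := hD.exists_app φ (𝟙 X)
  have h : App φ e y := by
    have h' : (e ≫ 𝟙 X : Z ⟶ X) = e := Category.comp_id e
    exact (congrArg (fun t : Z ⟶ X => App (A := D.eqObj X) φ t y) h').mp h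
  refine ⟨Z, e, y, he, hD.hom_ext fun Y k z hz => (app_elt hD).2 ?_⟩
  exact (h.comp k).eqv (App.of_comp hD (app_graph.2 (.refl _)) hz)

/-- Injectivity in the internal logic. -/
def Inj (φ : A ⟶ B) : Prop :=
  ∀ ⦃X : E⦄ (x x' : X ⟶ A.obj) (y : X ⟶ B.obj), App φ x y → App φ x' y → A.Eqv x x'

/-- Surjectivity in the internal logic. -/
def Surj (φ : A ⟶ B) : Prop :=
  ∀ ⦃X : E⦄ (y : X ⟶ B.obj), ∃ (Z : E) (e : Z ⟶ X) (x : Z ⟶ A.obj), D.Cov e ∧ App φ x (e ≫ y)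

lemma Inj.mono (hD : D.Comprehension) {φ : A ⟶ B} (h : Inj φ) : Mono φ := by
  refine ⟨fun {Z} α β hαβ => hD.hom_ext fun X x y hx => ?_⟩
  obtain ⟨X₁, e₁, y', he₁, hy'⟩ := hD.exists_app β x
  obtain ⟨X₂, e₂, z, he₂, hz⟩ := hD.exists_app φ (e₁ ≫ y)
  have h1 : App (β ≫ φ) (e₂ ≫ e₁ ≫ x) z := by
    rw [← hαβ]
    exact ((hx.comp e₁).comp e₂).trans hz
  have h2 := (hy'.comp e₂).of_comp hD h1
  refine App.of_cov (he₂.comp he₁) ?_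
  rw [Category.assoc, Category.assoc]
  exact (hy'.comp e₂).cong (.refl _) (h _ _ _ h2 hz)

lemma Surj.epi (hD : D.Comprehension) {φ : A ⟶ B} (h : Surj φ) : Epi φ := by
  refine ⟨fun {Z} α β hαβ => hD.hom_ext fun X y z hz => ?_⟩
  obtain ⟨X₁, e₁, x, he₁, hx⟩ := h y
  have h1 : App (φ ≫ β) x (e₁ ≫ z) := by
    rw [← hαβ]
    exact hx.trans (hz.comp e₁)
  exact App.of_cov he₁ (hx.of_comp hD h1)

/-- The descended relation takes `y` to `z` when some local preimage of `y` has value `z`; the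
hypothesis makes it single-valued. -/
lemma Surj.exists_desc (hD : D.Comprehension) {φ : A ⟶ B} (h : Surj φ) (g : A ⟶ C)
    (H : ∀ ⦃X : E⦄ (x x' : X ⟶ A.obj) (y : X ⟶ B.obj) (z : X ⟶ C.obj), App φ x y → App φ x' y →
      App g x z → App g x' z) : ∃ k : B ⟶ C, φ ≫ k = g := by
  let ρ := relComp (relSwap (EqHom.rel φ)) (EqHom.rel g)
  have hρ : ∀ {X : E} {y : X ⟶ B.obj} {z : X ⟶ C.obj}, D.Rel ρ y z ↔
      ∃ (Z : E) (e : Z ⟶ X) (x : Z ⟶ A.obj), D.Cov e ∧ App φ x (e ≫ y) ∧ App g x (e ≫ z) := by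
    intro X y z
    refine (rel_relComp hD).trans ?_
    simp only [rel_relSwap]
    rfl
  refine ⟨homOfRel hD ρ ?_ ?_ ?_, hD.hom_ext fun X x z hz => ?_⟩
  · intro X y y' z z' hy hz hz'
    obtain ⟨X₁, e₁, x, he₁, h1, h2⟩ := hρ.1 hz
    exact hρ.2 ⟨X₁, e₁, x, he₁, h1.cong (.refl _) (hy.comp _), h2.cong (.refl _) (hz'.comp _)⟩
  · intro X y z z' hz hz'
    obtain ⟨X₁, e₁, x, he₁, h1, h2⟩ := hρ.1 hz
    obtain ⟨X₂, e₂, x', he₂, h1', h2'⟩ := hρ.1 (Rel.comp hz' e₁)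
    refine EqObj.Eqv.of_cov (he₂.comp he₁) ?_
    rw [Category.assoc, Category.assoc]
    exact (H _ _ _ _ (h1.comp e₂) h1' (h2.comp e₂)).eqv h2'
  · intro X y
    obtain ⟨X₁, e₁, x, he₁, hx⟩ := h y
    obtain ⟨X₂, e₂, z, he₂, hz⟩ := hD.exists_app g x
    refine ⟨X₂, e₂ ≫ e₁, z, he₂.comp he₁, hρ.2 ⟨X₂, 𝟙 _, e₂ ≫ x, cov_id _, ?_, ?_⟩⟩
    · rw [Category.id_comp, Category.assoc]
      exact hx.comp e₂
    · rwa [Category.id_comp]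
  · obtain ⟨X₁, e₁, y, he₁, hy, hz'⟩ := hD.app_comp hz
    obtain ⟨X₂, e₂, x', he₂, h1, h2⟩ := hρ.1 hz'
    refine App.of_cov (he₂.comp he₁) ?_
    rw [Category.assoc, Category.assoc]
    exact H _ _ _ _ h1 (hy.comp e₂) h2

/-- Pullbacks of functional relations, elementwise. -/
theorem isPullback_of_app (hD : D.Comprehension) {W : D.EqObj} {a : W ⟶ A} {b : W ⟶ B} {f : A ⟶ C}
    {g : B ⟶ C} (w : a ≫ f = b ≫ g)
    (inj : ∀ ⦃X : E⦄ (u v : X ⟶ W.obj) (x : X ⟶ A.obj) (y : X ⟶ B.obj), App a u x → App a v x →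
      App b u y → App b v y → W.Eqv u v)
    (H : ∀ ⦃X : E⦄ (x : X ⟶ A.obj) (y : X ⟶ B.obj) (z : X ⟶ C.obj), App f x z → App g y z →
      ∃ (Z : E) (e : Z ⟶ X) (u : Z ⟶ W.obj), D.Cov e ∧ App a u (e ≫ x) ∧ App b u (e ≫ y)) :
    IsPullback a b f g := by
  refine isPullback_of_existsUnique w (fun P α β hαβ => ?_) (fun P l l' ha hb => ?_)
  -- The induced arrow takes `p` to those `u` whose projections are the values of `α` and `β` at
  -- `p`.
  · let ρ := relComp (EqHom.rel α) (relSwap (EqHom.rel a)) ⊓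
      relComp (EqHom.rel β) (relSwap (EqHom.rel b))
    have hρ : ∀ {X : E} {p : X ⟶ P.obj} {u : X ⟶ W.obj}, D.Rel ρ p u ↔
        (∃ (Z : E) (e : Z ⟶ X) (x : Z ⟶ A.obj), D.Cov e ∧ App α (e ≫ p) x ∧ App a (e ≫ u) x) ∧
        ∃ (Z : E) (e : Z ⟶ X) (y : Z ⟶ B.obj), D.Cov e ∧ App β (e ≫ p) y ∧ App b (e ≫ u) y := by
      intro X p u
      refine rel_inf.trans (and_congr ((rel_relComp hD).trans ?_) ((rel_relComp hD).trans ?_)) <;>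
      · simp only [rel_relSwap]
        rfl
    refine ⟨homOfRel hD ρ ?_ ?_ ?_, ?_, ?_⟩
    · intro X p p' u u' hp h hu
      obtain ⟨⟨X₁, e₁, x, he₁, h1, h2⟩, X₂, e₂, y, he₂, h3, h4⟩ := hρ.1 h
      exact hρ.2 ⟨⟨X₁, e₁, x, he₁, h1.cong (hp.comp _) (.refl _), h2.cong (hu.comp _) (.refl _)⟩,
        X₂, e₂, y, he₂, h3.cong (hp.comp _) (.refl _), h4.cong (hu.comp _) (.refl _)⟩
    · intro X p u u' h h'
      obtain ⟨⟨X₁, e₁, x, he₁, h1, h2⟩, -⟩ := hρ.1 h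
      obtain ⟨-, X₂, e₂, y, he₂, h3, h4⟩ := hρ.1 (Rel.comp h e₁)
      obtain ⟨⟨X₃, e₃, x', he₃, h1', h2'⟩, -⟩ := hρ.1 (Rel.comp h' (e₂ ≫ e₁))
      obtain ⟨-, X₄, e₄, y', he₄, h3', h4'⟩ := hρ.1 (Rel.comp h' (e₃ ≫ e₂ ≫ e₁))
      refine EqObj.Eqv.of_cov (he₄.comp (he₃.comp (he₂.comp he₁))) ?_
      have hx := (h1'.comp e₄).eqv (y' := (e₄ ≫ e₃ ≫ e₂) ≫ x) (by
        have := h1.comp (e₄ ≫ e₃ ≫ e₂)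
        simpa only [Category.assoc] using this)
      have hy := h3'.eqv (y' := (e₄ ≫ e₃) ≫ y) (by
        have := h3.comp (e₄ ≫ e₃)
        simpa only [Category.assoc] using this)
      refine inj _ _ _ _ (?_ : App a _ ((e₄ ≫ e₃ ≫ e₂) ≫ x)) ?_
        (?_ : App b _ ((e₄ ≫ e₃) ≫ y)) ?_
      · simpa only [Category.assoc] using h2.comp (e₄ ≫ e₃ ≫ e₂)
      · simpa only [Category.assoc] using (h2'.comp e₄).cong (.refl _) hx
      · simpa only [Category.assoc] using h4.comp (e₄ ≫ e₃)
      · simpa only [Category.assoc] using h4'.cong (.refl _) hy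
    · intro X p
      obtain ⟨X₁, e₁, x, he₁, hx⟩ := hD.exists_app α p
      obtain ⟨X₂, e₂, y, he₂, hy⟩ := hD.exists_app β (e₁ ≫ p)
      obtain ⟨X₃, e₃, z, he₃, hz⟩ := hD.exists_app g y
      have hx' : App α (e₃ ≫ e₂ ≫ e₁ ≫ p) (e₃ ≫ e₂ ≫ x) := (hx.comp e₂).comp e₃
      have hc : App (α ≫ f) (e₃ ≫ e₂ ≫ e₁ ≫ p) z := by
        rw [hαβ]
        exact (hy.comp e₃).trans hz
      obtain ⟨X₄, e₄, u, he₄, h1, h2⟩ := H _ _ _ (hx'.of_comp hD hc) hz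
      refine ⟨X₄, e₄ ≫ e₃ ≫ e₂ ≫ e₁, u, he₄.comp (he₃.comp (he₂.comp he₁)), hρ.2
        ⟨⟨X₄, 𝟙 _, e₄ ≫ e₃ ≫ e₂ ≫ x, cov_id _, ?_, by rwa [Category.id_comp]⟩,
          X₄, 𝟙 _, e₄ ≫ e₃ ≫ y, cov_id _, ?_, by rwa [Category.id_comp]⟩⟩
      · simpa only [Category.assoc, Category.id_comp] using hx'.comp e₄
      · simpa only [Category.assoc, Category.id_comp] using (hy.comp e₃).comp e₄
    · refine hD.hom_ext fun X p x hx => ?_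
      obtain ⟨X₁, e₁, u, he₁, h, h'⟩ := hD.app_comp hx
      obtain ⟨⟨X₂, e₂, x', he₂, h1, h2⟩, -⟩ := hρ.1 h
      refine App.of_cov (he₂.comp he₁) ?_
      rw [Category.assoc, Category.assoc]
      exact h1.cong (.refl _) (h2.eqv (h'.comp e₂))
    · refine hD.hom_ext fun X p x hx => ?_
      obtain ⟨X₁, e₁, u, he₁, h, h'⟩ := hD.app_comp hx
      obtain ⟨-, X₂, e₂, x', he₂, h1, h2⟩ := hρ.1 h
      refine App.of_cov (he₂.comp he₁) ?_
      rw [Category.assoc, Category.assoc]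
      exact h1.cong (.refl _) (h2.eqv (h'.comp e₂))
  · refine hD.hom_ext fun X p u hu => ?_
    obtain ⟨X₁, e₁, v, he₁, hv⟩ := hD.exists_app l' p
    obtain ⟨X₂, e₂, x, he₂, hx⟩ := hD.exists_app a v
    obtain ⟨X₃, e₃, y, he₃, hy⟩ := hD.exists_app b (e₂ ≫ v)
    have hu' : App l (e₃ ≫ e₂ ≫ e₁ ≫ p) (e₃ ≫ e₂ ≫ e₁ ≫ u) := ((hu.comp e₁).comp e₂).comp e₃
    have hv' : App l' (e₃ ≫ e₂ ≫ e₁ ≫ p) (e₃ ≫ e₂ ≫ v) := (hv.comp e₂).comp e₃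
    have hx' : App a (e₃ ≫ e₂ ≫ v) (e₃ ≫ x) := hx.comp e₃
    refine App.of_cov (he₃.comp (he₂.comp he₁)) ?_
    simp only [Category.assoc]
    refine hv'.cong (.refl _) (inj _ _ _ _ hx' ?_ hy ?_)
    · exact hu'.of_comp hD (by rw [ha]; exact hv'.trans hx')
    · exact hu'.of_comp hD (by rw [hb]; exact hv'.trans hy)

/-- Apply the universal property to elements viewed as arrows out of a discrete object, and
represent the induced arrow by an element after a cover. -/
lemma isPullback_exists (hD : D.Comprehension) {W : D.EqObj} {a : W ⟶ A} {b : W ⟶ B} {f : A ⟶ C}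
    {g : B ⟶ C} (h : IsPullback a b f g) {X : E} {x : X ⟶ A.obj} {y : X ⟶ B.obj} {z : X ⟶ C.obj}
    (hx : App f x z) (hy : App g y z) :
    ∃ (Z : E) (e : Z ⟶ X) (u : Z ⟶ W.obj), D.Cov e ∧ App a u (e ≫ x) ∧ App b u (e ≫ y) := by
  rw [← elt_comp_eq_elt_iff hD] at hx hy
  obtain ⟨Z, e, u, he, hu⟩ := exists_eq_elt hD (h.lift _ _ (hx.trans hy.symm))
  have key : ∀ {B : D.EqObj} (x : X ⟶ B.obj), elt hD (e ≫ x) = D.graphFunctor.map e ≫ elt hD x := by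
    intro B x
    refine hD.hom_ext fun Y k z hz => ?_
    have hz := (app_elt hD).1 hz
    exact App.trans (app_graph.2 (.refl _)) ((app_elt hD).2
      (EqObj.Eqv.trans (.of_eq (Category.assoc _ _ _)) hz))
  refine ⟨Z, e, u, he, ?_, ?_⟩
  · exact (elt_comp_eq_elt_iff hD).1 ((congrArg (· ≫ a) hu.symm).trans
      ((Category.assoc _ _ _).trans ((congrArg _ (h.lift_fst _ _ _)).trans (key x).symm)))
  · exact (elt_comp_eq_elt_iff hD).1 ((congrArg (· ≫ b) hu.symm).trans
      ((Category.assoc _ _ _).trans ((congrArg _ (h.lift_snd _ _ _)).trans (key y).symm)))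

/-- The pairs with a common value in `C` form a predicate, represented by an arrow `u : U ⟶ A.obj ⨯
B.obj`. The vertex is `U` with the equivalence relation induced from `A` and `B`, so `u` need not be
monic. -/
theorem exists_pullback (hD : D.Comprehension) (f : A ⟶ C) (g : B ⟶ C) :
    ∃ (W : D.EqObj) (a : W ⟶ A) (b : W ⟶ B), IsPullback a b f g := by
  obtain ⟨U, u, hu⟩ := hD (relComp (EqHom.rel f) (relSwap (EqHom.rel g)))
  have hU : ∀ {X : E} {x : X ⟶ A.obj} {y : X ⟶ B.obj},
      (∃ (Z : E) (e : Z ⟶ X) (k : Z ⟶ U), D.Cov e ∧ e ≫ x = k ≫ u ≫ prod.fst ∧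
        e ≫ y = k ≫ u ≫ prod.snd) ↔
      ∃ (Z : E) (e : Z ⟶ X) (z : Z ⟶ C.obj), D.Cov e ∧ App f (e ≫ x) z ∧ App g (e ≫ y) z := by
    intro X x y
    have h1 := rel_ofArrow hD (u ≫ prod.fst) (u ≫ prod.snd) (x := x) (y := y)
    rw [← prod.comp_lift, prod.lift_fst_snd, Category.comp_id, ← hu, rel_relComp hD] at h1
    simp only [rel_relSwap] at h1
    exact h1.symm
  let ρ : D.Pred (U ⨯ U) :=
    D.sub₂ A.rel (prod.fst ≫ u ≫ prod.fst) (prod.snd ≫ u ≫ prod.fst) ⊓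
      D.sub₂ B.rel (prod.fst ≫ u ≫ prod.snd) (prod.snd ≫ u ≫ prod.snd)
  have hρ : ∀ {X : E} {x y : X ⟶ U}, D.Rel ρ x y ↔
      A.Eqv (x ≫ u ≫ prod.fst) (y ≫ u ≫ prod.fst) ∧
        B.Eqv (x ≫ u ≫ prod.snd) (y ≫ u ≫ prod.snd) := by
    intro X x y
    refine rel_inf.trans (and_congr (mem_sub₂.trans ?_) (mem_sub₂.trans ?_)) <;>
    · rw [← Category.assoc, ← Category.assoc _ prod.snd, prod.lift_fst, prod.lift_snd]
      rfl
  let W : D.EqObj := EqObj.ofRel hD U ρ (fun X x => hρ.2 ⟨.refl _, .refl _⟩)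
    (fun X x y h => hρ.2 ⟨(hρ.1 h).1.symm, (hρ.1 h).2.symm⟩)
    (fun X x y z h h' => hρ.2 ⟨(hρ.1 h).1.trans (hρ.1 h').1, (hρ.1 h).2.trans (hρ.1 h').2⟩)
  let a : W ⟶ A := ofArrow (A := W) hD (u ≫ prod.fst) (fun X x x' h => (hρ.1 h).1)
  let b : W ⟶ B := ofArrow (A := W) hD (u ≫ prod.snd) (fun X x x' h => (hρ.1 h).2)
  have ha : ∀ {X : E} {x : X ⟶ W.obj} {y : X ⟶ A.obj}, App a x y ↔
      A.Eqv (x ≫ u ≫ prod.fst) y := app_ofArrow (A := W) hD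
  have hb : ∀ {X : E} {x : X ⟶ W.obj} {y : X ⟶ B.obj}, App b x y ↔
      B.Eqv (x ≫ u ≫ prod.snd) y := app_ofArrow (A := W) hD
  refine ⟨W, a, b, isPullback_of_app hD ?_ ?_ ?_⟩
  · refine hD.hom_ext fun X x z hz => ?_
    have hz' := App.of_comp hD (ha.2 (.refl _)) hz
    obtain ⟨Z, e, z', he, h1, h2⟩ := hU.1 ⟨X, 𝟙 X, x, cov_id X, Category.id_comp _,
      Category.id_comp _⟩
    refine App.of_cov he (App.trans (hb.2 (.of_eq (Category.assoc _ _ _))) ?_)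
    exact h2.cong (.refl _) (h1.eqv (hz'.comp e))
  · intro X x x' y z h1 h2 h3 h4
    exact hρ.2 ⟨(ha.1 h1).trans (ha.1 h2).symm, (hb.1 h3).trans (hb.1 h4).symm⟩
  · intro X x y z hx hy
    obtain ⟨Z, e, k, he, h1, h2⟩ := hU.2 ⟨X, 𝟙 X, z, cov_id X, by rwa [Category.id_comp],
      by rwa [Category.id_comp]⟩
    exact ⟨Z, e, k, he, ha.2 (.of_eq h1.symm), hb.2 (.of_eq h2.symm)⟩

lemma isTerminal_eqObj (hD : D.Comprehension) {T : E} (hT : IsTerminal T) :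
    Nonempty (IsTerminal (D.eqObj T)) := by
  refine ⟨IsTerminal.ofUniqueHom (fun A => homOfRel hD ⊤ (fun _ _ _ _ _ _ _ _ => mem_top _)
    (fun X x y y' _ _ => .of_eq (hT.hom_ext _ _))
    (fun X x => ⟨X, 𝟙 X, hT.from X, cov_id X, mem_top _⟩)) (fun A φ => ?_)⟩
  exact hD.hom_ext fun X x y _ => mem_top _

lemma hasFiniteLimits (hD : D.Comprehension) : HasFiniteLimits D.EqObj := by
  haveI : ∀ {X Y Z : D.EqObj} {f : X ⟶ Z} {g : Y ⟶ Z}, HasLimit (cospan f g) := by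
    intro X Y Z f g
    obtain ⟨W, a, b, h⟩ := exists_pullback hD f g
    exact h.hasPullback
  haveI : HasPullbacks D.EqObj := hasPullbacks_of_hasLimit_cospan _
  haveI : HasTerminal D.EqObj :=
    (isTerminal_eqObj hD terminalIsTerminal).some.hasTerminal
  exact hasFiniteLimits_of_hasTerminal_and_pullbacks

/-- The quotient of an object by a coarser equivalence relation. -/
theorem exists_quotient (hD : D.Comprehension) (A : D.EqObj) (ρ : D.Pred (A.obj ⨯ A.obj))
    (le : ∀ ⦃X : E⦄ (x y : X ⟶ A.obj), A.Eqv x y → D.Rel ρ x y)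
    (symm : ∀ ⦃X : E⦄ (x y : X ⟶ A.obj), D.Rel ρ x y → D.Rel ρ y x)
    (trans : ∀ ⦃X : E⦄ (x y z : X ⟶ A.obj), D.Rel ρ x y → D.Rel ρ y z → D.Rel ρ x z) :
    ∃ (Q : D.EqObj) (q : A ⟶ Q), Surj q ∧ ∀ ⦃X : E⦄ (x x' : X ⟶ A.obj),
      (∃ z, App q x z ∧ App q x' z) ↔ D.Rel ρ x x' := by
  let Q : D.EqObj := EqObj.ofRel hD A.obj ρ (fun X x => le _ _ (.refl _)) symm trans
  let q : A ⟶ Q := ofArrow (B := Q) hD (𝟙 A.obj) (fun X x x' h => by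
    have h₁ : x ≫ 𝟙 A.obj = x := Category.comp_id x
    have h₂ : x' ≫ 𝟙 A.obj = x' := Category.comp_id x'
    exact EqObj.Eqv.trans (EqObj.Eqv.trans (A := Q) (.of_eq h₁) (le _ _ h)) (.of_eq h₂.symm))
  have hq : ∀ {X : E} {x : X ⟶ A.obj} {z : X ⟶ Q.obj}, App q x z ↔ Q.Eqv x z := by
    intro X x z
    refine (app_ofArrow (B := Q) hD).trans ?_
    have h₁ : x ≫ 𝟙 A.obj = x := Category.comp_id x
    exact (congrArg (fun t : X ⟶ A.obj => Q.Eqv t z) h₁).to_iff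
  refine ⟨Q, q, fun X y => ⟨X, 𝟙 X, y, cov_id X, hq.2 (.of_eq (Category.id_comp y).symm)⟩,
    fun X x x' => ⟨?_, fun h => ⟨x', hq.2 h, hq.2 (.refl _)⟩⟩⟩
  rintro ⟨z, h, h'⟩
  exact (hq.1 h).trans (hq.1 h').symm

/-- The image is realized as the quotient of `A` by the relation of having a common value under `f`,
not as a subobject of `B`. -/
theorem exists_surj_mono (hD : D.Comprehension) (f : A ⟶ B) :
    ∃ (M : D.EqObj) (e : A ⟶ M) (m : M ⟶ B), Surj e ∧ Mono m ∧ e ≫ m = f := by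
  have hρ : ∀ {X : E} {x x' : X ⟶ A.obj},
      D.Rel (relComp (EqHom.rel f) (relSwap (EqHom.rel f))) x x' ↔
      ∃ (Z : E) (e : Z ⟶ X) (y : Z ⟶ B.obj), D.Cov e ∧ App f (e ≫ x) y ∧ App f (e ≫ x') y := by
    intro X x x'
    refine (rel_relComp hD).trans ?_
    simp only [rel_relSwap]
    rfl
  obtain ⟨M, q, hq, hqf⟩ := exists_quotient hD A (relComp (EqHom.rel f) (relSwap (EqHom.rel f)))
    (fun X x y h => by
      obtain ⟨Z, e, z, he, hz⟩ := hD.exists_app f x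
      exact hρ.2 ⟨Z, e, z, he, hz, hz.cong (h.comp e) (.refl _)⟩)
    (fun X x y h => by
      obtain ⟨Z, e, z, he, h1, h2⟩ := hρ.1 h
      exact hρ.2 ⟨Z, e, z, he, h2, h1⟩)
    (fun X x y z h h' => by
      obtain ⟨Z, e, w, he, h1, h2⟩ := hρ.1 h
      obtain ⟨Z', e', w', he', h1', h2'⟩ := hρ.1 (Rel.comp h' e)
      refine hρ.2 ⟨Z', e' ≫ e, w', he'.comp he, ?_, ?_⟩
      · rw [Category.assoc]
        exact (h1.comp e').cong (.refl _) ((h2.comp e').eqv h1')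
      · rwa [Category.assoc])
  obtain ⟨m, rfl⟩ := hq.exists_desc hD f (fun X x x' y z hx hx' hz => by
    obtain ⟨Z, e, w, he, h1, h2⟩ := hρ.1 ((hqf x x').1 ⟨y, hx, hx'⟩)
    exact App.of_cov he (h2.cong (.refl _) (h1.eqv (hz.comp e))))
  refine ⟨M, q, m, hq, Inj.mono hD fun X u v y hu hv => ?_, rfl⟩
  obtain ⟨X₁, e₁, x, he₁, hx⟩ := hq u
  obtain ⟨X₂, e₂, x', he₂, hx'⟩ := hq (e₁ ≫ v)
  obtain ⟨z, hz, hz'⟩ := (hqf (e₂ ≫ x) x').2 (hρ.2 ⟨X₂, 𝟙 _, e₂ ≫ e₁ ≫ y, cov_id _,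
    by rw [Category.id_comp]; exact (hx.trans (hu.comp e₁)).comp e₂,
    by rw [Category.id_comp]; exact hx'.trans ((hv.comp e₁).comp e₂)⟩)
  refine EqObj.Eqv.of_cov (he₂.comp he₁) ?_
  rw [Category.assoc, Category.assoc]
  exact ((hx.comp e₂).eqv hz).trans (hx'.eqv hz').symm

lemma Surj.of_isPullback (hD : D.Comprehension) {W : D.EqObj} {a : W ⟶ A} {b : W ⟶ B} {f : A ⟶ C}
    {g : B ⟶ C} (h : IsPullback a b f g) (hf : Surj f) : Surj b := by
  intro X y
  obtain ⟨X₁, e₁, z, he₁, hz⟩ := hD.exists_app g y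
  obtain ⟨X₂, e₂, x, he₂, hx⟩ := hf z
  obtain ⟨X₃, e₃, u, he₃, h1, h2⟩ := isPullback_exists hD h hx (hz.comp e₂)
  exact ⟨X₃, e₃ ≫ e₂ ≫ e₁, u, he₃.comp (he₂.comp he₁), by simpa only [Category.assoc] using h2⟩

/-- By `Surj.exists_desc` a surjection is the coequalizer of its kernel pair. -/
lemma Surj.isRegularEpi (hD : D.Comprehension) {f : A ⟶ B} (hf : Surj f) : IsRegularEpi f := by
  obtain ⟨W, a, b, h⟩ := exists_pullback hD f f
  haveI := hf.epi hD
  have key : ∀ {Z : D.EqObj} (g : A ⟶ Z), a ≫ g = b ≫ g → ∃ k : B ⟶ Z, f ≫ k = g := by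
    intro Z g hg
    refine hf.exists_desc hD g fun X x x' y z hx hx' hz => ?_
    obtain ⟨X₁, e₁, u, he₁, h1, h2⟩ := isPullback_exists hD h hx hx'
    refine App.of_cov he₁ (h2.of_comp hD ?_)
    rw [← hg]
    exact h1.trans (hz.comp e₁)
  refine ⟨⟨⟨W, a, b, h.w, Cofork.IsColimit.mk _ (fun s => (key s.π s.condition).choose)
    (fun s => (key s.π s.condition).choose_spec) (fun s m hm => ?_)⟩⟩⟩
  rw [← cancel_epi f]
  exact hm.trans (key s.π s.condition).choose_spec.symm

/-- Surjective functional relations, as a class of arrows. -/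
def surjective (D : ExDoctrine.{v₂, u₂, w} E) : MorphismProperty D.EqObj := fun _ _ f => Surj f

theorem regular_and_isRegularEpi_iff (hD : D.Comprehension) :
    Regular D.EqObj ∧ ∀ ⦃A B : D.EqObj⦄ (e : A ⟶ B), IsRegularEpi e ↔ Surj e := by
  haveI := hasFiniteLimits hD
  haveI : (surjective D).IsStableUnderBaseChange :=
    ⟨fun {_ _ _ _ _ _ _ _} h hg => Surj.of_isPullback hD h hg⟩
  exact regular_of_factorization (surjective D) (fun X Y f => exists_surj_mono hD f)
    (fun X Y e he => Surj.isRegularEpi hD he)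

lemma isRegularEpi_iff (hD : D.Comprehension) (e : A ⟶ B) : IsRegularEpi e ↔ Surj e :=
  (regular_and_isRegularEpi_iff hD).2 e

/-- A categorical equivalence relation on `X` is read as a predicate on `X.obj ⨯ X.obj` coarser than
the given relation. The quotient keeps the underlying object and replaces the relation, so its
kernel pair is the right one by construction. -/
theorem isExact (hD : D.Comprehension) : IsExact D.EqObj where
  toRegular := (regular_and_isRegularEpi_iff hD).1
  effective {X Q} p₁ p₂ h := by
    obtain ⟨⟨h⟩⟩ := h
    have hρ : ∀ {Y : E} {x x' : Y ⟶ X.obj},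
        D.Rel (relComp (relSwap (EqHom.rel p₁)) (EqHom.rel p₂)) x x' ↔
        ∃ (Z : E) (e : Z ⟶ Y) (q : Z ⟶ Q.obj), D.Cov e ∧ App p₁ q (e ≫ x) ∧
          App p₂ q (e ≫ x') := by
      intro Y x x'
      refine (rel_relComp hD).trans ?_
      simp only [rel_relSwap]
      rfl
    obtain ⟨P, π, hπ, hπρ⟩ := exists_quotient hD X
      (relComp (relSwap (EqHom.rel p₁)) (EqHom.rel p₂))
      (fun Y x x' hx => by
        obtain ⟨Z, e, q, he, hq⟩ := hD.exists_app h.r x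
        refine hρ.2 ⟨Z, e, q, he, hq.of_comp hD ?_, hq.of_comp hD ?_⟩
        · rw [h.reflexivity₁]
          exact EqObj.Eqv.refl _
        · rw [h.reflexivity₂]
          exact hx.comp e)
      (fun Y x x' hx => by
        obtain ⟨Z, e, q, he, h1, h2⟩ := hρ.1 hx
        obtain ⟨Z', e', q', he', hq'⟩ := hD.exists_app h.s q
        refine hρ.2 ⟨Z', e' ≫ e, q', he'.comp he, hq'.of_comp hD ?_, hq'.of_comp hD ?_⟩
        · rw [h.symmetry₁, Category.assoc]
          exact h2.comp e'
        · rw [h.symmetry₂, Category.assoc]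
          exact h1.comp e')
      (fun Y x y z hx hy => by
        obtain ⟨Z, e, q, he, h1, h2⟩ := hρ.1 hx
        obtain ⟨Z', e', q', he', h1', h2'⟩ := hρ.1 (Rel.comp hy e)
        have hc : IsPullback h.c.fst h.c.snd p₂ p₁ :=
          ⟨⟨h.c.condition⟩, ⟨h.isLimit.ofIsoLimit (PullbackCone.eta _)⟩⟩
        obtain ⟨Z₂, e₂, u, he₂, hu₁, hu₂⟩ := isPullback_exists hD hc (h2.comp e') h1'
        obtain ⟨Z₃, e₃, q₃, he₃, hq₃⟩ := hD.exists_app h.t u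
        refine hρ.2 ⟨Z₃, e₃ ≫ e₂ ≫ e' ≫ e, q₃, he₃.comp (he₂.comp (he'.comp he)),
          hq₃.of_comp hD ?_, hq₃.of_comp hD ?_⟩
        · rw [h.transitivity₁]
          simp only [Category.assoc]
          exact ((hu₁.trans ((h1.comp e').comp e₂)).comp e₃)
        · rw [h.transitivity₂]
          simp only [Category.assoc]
          exact ((hu₂.trans (h2'.comp e₂)).comp e₃))
    refine ⟨P, π, isPullback_of_app hD ?_ ?_ ?_⟩
    · refine hD.hom_ext fun Y q z hz => ?_
      obtain ⟨Z, e, x, he, h1, h2⟩ := hD.app_comp hz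
      obtain ⟨Z', e', x', he', h1'⟩ := hD.exists_app p₂ (e ≫ q)
      obtain ⟨w, hw, hw'⟩ := (hπρ (e' ≫ x) x').2 (hρ.2 ⟨Z', 𝟙 _, e' ≫ e ≫ q, cov_id _,
        by rw [Category.id_comp]; exact h1.comp e', by rwa [Category.id_comp]⟩)
      refine App.of_cov (he'.comp he) ?_
      rw [Category.assoc, Category.assoc]
      exact h1'.trans (hw'.cong (.refl _) (hw.eqv (h2.comp e')))
    · intro Y u v x y h1 h2 h3 h4
      rw [← elt_comp_eq_elt_iff hD] at h1 h2 h3 h4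
      rw [← elt_eq_elt_iff hD]
      exact h.right_cancellation _ _ (h1.trans h2.symm) (h3.trans h4.symm)
    · intro Y x y z hx hy
      exact hρ.1 ((hπρ x y).1 ⟨z, hx, hy⟩)

/-- Equality in discrete objects is equality after a cover, so two elements with a common value
define, after a cover, an element of the pullback in `E`. -/
lemma graphFunctor_map_isPullback (hD : D.Comprehension) {W A B C : E} {a : W ⟶ A} {b : W ⟶ B}
    {f : A ⟶ C} {g : B ⟶ C} (h : IsPullback a b f g) :
    IsPullback (D.graphFunctor.map a) (D.graphFunctor.map b) (D.graphFunctor.map f)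
      (D.graphFunctor.map g) := by
  refine isPullback_of_app hD (by rw [← Functor.map_comp, h.w, Functor.map_comp]) ?_ ?_
  · intro X (u : X ⟶ W) (v : X ⟶ W) x y h1 h2 h3 h4
    have e₁ := (app_graph.1 h1).trans (app_graph.1 h2).symm
    have e₂ := (app_graph.1 h3).trans (app_graph.1 h4).symm
    obtain ⟨Z, e, he, hx⟩ := (eqv_eqObj hD).1 e₁
    obtain ⟨Z', e', he', hy⟩ := (eqv_eqObj hD).1 (e₂.comp e)
    refine (eqv_eqObj hD).2 ⟨Z', e' ≫ e, he'.comp he, h.hom_ext ?_ ?_⟩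
    · have hx : e ≫ u ≫ a = e ≫ v ≫ a := hx
      simp only [Category.assoc, hx]
    · have hy : e' ≫ e ≫ u ≫ b = e' ≫ e ≫ v ≫ b := hy
      simpa only [Category.assoc] using hy
  · intro X (x : X ⟶ A) (y : X ⟶ B) z hx hy
    obtain ⟨Z, e, he, hxy⟩ := (eqv_eqObj hD).1 ((app_graph.1 hx).trans (app_graph.1 hy).symm)
    have hxy : e ≫ x ≫ f = e ≫ y ≫ g := hxy
    have w : (e ≫ x) ≫ f = (e ≫ y) ≫ g := by rw [Category.assoc, hxy, Category.assoc]
    exact ⟨Z, e, h.lift _ _ w, he, app_graph.2 (.of_eq (h.lift_fst _ _ w)),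
      app_graph.2 (.of_eq (h.lift_snd _ _ w))⟩

lemma surj_graph_iff (hD : D.Comprehension) {A B : E} (f : A ⟶ B) :
    Surj (D.graphFunctor.map f) ↔ D.Cov f := by
  constructor
  · intro h
    obtain ⟨Z, e, x, he, hx⟩ := h (𝟙 B)
    obtain ⟨Z', e', he', h'⟩ := (eqv_eqObj hD).1 (app_graph.1 hx)
    have h' : e' ≫ x ≫ f = e' ≫ e ≫ 𝟙 B := h'
    rw [Category.comp_id] at h'
    refine Cov.of_comp (f := e' ≫ x) ?_
    have h'' := he'.comp he
    have h₃ : (e' ≫ x) ≫ f = e' ≫ e := (Category.assoc _ _ _).trans h'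
    rwa [← h₃] at h''
  · intro h X (y : X ⟶ B)
    obtain ⟨Z, e, x, he, hx⟩ := h.exists_cover y
    exact ⟨Z, e, x, he, app_graph.2 (.of_eq hx.symm)⟩

end ExDoctrine

/-! ### Finite-limit fibrations from stable limits -/

section
variable {R : Type u₁} [Category.{v₁} R] {E : Type u₂} [Category.{v₂} E] {p : E ⥤ R}

lemma isPullback_of_fm {I : R} {W A B C : p.Fiber I} {a : W ⟶ A} {b : W ⟶ B} {f : A ⟶ C}
    {g : B ⟶ C} (h : IsPullback (fm a) (fm b) (fm f) (fm g)) : IsPullback a b f g := by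
  refine isPullback_of_existsUnique (Functor.Fiber.hom_ext h.w) (fun X x y hxy => ?_)
    (fun X l l' h1 h2 => Functor.Fiber.hom_ext
      (h.hom_ext (congrArg fm h1) (congrArg fm h2)))
  have e : fm x ≫ fm f = fm y ≫ fm g := congrArg fm hxy
  have h1 := h.lift_fst (fm x) (fm y) e
  have : p.IsHomLift (𝟙 I) (h.lift (fm x) (fm y) e ≫ fm a) := by rw [h1]; infer_instance
  have := isHomLift_of_comp_vertical p (𝟙 I) (h.lift (fm x) (fm y) e) (fm a)
  exact ⟨fhom (h.lift (fm x) (fm y) e) this, Functor.Fiber.hom_ext h1,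
    Functor.Fiber.hom_ext (h.lift_snd (fm x) (fm y) e)⟩

lemma isTerminal_of_isOne {I : R} {T : p.Fiber I} (h : IsOne p (fo T)) :
    Nonempty (IsTerminal T) := by
  have H : ∀ X : p.Fiber I, ∃! f : fo X ⟶ fo T, p.IsHomLift (𝟙 I) f := fun X =>
    h.existsUnique (fo_over T) (fo_over X) (𝟙 I)
  exact ⟨IsTerminal.ofUniqueHom (fun X => fhom _ (H X).choose_spec.1)
    (fun X m => Functor.Fiber.hom_ext ((H X).choose_spec.2 _ m.2))⟩

/-- A fibration whose fibers have terminal objects and pullbacks which are stable, in the sense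
that they are terminal and pullbacks with respect to arbitrary arrows, has finite limits. -/
theorem isFiniteLimitFibration_of_isOne_of_isPullback [p.IsFibered]
    (h1 : ∀ I, ∃ T : p.Fiber I, IsOne p (fo T))
    (h2 : ∀ ⦃I : R⦄ ⦃A B C : p.Fiber I⦄ (f : A ⟶ C) (g : B ⟶ C),
      ∃ (W : p.Fiber I) (a : W ⟶ A) (b : W ⟶ B), IsPullback (fm a) (fm b) (fm f) (fm g)) :
    IsFiniteLimitFibration p := by
  have hlim (I : R) : HasFiniteLimits (p.Fiber I) := by
    haveI : ∀ {X Y Z : p.Fiber I} {f : X ⟶ Z} {g : Y ⟶ Z}, HasLimit (cospan f g) := by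
      intro X Y Z f g
      obtain ⟨W, a, b, h⟩ := h2 f g
      exact (isPullback_of_fm h).hasPullback
    haveI : HasPullbacks (p.Fiber I) := hasPullbacks_of_hasLimit_cospan _
    haveI : HasTerminal (p.Fiber I) := by
      obtain ⟨T, hT⟩ := h1 I
      exact (isTerminal_of_isOne hT).some.hasTerminal
    exact hasFiniteLimits_of_hasTerminal_and_pullbacks
  refine { hasFiniteLimits := hlim, preserves := fun {J I} u => ?_ }
  haveI := hlim I
  refine preservesFiniteLimits_of_isPullback _ ?_ ?_
  · obtain ⟨T, hT⟩ := h1 I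
    obtain ⟨hT'⟩ := isTerminal_of_isOne hT
    have H : ∀ X : p.Fiber J, ∃! f : fo X ⟶ fo T, p.IsHomLift u f := fun X =>
      hT.existsUnique (fo_over T) (fo_over X) u
    have : IsTerminal ((reindex p u).obj T) :=
      IsTerminal.ofUniqueHom (fun X => flift p u _ (H X).choose_spec.1)
        (fun X m => rhom_ext p u ((H X).unique inferInstance (by
          rw [flift_fac]
          exact (H X).choose_spec.1)))
    exact ⟨this.ofIso ((reindex p u).mapIso (hT'.uniqueUpToIso terminalIsTerminal))⟩
  · intro W A B C a b f g h
    obtain ⟨W', a', b', h'⟩ := h2 f g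
    have key : IsPullback ((reindex p u).map a') ((reindex p u).map b') ((reindex p u).map f)
        ((reindex p u).map g) := by
      refine isPullback_of_existsUnique
        (by rw [← Functor.map_comp, (isPullback_of_fm h').w, Functor.map_comp]) ?_ ?_
      · intro X x y hxy
        have hc : (fm x ≫ rmap p u A) ≫ fm f = (fm y ≫ rmap p u B) ≫ fm g := by
          rw [Category.assoc, Category.assoc, ← reindex_fac, ← reindex_fac, ← Category.assoc,
            ← Category.assoc, ← fm_comp, ← fm_comp, hxy]
        have hl : p.IsHomLift u (h'.lift _ _ hc ≫ fm a') := by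
          rw [h'.lift_fst]
          infer_instance
        have hl' := isHomLift_of_comp_vertical p u (h'.lift _ _ hc) (fm a')
        refine ⟨flift p u _ hl', rhom_ext p u ?_, rhom_ext p u ?_⟩
        · rw [fm_comp, Category.assoc, reindex_fac, ← Category.assoc, flift_fac, h'.lift_fst]
        · rw [fm_comp, Category.assoc, reindex_fac, ← Category.assoc, flift_fac, h'.lift_snd]
      · intro X l l' ha hb
        refine rhom_ext p u (h'.hom_ext ?_ ?_)
        · rw [Category.assoc, Category.assoc, ← reindex_fac, ← Category.assoc, ← Category.assoc,
            ← fm_comp, ← fm_comp, ha]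
        · rw [Category.assoc, Category.assoc, ← reindex_fac, ← Category.assoc, ← Category.assoc,
            ← fm_comp, ← fm_comp, hb]
    refine IsPullback.of_iso key
      ((reindex p u).mapIso ((isPullback_of_fm h').isoIsPullback _ _ h)) (Iso.refl _) (Iso.refl _)
      (Iso.refl _) ?_ ?_ (by simp) (by simp)
    · simp [← Functor.map_comp]
    · simp [← Functor.map_comp]

end

/-! ### Gluing fibrations -/

namespace Gluing
variable {R : Type u₁} [Category.{v₁} R] {C : Type u₂} [Category.{v₂} C] {Δ : R ⥤ C}

variable (Δ) in
/-- The gluing fibration of `Δ`. -/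
abbrev gl : Comma (Functor.id C) Δ ⥤ R := Comma.snd (Functor.id C) Δ

/-- The structure arrow of an object of the gluing fibration. -/
def str (A : Comma (Functor.id C) Δ) : A.left ⟶ Δ.obj A.right := A.hom

/-- An object of the gluing fibration. -/
abbrev mkObj {X : C} {I : R} (a : X ⟶ Δ.obj I) : Comma (Functor.id C) Δ := ⟨X, I, a⟩

/-- An arrow of the gluing fibration. -/
abbrev mkHom {A B : Comma (Functor.id C) Δ} (f : A.left ⟶ B.left) (u : A.right ⟶ B.right)
    (w : f ≫ str B = str A ≫ Δ.map u) : A ⟶ B := ⟨f, u, w⟩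

lemma str_w {A B : Comma (Functor.id C) Δ} (f : A ⟶ B) :
    f.left ≫ str B = str A ≫ Δ.map f.right := f.w

lemma right_eq_of_isHomLift {A B : Comma (Functor.id C) Δ} {f : A ⟶ B} {t : A.right ⟶ B.right}
    (h : (gl Δ).IsHomLift t f) : f.right = t :=
  (IsHomLift.eq_of_isHomLift (gl Δ) t f).symm

lemma isHomLift_of_right_eq {A B : Comma (Functor.id C) Δ} {f : A ⟶ B} {t : A.right ⟶ B.right}
    (h : f.right = t) : (gl Δ).IsHomLift t f := by
  subst h
  exact inferInstanceAs ((gl Δ).IsHomLift ((gl Δ).map f) f)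

variable (Δ) in
/-- Preservation of pullback squares. -/
def PreservesPullbackSquares : Prop :=
  ∀ ⦃W X Y Z : R⦄ ⦃a : W ⟶ X⦄ ⦃b : W ⟶ Y⦄ ⦃f : X ⟶ Z⦄ ⦃g : Y ⟶ Z⦄, IsPullback a b f g →
    IsPullback (Δ.map a) (Δ.map b) (Δ.map f) (Δ.map g)

lemma isPullback_of_left_right (hΔ : PreservesPullbackSquares Δ) {W A B D : Comma (Functor.id C) Δ}
    {a : W ⟶ A} {b : W ⟶ B} {f : A ⟶ D} {g : B ⟶ D}
    (hl : IsPullback a.left b.left f.left g.left)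
    (hr : IsPullback a.right b.right f.right g.right) : IsPullback a b f g := by
  refine isPullback_of_existsUnique (CommaMorphism.ext hl.w hr.w) (fun X x y h => ?_)
    (fun X l l' h1 h2 => ?_)
  · have h1 : x.left ≫ f.left = y.left ≫ g.left := congrArg CommaMorphism.left h
    have h2 : x.right ≫ f.right = y.right ≫ g.right := congrArg CommaMorphism.right h
    refine ⟨mkHom (hl.lift _ _ h1) (hr.lift _ _ h2) ((hΔ hr).hom_ext ?_ ?_), ?_, ?_⟩
    · rw [Category.assoc, ← str_w, ← Category.assoc, hl.lift_fst, Category.assoc, ← Δ.map_comp,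
        hr.lift_fst, str_w]
    · rw [Category.assoc, ← str_w, ← Category.assoc, hl.lift_snd, Category.assoc, ← Δ.map_comp,
        hr.lift_snd, str_w]
    · exact CommaMorphism.ext (hl.lift_fst _ _ _) (hr.lift_fst _ _ _)
    · exact CommaMorphism.ext (hl.lift_snd _ _ _) (hr.lift_snd _ _ _)
  · exact CommaMorphism.ext
      (hl.hom_ext (congrArg CommaMorphism.left h1) (congrArg CommaMorphism.left h2))
      (hr.hom_ext (congrArg CommaMorphism.right h1) (congrArg CommaMorphism.right h2))

lemma exists_isPullback [HasFiniteLimits R] [HasFiniteLimits C] (hΔ : PreservesPullbackSquares Δ)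
    {A B D : Comma (Functor.id C) Δ} (f : A ⟶ D) (g : B ⟶ D) :
    ∃ (W : Comma (Functor.id C) Δ) (a : W ⟶ A) (b : W ⟶ B), IsPullback a b f g ∧
      IsPullback a.left b.left f.left g.left ∧ IsPullback a.right b.right f.right g.right := by
  have hr := IsPullback.of_hasPullback f.right g.right
  have hl := IsPullback.of_hasPullback f.left g.left
  have w : (pullback.fst f.left g.left ≫ str A) ≫ Δ.map f.right =
      (pullback.snd f.left g.left ≫ str B) ≫ Δ.map g.right := by
    rw [Category.assoc, Category.assoc, ← str_w, ← str_w, ← Category.assoc, hl.w, Category.assoc]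
  let W : Comma (Functor.id C) Δ := mkObj ((hΔ hr).lift _ _ w)
  let a : W ⟶ A := mkHom (pullback.fst f.left g.left) (pullback.fst f.right g.right)
    ((hΔ hr).lift_fst _ _ w).symm
  let b : W ⟶ B := mkHom (pullback.snd f.left g.left) (pullback.snd f.right g.right)
    ((hΔ hr).lift_snd _ _ w).symm
  exact ⟨W, a, b, isPullback_of_left_right hΔ hl hr, hl, hr⟩

lemma isPullback_left [HasFiniteLimits R] [HasFiniteLimits C] (hΔ : PreservesPullbackSquares Δ)
    {W A B D : Comma (Functor.id C) Δ} {a : W ⟶ A} {b : W ⟶ B} {f : A ⟶ D} {g : B ⟶ D}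
    (h : IsPullback a b f g) : IsPullback a.left b.left f.left g.left := by
  obtain ⟨W', a', b', h1, h2, -⟩ := exists_isPullback hΔ f g
  refine IsPullback.of_iso h2 ((Comma.fst _ _).mapIso (h1.isoIsPullback _ _ h)) (Iso.refl _)
    (Iso.refl _) (Iso.refl _) ?_ ?_ (by simp) (by simp)
  · simp [← Comma.comp_left]
  · simp [← Comma.comp_left]

lemma isCart_of_isPullback {A B : Comma (Functor.id C) Δ} {f : A ⟶ B}
    (h : IsPullback f.left (str A) (str B) (Δ.map f.right)) : IsCart (gl Δ) f := by
  refine { universal_property' := ?_ }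
  intro X t x hx
  have hx' : x.right = t ≫ f.right := right_eq_of_isHomLift hx
  have w : x.left ≫ str B = (str X ≫ Δ.map t) ≫ Δ.map f.right := by
    rw [str_w, hx', Δ.map_comp, Category.assoc]
  refine ⟨mkHom (h.lift x.left (str X ≫ Δ.map t) w) t (h.lift_snd _ _ _),
    ⟨isHomLift_of_right_eq rfl, CommaMorphism.ext (h.lift_fst _ _ _) hx'.symm⟩, ?_⟩
  rintro y ⟨hy, rfl⟩
  have hy' : y.right = t := right_eq_of_isHomLift hy
  refine CommaMorphism.ext (h.hom_ext ?_ ?_) hy'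
  · exact (h.lift_fst _ _ w).symm
  · refine Eq.trans ?_ (h.lift_snd _ _ w).symm
    rw [str_w, hy']

lemma exists_isCart [HasFiniteLimits C] (B : Comma (Functor.id C) Δ) {I : R} (u : I ⟶ B.right) :
    ∃ (A : Comma (Functor.id C) Δ) (f : A ⟶ B), (gl Δ).IsStronglyCartesian u f ∧
      IsPullback f.left (str A) (str B) (Δ.map f.right) := by
  have h := IsPullback.of_hasPullback (str B) (Δ.map u)
  let A : Comma (Functor.id C) Δ := mkObj (pullback.snd (str B) (Δ.map u))
  let f : A ⟶ B := mkHom (pullback.fst (str B) (Δ.map u)) u h.w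
  exact ⟨A, f, isCart_of_isPullback (f := f) h, h⟩

instance [HasFiniteLimits C] : (gl Δ).IsFibered :=
  IsFibered.of_exists_isStronglyCartesian (fun B I u => by
    obtain ⟨A, f, hf, -⟩ := exists_isCart B u
    exact ⟨A, f, hf⟩)

lemma isIso_left {A B : Comma (Functor.id C) Δ} (f : A ⟶ B) [IsIso f] : IsIso f.left :=
  inferInstanceAs (IsIso ((Comma.fst _ _).map f))

/-- A cartesian arrow is isomorphic to the one built from a chosen pullback over the same base
arrow. -/
lemma isPullback_of_isCart [HasFiniteLimits C] {A B : Comma (Functor.id C) Δ} {f : A ⟶ B}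
    (hf : IsCart (gl Δ) f) : IsPullback f.left (str A) (str B) (Δ.map f.right) := by
  obtain ⟨A', f', hf', h⟩ := exists_isCart B f.right
  have hf₁ : (gl Δ).IsStronglyCartesian f.right f := hf
  let e : A ≅ A' := IsCartesian.domainUniqueUpToIso (gl Δ) f.right f' f
  have he : e.inv ≫ f = f' := IsCartesian.fac (gl Δ) f.right f f'
  refine IsPullback.of_iso h ((Comma.fst _ _).mapIso e.symm) (Iso.refl _)
    (Δ.mapIso ((Comma.snd _ _).mapIso e.symm)) (Iso.refl _) ?_ ?_ (by simp) ?_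
  · rw [Iso.refl_hom, Category.comp_id, ← he]
    rfl
  · exact (str_w e.inv).symm
  · rw [Iso.refl_hom, Category.comp_id, ← he]
    exact Δ.map_comp _ _

lemma isOne_of_isIso_str {T : Comma (Functor.id C) Δ} (h : IsIso (str T)) : IsOne (gl Δ) T := by
  intro X t
  refine ⟨mkHom (str X ≫ Δ.map t ≫ inv (str T)) t (by simp), isHomLift_of_right_eq rfl,
    fun g hg => ?_⟩
  have hg' : g.right = t := right_eq_of_isHomLift hg
  refine CommaMorphism.ext ?_ hg'
  change g.left = str X ≫ Δ.map t ≫ inv (str T)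
  rw [← hg', ← Category.assoc, ← str_w, Category.assoc, IsIso.hom_inv_id, Category.comp_id]

/-- The structure arrow of an object of a fiber. -/
def fstr {I : R} (A : (gl Δ).Fiber I) : (fo A).left ⟶ Δ.obj I :=
  str (fo A) ≫ Δ.map (eqToHom (fo_over A))

/-- An object of a fiber. -/
abbrev fob {X : C} {I : R} (a : X ⟶ Δ.obj I) : (gl Δ).Fiber I :=
  Functor.Fiber.mk (p := gl Δ) (a := mkObj a) rfl

lemma fstr_fob {X : C} {I : R} (a : X ⟶ Δ.obj I) : fstr (fob a) = a := by
  change a ≫ Δ.map (𝟙 I) = a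
  rw [Δ.map_id, Category.comp_id]

lemma right_of_isHomLift {I J : R} {A : (gl Δ).Fiber I} {B : (gl Δ).Fiber J} {u : I ⟶ J}
    {f : fo A ⟶ fo B} (h : (gl Δ).IsHomLift u f) :
    f.right = eqToHom (fo_over A) ≫ u ≫ eqToHom (fo_over B).symm := by
  have := IsHomLift.fac' (gl Δ) u f
  exact this

lemma fstr_w {I J : R} {A : (gl Δ).Fiber I} {B : (gl Δ).Fiber J} {u : I ⟶ J} {f : fo A ⟶ fo B}
    (h : (gl Δ).IsHomLift u f) : f.left ≫ fstr B = fstr A ≫ Δ.map u := by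
  rw [fstr, fstr, ← Category.assoc, str_w, right_of_isHomLift h, Category.assoc, Category.assoc,
    ← Δ.map_comp, ← Δ.map_comp]
  simp

lemma exists_lift {I J : R} {A : (gl Δ).Fiber I} {B : (gl Δ).Fiber J} {u : I ⟶ J}
    (φ : (fo A).left ⟶ (fo B).left) (h : φ ≫ fstr B = fstr A ≫ Δ.map u) :
    ∃ f : fo A ⟶ fo B, (gl Δ).IsHomLift u f ∧ f.left = φ := by
  refine ⟨mkHom φ (eqToHom (fo_over A) ≫ u ≫ eqToHom (fo_over B).symm) ?_, ?_, rfl⟩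
  · rw [fstr, fstr, ← Category.assoc] at h
    rw [← cancel_mono (Δ.map (eqToHom (fo_over B))), h]
    simp only [Category.assoc, ← Δ.map_comp]
    simp
  · exact IsHomLift.of_fac' (gl Δ) u _ (fo_over A) (fo_over B) rfl

variable {I : R} {W A B D : (gl Δ).Fiber I}

lemma fm_w (f : A ⟶ B) : (fm f).left ≫ fstr B = fstr A := by
  rw [fstr_w (inferInstance : (gl Δ).IsHomLift (𝟙 I) (fm f)), Δ.map_id, Category.comp_id]

lemma exists_fm (φ : (fo A).left ⟶ (fo B).left) (h : φ ≫ fstr B = fstr A) :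
    ∃ f : A ⟶ B, (fm f).left = φ := by
  obtain ⟨f, hf, rfl⟩ := exists_lift (u := 𝟙 I) φ (by rw [h, Δ.map_id, Category.comp_id])
  exact ⟨fhom f hf, rfl⟩

lemma fm_left_congr {f g : A ⟶ B} (h : f = g) : (fm f).left = (fm g).left := by rw [h]

lemma fiber_hom_ext {f g : A ⟶ B} (h : (fm f).left = (fm g).left) : f = g := by
  refine Functor.Fiber.hom_ext (CommaMorphism.ext h ?_)
  exact (right_of_isHomLift (inferInstance : (gl Δ).IsHomLift (𝟙 I) (fm f))).trans
    (right_of_isHomLift (inferInstance : (gl Δ).IsHomLift (𝟙 I) (fm g))).symm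

instance (f : A ⟶ B) : IsIso (fm f).right :=
  isIso_map_of_isVertical (isVertical_of_isHomLift (inferInstance : (gl Δ).IsHomLift (𝟙 I) (fm f)))

lemma mono_of_left {f : A ⟶ B} (h : Mono (fm f).left) : Mono f :=
  ⟨fun _ _ w => fiber_hom_ext ((cancel_mono (fm f).left).1 (fm_left_congr w))⟩

lemma isPullback_fm_of_left (hΔ : PreservesPullbackSquares Δ) {a : W ⟶ A} {b : W ⟶ B} {f : A ⟶ D}
    {g : B ⟶ D} (h : IsPullback (fm a).left (fm b).left (fm f).left (fm g).left) :
    IsPullback (fm a) (fm b) (fm f) (fm g) := by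
  refine isPullback_of_left_right hΔ h (IsPullback.of_vert_isIso ⟨?_⟩)
  have h' : a ≫ f = b ≫ g := fiber_hom_ext h.w
  have h'' : fm (a ≫ f) = fm (b ≫ g) := by rw [h']
  exact congrArg CommaMorphism.right h''

lemma exists_isPullback_fm [HasFiniteLimits C] (hΔ : PreservesPullbackSquares Δ)
    (f : A ⟶ D) (g : B ⟶ D) :
    ∃ (W : (gl Δ).Fiber I) (a : W ⟶ A) (b : W ⟶ B), IsPullback (fm a) (fm b) (fm f) (fm g) := by
  have hl := IsPullback.of_hasPullback (fm f).left (fm g).left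
  obtain ⟨a, ha⟩ := exists_fm (A := fob (pullback.fst (fm f).left (fm g).left ≫ fstr A)) (B := A)
    (pullback.fst (fm f).left (fm g).left) (fstr_fob _).symm
  obtain ⟨b, hb⟩ := exists_fm (A := fob (pullback.fst (fm f).left (fm g).left ≫ fstr A)) (B := B)
    (pullback.snd (fm f).left (fm g).left) (by
      rw [fstr_fob, ← fm_w f, ← fm_w g]
      exact (Category.assoc _ _ _).symm.trans
        ((congrArg (· ≫ fstr D) hl.w.symm).trans (Category.assoc _ _ _)))
  refine ⟨_, a, b, isPullback_fm_of_left hΔ ?_⟩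
  rw [ha, hb]
  exact hl

lemma isFiniteLimitFibration [HasFiniteLimits C] (hΔ : PreservesPullbackSquares Δ) :
    IsFiniteLimitFibration (gl Δ) :=
  isFiniteLimitFibration_of_isOne_of_isPullback
    (fun I => ⟨Functor.Fiber.mk (a := mkObj (𝟙 (Δ.obj I))) rfl,
      isOne_of_isIso_str (T := mkObj (𝟙 (Δ.obj I))) (inferInstanceAs (IsIso (𝟙 _)))⟩)
    (fun _ _ _ _ f g => exists_isPullback_fm hΔ f g)

section
variable [HasFiniteLimits R] [HasFiniteLimits C]

lemma isPullback_iff_of_fiber (hΔ : PreservesPullbackSquares Δ) {a : W ⟶ A} {b : W ⟶ B} {f : A ⟶ D}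
    {g : B ⟶ D} :
    IsPullback a b f g ↔ IsPullback (fm a).left (fm b).left (fm f).left (fm g).left := by
  haveI := isFiniteLimitFibration hΔ
  rw [← isPullback_fm_iff]
  exact ⟨isPullback_left hΔ, isPullback_fm_of_left hΔ⟩

/-- Arrows descend along the left part, and the descended arrow is compatible with the structure
arrows because the left part can be cancelled. -/
lemma isRegularEpi_of_left (hΔ : PreservesPullbackSquares Δ) (f : A ⟶ B)
    (hf : IsRegularEpi (fm f).left) : IsRegularEpi f := by
  haveI := isFiniteLimitFibration hΔ
  have hk := (isPullback_iff_of_fiber hΔ).1 (IsPullback.of_hasPullback f f)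
  have key : ∀ {Z : (gl Δ).Fiber I} (g : A ⟶ Z), pullback.fst f f ≫ g = pullback.snd f f ≫ g →
      ∃ k : B ⟶ Z, f ≫ k = g := by
    intro Z g hg
    obtain ⟨k, hk'⟩ := IsRegularEpi.exists_of_isKernelPair (fm f).left hk (fm g).left
      (fm_left_congr hg)
    obtain ⟨k', rfl⟩ := exists_fm k (by
      rw [← cancel_epi (fm f).left, ← Category.assoc, hk', fm_w, fm_w])
    exact ⟨k', fiber_hom_ext hk'⟩
  haveI : Epi f := ⟨fun g h w => fiber_hom_ext ((cancel_epi (fm f).left).1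
    (fm_left_congr w))⟩
  refine ⟨⟨⟨_, _, _, pullback.condition, Cofork.IsColimit.mk _
    (fun s => (key s.π s.condition).choose)
    (fun s => (key s.π s.condition).choose_spec) (fun s m hm => ?_)⟩⟩⟩
  rw [← cancel_epi f]
  exact hm.trans (key s.π s.condition).choose_spec.symm

variable (Δ I) in
/-- The vertical arrows that are regular epimorphisms in the glued category. -/
def leftRegularEpi : MorphismProperty ((gl Δ).Fiber I) := fun _ _ f => IsRegularEpi (fm f).left

end

section
variable [HasFiniteLimits R] [Regular C]

/-- Factorizations are taken in `C`; the middle object receives its structure arrow by composing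
with that of the target. -/
lemma regular_and_isRegularEpi_iff (hΔ : PreservesPullbackSquares Δ) (I : R) :
    Regular ((gl Δ).Fiber I) ∧
      ∀ ⦃A B : (gl Δ).Fiber I⦄ (e : A ⟶ B), IsRegularEpi e ↔ IsRegularEpi (fm e).left := by
  haveI := isFiniteLimitFibration hΔ
  haveI : (leftRegularEpi Δ I).IsStableUnderBaseChange :=
    ⟨fun {_ _ _ _ _ _ _ _} h hg => Regular.regularEpiIsStableUnderBaseChange.of_isPullback
      ((isPullback_iff_of_fiber hΔ).1 h) hg⟩
  refine regular_of_factorization (leftRegularEpi Δ I) (fun A B f => ?_)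
    (fun A B e he => isRegularEpi_of_left hΔ e he)
  let F := Regular.strongEpiMonoFactorisation (fm f).left
  have hF : F.e ≫ F.m = (fm f).left := F.fac
  obtain ⟨e, he⟩ := exists_fm (A := A) (B := fob (F.m ≫ fstr B)) F.e (by
    rw [fstr_fob]
    exact (Category.assoc _ _ _).symm.trans ((congrArg (· ≫ fstr B) hF).trans (fm_w f)))
  obtain ⟨m, hm⟩ := exists_fm (A := fob (F.m ≫ fstr B)) (B := B) F.m (fstr_fob _).symm
  refine ⟨_, e, m, ?_, mono_of_left ?_, fiber_hom_ext ?_⟩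
  · change IsRegularEpi (fm e).left
    rw [he]
    exact inferInstanceAs (IsRegularEpi (Regular.strongEpiMonoFactorisation (fm f).left).e)
  · rw [hm]
    exact inferInstanceAs (Mono F.m)
  · change (fm e).left ≫ (fm m).left = _
    rw [he, hm]
    exact hF

lemma isRegularEpi_iff (hΔ : PreservesPullbackSquares Δ) (e : A ⟶ B) :
    IsRegularEpi e ↔ IsRegularEpi (fm e).left :=
  (regular_and_isRegularEpi_iff hΔ I).2 e

lemma isPullback_fstr {J : R} {A : (gl Δ).Fiber J} {B : (gl Δ).Fiber I} {u : J ⟶ I}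
    {f : fo A ⟶ fo B} (hf : (gl Δ).IsStronglyCartesian u f) :
    IsPullback f.left (fstr A) (fstr B) (Δ.map u) := by
  refine IsPullback.of_iso (isPullback_of_isCart (isCart_of_isStronglyCartesian hf)) (Iso.refl _)
    (Iso.refl _) (Δ.mapIso (eqToIso (fo_over A))) (Δ.mapIso (eqToIso (fo_over B)))
    (by simp) (by simp [fstr]) (by simp [fstr]) ?_
  change Δ.map f.right ≫ Δ.map (eqToHom (fo_over B)) = Δ.map (eqToHom (fo_over A)) ≫ Δ.map u
  rw [right_of_isHomLift (A := A) (B := B) (u := u) (f := f) inferInstance, ← Δ.map_comp,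
    ← Δ.map_comp]
  congr 1
  rw [Category.assoc, Category.assoc, eqToHom_trans]
  exact congrArg _ (Category.comp_id u)

/-- This square makes reindexing preserve regular epimorphisms, since in `C` they are stable under
pullback. -/
lemma isPullback_reindex [(gl Δ).IsPreFibered] {J : R} (u : J ⟶ I) (f : A ⟶ B) :
    IsPullback (fm ((reindex (gl Δ) u).map f)).left (rmap (gl Δ) u A).left (rmap (gl Δ) u B).left
      (fm f).left := by
  haveI : (gl Δ).IsStronglyCartesian u (rmap (gl Δ) u A) := inferInstance
  have hA := isPullback_fstr (u := u) (f := rmap (gl Δ) u A) inferInstance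
  have hB := isPullback_fstr (u := u) (f := rmap (gl Δ) u B) inferInstance
  rw [← fm_w ((reindex (gl Δ) u).map f), ← fm_w f] at hA
  exact (IsPullback.of_bot hA (congrArg CommaMorphism.left (reindex_fac (gl Δ) u f)).symm hB).flip

/-- Left parts of cartesian arrows are pullbacks of arrows in the image of `Δ`. So `a.left` is a
regular epimorphism whose kernel pair is given by the left parts of `a₀` and `a₁`, and arrows
descend along it. -/
theorem preStack_aux (hΔ : PreservesPullbackSquares Δ)
    (hΔ' : ∀ ⦃J I : R⦄ (e : J ⟶ I), IsRegularEpi e → IsRegularEpi (Δ.map e))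
    {J K : R} {e : J ⟶ I} {d₀ d₁ : K ⟶ J} (he : IsRegularEpi e) (hk : IsKernelPair e d₀ d₁)
    {A₁ : (gl Δ).Fiber J} {A₂ : (gl Δ).Fiber K} (a : fo A₁ ⟶ fo A) (a₀ a₁ : fo A₂ ⟶ fo A₁)
    (ha : (gl Δ).IsStronglyCartesian e a) (ha₀ : (gl Δ).IsStronglyCartesian d₀ a₀)
    (ha₁ : (gl Δ).IsStronglyCartesian d₁ a₁) (w : a₀ ≫ a = a₁ ≫ a) (g : fo A₁ ⟶ fo B)
    (hg : (gl Δ).IsHomLift e g) (hw : a₀ ≫ g = a₁ ≫ g) :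
    ∃! h : fo A ⟶ fo B, (gl Δ).IsHomLift (𝟙 I) h ∧ a ≫ h = g := by
  have h := isPullback_fstr ha
  haveI : IsRegularEpi a.left :=
    Regular.regularEpiIsStableUnderBaseChange.of_isPullback h.flip (hΔ' e he)
  have hka : IsKernelPair a.left a₁.left a₀.left := by
    have ho := (isPullback_fstr ha₁).paste_vert (hΔ hk.flip)
    rw [← fstr_w (A := A₂) (B := A₁) (u := d₀) (f := a₀) inferInstance,
      ← fstr_w (A := A₁) (B := A) (u := e) (f := a) inferInstance] at ho
    exact IsPullback.of_bot ho (congrArg CommaMorphism.left w).symm h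
  obtain ⟨k, hk'⟩ := IsRegularEpi.exists_of_isKernelPair a.left hka g.left
    (congrArg CommaMorphism.left hw).symm
  obtain ⟨h, hh, rfl⟩ := exists_lift (A := A) (B := B) (u := 𝟙 I) k (by
    rw [← cancel_epi a.left, ← Category.assoc, hk', Δ.map_id, Category.comp_id, fstr_w hg,
      fstr_w (A := A₁) (B := A) (u := e) (f := a) inferInstance])
  refine ⟨h, ⟨hh, CommaMorphism.ext hk' ?_⟩, ?_⟩
  · have h3 : (gl Δ).IsHomLift (e ≫ 𝟙 I) (a ≫ h) := inferInstance
    rw [Category.comp_id] at h3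
    exact map_eq_map_of_isHomLift h3 hg
  · rintro h' ⟨hh', h2⟩
    refine CommaMorphism.ext ?_ (map_eq_map_of_isHomLift (p := gl Δ) hh' hh)
    rw [← cancel_epi a.left, hk', ← h2]
    rfl

theorem isPreStack (hΔ : PreservesPullbackSquares Δ)
    (hΔ' : ∀ ⦃J I : R⦄ (e : J ⟶ I), IsRegularEpi e → IsRegularEpi (Δ.map e)) :
    IsPreStack (gl Δ) := by
  intro I J K e d₀ d₁ he hk A A₁ A₂ B B₁ B₂ a a₀ a₁ b b₀ b₁ ha ha₀ ha₁ w hb hb₀ hb₁ w' f₁ f₂ hf₁ hf₂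
    h₀ h₁
  have hA := IsHomLift.codomain_eq (gl Δ) e a
  have hA₁ := IsHomLift.domain_eq (gl Δ) e a
  have hA₂ := IsHomLift.domain_eq (gl Δ) d₀ a₀
  have hB := IsHomLift.codomain_eq (gl Δ) e b
  have hg : (gl Δ).IsHomLift e (f₁ ≫ b) := by
    have : (gl Δ).IsHomLift (𝟙 J ≫ e) (f₁ ≫ b) := inferInstance
    rwa [Category.id_comp] at this
  refine preStack_aux hΔ hΔ' he hk (A := Functor.Fiber.mk hA) (A₁ := Functor.Fiber.mk hA₁)
    (A₂ := Functor.Fiber.mk hA₂) (B := Functor.Fiber.mk hB) a a₀ a₁ ha ha₀ ha₁ w (f₁ ≫ b) hg ?_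
  change a₀ ≫ f₁ ≫ b = a₁ ≫ f₁ ≫ b
  rw [← Category.assoc, ← h₀, Category.assoc, w', ← Category.assoc, h₁, Category.assoc]

/-- Composing a structure arrow with `Δ.map u` leaves the left part alone, so identities on left
parts provide the cocartesian lifts, and any other cocartesian arrow differs from one of them by an
isomorphism. Stability and disjointness of sums thus become statements about isomorphisms in `C`. -/
lemma isCocart_iff {A B : Comma (Functor.id C) Δ} (f : A ⟶ B) :
    IsCocart (gl Δ) f ↔ IsIso f.left := by
  have key : ∀ {A B : Comma (Functor.id C) Δ} (f : A ⟶ B), IsIso f.left → IsCocart (gl Δ) f := by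
    intro A B f hf
    refine { universal_property' := ?_ }
    intro X t x hx
    have hx' : x.right = f.right ≫ t := right_eq_of_isHomLift hx
    refine ⟨mkHom (inv f.left ≫ x.left) t ?_, ⟨isHomLift_of_right_eq rfl,
      CommaMorphism.ext (IsIso.hom_inv_id_assoc _ _) hx'.symm⟩, ?_⟩
    · rw [Category.assoc, IsIso.inv_comp_eq, str_w, hx', ← Category.assoc, str_w, Δ.map_comp,
        Category.assoc]
    · rintro y ⟨hy, rfl⟩
      have hy' : y.right = t := right_eq_of_isHomLift hy
      exact CommaMorphism.ext (IsIso.inv_hom_id_assoc f.left y.left).symm hy'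
  refine ⟨fun h => ?_, key f⟩
  let g : A ⟶ mkObj (str A ≫ Δ.map f.right) := mkHom (𝟙 A.left) f.right (Category.id_comp _)
  have hg : (gl Δ).IsStronglyCocartesian f.right g :=
    key g (inferInstanceAs (IsIso (𝟙 A.left)))
  have hf : (gl Δ).IsStronglyCocartesian f.right f := h
  let e := IsCocartesian.codomainUniqueUpToIso (gl Δ) f.right f g
  have he : f ≫ e.hom = g := IsCocartesian.fac (gl Δ) f.right f g
  have h1 : f.left ≫ e.hom.left = 𝟙 A.left := congrArg CommaMorphism.left he
  haveI := isIso_left e.hom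
  have : f.left = inv e.hom.left := by
    rw [← cancel_mono e.hom.left, IsIso.inv_hom_id]
    exact h1
  rw [this]
  infer_instance

theorem isEquivalenceRelation_left (hΔ : PreservesPullbackSquares Δ) {p₁ p₂ : B ⟶ A}
    (h : IsEquivalenceRelation p₁ p₂) : IsEquivalenceRelation (fm p₁).left (fm p₂).left := by
  obtain ⟨⟨h⟩⟩ := h
  have hc : IsPullback h.c.fst h.c.snd p₂ p₁ :=
    ⟨⟨h.c.condition⟩, ⟨h.isLimit.ofIsoLimit (PullbackCone.eta _)⟩⟩
  have hc' := (isPullback_iff_of_fiber hΔ).1 hc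
  refine ⟨⟨{
    r := (fm h.r).left
    s := (fm h.s).left
    t := (fm h.t).left
    c := PullbackCone.mk _ _ hc'.w
    isLimit := hc'.isLimit
    reflexivity₁ := fm_left_congr h.reflexivity₁
    reflexivity₂ := fm_left_congr h.reflexivity₂
    symmetry₁ := fm_left_congr h.symmetry₁
    symmetry₂ := fm_left_congr h.symmetry₂
    transitivity₁ := fm_left_congr h.transitivity₁
    transitivity₂ := fm_left_congr h.transitivity₂
    right_cancellation := fun {Z} l l' h1 h2 => ?_ }⟩⟩
  -- The arrows `l` and `l'` of `C` become vertical once `l ≫ fstr B` is taken as the structure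
  -- arrow of their domain, and this is also the composite for `l'`.
  have w : l' ≫ fstr B = l ≫ fstr B := by
    rw [← fm_w p₁, ← Category.assoc, ← Category.assoc, h1]
  obtain ⟨m, hm⟩ := exists_fm (A := fob (l ≫ fstr B)) (B := B) l (fstr_fob _).symm
  obtain ⟨m', hm'⟩ := exists_fm (A := fob (l ≫ fstr B)) (B := B) l' (w.trans (fstr_fob _).symm)
  have hmm : m = m' := h.right_cancellation _ _
    (fiber_hom_ext ((congrArg (· ≫ (fm p₁).left) hm).trans
      (h1.trans (congrArg (· ≫ (fm p₁).left) hm'.symm))))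
    (fiber_hom_ext ((congrArg (· ≫ (fm p₂).left) hm).trans
      (h2.trans (congrArg (· ≫ (fm p₂).left) hm'.symm))))
  exact hm.symm.trans ((fm_left_congr hmm).trans hm')

end

section
variable [Regular R] [IsExact C]

/-- The quotient is formed in `C`. Its structure arrow is induced by that of `A`, which coequalizes
the relation because both projections are vertical. -/
theorem isExact_fiber (hΔ : PreservesPullbackSquares Δ) (I : R) : IsExact ((gl Δ).Fiber I) where
  toRegular := (regular_and_isRegularEpi_iff hΔ I).1
  effective {A B} p₁ p₂ h := by
    obtain ⟨Y, π, hπ⟩ := IsExact.effective _ _ (isEquivalenceRelation_left hΔ h)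
    let F := Regular.strongEpiMonoFactorisation π
    have hF : F.e ≫ F.m = π := F.fac
    haveI : IsRegularEpi F.e :=
      inferInstanceAs (IsRegularEpi (Regular.strongEpiMonoFactorisation π).e)
    have hk : IsKernelPair F.e (fm p₁).left (fm p₂).left := by
      rw [← hF] at hπ
      refine hπ.cancel_right_of_mono (f₂ := F.m)
    obtain ⟨k, hk'⟩ := IsRegularEpi.exists_of_isKernelPair F.e hk (fstr A)
      ((fm_w p₁).trans (fm_w p₂).symm)
    obtain ⟨m, hm⟩ := exists_fm (A := A) (B := fob k) F.e
      ((congrArg (F.e ≫ ·) (fstr_fob k)).trans hk')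
    refine ⟨fob k, m, (isPullback_iff_of_fiber hΔ).2 ?_⟩
    rw [hm]
    exact hk

theorem isFiberedPretopos (hΔ : PreservesPullbackSquares Δ)
    (hΔ' : ∀ ⦃J I : R⦄ (e : J ⟶ I), IsRegularEpi e → IsRegularEpi (Δ.map e)) :
    IsFiberedPretopos (gl Δ) where
  toIsFiniteLimitFibration := isFiniteLimitFibration hΔ
  preStack := isPreStack hΔ hΔ'
  regular I := (regular_and_isRegularEpi_iff hΔ I).1
  reindex_regular {J I} u := by
    haveI := isFiniteLimitFibration hΔ
    refine ⟨inferInstance, fun {A B} f hf => ?_⟩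
    rw [isRegularEpi_iff hΔ] at hf ⊢
    exact Regular.regularEpiIsStableUnderBaseChange.of_isPullback (isPullback_reindex u f).flip hf
  exact := isExact_fiber hΔ
  sums := {
    exists_sum := fun A I u => ⟨mkObj (str A ≫ Δ.map u), mkHom (𝟙 A.left) u (Category.id_comp _),
      (isCocart_iff (mkHom (𝟙 A.left) u (Category.id_comp _) :
        A ⟶ mkObj (str A ≫ Δ.map u))).2 (inferInstanceAs (IsIso (𝟙 A.left)))⟩
    stable := fun {W A B D a b f g} h hf => by
      rw [isCocart_iff] at hf ⊢
      exact MorphismProperty.of_isPullback (P := .isomorphisms C) (isPullback_left hΔ h) hf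
    disjoint := fun {A B K s k₀ k₁ d} hs hk hd _ => by
      rw [isCocart_iff] at hs ⊢
      have hk₀ : IsIso k₀.left :=
        MorphismProperty.of_isPullback (P := .isomorphisms C) (isPullback_left hΔ hk).flip hs
      have h : d.left ≫ k₀.left = 𝟙 A.left := congrArg CommaMorphism.left hd
      have : d.left = inv k₀.left := by
        rw [← cancel_mono k₀.left, IsIso.inv_hom_id]
        exact h
      rw [this]
      infer_instance }

/-- Every arrow is a cocartesian one, which is a cover with invertible left part, followed by a
vertical one; and vertical covers are the regular epimorphisms of the fiber. -/
theorem sColl_iff (hΔ : PreservesPullbackSquares Δ)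
    (hΔ' : ∀ ⦃J I : R⦄ (e : J ⟶ I), IsRegularEpi e → IsRegularEpi (Δ.map e))
    {A B : Comma (Functor.id C) Δ} (f : A ⟶ B) : SColl (gl Δ) f ↔ IsRegularEpi f.left := by
  haveI := isFiberedPretopos hΔ hΔ'
  obtain ⟨D, s, v, -, hs, hv, rfl⟩ := exists_cocart_vertical (p := gl Δ) f
  have hs' := (isCocart_iff s).1 hs
  obtain ⟨v', hv'⟩ := exists_fm_eq (p := gl Δ) (I := (gl Δ).obj B)
    (A := Functor.Fiber.mk (a := D) (IsHomLift.domain_eq (gl Δ) (𝟙 ((gl Δ).obj B)) v))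
    (B := Functor.Fiber.mk (a := B) rfl) v hv
  have h1 : SColl (gl Δ) v ↔ IsRegularEpi v.left := by
    have := (sColl_fm_iff v').trans (isRegularEpi_iff hΔ v')
    rwa [hv'] at this
  have h2 : SColl (gl Δ) (s ≫ v) ↔ SColl (gl Δ) v :=
    ⟨fun h => h.of_comp, fun h => (sColl_of_isCocart hs).comp h⟩
  rw [h2, h1, Comma.comp_left]
  exact (MorphismProperty.cancel_left_of_respectsIso (P := .regularEpi C) s.left v.left).symm

end

end Gluing

/-! ### Descent in a pre-stack -/

section
variable {R : Type u₁} [Category.{v₁} R] [HasFiniteLimits R] {E : Type u₂} [Category.{v₂} E]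
  {p : E ⥤ R}

/-- In a pre-stack, arrows descend along cartesian arrows over regular epimorphisms. -/
theorem IsPreStack.existsUnique_desc [IsFiniteLimitFibration p] (hp : IsPreStack p) {X X' W : E}
    {c : X' ⟶ X} (hc : IsCoverCart p c) (hW : p.obj W = p.obj X) (g : X' ⟶ W)
    (hg : p.map g ≫ eqToHom hW = p.map c)
    (H : ∀ ⦃Z : E⦄ (x y : Z ⟶ X'), x ≫ c = y ≫ c → x ≫ g = y ≫ g) :
    ∃! h : X ⟶ W, p.IsHomLift (𝟙 (p.obj X)) h ∧ c ≫ h = g := by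
  haveI := totalHasFiniteLimits p
  have hk := IsPullback.of_hasPullback c c
  have hkp := map_isPullback (p := p) hk
  have hc1 := hc.1
  have d₁ : IsCart p (pullback.snd c c) := isCart_of_isPullback hk hc.1
  have d₀ : IsCart p (pullback.fst c c) := isCart_of_isPullback hk.flip hc.1
  have hg' : p.IsHomLift (p.map c) g := by
    rw [← hg]
    exact (IsHomLift.lift_comp_eqToHom_iff _ _ _ _).2 inferInstance
  let B : p.Fiber (p.obj X) := Functor.Fiber.mk hW
  let b := rmap p (p.map c) B
  have hb : p.IsStronglyCartesian (p.map c) b := inferInstance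
  let g₀ : X' ⟶ fo B := g
  have hg₀ : p.IsHomLift (p.map c) g₀ := hg'
  let f₁ := IsStronglyCartesian.map p (p.map c) b (Category.id_comp (p.map c)).symm g₀
  have hf₁ : f₁ ≫ b = g := IsStronglyCartesian.fac p (p.map c) b _ g₀
  have hf₁' : p.IsHomLift (𝟙 (p.obj X')) f₁ := inferInstance
  let b₀ := rmap p (p.map (pullback.fst c c)) ((reindex p (p.map c)).obj B)
  have hb₀ : p.IsStronglyCartesian (p.map (pullback.fst c c)) b₀ := inferInstance
  have hbb : p.IsHomLift (p.map (pullback.snd c c) ≫ p.map c) (b₀ ≫ b) := by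
    rw [← hkp.w]
    infer_instance
  -- Descent data on the target: since `b` is cartesian, the second arrow `b₁` is determined by the
  -- first through `b₁ ≫ b = b₀ ≫ b`.
  let b₁ := IsStronglyCartesian.map p (p.map c) b (g := p.map (pullback.snd c c)) rfl (b₀ ≫ b)
  have hb₁ : b₁ ≫ b = b₀ ≫ b := IsStronglyCartesian.fac p (p.map c) b rfl (b₀ ≫ b)
  have hb₁l : p.IsHomLift (p.map (pullback.snd c c)) b₁ := inferInstance
  have hb₁c : p.IsStronglyCartesian (p.map (pullback.snd c c)) b₁ := by
    haveI : p.IsStronglyCartesian (p.map (pullback.snd c c) ≫ p.map c) (b₁ ≫ b) := by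
      rw [hb₁, ← hkp.w]
      infer_instance
    exact IsStronglyCartesian.of_comp p (f := p.map (pullback.snd c c)) (g := p.map c) (φ := b₁) (ψ := b)
  have hf₂ : p.IsHomLift (p.map (pullback.fst c c)) (pullback.fst c c ≫ f₁) := by
    have : p.IsHomLift (p.map (pullback.fst c c) ≫ 𝟙 (p.obj X')) (pullback.fst c c ≫ f₁) :=
      inferInstance
    rwa [Category.comp_id] at this
  let f₂ := IsStronglyCartesian.map p (p.map (pullback.fst c c)) b₀
    (Category.id_comp (p.map (pullback.fst c c))).symm (pullback.fst c c ≫ f₁)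
  have hf₂f : f₂ ≫ b₀ = pullback.fst c c ≫ f₁ := IsStronglyCartesian.fac p _ b₀ _ _
  have key := hp (p.map c) _ _ hc.2 hkp c (pullback.fst c c) (pullback.snd c c) b b₀ b₁ hc.1 d₀ d₁
    pullback.condition hb hb₀ hb₁c hb₁.symm f₁ f₂ hf₁' inferInstance hf₂f (by
      have h1 : p.IsHomLift (p.map (pullback.snd c c)) (f₂ ≫ b₁) := by
        have : p.IsHomLift (𝟙 _ ≫ p.map (pullback.snd c c)) (f₂ ≫ b₁) := inferInstance
        rwa [Category.id_comp] at this
      have h2 : p.IsHomLift (p.map (pullback.snd c c)) (pullback.snd c c ≫ f₁) := by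
        have : p.IsHomLift (p.map (pullback.snd c c) ≫ 𝟙 (p.obj X')) (pullback.snd c c ≫ f₁) :=
          inferInstance
        rwa [Category.comp_id] at this
      apply IsStronglyCartesian.ext p (p.map c) b (p.map (pullback.snd c c))
      rw [Category.assoc, hb₁, ← Category.assoc, hf₂f, Category.assoc, Category.assoc, hf₁]
      exact H _ _ pullback.condition)
  rw [hf₁] at key
  exact key

end

/-! ### The embedding of discrete objects -/

section
variable {R : Type u₁} [Category.{v₁} R] [HasFiniteLimits R] {S : BasedCategory.{v₂, u₂} R}
  [IsFiniteLimitFibration S.p] {D : ExDoctrine.{v₂, u₂, w} S.obj}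

lemma isHomLift_congr {A B : S.obj} {I J : R} {u : I ⟶ J} {f g : A ⟶ B} (h : f = g)
    (hg : S.p.IsHomLift u g) : S.p.IsHomLift u f := h ▸ hg

lemma isHomLift_one {V : S.obj} {I : R} (z : V ⟶ one S.p I) :
    S.p.IsHomLift (S.p.map z ≫ eqToHom (one_over S.p I)) z :=
  (IsHomLift.lift_comp_eqToHom_iff _ _ _ _).2 inferInstance

lemma isHomLift_comp_oneFunctor_map {V : S.obj} {I J K : R} {t : K ⟶ I} {z : V ⟶ one S.p I}
    (h : S.p.IsHomLift t z) (u : I ⟶ J) : S.p.IsHomLift (t ≫ u) (z ≫ (oneFunctor S.p).map u) :=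
  @IsHomLift.comp _ _ _ _ S.p _ _ _ _ _ _ t u z ((oneFunctor S.p).map u) h
    (oneFunctor_map_isHomLift S.p u)

lemma oneFunctor_map_isPullback {W X Y Z : R} {a : W ⟶ X} {b : W ⟶ Y} {f : X ⟶ Z} {g : Y ⟶ Z}
    (h : IsPullback a b f g) : IsPullback ((oneFunctor S.p).map a) ((oneFunctor S.p).map b)
      ((oneFunctor S.p).map f) ((oneFunctor S.p).map g) := by
  refine isPullback_of_existsUnique (by rw [← Functor.map_comp, h.w, Functor.map_comp])
    (fun V x y hxy => ?_) (fun V l l' h1 h2 => ?_)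
  · have e : (S.p.map x ≫ eqToHom (one_over S.p X)) ≫ f =
        (S.p.map y ≫ eqToHom (one_over S.p Y)) ≫ g := by
      have h1 := isHomLift_comp_oneFunctor_map (isHomLift_one x) f
      have h2 := isHomLift_comp_oneFunctor_map (isHomLift_one y) g
      exact homLift_unique h1 (isHomLift_congr hxy h2)
    obtain ⟨l, hl, -⟩ := (isOne_one (p := S.p) W).existsUnique (one_over S.p W) rfl (h.lift _ _ e)
    have ha := isHomLift_comp_oneFunctor_map hl a
    have hb := isHomLift_comp_oneFunctor_map hl b
    rw [h.lift_fst] at ha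
    rw [h.lift_snd] at hb
    exact ⟨l, (isOne_one X).hom_ext (map_eq_map_of_isHomLift ha (isHomLift_one x)),
      (isOne_one Y).hom_ext (map_eq_map_of_isHomLift hb (isHomLift_one y))⟩
  · refine (isOne_one W).hom_ext ?_
    rw [← cancel_mono (eqToHom (one_over S.p W))]
    have ha := isHomLift_comp_oneFunctor_map (isHomLift_one l') a
    have hb := isHomLift_comp_oneFunctor_map (isHomLift_one l') b
    exact h.hom_ext
      (homLift_unique (isHomLift_comp_oneFunctor_map (isHomLift_one l) a) (isHomLift_congr h1 ha))
      (homLift_unique (isHomLift_comp_oneFunctor_map (isHomLift_one l) b) (isHomLift_congr h2 hb))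

lemma isIso_bang {A : S.obj} (hA : IsOne S.p A) : IsIso (bang S.p A) := by
  obtain ⟨g, hg, -⟩ := hA.existsUnique rfl (one_over S.p (S.p.obj A)) (𝟙 (S.p.obj A))
  have hb : S.p.IsHomLift (𝟙 (S.p.obj A)) (bang S.p A) := toOne_isHomLift S.p _
  have h1 : S.p.IsHomLift (𝟙 (S.p.obj A)) (bang S.p A ≫ g) := inferInstance
  have h2 : S.p.IsHomLift (𝟙 (S.p.obj A)) (g ≫ bang S.p A) := inferInstance
  exact ⟨g, hA.hom_ext (map_eq_map_of_isHomLift h1 (IsHomLift.id rfl)),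
    (isOne_one _).hom_ext (map_eq_map_of_isHomLift h2 (IsHomLift.id (one_over S.p _)))⟩

lemma constFunctor_preservesPullbackSquares (hD : D.Comprehension) :
    Gluing.PreservesPullbackSquares (constFunctor S D) :=
  fun _ _ _ _ _ _ _ _ h => ExDoctrine.graphFunctor_map_isPullback hD (oneFunctor_map_isPullback h)

lemma discrete_isLexFunctor (hD : D.Comprehension) : IsLexFunctor (discrete S D) where
  map_isPullback h := Gluing.isPullback_of_left_right (constFunctor_preservesPullbackSquares hD)
    (ExDoctrine.graphFunctor_map_isPullback hD h) (map_isPullback (p := S.p) h)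
  map_isOne {A} hA := by
    have : IsIso (bang S.p A) := isIso_bang hA
    exact Gluing.isOne_of_isIso_str (T := (discrete S D).obj A)
      (inferInstanceAs (IsIso (D.graphFunctor.map (bang S.p A))))

/-- Represent the structure relation `φ` by an arrow `u` from some `U` into the product of `A` with
the terminal object of the fiber. Its second component provides the base arrow, and its first
component is surjective because `φ` is total. -/
theorem discrete_exists_cover (hD : D.Comprehension) (Y : (glue S D).obj) :
    ∃ (U : S.obj) (s : (discrete S D).obj U ⟶ Y), ExDoctrine.Surj (A := D.eqObj U) s.left := by
  let A : D.EqObj := Y.left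
  let φ : A ⟶ D.eqObj (one S.p Y.right) := Y.hom
  obtain ⟨U, u, hu⟩ := hD (ExDoctrine.EqHom.rel φ)
  have hφ : ∀ {X : S.obj} {x : X ⟶ A.obj} {k : X ⟶ one S.p Y.right}, ExDoctrine.App φ x k ↔
      ∃ (Z : S.obj) (e : Z ⟶ X) (w : Z ⟶ U), D.Cov e ∧ e ≫ x = w ≫ u ≫ prod.fst ∧
        e ≫ k = w ≫ u ≫ prod.snd := by
    intro X x k
    have h1 := ExDoctrine.rel_ofArrow hD (u ≫ prod.fst) (u ≫ prod.snd) (x := x) (y := k)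
    rw [← prod.comp_lift, prod.lift_fst_snd, Category.comp_id, ← hu] at h1
    exact h1
  let t : S.p.obj U ⟶ Y.right := S.p.map (u ≫ prod.snd) ≫ eqToHom (one_over S.p Y.right)
  have ht : bang S.p U ≫ (oneFunctor S.p).map t = u ≫ prod.snd := by
    have h1 : S.p.IsHomLift (𝟙 (S.p.obj U)) (bang S.p U) := toOne_isHomLift S.p _
    have h3 := isHomLift_comp_oneFunctor_map h1 t
    rw [Category.id_comp] at h3
    exact (isOne_one _).hom_ext (map_eq_map_of_isHomLift h3 (isHomLift_one (u ≫ prod.snd)))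
  have hw : ExDoctrine.elt hD (A := A) (u ≫ prod.fst) ≫ φ =
      D.graphFunctor.map (bang S.p U) ≫ (constFunctor S D).map t := by
    have h1 : ExDoctrine.elt hD (A := A) (u ≫ prod.fst) ≫ φ =
        ExDoctrine.elt hD (A := D.eqObj (one S.p Y.right)) (u ≫ prod.snd) :=
      (ExDoctrine.elt_comp_eq_elt_iff hD).2 (hφ.2 ⟨U, 𝟙 U, 𝟙 U, ExDoctrine.cov_id U, rfl, rfl⟩)
    have h2 : D.graphFunctor.map (u ≫ prod.snd) =
        D.graphFunctor.map (bang S.p U) ≫ (constFunctor S D).map t := by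
      rw [← ht]
      exact D.graphFunctor.map_comp _ _
    rw [h1, ← h2]
    exact hD.hom_ext fun X x k h => ExDoctrine.app_graph.2 ((ExDoctrine.app_elt hD).1 h)
  refine ⟨U, Gluing.mkHom (A := (discrete S D).obj U) (B := Y)
    (ExDoctrine.elt hD (A := A) (u ≫ prod.fst)) t hw, fun X x => ?_⟩
  obtain ⟨Z, e, k, he, hk⟩ := hD.exists_app φ x
  obtain ⟨Z', e', w, he', h1, -⟩ := hφ.1 hk
  refine ⟨Z', e' ≫ e, w, he'.comp he, (ExDoctrine.app_elt hD).2 (.of_eq ?_)⟩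
  rw [← h1, Category.assoc]

end

/-! ### Gluing for a doctrine with comprehension -/

section
variable {R : Type u₁} [Category.{v₁} R] [Regular R] {S : BasedCategory.{v₂, u₂} R}
  [IsFiniteLimitFibration S.p] {D : ExDoctrine.{v₂, u₂, w} S.obj}

lemma constFunctor_map_isRegularEpi (hD : D.Comprehension)
    (h : ∀ ⦃J I : R⦄ (e : J ⟶ I), IsRegularEpi e → D.Cov ((oneFunctor S.p).map e)) ⦃J I : R⦄
    (e : J ⟶ I) (he : IsRegularEpi e) : IsRegularEpi ((constFunctor S D).map e) :=
  (ExDoctrine.isRegularEpi_iff hD _).2 ((ExDoctrine.surj_graph_iff hD _).2 (h e he))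

theorem glue_isFiberedPretopos (hD : D.Comprehension)
    (h : ∀ ⦃J I : R⦄ (e : J ⟶ I), IsRegularEpi e → D.Cov ((oneFunctor S.p).map e)) :
    IsFiberedPretopos (glue S D).p := by
  haveI := ExDoctrine.isExact hD
  exact Gluing.isFiberedPretopos (constFunctor_preservesPullbackSquares hD)
    (constFunctor_map_isRegularEpi hD h)

theorem sColl_glue_iff (hD : D.Comprehension)
    (h : ∀ ⦃J I : R⦄ (e : J ⟶ I), IsRegularEpi e → D.Cov ((oneFunctor S.p).map e))
    {X Y : (glue S D).obj} (f : X ⟶ Y) : SColl (glue S D).p f ↔ ExDoctrine.Surj f.left := by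
  haveI := ExDoctrine.isExact hD
  exact (Gluing.sColl_iff (constFunctor_preservesPullbackSquares hD)
    (constFunctor_map_isRegularEpi hD h) f).trans (ExDoctrine.isRegularEpi_iff hD f.left)

theorem sColl_discrete_map_iff (hD : D.Comprehension)
    (h : ∀ ⦃J I : R⦄ (e : J ⟶ I), IsRegularEpi e → D.Cov ((oneFunctor S.p).map e))
    {A B : S.obj} (f : A ⟶ B) : SColl (glue S D).p ((discrete S D).map f) ↔ D.Cov f :=
  (sColl_glue_iff hD h _).trans (ExDoctrine.surj_graph_iff hD f)

end

/-! ### Covers and predicates of a geometric pre-stack -/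

section
variable {R : Type u₁} [Category.{v₁} R] [HasFiniteLimits R]

/-- The pre-stack condition enters here. The pullback of `c` along `t` lifts through `k`; the lift
satisfies the descent condition because `k` is monic, so it descends to a vertical section. -/
lemma sColl_of_isCoverCart {E : Type u₂} [Category.{v₂} E] {p : E ⥤ R} [IsFiniteLimitPreStack p]
    {X V : E} {c : X ⟶ V} (hc : IsCoverCart p c)
    (hst : ∀ ⦃W A B D : E⦄ ⦃a : W ⟶ A⦄ ⦃b : W ⟶ B⦄ ⦃f : A ⟶ D⦄ ⦃g : B ⟶ D⦄,
      IsPullback a b f g → IsCoverCart p f → IsCoverCart p b) : SColl p c := by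
  haveI := totalHasFiniteLimits p
  intro X t W k hk H
  have h := IsPullback.of_hasPullback c t
  have hc' := hst h hc
  obtain ⟨s, hs⟩ := H (pullback.fst c t) (pullback.snd c t) pullback.condition
  have hk' : p.IsHomLift (𝟙 (p.obj X)) k := hk.1
  have hW : p.obj W = p.obj X := IsHomLift.domain_eq p (𝟙 (p.obj X)) k
  have hkm : p.map k = eqToHom hW := by
    have := IsHomLift.fac' p (𝟙 (p.obj X)) k
    simpa using this
  have hp := IsFiniteLimitPreStack.preStack (p := p)
  haveI := hk.2
  obtain ⟨l, ⟨hl, hl'⟩, -⟩ := hp.existsUnique_desc hc' hW s (by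
    rw [← hkm, ← p.map_comp, hs]) (fun Z x y hxy => by
      rw [← cancel_mono k, Category.assoc, Category.assoc, hs, hxy])
  refine ⟨l, (hp.existsUnique_desc hc' rfl (pullback.snd c t) (by simp)
    (fun Z x y hxy => hxy)).unique ⟨?_, ?_⟩ ⟨?_, Category.comp_id _⟩⟩
  · infer_instance
  · rw [← Category.assoc, hl', hs]
  · exact IsHomLift.id rfl

end

section
variable {R : Type u₁} [Category.{v₁} R] [HasFiniteLimits R] {S : BasedCategory.{v₂, u₂} R}
  [IsGeometricPreStack S.p]

/-- Both sides say that `e` factors through no proper vertical subobject. On the left, stability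
under base change is provided by `VSub.ex_elim`. -/
lemma cov_subDoctrine_iff {U V : S.obj} (e : U ⟶ V) : (subDoctrine S).Cov e ↔ SColl S.p e := by
  constructor
  · intro h X t W k hk H
    haveI := hk.2
    have h1 : (VSub.ex e (⊤ : VSub S U)).1.Factors t :=
      VSub.le_iff.1 (show (⊤ : VSub S V) ≤ _ from h) X t ((Subobject.top_factors t))
    have h2 := VSub.ex_elim e ⊤ t (𝟙 X) ⟨Subobject.mk k, W, k, hk.2, hk.1, rfl⟩ h1
      (fun Y y r _ hy => (factors_mk k _).2 (by
        rw [Category.comp_id]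
        exact H y r hy))
    exact (factors_mk k _).1 h2
  · intro h
    change (⊤ : VSub S V) ≤ VSub.ex e ⊤
    have h1 : (VSub.ex e (⊤ : VSub S U)).1.Factors e := by
      have := VSub.factors_ex e ⊤ (𝟙 U) (Subobject.top_factors _)
      rwa [Category.id_comp] at this
    generalize VSub.ex e (⊤ : VSub S U) = Q at *
    obtain ⟨Q, W, n, hn, hv, rfl⟩ := Q
    obtain ⟨k, hk⟩ := (factors_mk n _).1 h1
    refine VSub.le_iff.2 fun X x _ => (factors_mk n x).2 ?_
    obtain ⟨s, hs⟩ := h.exists_lift (IsVMono.isPred ⟨hv, hn⟩) (𝟙 V) k (by rw [hk, Category.comp_id])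
    exact ⟨x ≫ s, by rw [Category.assoc, hs, Category.comp_id]⟩

lemma mem_subDoctrine_iff {A X : S.obj} (P : VSub S A) (x : X ⟶ A) :
    (subDoctrine S).Mem P x ↔ P.1.Factors x := by
  constructor
  · intro h
    have := VSub.le_iff.1 (show (⊤ : VSub S X) ≤ VSub.pull x P from h) X (𝟙 X)
      (Subobject.top_factors _)
    rwa [VSub.factors_pull, Category.id_comp] at this
  · intro h
    change (⊤ : VSub S X) ≤ VSub.pull x P
    refine VSub.le_iff.2 fun Y y _ => ?_
    rw [VSub.factors_pull]
    exact Subobject.factors_of_factors_right _ h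

variable (S) in
lemma comprehension_subDoctrine : (subDoctrine S).Comprehension := by
  rintro A ⟨P, U, m, hm, hv, rfl⟩
  refine ⟨U, m, le_antisymm ?_ ?_⟩
  · change _ ≤ VSub.ex m ⊤
    refine VSub.le_iff.2 fun X x hx => ?_
    obtain ⟨t, rfl⟩ := (factors_mk m x).1 hx
    exact VSub.factors_ex m ⊤ t (Subobject.top_factors _)
  · refine (VSub.ex_le_iff _ _ _).2 (VSub.le_iff.2 fun X x _ => (VSub.factors_pull _ _ _).2 ?_)
    exact (factors_mk m _).2 ⟨x, rfl⟩

end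

/-! ### Density of the embedding into sheaves -/

section
variable {R : Type u₁} [Category.{v₁} R] [Regular R] {S : BasedCategory.{v₂, u₂} R}

lemma isCoverCart_oneFunctor_map [IsFiniteLimitFibration S.p] {J I : R} (e : J ⟶ I)
    (he : IsRegularEpi e) : IsCoverCart S.p ((oneFunctor S.p).map e) := by
  refine ⟨(isOne_one J).isCart (isOne_one I) _, ?_⟩
  have h := oneFunctor_map_isHomLift S.p e
  have := IsHomLift.fac' S.p e ((oneFunctor S.p).map e)
  rw [this]
  have h1 : MorphismProperty.regularEpi R (e ≫ eqToHom (one_over S.p I).symm) :=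
    (MorphismProperty.cancel_right_of_respectsIso (P := .regularEpi R) _ _).2 he
  exact (MorphismProperty.cancel_left_of_respectsIso (P := .regularEpi R) _ _).2 h1

variable [IsGeometricPreStack S.p]

lemma cov_oneFunctor_map ⦃J I : R⦄ (e : J ⟶ I) (he : IsRegularEpi e) :
    (subDoctrine S).Cov ((oneFunctor S.p).map e) :=
  (cov_subDoctrine_iff _).2 (sColl_of_isCoverCart (isCoverCart_oneFunctor_map e he)
    (fun _ _ _ _ _ _ _ _ h hf => isCoverCart_of_isPullback h hf))

variable (S) in
theorem isFiberedPretopos_sheaves : IsFiberedPretopos (Sheaves S).p :=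
  glue_isFiberedPretopos (comprehension_subDoctrine S) cov_oneFunctor_map

variable (S) in
theorem isCoherentFunctor_zeta : IsCoherentFunctor (zeta S) where
  toIsLexFunctor := discrete_isLexFunctor (comprehension_subDoctrine S)
  map_sColl h := (sColl_discrete_map_iff (comprehension_subDoctrine S) cov_oneFunctor_map _).2
    ((cov_subDoctrine_iff _).2 h)

variable (S) in
theorem zeta_exists_cover (Y : (Sheaves S).obj) :
    ∃ (U : S.obj) (s : (zeta S).obj U ⟶ Y), SColl (Sheaves S).p s := by
  obtain ⟨U, s, hs⟩ := discrete_exists_cover (comprehension_subDoctrine S) Y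
  exact ⟨U, s, (sColl_glue_iff (comprehension_subDoctrine S) cov_oneFunctor_map s).2 hs⟩

/-- Arrows with the same graph agree after a cover; as their base arrows coincide, `SColl.hom_ext`
makes them equal. -/
lemma zeta_map_injective {A B : S.obj} {f g : A ⟶ B} (h : (zeta S).map f = (zeta S).map g) :
    f = g := by
  have h1 : (subDoctrine S).graphFunctor.map f = (subDoctrine S).graphFunctor.map g :=
    congrArg CommaMorphism.left h
  have h2 : S.p.map f = S.p.map g := congrArg CommaMorphism.right h
  have h3 : ExDoctrine.App ((subDoctrine S).graphFunctor.map f) (𝟙 A) g := by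
    rw [h1]
    exact ExDoctrine.app_graph.2 (.of_eq (Category.id_comp g))
  obtain ⟨Z, e, he, h4⟩ := (ExDoctrine.eqv_eqObj (comprehension_subDoctrine S)).1
    (ExDoctrine.app_graph.1 h3)
  have h4 : e ≫ 𝟙 A ≫ f = e ≫ g := h4
  rw [Category.id_comp] at h4
  exact ((cov_subDoctrine_iff e).1 he).hom_ext h2 h4

/-- A functional relation over a base arrow, all of whose pullbacks are represented by vertical
monomorphisms, is the graph of an arrow. -/
theorem exists_hom_of_functional {A B T : S.obj} (P : ∀ {X : S.obj}, (X ⟶ A) → (X ⟶ B) → Prop)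
    (c : A ⟶ T) (d : B ⟶ T) (hd : IsIso (S.p.map d))
    (hcomp : ∀ {X Y : S.obj} (e : Y ⟶ X) {x : X ⟶ A} {y : X ⟶ B}, P x y → P (e ≫ x) (e ≫ y))
    (huniq : ∀ {X : S.obj} {x : X ⟶ A} {y y' : X ⟶ B}, P x y → P x y' →
      ∃ (Z : S.obj) (e : Z ⟶ X), SColl S.p e ∧ e ≫ y = e ≫ y')
    (hex : ∃ (Z : S.obj) (e : Z ⟶ A) (b : Z ⟶ B), SColl S.p e ∧ P e b)
    (hover : ∀ {X : S.obj} {x : X ⟶ A} {y : X ⟶ B}, P x y →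
      ∃ (Z : S.obj) (e : Z ⟶ X), SColl S.p e ∧ e ≫ x ≫ c = e ≫ y ≫ d)
    (hrep : ∀ {G : S.obj} (x : G ⟶ A) (y : G ⟶ B), ∃ (V : S.obj) (n : V ⟶ G),
      IsVMono S.p n ∧ ∀ {X : S.obj} (t : X ⟶ G), (∃ s, s ≫ n = t) ↔ P (t ≫ x) (t ≫ y)) :
    ∃ f : A ⟶ B, f ≫ d = c ∧ P (𝟙 A) f := by
  haveI := totalHasFiniteLimits S.p
  -- Working in the pullback over `T`, and not in the product, makes the projection to `A`
  -- invertible in the base, so that a monic cover built from it is an isomorphism.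
  have hG := IsPullback.of_hasPullback c d
  generalize pullback.fst c d = g₁, pullback.snd c d = g₂ at hG
  generalize pullback c d = G at *
  have hg₁ : IsIso (S.p.map g₁) :=
    MorphismProperty.of_isPullback (P := .isomorphisms R) (map_isPullback (p := S.p) hG).flip hd
  obtain ⟨V, n, hnv, hV⟩ := hrep g₁ g₂
  have hn := hnv.2
  have happ : P (n ≫ g₁) (n ≫ g₂) := (hV n).1 ⟨𝟙 V, Category.id_comp n⟩
  -- Single-valuedness makes the relation monic over `A`; totality then makes it a cover of `A`.
  have hmono : Mono (n ≫ g₁) := by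
    refine ⟨fun {X} x y hxy => ?_⟩
    rw [← cancel_mono n]
    have hxy' : (x ≫ n) ≫ g₁ = (y ≫ n) ≫ g₁ := by rw [Category.assoc, hxy, Category.assoc]
    refine hG.hom_ext hxy' ?_
    have h1 := hcomp x happ
    have h2 := hcomp y happ
    rw [← hxy] at h2
    obtain ⟨Z, e, he, h⟩ := huniq h1 h2
    refine he.hom_ext ?_ (by simpa only [Category.assoc] using h)
    have hb : ((x ≫ n) ≫ g₂) ≫ d = ((y ≫ n) ≫ g₂) ≫ d := by
      rw [Category.assoc, Category.assoc (y ≫ n), ← hG.w, ← Category.assoc, ← Category.assoc (y ≫ n),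
        hxy']
    have hb' := congrArg S.p.map hb
    rwa [S.p.map_comp, S.p.map_comp _ d, cancel_mono] at hb'
  have hcov : SColl S.p (n ≫ g₁) := by
    obtain ⟨Z, e, b, he, hb⟩ := hex
    obtain ⟨Z', e', he', h⟩ := hover hb
    have w : (e' ≫ e) ≫ c = (e' ≫ b) ≫ d := by rw [Category.assoc, h, Category.assoc]
    obtain ⟨t, ht⟩ := (hV (hG.lift _ _ w)).2 (by
      rw [hG.lift_fst, hG.lift_snd]
      exact hcomp e' hb)
    refine SColl.of_comp (e := t) ?_
    rw [← Category.assoc, ht, hG.lift_fst]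
    exact he'.comp he
  have hni := hnv.isPred.2
  haveI : IsIso (n ≫ g₁) := hcov.isIso_of_isPred ⟨hmono, by rw [S.p.map_comp]; infer_instance⟩
  refine ⟨inv (n ≫ g₁) ≫ n ≫ g₂, ?_, ?_⟩
  · rw [← cancel_epi (n ≫ g₁), ← Category.assoc (n ≫ g₁) (_ ≫ _), IsIso.hom_inv_id_assoc,
      Category.assoc, Category.assoc, ← hG.w]
  · have := hcomp (inv (n ≫ g₁)) happ
    rwa [IsIso.inv_hom_id] at this

lemma app_congr_left {A B : S.obj} {ψ : (subDoctrine S).eqObj A ⟶ (subDoctrine S).eqObj B}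
    {X : S.obj} {x x' : X ⟶ A} {y : X ⟶ B} (h : x = x')
    (hx : ExDoctrine.App (A := (subDoctrine S).eqObj A) (B := (subDoctrine S).eqObj B) ψ x y) :
    ExDoctrine.App (A := (subDoctrine S).eqObj A) (B := (subDoctrine S).eqObj B) ψ x' y :=
  h ▸ hx

/-- A functional relation compatible with two arrows, the second of which is vertical up to an
isomorphism, is the graph of an arrow. -/
theorem exists_hom_of_app {A B T : S.obj} (ψ : (subDoctrine S).eqObj A ⟶ (subDoctrine S).eqObj B)
    (c : A ⟶ T) (d : B ⟶ T) (hd : IsIso (S.p.map d))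
    (hψ : ψ ≫ (subDoctrine S).graphFunctor.map d = (subDoctrine S).graphFunctor.map c) :
    ∃ f : A ⟶ B, f ≫ d = c ∧ ExDoctrine.App (A := (subDoctrine S).eqObj A)
      (B := (subDoctrine S).eqObj B) ψ (𝟙 A) f := by
  have hD := comprehension_subDoctrine S
  refine exists_hom_of_functional (fun x y => ExDoctrine.App (A := (subDoctrine S).eqObj A)
      (B := (subDoctrine S).eqObj B) ψ x y) c d hd (fun e x y h => h.comp e)
    (fun {X x y y'} h h' => ?_) ?_ (fun {X x y} h => ?_) (fun {G} x y => ?_)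
  · obtain ⟨Z, e, he, h⟩ := (ExDoctrine.eqv_eqObj hD).1 (h.eqv h')
    exact ⟨Z, e, (cov_subDoctrine_iff e).1 he, h⟩
  · obtain ⟨Z, e, b, he, hb⟩ := hD.exists_app ψ (𝟙 A)
    exact ⟨Z, e, b, (cov_subDoctrine_iff e).1 he, app_congr_left (Category.comp_id e) hb⟩
  · have h1 := h.trans (ExDoctrine.app_graph (f := d).2 (.refl _))
    rw [hψ] at h1
    have h2 := ExDoctrine.app_graph (D := subDoctrine S) (f := c) (x := x).2 (.of_eq rfl)
    obtain ⟨Z, e, he, h⟩ := (ExDoctrine.eqv_eqObj hD).1 (h2.eqv h1)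
    exact ⟨Z, e, (cov_subDoctrine_iff e).1 he, h⟩
  · obtain ⟨V, n, hn, hnv, hP⟩ :=
      ((subDoctrine S).sub₂ (ExDoctrine.EqHom.rel ψ) x y : VSub S _).2
    exact ⟨V, n, ⟨hnv, hn⟩, fun {X} t => (factors_mk n t).symm.trans
      ((Iff.of_eq (congrArg (fun Q : Subobject G => Q.Factors t) hP)).symm.trans
        ((mem_subDoctrine_iff _ _).symm.trans ExDoctrine.mem_sub₂))⟩

lemma map_eq_of_comp_bang {A B : S.obj} {f : A ⟶ B} {u : S.p.obj A ⟶ S.p.obj B}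
    {w : one S.p (S.p.obj A) ⟶ one S.p (S.p.obj B)} (hw : S.p.IsHomLift u w)
    (h : f ≫ bang S.p B = bang S.p A ≫ w) : S.p.map f = u := by
  have hA : IsIso (S.p.map (bang S.p A)) :=
    isIso_map_of_isVertical (isVertical_of_isHomLift (toOne_isHomLift S.p (𝟙 (S.p.obj A))))
  have h0 : bang S.p A ≫ (oneFunctor S.p).map (S.p.map f) = bang S.p A ≫ w :=
    (bang_natural S.p f).symm.trans h
  have h1 := congrArg S.p.map h0
  have h2 : (oneFunctor S.p).map (S.p.map f) = w :=
    (isOne_one _).hom_ext ((cancel_epi (S.p.map (bang S.p A))).1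
      ((S.p.map_comp _ _).symm.trans (h1.trans (S.p.map_comp _ _))))
  exact homLift_unique (isHomLift_congr h2.symm (oneFunctor_map_isHomLift S.p _)) hw

/-- The left part of `φ` is a functional relation compatible with the arrows to the terminal objects
of the fibers, hence the graph of an arrow by `exists_hom_of_app`. The same compatibility determines
the base arrow. -/
theorem zeta_exists_map {A B : S.obj} (φ : (zeta S).obj A ⟶ (zeta S).obj B) :
    ∃ f : A ⟶ B, (zeta S).map f = φ := by
  have hD := comprehension_subDoctrine S
  let ψ : (subDoctrine S).eqObj A ⟶ (subDoctrine S).eqObj B := φ.left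
  let u : S.p.obj A ⟶ S.p.obj B := φ.right
  obtain ⟨w, hw, hψ⟩ : ∃ w : one S.p (S.p.obj A) ⟶ one S.p (S.p.obj B), S.p.IsHomLift u w ∧
      ψ ≫ (subDoctrine S).graphFunctor.map (bang S.p B) =
        (subDoctrine S).graphFunctor.map (bang S.p A ≫ w) :=
    ⟨(oneFunctor S.p).map u, oneFunctor_map_isHomLift S.p u,
      φ.w.trans ((subDoctrine S).graphFunctor.map_comp (bang S.p A) ((oneFunctor S.p).map u)).symm⟩
  obtain ⟨f, hfu, hf⟩ := exists_hom_of_app ψ (bang S.p A ≫ w) (bang S.p B)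
    (isIso_map_of_isVertical (isVertical_of_isHomLift (toOne_isHomLift S.p (𝟙 (S.p.obj B))))) hψ
  refine ⟨f, CommaMorphism.ext (hD.hom_ext fun X x y h => ?_) (map_eq_of_comp_bang hw hfu)⟩
  exact (app_congr_left (Category.comp_id x) (hf.comp x)).cong (.refl _) (ExDoctrine.app_graph.1 h)

theorem isDense_zeta : IsDense (zeta S) where
  coherent := isCoherentFunctor_zeta S
  full := ⟨fun φ => zeta_exists_map φ⟩
  faithful := ⟨fun h => zeta_map_injective h⟩
  exists_cover := zeta_exists_cover S
  exists_pred {A U} m hm := by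
    haveI := isFiberedPretopos_sheaves S
    -- With `U` covered by an object of `S`, the composite into the image of `A` comes from an arrow
    -- `f`. Then `m` and the predicate part of `f` are two images of the same arrow, so their
    -- domains are isomorphic.
    obtain ⟨U', s, hs⟩ := zeta_exists_cover S U
    obtain ⟨f, hf⟩ := zeta_exists_map (s ≫ m)
    obtain ⟨V, e, n, hn, he, rfl⟩ := exists_image (p := S.p) f
    have hn' := (isCoherentFunctor_zeta S).map_isPred hn.isPred
    have he' := (isCoherentFunctor_zeta S).map_sColl he
    haveI := hm.1
    haveI := hn'.1
    rw [(zeta S).map_comp] at hf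
    obtain ⟨l, hl⟩ := hs.exists_lift hn' m _ hf.symm
    obtain ⟨l', hl'⟩ := he'.exists_lift hm _ _ hf
    exact ⟨V, n, ⟨l, l', by rw [← cancel_mono m, Category.assoc, hl', hl, Category.id_comp],
      by rw [← cancel_mono ((zeta S).map n), Category.assoc, hl, hl', Category.id_comp]⟩, hl⟩

end

/-! ### Recognizing geometric pre-stacks -/

section
variable {R : Type u₁} [Category.{v₁} R] {E : Type u₂} [Category.{v₂} E] {p : E ⥤ R}

lemma isHomLift_id_of_eq {I J : R} (h : J = I) {A B : E} {n : A ⟶ B} (hn : p.IsHomLift (𝟙 J) n) :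
    p.IsHomLift (𝟙 I) n := by
  subst h
  exact hn

/-- Covers are stable under pullback in the total category; this square turns that into stability
under reindexing. -/
lemma isPullback_rmap [p.IsFibered] {J I : R} (u : J ⟶ I) {A B : p.Fiber I} (f : A ⟶ B) :
    IsPullback (fm ((reindex p u).map f)) (rmap p u A) (rmap p u B) (fm f) := by
  have hA : p.IsStronglyCartesian u (rmap p u A) := inferInstance
  have hB : p.IsStronglyCartesian u (rmap p u B) := inferInstance
  refine isPullback_of_existsUnique (reindex_fac p u f) (fun X x y h => ?_)
    (fun X l l' h1 h2 => ?_)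
  · let X₀ : p.Fiber (p.obj X) := Functor.Fiber.mk (a := X) rfl
    let t : p.obj X ⟶ J := under (X := X₀) x
    have hx : p.IsHomLift t x := under_isHomLift (X := X₀) x
    have hyf : p.IsHomLift (t ≫ u) (y ≫ fm f) := by
      rw [← h]
      infer_instance
    have hy : p.IsHomLift (t ≫ u) y := isHomLift_of_comp_vertical p (t ≫ u) y (fm f)
    let l := IsStronglyCartesian.map p u (rmap p u A) (g := t) rfl y
    have hl : l ≫ rmap p u A = y := IsStronglyCartesian.fac p u (rmap p u A) rfl y
    have hlt : p.IsHomLift t l := IsStronglyCartesian.map_isHomLift p u (rmap p u A) rfl y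
    have hlf : p.IsHomLift t (l ≫ fm ((reindex p u).map f)) := inferInstance
    refine ⟨l, IsStronglyCartesian.ext p u (rmap p u B) t ?_, hl⟩
    rw [Category.assoc, reindex_fac, ← Category.assoc, hl, h]
  · let X₀ : p.Fiber (p.obj X) := Functor.Fiber.mk (a := X) rfl
    let t : p.obj X ⟶ J := under (X := X₀) l
    have hl : p.IsHomLift t l := under_isHomLift (X := X₀) l
    have hl1 : p.IsHomLift t (l' ≫ fm ((reindex p u).map f)) := by
      rw [← h1]
      infer_instance
    have hl' : p.IsHomLift t l' := isHomLift_of_comp_vertical p t l' (fm ((reindex p u).map f))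
    exact IsStronglyCartesian.ext p u (rmap p u A) t h2

/-- A finite-limit pre-stack is geometric as soon as arrows factorize into covers followed by
vertical monomorphisms, and vertical covers are effective in the fibers. -/
theorem isGeometricPreStack_of_factorization [HasFiniteLimits R] [IsFiniteLimitPreStack p]
    (H : ∀ ⦃U B : E⦄ (f : U ⟶ B), ∃ (V : E) (e : U ⟶ V) (n : V ⟶ B),
      IsVMono p n ∧ SColl p e ∧ e ≫ n = f)
    (hdesc : ∀ ⦃I : R⦄ ⦃A B Z : p.Fiber I⦄ (e : A ⟶ B) (g : A ⟶ Z), SColl p (fm e) →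
      (∀ ⦃X : E⦄ (x y : X ⟶ fo A), x ≫ fm e = y ≫ fm e → x ≫ fm g = y ≫ fm g) →
      ∃ k : B ⟶ Z, e ≫ k = g) : IsGeometricPreStack p := by
  have hreg (I : R) : Regular (p.Fiber I) ∧
      ∀ ⦃X Y : p.Fiber I⦄ (e : X ⟶ Y), IsRegularEpi e ↔ SColl p (fm e) := by
    let W : MorphismProperty (p.Fiber I) := fun A B e => SColl p (fm e)
    have hW : W.IsStableUnderBaseChange :=
      ⟨fun {X Y Y' S} f g f' g' sq hg => SColl.of_isPullback (isPullback_fm_iff.2 sq).flip.flip hg⟩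
    refine regular_of_factorization W (fun A B f => ?_) (fun A B e he => ?_)
    · obtain ⟨V, e, n, hn, he, h⟩ := H (fm f)
      have hn1 : p.IsHomLift (𝟙 (p.obj (fo B))) n := hn.1
      obtain ⟨V₀, rfl⟩ := exists_fo_eq
        ((IsHomLift.domain_eq p (𝟙 (p.obj (fo B))) n).trans (fo_over B))
      have hn2 : p.IsHomLift (𝟙 I) n := by
        exact isHomLift_id_of_eq (fo_over B) hn1
      have he2 : p.IsHomLift (𝟙 I) (e ≫ n) := by
        rw [h]
        infer_instance
      have he1 : p.IsHomLift (𝟙 I) e := isHomLift_of_comp_vertical p (𝟙 I) e n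
      obtain ⟨n, rfl⟩ := exists_fm_eq n hn2
      obtain ⟨e, rfl⟩ := exists_fm_eq e he1
      have := hn.2
      refine ⟨V₀, e, n, he, ⟨fun x y hxy => Functor.Fiber.hom_ext ?_⟩, Functor.Fiber.hom_ext h⟩
      exact (cancel_mono (fm n)).1 (congrArg fm hxy)
    · have hk : IsPullback (pullback.fst e e) (pullback.snd e e) e e :=
        IsPullback.of_hasPullback e e
      have key : ∀ {Z : p.Fiber I} (g : A ⟶ Z), pullback.fst e e ≫ g = pullback.snd e e ≫ g →
          ∃ k : B ⟶ Z, e ≫ k = g := by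
        intro Z g hg
        refine hdesc e g he (fun X x y hxy => ?_)
        have hk' := isPullback_fm_iff.2 hk
        have h1 := hk'.lift_fst x y hxy
        have h2 := hk'.lift_snd x y hxy
        generalize hk'.lift x y hxy = l at h1 h2
        rw [← h1, ← h2, Category.assoc, Category.assoc, ← fm_comp, ← fm_comp, hg]
      have hepi : Epi e := ⟨fun {Z} g h w => Functor.Fiber.hom_ext (he.hom_ext
        (map_eq_map_of_isHomLift (u := 𝟙 I) inferInstance inferInstance) (congrArg fm w))⟩
      refine ⟨⟨⟨_, _, _, pullback.condition, Cofork.IsColimit.mk _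
        (fun s => (key s.π s.condition).choose)
        (fun s => (key s.π s.condition).choose_spec) (fun s m hm => ?_)⟩⟩⟩
      rw [← cancel_epi e]
      exact hm.trans (key s.π s.condition).choose_spec.symm
  exact
    { regular := fun I => (hreg I).1
      reindex_regular := fun {J I} u =>
        { preservesFiniteLimits := inferInstance
          map_regularEpi := fun {X Y} f hf => by
            rw [(hreg _).2] at hf ⊢
            exact SColl.of_isPullback (isPullback_rmap u f).flip hf }
      unions := hasStableUnions_of_factorization H }

end

/-! ### Full subfibrations closed under finite limits and subobjects -/

section
variable {R : Type u₁} [Category.{v₁} R] {T : BasedCategory.{v₂, u₂} R}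

/-- The full subcategory of the total category on the objects satisfying `P`, over the base. -/
abbrev fullSubfibration (T : BasedCategory.{v₂, u₂} R) (P : ObjectProperty T.obj) :
    BasedCategory R :=
  BasedCategory.ofFunctor (Functor.comp P.ι T.p)

/-- The inclusion of a full subfibration. -/
def fullSubfibrationι (T : BasedCategory.{v₂, u₂} R) (P : ObjectProperty T.obj) :
    fullSubfibration T P ⥤ᵇ T where
  toFunctor := P.ι
  w := rfl

/-- `P` is closed under finite limits in the total category, and under subobjects. -/
structure IsClosedUnderSubobjects (p : T.obj ⥤ R) [IsFiniteLimitFibration p]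
    (P : ObjectProperty T.obj) : Prop where
  one_mem (I : R) : P (one p I)
  of_jointly_mono {W A B : T.obj} (a : W ⟶ A) (b : W ⟶ B)
    (h : ∀ ⦃X : T.obj⦄ (x y : X ⟶ W), x ≫ a = y ≫ a → x ≫ b = y ≫ b → x = y) : P A → P B → P W

variable {P : ObjectProperty T.obj}

lemma isHomLift_homMk {I J : R} {u : I ⟶ J} {A B : P.FullSubcategory} {f : A ⟶ B}
    (h : T.p.IsHomLift u f.hom) : (Functor.comp P.ι T.p).IsHomLift u f :=
  IsHomLift.of_fac' (Functor.comp P.ι T.p) u f (IsHomLift.domain_eq T.p u f.hom)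
    (IsHomLift.codomain_eq T.p u f.hom) (IsHomLift.fac' T.p u f.hom)

lemma isHomLift_hom {I J : R} {u : I ⟶ J} {A B : P.FullSubcategory} {f : A ⟶ B}
    (h : (Functor.comp P.ι T.p).IsHomLift u f) : T.p.IsHomLift u f.hom :=
  IsHomLift.of_fac' T.p u f.hom (IsHomLift.domain_eq (Functor.comp P.ι T.p) u f)
    (IsHomLift.codomain_eq (Functor.comp P.ι T.p) u f)
    (IsHomLift.fac' (Functor.comp P.ι T.p) u f)

lemma isStronglyCartesian_of_hom {I J : R} {u : I ⟶ J} {A B : P.FullSubcategory} {f : A ⟶ B}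
    (h : T.p.IsStronglyCartesian u f.hom) :
    (Functor.comp P.ι T.p).IsStronglyCartesian u f := by
  have hf := isHomLift_homMk (f := f) h.toIsHomLift
  refine { universal_property' := ?_ }
  intro X t x hx
  have hx' := isHomLift_hom hx
  refine ⟨ObjectProperty.homMk (IsStronglyCartesian.map T.p u f.hom rfl x.hom),
    ⟨isHomLift_homMk (IsStronglyCartesian.map_isHomLift T.p u f.hom rfl x.hom),
      ObjectProperty.hom_ext _ (IsStronglyCartesian.fac T.p u f.hom rfl x.hom)⟩, ?_⟩
  rintro y ⟨hy, rfl⟩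
  have hy' := isHomLift_hom hy
  refine ObjectProperty.hom_ext _ ?_
  exact IsStronglyCartesian.map_uniq T.p u f.hom rfl _ _ rfl

lemma isOne_of_obj {A : P.FullSubcategory} (h : IsOne T.p A.obj) :
    IsOne (fullSubfibration T P).p A := by
  intro X t
  obtain ⟨f, hf, hu⟩ := h (X := X.obj) t
  exact ⟨ObjectProperty.homMk f, isHomLift_homMk hf, fun g hg =>
    ObjectProperty.hom_ext _ (hu g.hom (isHomLift_hom hg))⟩

lemma isPullback_of_hom {W A B C : P.FullSubcategory} {a : W ⟶ A} {b : W ⟶ B} {f : A ⟶ C}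
    {g : B ⟶ C} (h : IsPullback a.hom b.hom f.hom g.hom) : IsPullback a b f g :=
  IsPullback.of_map P.ι (ObjectProperty.hom_ext _ h.w) h

lemma exists_isStronglyCartesian {E : Type u₂} [Category.{v₂} E] {p : E ⥤ R} [p.IsFibered]
    {I : R} (B : E) (u : I ⟶ p.obj B) : ∃ (A : E) (f : A ⟶ B), p.IsStronglyCartesian u f := by
  have h : p.IsStronglyCartesian u (rmap p u (Functor.Fiber.mk (p := p) (a := B) rfl)) :=
    inferInstance
  exact ⟨_, _, h⟩

namespace IsClosedUnderSubobjects
variable [HasFiniteLimits R] [IsFiniteLimitFibration T.p] (hP : IsClosedUnderSubobjects T.p P)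
include hP

lemma of_mono {U A : T.obj} (m : U ⟶ A) (hm : Mono m) (hA : P A) : P U :=
  hP.of_jointly_mono m m (fun _ x y h _ => (cancel_mono m).1 h) hA hA

lemma of_isPullback {W A B C : T.obj} {a : W ⟶ A} {b : W ⟶ B} {f : A ⟶ C} {g : B ⟶ C}
    (h : IsPullback a b f g) (hA : P A) (hB : P B) : P W :=
  hP.of_jointly_mono a b (fun _ _ _ h1 h2 => h.hom_ext h1 h2) hA hB

/-- A cartesian arrow and the arrow to the terminal object of the fiber are jointly monic: the
second determines the base arrow, and then the first determines the arrow. -/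
lemma of_isStronglyCartesian {I J : R} {u : I ⟶ J} {A B : T.obj} {f : A ⟶ B}
    (h : T.p.IsStronglyCartesian u f) (hB : P B) : P A := by
  subst_hom_lift T.p u f
  refine hP.of_jointly_mono f (bang T.p A) (fun X x y h1 h2 => ?_) hB (hP.one_mem _)
  have hv : IsIso (T.p.map (bang T.p A)) :=
    isIso_map_of_isVertical (isVertical_of_isHomLift (toOne_isHomLift T.p (𝟙 (T.p.obj A))))
  have h3 := congrArg T.p.map h2
  rw [T.p.map_comp, T.p.map_comp, cancel_mono] at h3
  have h4 : T.p.IsHomLift (T.p.map x) y := by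
    rw [h3]
    infer_instance
  exact IsStronglyCartesian.ext T.p (T.p.map f) f (T.p.map x) h1

theorem isFibered : (fullSubfibration T P).p.IsFibered :=
  IsFibered.of_exists_isStronglyCartesian (p := (fullSubfibration T P).p) (fun B I u => by
    obtain ⟨A, f, hf⟩ := exists_isStronglyCartesian (p := T.p) B.obj u
    exact ⟨⟨A, hP.of_isStronglyCartesian hf B.property⟩, ObjectProperty.homMk f,
      isStronglyCartesian_of_hom hf⟩)

theorem isFiniteLimitFibration : IsFiniteLimitFibration (fullSubfibration T P).p := by
  haveI := hP.isFibered
  refine isFiniteLimitFibration_of_isOne_of_isPullback (fun I => ?_) (fun I A B C f g => ?_)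
  · exact ⟨Functor.Fiber.mk (p := (fullSubfibration T P).p) (a := ⟨one T.p I, hP.one_mem I⟩)
      (one_over T.p I), isOne_of_obj (isOne_one I)⟩
  · haveI := totalHasFiniteLimits T.p
    let A' : T.p.Fiber I := Functor.Fiber.mk (a := (fo A).obj) (fo_over A)
    let B' : T.p.Fiber I := Functor.Fiber.mk (a := (fo B).obj) (fo_over B)
    let C' : T.p.Fiber I := Functor.Fiber.mk (a := (fo C).obj) (fo_over C)
    let f' : A' ⟶ C' := fhom (fm f).hom (isHomLift_hom (f := fm f) f.2)
    let g' : B' ⟶ C' := fhom (fm g).hom (isHomLift_hom (f := fm g) g.2)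
    have h := isPullback_of_fiber (IsPullback.of_hasPullback f' g')
    let W : P.FullSubcategory := ⟨fo (pullback f' g'),
      hP.of_isPullback h (fo A).property (fo B).property⟩
    let W' : (fullSubfibration T P).p.Fiber I := Functor.Fiber.mk (a := W) (fo_over (pullback f' g'))
    let a : W ⟶ fo A := ObjectProperty.homMk (fm (pullback.fst f' g'))
    let b : W ⟶ fo B := ObjectProperty.homMk (fm (pullback.snd f' g'))
    have ha : (fullSubfibration T P).p.IsHomLift (𝟙 I) a :=
      isHomLift_homMk (f := a) (pullback.fst f' g').2
    have hb : (fullSubfibration T P).p.IsHomLift (𝟙 I) b :=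
      isHomLift_homMk (f := b) (pullback.snd f' g').2
    exact ⟨W', fhom (A := W') a ha, fhom (A := W') b hb, isPullback_of_hom h⟩

/-- Limits formed in `T` lie in the subcategory, so every pullback or fiberwise terminal object of
the subcategory is isomorphic to one of `T`. -/
theorem isLexFunctor : IsLexFunctor (fullSubfibrationι T P) where
  map_isPullback {W A B C a b f g} h := by
    haveI := totalHasFiniteLimits T.p
    have h0 := IsPullback.of_hasPullback f.hom g.hom
    let V : P.FullSubcategory := ⟨pullback f.hom g.hom, hP.of_isPullback h0 A.property B.property⟩
    let a₀ : V ⟶ A := ObjectProperty.homMk (pullback.fst f.hom g.hom)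
    let b₀ : V ⟶ B := ObjectProperty.homMk (pullback.snd f.hom g.hom)
    have h1 : IsPullback a₀ b₀ f g := isPullback_of_hom h0
    let e := h1.isoIsPullback _ _ h
    refine IsPullback.of_iso h0 (P.ι.mapIso e) (Iso.refl _) (Iso.refl _) (Iso.refl _) ?_ ?_ ?_ ?_
    · exact (Category.comp_id _).trans
        (congrArg P.ι.map (h1.isoIsPullback_hom_fst _ _ h)).symm
    · exact (Category.comp_id _).trans
        (congrArg P.ι.map (h1.isoIsPullback_hom_snd _ _ h)).symm
    · exact (Category.comp_id _).trans (Category.id_comp _).symm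
    · exact (Category.comp_id _).trans (Category.id_comp _).symm
  map_isOne {A} hA := by
    let V : P.FullSubcategory := ⟨one T.p (T.p.obj A.obj), hP.one_mem _⟩
    have hV : IsOne (fullSubfibration T P).p V := isOne_of_obj (isOne_one _)
    let v : V ⟶ A := (hA.existsUnique (X := V) rfl (one_over T.p (T.p.obj A.obj)) (𝟙 _)).choose
    have hv : T.p.IsHomLift (𝟙 (T.p.obj A.obj)) v.hom :=
      isHomLift_hom (hA.existsUnique (X := V) rfl (one_over T.p (T.p.obj A.obj)) (𝟙 _)).choose_spec.1
    let w : A ⟶ V := ObjectProperty.homMk (bang T.p A.obj)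
    have hw : T.p.IsHomLift (𝟙 (T.p.obj A.obj)) w.hom := toOne_isHomLift T.p _
    have h1 : v ≫ w = 𝟙 V := hV.hom_ext (map_eq_map_of_isHomLift (p := T.p)
      (u := 𝟙 (T.p.obj A.obj)) (f := v.hom ≫ w.hom) (g := 𝟙 V.obj) inferInstance
      (IsHomLift.id (one_over T.p _)))
    have h2 : w ≫ v = 𝟙 A := hA.hom_ext (map_eq_map_of_isHomLift (p := T.p)
      (u := 𝟙 (T.p.obj A.obj)) (f := w.hom ≫ v.hom) (g := 𝟙 A.obj) inferInstance
      (IsHomLift.id rfl))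
    exact (isOne_one (p := T.p) (T.p.obj A.obj)).of_iso
      ⟨v.hom, w.hom, congrArg P.ι.map h1, congrArg P.ι.map h2⟩ hv

lemma isStronglyCartesian_hom {I J : R} {u : I ⟶ J} {A B : P.FullSubcategory} {f : A ⟶ B}
    (h : (fullSubfibration T P).p.IsStronglyCartesian u f) :
    T.p.IsStronglyCartesian u f.hom := by
  haveI := hP.isFiniteLimitFibration
  exact (hP.isLexFunctor.isFiberedFunctor f (isCart_of_isStronglyCartesian h)).isStronglyCartesian
    (isHomLift_hom h.toIsHomLift)

theorem isPreStack (h : IsPreStack T.p) : IsPreStack (fullSubfibration T P).p := by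
  intro I J K e d₀ d₁ he hk A A₁ A₂ B B₁ B₂ a a₀ a₁ b b₀ b₁ ha ha₀ ha₁ haa hb hb₀ hb₁ hbb f₁ f₂
    hf₁ hf₂ h₀ h₁
  obtain ⟨g, ⟨hg, hg'⟩, hu⟩ := h e d₀ d₁ he hk a.hom a₀.hom a₁.hom b.hom b₀.hom b₁.hom
    (hP.isStronglyCartesian_hom ha) (hP.isStronglyCartesian_hom ha₀)
    (hP.isStronglyCartesian_hom ha₁) (congrArg P.ι.map haa) (hP.isStronglyCartesian_hom hb)
    (hP.isStronglyCartesian_hom hb₀) (hP.isStronglyCartesian_hom hb₁) (congrArg P.ι.map hbb)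
    f₁.hom f₂.hom (isHomLift_hom hf₁) (isHomLift_hom hf₂) (congrArg P.ι.map h₀)
    (congrArg P.ι.map h₁)
  exact ⟨ObjectProperty.homMk g, ⟨isHomLift_homMk hg, ObjectProperty.hom_ext _ hg'⟩,
    fun k hk => ObjectProperty.hom_ext _ (hu k.hom ⟨isHomLift_hom hk.1, congrArg P.ι.map hk.2⟩)⟩

lemma isVMono_hom {A B : P.FullSubcategory} {m : A ⟶ B}
    (h : IsVMono (fullSubfibration T P).p m) : IsVMono T.p m.hom := by
  haveI := hP.isFiniteLimitFibration
  exact ⟨isHomLift_hom (u := 𝟙 (T.p.obj B.obj)) h.1, hP.isLexFunctor.map_mono h.2⟩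

lemma sColl_of_sColl_hom {A B : P.FullSubcategory} {e : A ⟶ B} (h : SColl T.p e.hom) :
    SColl (fullSubfibration T P).p e := by
  haveI := totalHasFiniteLimits T.p
  intro X t W k hk H
  obtain ⟨s, hs⟩ := h t.hom k.hom (hP.isVMono_hom hk) (fun Y y r hyr => by
    have h0 := IsPullback.of_hasPullback e.hom t.hom
    let V : P.FullSubcategory := ⟨pullback e.hom t.hom, hP.of_isPullback h0 A.property X.property⟩
    let a₀ : V ⟶ A := ObjectProperty.homMk (pullback.fst e.hom t.hom)
    let b₀ : V ⟶ X := ObjectProperty.homMk (pullback.snd e.hom t.hom)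
    obtain ⟨s, hs⟩ := H a₀ b₀ (ObjectProperty.hom_ext _ h0.w)
    have hs' : s.hom ≫ k.hom = pullback.snd e.hom t.hom := congrArg P.ι.map hs
    exact ⟨h0.lift y r hyr ≫ s.hom, by rw [Category.assoc, hs', h0.lift_snd]⟩)
  exact ⟨ObjectProperty.homMk s, ObjectProperty.hom_ext _ hs⟩

/-- A test object of `T` need not satisfy `P`. It is replaced by a cover that does, and the section
found there descends because `k` is a predicate. -/
lemma sColl_hom (hcov : ∀ Y : T.obj, ∃ (U : T.obj) (s : U ⟶ Y), P U ∧ SColl T.p s)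
    {A B : P.FullSubcategory} {e : A ⟶ B} (h : SColl (fullSubfibration T P).p e) :
    SColl T.p e.hom := by
  haveI := totalHasFiniteLimits T.p
  haveI := hP.isFiniteLimitFibration
  intro X t W k hk H
  obtain ⟨X', s, hX', hs⟩ := hcov X
  have h0 := IsPullback.of_hasPullback k s
  have hk' := hk.isPred.of_isPullback h0
  have hk1 := hk'.1
  let X₁ : P.FullSubcategory := ⟨X', hX'⟩
  let W₁ : P.FullSubcategory := ⟨pullback k s, hP.of_mono _ hk'.1 hX'⟩
  let k₁ : W₁ ⟶ X₁ := ObjectProperty.homMk (pullback.snd k s)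
  let t₁ : X₁ ⟶ B := ObjectProperty.homMk (s ≫ t)
  have hk₁ : IsPred (fullSubfibration T P).p k₁ := by
    refine ⟨⟨fun x y hxy => ObjectProperty.hom_ext _ ?_⟩, hk'.2⟩
    exact (cancel_mono (pullback.snd k s)).1 (congrArg P.ι.map hxy)
  obtain ⟨σ, hσ⟩ := SColl.exists_section h t₁ k₁ hk₁ (fun Y y r hyr => by
    have hyr' : y.hom ≫ e.hom = r.hom ≫ s ≫ t := congrArg P.ι.map hyr
    obtain ⟨z, hz⟩ := H y.hom (r.hom ≫ s) (by rw [hyr', Category.assoc])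
    exact ⟨ObjectProperty.homMk (h0.lift z r.hom hz),
      ObjectProperty.hom_ext _ (h0.lift_snd _ _ _)⟩)
  have hσ' : σ.hom ≫ pullback.snd k s = 𝟙 X' := congrArg P.ι.map hσ
  exact hs.exists_lift hk.isPred (𝟙 X) (σ.hom ≫ pullback.fst k s) (by
    rw [Category.assoc, h0.w, reassoc_of% hσ', Category.comp_id]
    exact (Category.id_comp s).symm)

/-- Factorizations are computed in `T` and stay in the subcategory by closure under subobjects;
descent along vertical covers is that of the fibered pretopos `T`. -/
theorem isGeometricPreStack_and_isDense [IsFiberedPretopos T.p]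
    (hcov : ∀ Y : T.obj, ∃ (U : T.obj) (s : U ⟶ Y), P U ∧ SColl T.p s) :
    IsGeometricPreStack (fullSubfibration T P).p ∧ IsDense (fullSubfibrationι T P) := by
  haveI := hP.isFiniteLimitFibration
  have hpre : IsFiniteLimitPreStack (fullSubfibration T P).p :=
    { preStack := hP.isPreStack IsFiniteLimitPreStack.preStack }
  refine ⟨isGeometricPreStack_of_factorization (fun U B f => ?_)
    (fun I A B Z e g he H => ?_), ?_⟩
  · obtain ⟨V, e, n, hn, he, h⟩ := exists_image (p := T.p) f.hom
    let V₁ : P.FullSubcategory := ⟨V, hP.of_mono n hn.2 B.property⟩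
    let e₁ : U ⟶ V₁ := ObjectProperty.homMk e
    let n₁ : V₁ ⟶ B := ObjectProperty.homMk n
    refine ⟨V₁, e₁, n₁, ⟨isHomLift_homMk (f := n₁) hn.1, ⟨fun x y hxy => ?_⟩⟩,
      hP.sColl_of_sColl_hom (e := e₁) he, ObjectProperty.hom_ext _ h⟩
    have := hn.2
    exact ObjectProperty.hom_ext _ ((cancel_mono n).1 (congrArg P.ι.map hxy))
  · have he' := hP.sColl_hom hcov he
    haveI := totalHasFiniteLimits T.p
    obtain ⟨k, hk, hk'⟩ := he'.exists_desc (𝟙 I) (𝟙 I) (isHomLift_hom (f := fm e) e.2) (fm g).hom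
      (by
        have := isHomLift_hom (f := fm g) g.2
        rwa [Category.comp_id])
      (fun X x y hxy => by
        have h0 := IsPullback.of_hasPullback (fm e).hom (fm e).hom
        let V : P.FullSubcategory := ⟨pullback (fm e).hom (fm e).hom,
          hP.of_isPullback h0 (fo A).property (fo A).property⟩
        let a₀ : V ⟶ fo A := ObjectProperty.homMk (pullback.fst (fm e).hom (fm e).hom)
        let b₀ : V ⟶ fo A := ObjectProperty.homMk (pullback.snd (fm e).hom (fm e).hom)
        have h1 : pullback.fst (fm e).hom (fm e).hom ≫ (fm g).hom =
            pullback.snd (fm e).hom (fm e).hom ≫ (fm g).hom :=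
          congrArg P.ι.map (H a₀ b₀ (ObjectProperty.hom_ext _ h0.w))
        have h2 := h0.lift_fst x y hxy
        have h3 := h0.lift_snd x y hxy
        generalize h0.lift x y hxy = l at h2 h3
        rw [← h2, ← h3, Category.assoc, Category.assoc, h1])
    let k₁ : fo B ⟶ fo Z := ObjectProperty.homMk k
    exact ⟨fhom k₁ (isHomLift_homMk (f := k₁) hk),
      Functor.Fiber.hom_ext (ObjectProperty.hom_ext _ hk')⟩
  · exact
      { coherent := ⟨hP.isLexFunctor, fun h => hP.sColl_hom hcov h⟩
        full := inferInstanceAs P.ι.Full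
        faithful := inferInstanceAs P.ι.Faithful
        exists_pred := fun {A U} m hm => by
          let V : P.FullSubcategory := ⟨U, hP.of_mono m hm.1 A.property⟩
          let n : V ⟶ A := ObjectProperty.homMk m
          exact ⟨V, n, Iso.refl U, Category.id_comp m⟩
        exists_cover := fun Y => by
          obtain ⟨U, s, hU, hs⟩ := hcov Y
          exact ⟨⟨U, hU⟩, s, hs⟩ }

end IsClosedUnderSubobjects

end

/-! ### Presheaves and subobjects of representables -/

section
variable {R : Type u₁} [Category.{v₁} R] [Regular R] {C : BasedCategory.{v₂, u₂} R}

/-- The order on these predicates already ignores cartesian arrows over regular epimorphisms, so no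
appeal to the pre-stack condition is needed. -/
lemma cov_sievDoctrine_of_isCoverCart [IsFiniteLimitFibration C.p] {X Y : C.obj} {e : Y ⟶ X}
    (he : IsCoverCart C.p e) : (sievDoctrine C).Cov e := by
  change (⊤ : SievPred C X).1 ≤ (SievPred.ex e ⊤).1
  rw [show (⊤ : SievPred C X).1 = gen (𝟙 X) from SievPred.top_eq_gen X, SievPred.gen_le_iff]
  refine SievPred.mem_of_cover _ (𝟙 X) e he ?_
  have h := SievPred.mem_ex e ⊤ (𝟙 Y) trivial
  rw [Category.id_comp] at h
  rw [Category.comp_id]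
  exact h

variable (C) in
lemma comprehension_sievDoctrine [IsFiniteLimitFibration C.p] :
    (sievDoctrine C).Comprehension := by
  rintro A ⟨P, U, f, rfl⟩
  refine ⟨U, f, le_antisymm ?_ ?_⟩
  · change gen f ≤ (SievPred.ex f ⊤).1
    have h := SievPred.mem_ex f ⊤ (𝟙 U) trivial
    rwa [Category.id_comp, ← SievPred.gen_le_iff] at h
  · refine (SievPred.ex_le_iff _ _ _).2 fun X x _ => ?_
    exact (gen f).downward_closed (SievPred.self_mem f) x

variable [IsFiniteLimitPreStack C.p]

lemma cov_sievDoctrine_oneFunctor_map ⦃J I : R⦄ (e : J ⟶ I) (he : IsRegularEpi e) :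
    (sievDoctrine C).Cov ((oneFunctor C.p).map e) :=
  cov_sievDoctrine_of_isCoverCart (isCoverCart_oneFunctor_map e he)

variable (C)

theorem isFiberedPretopos_presheaves : IsFiberedPretopos (Presheaves C).p :=
  glue_isFiberedPretopos (comprehension_sievDoctrine C) cov_sievDoctrine_oneFunctor_map

theorem isLexFunctor_fiberedYoneda : IsLexFunctor (fiberedYoneda C) :=
  discrete_isLexFunctor (comprehension_sievDoctrine C)

theorem fiberedYoneda_exists_cover (Y : (Presheaves C).obj) :
    ∃ (U : C.obj) (s : (fiberedYoneda C).obj U ⟶ Y), SColl (Presheaves C).p s := by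
  obtain ⟨U, s, hs⟩ := discrete_exists_cover (comprehension_sievDoctrine C) Y
  exact ⟨U, s, (sColl_glue_iff (comprehension_sievDoctrine C) cov_sievDoctrine_oneFunctor_map s).2 hs⟩

variable {C}

/-- Verticality can be dropped: reindex `A` along the base arrow of `m`. The embedding preserves the
cartesian lift, and `m` factors through it by a vertical monomorphism. -/
lemma isSubrepresentable_iff {X : (Presheaves C).obj} :
    isSubrepresentable C X ↔ ∃ (A : C.obj) (m : X ⟶ (fiberedYoneda C).obj A), Mono m := by
  constructor
  · rintro ⟨A, m, hm⟩
    exact ⟨A, m, hm.2⟩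
  · rintro ⟨A, m, hm⟩
    haveI := isFiberedPretopos_presheaves C
    obtain ⟨B, b, hb⟩ := exists_isStronglyCartesian (p := C.p) A
      ((Presheaves C).p.map m)
    have hb' := (isLexFunctor_fiberedYoneda C).isFiberedFunctor b (isCart_of_isStronglyCartesian hb)
    have hbl : C.p.IsHomLift ((Presheaves C).p.map m) b := hb.toIsHomLift
    have hb'' := hb'.isStronglyCartesian (BasedFunctor.preserves_isHomLift (fiberedYoneda C)
      ((Presheaves C).p.map m) b)
    let n := IsStronglyCartesian.map (Presheaves C).p ((Presheaves C).p.map m)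
      ((fiberedYoneda C).map b) (g := 𝟙 _) (Category.id_comp _).symm m
    have hn : n ≫ (fiberedYoneda C).map b = m := IsStronglyCartesian.fac _ _ _ _ _
    have hnl : (Presheaves C).p.IsHomLift (𝟙 _) n := IsStronglyCartesian.map_isHomLift _ _ _ _ _
    rw [← hn] at hm
    exact ⟨B, n, isVertical_of_isHomLift hnl, @mono_of_mono _ _ _ _ _ n ((fiberedYoneda C).map b) hm⟩

variable (C) in
-- A jointly monic pair into subobjects of two representables gives a monomorphism into the
-- representable of their product, formed as a pullback over the terminal object of the fiber over
-- `⊤_ R` and preserved by the lex embedding.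
theorem isClosedUnderSubobjects_isSubrepresentable
    (h : IsFiniteLimitFibration (Presheaves C).p) :
    IsClosedUnderSubobjects (Presheaves C).p (isSubrepresentable C) where
  one_mem I := by
    have h1 := (isLexFunctor_fiberedYoneda C).map_isOne (isOne_one (p := C.p) I)
    have h2 : (Presheaves C).p.obj ((fiberedYoneda C).obj (one C.p I)) = I :=
      ((fiberedYoneda C).w_obj _).trans (one_over C.p I)
    obtain ⟨v, hv, -⟩ := h1.existsUnique h2 (one_over (Presheaves C).p I) (𝟙 I)
    refine isSubrepresentable_iff.2 ⟨_, v, ⟨fun x y hxy => (isOne_one I).hom_ext ?_⟩⟩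
    have hv' := isIso_map_of_isVertical (isVertical_of_isHomLift hv)
    have h3 := congrArg (Presheaves C).p.map hxy
    rwa [Functor.map_comp, Functor.map_comp, cancel_mono] at h3
  of_jointly_mono {W A B} a b hab hA hB := by
    haveI := totalHasFiniteLimits C.p
    obtain ⟨A', m, hm⟩ := isSubrepresentable_iff.1 hA
    obtain ⟨B', n, hn⟩ := isSubrepresentable_iff.1 hB
    have hT : IsOne (Presheaves C).p ((fiberedYoneda C).obj (one C.p (⊤_ R))) :=
      (isLexFunctor_fiberedYoneda C).map_isOne (isOne_one _)
    have hT' : (Presheaves C).p.obj ((fiberedYoneda C).obj (one C.p (⊤_ R))) = ⊤_ R :=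
      ((fiberedYoneda C).w_obj _).trans (one_over C.p _)
    have ht : ∀ {X : (Presheaves C).obj}
        (x y : X ⟶ (fiberedYoneda C).obj (one C.p (⊤_ R))), x = y := fun x y =>
      hT.hom_ext ((cancel_mono (eqToHom hT')).1 (terminal.hom_ext _ _))
    have h0 := (isLexFunctor_fiberedYoneda C).map_isPullback
      (IsPullback.of_hasPullback (toOne C.p (terminal.from (C.p.obj A')))
        (toOne C.p (terminal.from (C.p.obj B'))))
    let l := h0.lift (a ≫ m) (b ≫ n) (ht _ _)
    refine isSubrepresentable_iff.2 ⟨_, l, ⟨fun x y hxy => hab x y ?_ ?_⟩⟩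
    · rw [← cancel_mono m, Category.assoc, Category.assoc, ← h0.lift_fst (a ≫ m) (b ≫ n) (ht _ _),
        ← Category.assoc, ← Category.assoc]
      exact congrArg (· ≫ _) hxy
    · rw [← cancel_mono n, Category.assoc, Category.assoc, ← h0.lift_snd (a ≫ m) (b ≫ n) (ht _ _),
        ← Category.assoc, ← Category.assoc]
      exact congrArg (· ≫ _) hxy

variable (C) in
/-- The inclusion of the subobjects of representables in the presheaves. -/
noncomputable def subrepresentablesι : Subrepresentables C ⥤ᵇ Presheaves C :=
  fullSubfibrationι (Presheaves C) (isSubrepresentable C)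

theorem subrepresentables_isGeometricPreStack_and_isDense (h : IsFiberedPretopos (Presheaves C).p) :
    IsGeometricPreStack (Subrepresentables C).p ∧
      IsDense (subrepresentablesι C) :=
  (isClosedUnderSubobjects_isSubrepresentable C inferInstance).isGeometricPreStack_and_isDense
    (fun Y => by
      obtain ⟨U, s, hs⟩ := fiberedYoneda_exists_cover C Y
      exact ⟨_, s, isSubrepresentable_iff.2 ⟨U, 𝟙 _, inferInstance⟩, hs⟩)

end

/-! ### Objects over terminal objects of the base -/

section
variable {R : Type u₁} [Category.{v₁} R]

/-- The equivalence of total categories underlying an equivalence over the base. -/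
def BasedEquiv.total {S : BasedCategory.{v₂, u₂} R} {T : BasedCategory.{v₃, u₃} R}
    (K : BasedEquiv S T) : S.obj ≌ T.obj :=
  CategoryTheory.Equivalence.mk K.functor.toFunctor K.inverse.toFunctor
    ((BasedNatTrans.forgetful S S).mapIso K.unitIso)
    ((BasedNatTrans.forgetful T T).mapIso K.counitIso)

/-- The objects lying over a terminal object of the base. -/
def overTerminal (T : BasedCategory.{v₂, u₂} R) : ObjectProperty T.obj :=
  fun X => Nonempty (IsTerminal (T.p.obj X))

instance (T : BasedCategory.{v₂, u₂} R) : (overTerminal T).IsClosedUnderIsomorphisms where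
  of_iso e h := ⟨h.some.ofIso (T.p.mapIso e)⟩

lemma overTerminal_obj_iff {S : BasedCategory.{v₂, u₂} R} {T : BasedCategory.{v₃, u₃} R}
    (F : S ⥤ᵇ T) (X : S.obj) : overTerminal T (F.obj X) ↔ overTerminal S X := by
  rw [overTerminal, overTerminal, F.w_obj]

/-- An equivalence over the base restricts to the objects over terminal objects. -/
noncomputable def BasedEquiv.overTerminal {S : BasedCategory.{v₂, u₂} R}
    {T : BasedCategory.{v₃, u₃} R} (K : BasedEquiv S T) :
    (overTerminal S).FullSubcategory ≌ (overTerminal T).FullSubcategory :=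
  K.total.congrFullSubcategory (by
    ext X
    exact overTerminal_obj_iff K.functor X)

variable [HasFiniteLimits R] (S : BasedCategory.{v₂, u₂} R) [IsFiniteLimitFibration S.p]
  {D : ExDoctrine.{v₂, u₂, w} S.obj}

lemma isTerminal_constFunctor_obj (hD : D.Comprehension) {J : R} (hJ : IsTerminal J) :
    Nonempty (IsTerminal ((constFunctor S D).obj J)) := by
  have h (X : S.obj) : ∃! f : X ⟶ one S.p J, S.p.IsHomLift (hJ.from (S.p.obj X)) f :=
    (isOne_one J).existsUnique (one_over S.p J) rfl _
  have hT : IsTerminal (one S.p J) := IsTerminal.ofUniqueHom (fun X => (h X).choose)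
    (fun X m => (isOne_one J).hom_ext ((cancel_mono (eqToHom (one_over S.p J))).1 (hJ.hom_ext _ _)))
  exact ExDoctrine.isTerminal_eqObj hD hT

/-- The part of the gluing fibration over terminal objects is the category of equivalence
relations. -/
theorem isEquivalence_fst_overTerminal (hD : D.Comprehension) :
    (Functor.comp (overTerminal (glue S D)).ι
      (Comma.fst (Functor.id D.EqObj) (constFunctor S D))).IsEquivalence where
  faithful := ⟨fun {X Y f g} h => ObjectProperty.hom_ext _ (CommaMorphism.ext h
    (Y.property.some.hom_ext _ _))⟩
  full := ⟨fun {X Y} f => by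
    have hY : Nonempty (IsTerminal ((constFunctor S D).obj ((glue S D).p.obj Y.obj))) :=
      isTerminal_constFunctor_obj S hD Y.property.some
    exact ⟨ObjectProperty.homMk (Gluing.mkHom (A := X.obj) (B := Y.obj) f
      (Y.property.some.from ((glue S D).p.obj X.obj)) (hY.some.hom_ext _ _)), rfl⟩⟩
  essSurj := ⟨fun X => by
    have hT := isTerminal_constFunctor_obj S hD terminalIsTerminal
    exact ⟨⟨Gluing.mkObj (Δ := constFunctor S D) (hT.some.from X), ⟨terminalIsTerminal⟩⟩,
      ⟨Iso.refl X⟩⟩⟩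

/-- Equivalent gluing fibrations have equivalent categories of equivalence relations. -/
theorem nonempty_eqObj_equivalence {S' : BasedCategory.{v₃, u₃} R} [IsFiniteLimitFibration S'.p]
    {D' : ExDoctrine.{v₃, u₃, v₄} S'.obj} (hD : D.Comprehension) (hD' : D'.Comprehension)
    (K : BasedEquiv (glue S D) (glue S' D')) : Nonempty (D.EqObj ≌ D'.EqObj) := by
  haveI := isEquivalence_fst_overTerminal S hD
  haveI := isEquivalence_fst_overTerminal S' hD'
  exact ⟨(Functor.asEquivalence (Functor.comp (overTerminal (glue S D)).ι
      (Comma.fst (Functor.id D.EqObj) (constFunctor S D)))).symm.trans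
    (K.overTerminal.trans (Functor.asEquivalence (Functor.comp (overTerminal (glue S' D')).ι
      (Comma.fst (Functor.id D'.EqObj) (constFunctor S' D')))))⟩

end

end FibSh

theorem lemma3p2p8 {R : Type u₁} [Category.{v₁} R] [Regular R] :
    (∀ (S : BasedCategory.{v₂, u₂} R) [IsGeometricPreStack S.p],
      IsFreePretopos.{v₁, u₁, v₂, u₂, _, _, v₃, u₃} (zeta S) ∧
      ∀ (T : BasedCategory.{max v₁ u₂ v₂, max u₁ u₂ v₂} R) (W : S ⥤ᵇ T),
        IsFreePretopos.{v₁, u₁, v₂, u₂, _, _, max v₁ u₂ v₂, max u₁ u₂ v₂} W →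
        ∃ K : BasedEquiv (Sheaves S) T, Nonempty (zeta S ⋙ K.functor ≅ W)) ∧
    (∀ (C : BasedCategory.{v₂, u₂} R) [IsFiniteLimitPreStack C.p],
      ∃ _ : IsGeometricPreStack (Subrepresentables C).p,
        Nonempty (BasedEquiv (Presheaves C) (Sheaves (Subrepresentables C))) ∧
        Nonempty (EqRelSiev C ≌ EqRelSub (Subrepresentables C))) := by
  refine ⟨fun S _ => ?_, fun C _ => ?_⟩
  · haveI := isFiberedPretopos_sheaves S
    -- Density gives freeness with respect to fibered pretoposes in every universe, including the
    -- one in which `W` is assumed free.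
    exact ⟨isDense_zeta.isFreePretopos, fun T W hW =>
      IsFreePretopos.exists_basedEquiv isDense_zeta.isFreePretopos isDense_zeta.isFreePretopos hW hW⟩
  · haveI := isFiberedPretopos_presheaves C
    obtain ⟨hS, hi⟩ := subrepresentables_isGeometricPreStack_and_isDense (C := C) inferInstance
    haveI := isFiberedPretopos_sheaves (Subrepresentables C)
    -- Presheaves on `C` and sheaves on the subobjects of representables are both free on the
    -- latter.
    obtain ⟨K, -⟩ := IsFreePretopos.exists_basedEquiv hi.isFreePretopos hi.isFreePretopos
      (isDense_zeta (S := Subrepresentables C)).isFreePretopos isDense_zeta.isFreePretopos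
    exact ⟨hS, ⟨K⟩, nonempty_eqObj_equivalence C (comprehension_sievDoctrine C)
      (comprehension_subDoctrine (Subrepresentables C)) K⟩
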